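/- **Setting.** Let $G$ be a finite-dimensional Lie group with Lie algebra $\mathfrak g$ (bracket defined by left-invariant vector fields), acting smoothly on the left on a finite-dimensional smooth manifold $Q$; for $\xi\in\mathfrak g$ let $\xi_Q(q)=\frac{d}{dt}\big|_{t=0}\exp(t\xi)\cdot q$ be the infinitesimal generator, and let $\mathbf J:T^*Q\to\mathfrak g^*$, $\langle\mathbf J(\alpha_q),\xi\rangle=\langle\alpha_q,\xi_Q(q)\rangle$. Let $X$ be an oriented smooth (Hausdorff, $\sigma$-compact) manifold of dimension $n+1$, let $U\subset X$ be open with compact closure $\bar U$, and let $\ell:L(TX,\mathfrak g)\to\Lambda^{n+1}X$ be a smooth Lagrangian density covering the identity of $X$. Let $Y=X\times Q\to X$ be the trivial bundle with the $G$-action on the second factor, with the trivial Ehresmann connection $\gamma:TY\to TQ$, and put $$\Pi=L(L(TX,TQ),\Lambda^{n+1}X)\to X\times Q,\qquad \Pi_{\mathfrak g}=\Pi\times_{Y}L(TX,\mathfrak g).$$ A smooth section of $\Pi_{\mathfrak g}$ over $\bar U$ is a pair $\psi=(\omega,\sigma)$, where $\omega$ covers a smooth map $q:\bar U\to Q$,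 $\omega(x)\in L(L(T_xX,T_{q(x)}Q),\Lambda^{n+1}_xX)$ and $\sigma(x)\in L(T_xX,\mathfrak g)$; smoothness on $\bar U$ means that near each point of $\bar U$ it is the restriction of a smooth section. Identify the dual jet bundle $J^1Y^\star$ with the $(n+1)$-forms on $Y$ that vanish on pairs of vertical vectors, and let $\Theta$ be its canonical $(n+1)$-form, $\Theta(z)(u_0,\dots,u_n)=z(T\pi\, u_0,\dots,T\pi\, u_n)$, $\pi:\Lambda^{n+1}Y\to Y$. Let $s^\gamma:\Pi\to J^1Y^\star$, $s^\gamma(v\otimes\alpha\otimes\mu)=\gamma^*\alpha\wedge\mathbf i_v\mu$, let $\mathcal J(z)(\xi)=\mathbf i_{\xi_Y}z$, and define $e:\Pi_{\mathfrak g}\to J^1Y^\star$ by $e(\omega,\sigma)=s^\gamma(\omega)-\sigma\wedge\mathcal J(s^\gamma(\omega))+\ell(\sigma)$ ($\sigma$ and $\ell(\sigma)$ being pulled back to $Y$). The *covariant Clebsch variational principle* is $\delta\int_U\psi^*\Theta_e=0$, $\Theta_e=e^*\Theta$: $\psi$ is *critical* if $\frac{d}{d\varepsilon}\big|_{\varepsilon=0}\int_U\psi_\varepsilon^*\Theta_e=0$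 for all smooth variations $\psi_\varepsilon$ of $\psi=\psi_0$ over $\bar U$ whose projection $q_\varepsilon$ to $Q$ is fixed on $\partial U$. The covariant momentum map $\mathfrak j:\Pi\to L(L(TX,\mathfrak g),\Lambda^{n+1}X)$ is $\mathfrak j(v\otimes\alpha_q\otimes\mu)=v\otimes\mathbf J(\alpha_q)\otimes\mu$, i.e. $\langle\mathfrak j(\omega),\sigma\rangle=\langle\omega,\sigma_Q(q)\rangle$, where $\sigma_Q(q)(v)=(\sigma(v))_Q(q)$. For a covariant derivative $\nabla$ on $Q$, $\tilde\nabla$ denotes the induced derivative of vector fields $f:X\to TQ$ along $q$, and $\tilde{\operatorname{div}}^\nabla\omega$ is defined by $\langle\tilde{\operatorname{div}}^\nabla\omega,f\rangle=\operatorname{div}\langle\omega,f\rangle-\langle\omega,\tilde\nabla f\rangle$, locally $(\partial_\mu\omega^\mu_A-\Gamma^B_{CA}\,\partial_\mu q^C\,\omega^\mu_B)\,dq^A\otimes d^{n+1}x$; $\nabla\sigma_Q$ is, at $x$, the map $b\in T_qQ\mapsto\big(v\mapsto\nabla_b(\sigma(x)v)_Q\big)$. All equations below are understood on $U$. **Proposition.**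 1. For every smooth section $\psi=(\omega,\sigma)$ of $\Pi_{\mathfrak g}$ over $\bar U$, $\psi^*\Theta_e=\ell(\sigma)+\langle\omega,\mathbf dq-\sigma_Q(q)\rangle$ on $U$, and $\psi$ is critical for the covariant Clebsch variational principle if and only if it is critical for $$\delta\int_U\ell(\sigma)+\langle\omega,\mathbf dq-\sigma_Q(q)\rangle=0 .$$ 2. Let $\nabla$ be a covariant derivative on $Q$ with vanishing torsion. A smooth section $\psi=(\omega,\sigma)$ is critical if and only if $$\tilde{\operatorname{div}}^\nabla(\omega)=-\langle\omega,\nabla\sigma_Q\rangle,\qquad \mathbf dq=\sigma_Q(q),\qquad \frac{\delta\ell}{\delta\sigma}=\mathfrak j(\omega).\tag{S}$$ 3. If $\psi=(\omega,\sigma)$ is critical, then $\sigma$ solves the covariant Euler–Poincaré equations $$\operatorname{div}\frac{\delta\ell}{\delta\sigma}+\operatorname{ad}^*_\sigma\frac{\delta\ell}{\delta\sigma}=0,\qquad \langle\operatorname{ad}^*_\sigma\nu,\xi\rangle=\langle\nu,[\sigma,\xi]\rangle,$$ and satisfies the compatibility condition $(\mathbf d\sigma-[\sigma,\sigma])_Q(q)=0$,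 where $[\sigma,\sigma](u,v)=[\sigma(u),\sigma(v)]$. 4. Suppose that $\ell$ is hyperregular, i.e. that $\sigma\mapsto\delta\ell/\delta\sigma$ is a diffeomorphism $L(TX,\mathfrak g)\to L(L(TX,\mathfrak g),\Lambda^{n+1}X)$. Let $h(\nu)=\langle\nu,\sigma\rangle-\ell(\sigma)$, with $\delta\ell/\delta\sigma=\nu$, be the associated Hamiltonian, let $\mathsf H=h\circ\mathfrak j:\Pi\to\Lambda^{n+1}X$, and let $\nabla$ be torsion-free. Consider the canonical covariant Hamilton equations $$\mathbf dq=\frac{\partial\mathsf H}{\partial\omega},\qquad \tilde{\operatorname{div}}^\nabla\omega=-\frac{\partial^\nabla\mathsf H}{\partial q},\tag{H}$$ where $\partial\mathsf H/\partial\omega$ is the fibre derivative and $\partial^\nabla\mathsf H/\partial q$ is the derivative, at fixed $x$, along $\nabla$-horizontal lifts. Then a smooth section $(\omega,\sigma)$ satisfies (S) if and only if $\omega$ satisfies (H) and $\sigma=\dfrac{\delta h}{\delta\nu}\Big|_{\nu=\mathfrak j(\omega)}$. In particular $\omega$ satisfies (H) if and only if there is a smooth $\tau$ such that $(\omega,\tau)$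 satisfies (S). -/

import Mathlib

open scoped Manifold ContDiff Topology

namespace CovariantClebsch

noncomputable section

/-! ## Model spaces and multilinear algebra

Mathlib's `TangentSpace I x` is, by definition, the model vector space, a vector being recorded by
its coordinates in the preferred chart at `x`.  The operations of this section are stated on model
spaces and are applied to tangent spaces. -/

/-- The model space `ℝ^{n+1}` of the base manifold. -/
abbrev BaseModel (n : ℕ) : Type := EuclideanSpace ℝ (Fin (n + 1))

/-- The standard basis of `ℝ^{n+1}`. -/
def stdVec (n : ℕ) (μ : Fin (n + 1)) : BaseModel n := EuclideanSpace.single μ 1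

/-- The standard coordinate functionals of `ℝ^{n+1}`. -/
def stdCovec (n : ℕ) (μ : Fin (n + 1)) : BaseModel n →L[ℝ] ℝ := EuclideanSpace.proj μ

/-- The contraction `T ⊗ V* ⊗ Λ^{n+1}T* → V* ⊗ Λⁿ T*`, where `T ⊗ V* ⊗ Λ^{n+1}T*` is realised as
`L(L(T, V), Λ^{n+1}T*)`: the tensor `w ⊗ α ⊗ μ` is sent to `v ↦ α(v) i_w μ`.  In coordinates,
`ν = ν_A^μ ∂_μ ⊗ dy^A ⊗ d^{n+1}x` is sent to `v ↦ ν_A^μ v^A i_{∂_μ} d^{n+1}x`. -/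
def contract {n : ℕ} {V : Type*} [NormedAddCommGroup V] [NormedSpace ℝ V]
    (ν : (BaseModel n →L[ℝ] V) →L[ℝ] (BaseModel n) [⋀^Fin (n + 1)]→L[ℝ] ℝ) :
    V →L[ℝ] (BaseModel n) [⋀^Fin n]→L[ℝ] ℝ :=
  ∑ μ : Fin (n + 1),
    (ContinuousLinearMap.apply ℝ ((BaseModel n) [⋀^Fin n]→L[ℝ] ℝ) (stdVec n μ)) ∘L
      (ContinuousAlternatingMap.curryLeftLI (𝕜 := ℝ) (E := BaseModel n) (F := ℝ)
        (n := n)).toContinuousLinearMap ∘L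
      ν ∘L (ContinuousLinearMap.smulRightL ℝ (BaseModel n) V (stdCovec n μ))

/-- The wedge product `θ ∧ β` of a `V`-valued one-form `θ` with a `k`-form `β` with values in `V*`,
contracting the `V` indices. -/
def wedgeContract {k : ℕ} {W V : Type*} [NormedAddCommGroup W] [NormedSpace ℝ W]
    [NormedAddCommGroup V] [NormedSpace ℝ V]
    (θ : W →L[ℝ] V) (β : V →L[ℝ] W [⋀^Fin k]→L[ℝ] ℝ) : W [⋀^Fin (k + 1)]→L[ℝ] ℝ :=
  ContinuousAlternatingMap.alternatizeUncurryFin (β ∘L θ)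

/-! ## Differential forms on manifolds -/

section Forms

variable {E : Type*} [NormedAddCommGroup E] [NormedSpace ℝ E]
  {H : Type*} [TopologicalSpace H] (I : ModelWithCorners ℝ E H)
  (M : Type*) [TopologicalSpace M] [ChartedSpace H M] [IsManifold I 1 M]


/-- Pull-back of alternating forms depends continuously on the linear map. -/
theorem continuous_compContinuousLinearMapCLM (E : Type*) [NormedAddCommGroup E] [NormedSpace ℝ E]
    (k : ℕ) :
    Continuous (fun g : E →L[ℝ] E =>
      (ContinuousAlternatingMap.compContinuousLinearMapCLM g :
        (E [⋀^Fin k]→L[ℝ] ℝ) →L[ℝ] (E [⋀^Fin k]→L[ℝ] ℝ))) := by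
  have hemb := ContinuousLinearMap.isEmbedding_postcomp (𝕜₁ := ℝ) (E := E [⋀^Fin k]→L[ℝ] ℝ)
    (σ := RingHom.id ℝ)
    (ContinuousAlternatingMap.toContinuousMultilinearMapCLM (E := E) (F := ℝ) (ι := Fin k) (𝕜 := ℝ) ℝ)
    ContinuousAlternatingMap.isEmbedding_toContinuousMultilinearMap
  rw [hemb.continuous_iff]
  have h1 : Continuous (fun g : E →L[ℝ] E =>
      (ContinuousMultilinearMap.compContinuousLinearMapContinuousMultilinear ℝ
        (fun _ : Fin k => E) (fun _ : Fin k => E) ℝ (fun _ => g)) ∘L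
      (ContinuousAlternatingMap.toContinuousMultilinearMapCLM (E := E) (F := ℝ) (ι := Fin k)
        (𝕜 := ℝ) ℝ)) := by
    refine Continuous.clm_comp ?_ continuous_const
    exact (ContinuousMultilinearMap.cont _).comp (continuous_pi fun _ => continuous_id)
  exact h1

/-- The bundle `Λ^k T*M` of alternating `k`-forms: the change of coordinates between two charts is
pull-back by the inverse change of coordinates of the tangent bundle. -/
def formCore (k : ℕ) : VectorBundleCore ℝ M (E [⋀^Fin k]→L[ℝ] ℝ) (atlas H M) where
  baseSet i := i.1.source
  isOpen_baseSet i := i.1.open_source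
  indexAt := achart H
  mem_baseSet_at := mem_chart_source H
  coordChange i j x := ContinuousAlternatingMap.compContinuousLinearMapCLM
    ((tangentBundleCore I M).coordChange j i x)
  coordChange_self i x hx α := by
    ext v
    change α (fun m => (tangentBundleCore I M).coordChange i i x (v m)) = α v
    congr 1
    funext m
    exact (tangentBundleCore I M).coordChange_self i x hx (v m)
  continuousOn_coordChange i j := by
    refine (continuous_compContinuousLinearMapCLM E k).comp_continuousOn ?_
    have := (tangentBundleCore I M).continuousOn_coordChange j i
    rwa [Set.inter_comm] at this
  coordChange_comp i j l x hx α := by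
    ext v
    change α (fun m => (tangentBundleCore I M).coordChange j i x
      ((tangentBundleCore I M).coordChange l j x (v m))) =
      α (fun m => (tangentBundleCore I M).coordChange l i x (v m))
    congr 1
    funext m
    exact (tangentBundleCore I M).coordChange_comp l j i x ⟨⟨hx.2, hx.1.2⟩, hx.1.1⟩ (v m)

/-- The total space of `Λ^k T*M`. -/
abbrev FormBundle (k : ℕ) : Type _ :=
  Bundle.TotalSpace (E [⋀^Fin k]→L[ℝ] ℝ) (formCore I M k).Fiber

variable {M}

/-- The canonical (tautological) `k`-form `Θ` on the total space `π : Λ^k T*M → M`: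
`Θ(z)(u_1, …, u_k) = z(Tπ u_1, …, Tπ u_k)`. -/
def canonicalForm (k : ℕ) (z : FormBundle I M k) :
    (TangentSpace (I.prod 𝓘(ℝ, E [⋀^Fin k]→L[ℝ] ℝ)) z) [⋀^Fin k]→L[ℝ] ℝ :=
  ContinuousAlternatingMap.compContinuousLinearMap
    (show (TangentSpace I z.proj) [⋀^Fin k]→L[ℝ] ℝ from z.snd)
    (mfderiv (I.prod 𝓘(ℝ, E [⋀^Fin k]→L[ℝ] ℝ)) I (fun w : FormBundle I M k => w.proj) z)

/-- The exterior derivative of a differential form on a manifold (with values in a fixed vector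
space), computed at `x` in the preferred chart at `x`. -/
def extDerivAt {k : ℕ} {W : Type*} [NormedAddCommGroup W] [NormedSpace ℝ W]
    (β : ∀ x : M, (TangentSpace I x) [⋀^Fin k]→L[ℝ] W) (x : M) :
    (TangentSpace I x) [⋀^Fin (k + 1)]→L[ℝ] W :=
  extDeriv (E := E) (fun y : E =>
    ContinuousAlternatingMap.compContinuousLinearMap (β ((extChartAt I x).symm y))
      (tangentCoordChange I x ((extChartAt I x).symm y) ((extChartAt I x).symm y) : E →L[ℝ] E))
    (extChartAt I x x)

end Forms

/-! ## Integration of top-degree forms on an oriented manifold -/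

section Integration

/-- `X` is oriented: the preferred charts form an oriented atlas. -/
class OrientedAtlas (n : ℕ) (X : Type*) [TopologicalSpace X] [ChartedSpace (BaseModel n) X]
    [IsManifold 𝓘(ℝ, BaseModel n) 1 X] : Prop where
  det_pos : ∀ x y z : X, z ∈ (chartAt (BaseModel n) x).source →
    z ∈ (chartAt (BaseModel n) y).source →
    0 < (tangentCoordChange 𝓘(ℝ, BaseModel n) x y z).det

variable (n : ℕ) (X : Type*) [TopologicalSpace X] [ChartedSpace (BaseModel n) X]
    [IsManifold 𝓘(ℝ, BaseModel n) ∞ X] [T2Space X] [SigmaCompactSpace X]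

/-- A smooth partition of unity subordinate to the preferred charts. -/
def chartPartition : SmoothPartitionOfUnity X 𝓘(ℝ, BaseModel n) X Set.univ :=
  Classical.choose (SmoothPartitionOfUnity.exists_isSubordinate_chartAt_source
    𝓘(ℝ, BaseModel n) X)

variable {X}

/-- The integral `∫_U α` of an `(n+1)`-form `α` over a subset `U` of the oriented manifold `X`:
the form is cut by the partition of unity, and each piece is integrated in its chart. -/
def formIntegral (U : Set X)
    (α : ∀ x : X, (TangentSpace 𝓘(ℝ, BaseModel n) x) [⋀^Fin (n + 1)]→L[ℝ] ℝ) : ℝ :=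
  ∑ᶠ i : X, ∫ y in (extChartAt 𝓘(ℝ, BaseModel n) i).target ∩
      (extChartAt 𝓘(ℝ, BaseModel n) i).symm ⁻¹' U,
    chartPartition n X i ((extChartAt 𝓘(ℝ, BaseModel n) i).symm y) *
      α ((extChartAt 𝓘(ℝ, BaseModel n) i).symm y) (fun μ =>
        tangentCoordChange 𝓘(ℝ, BaseModel n) i ((extChartAt 𝓘(ℝ, BaseModel n) i).symm y)
          ((extChartAt 𝓘(ℝ, BaseModel n) i).symm y) (stdVec n μ))

end Integration
/-! ## The infinitesimal action of a Lie group -/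

section Action

variable {EG : Type*} [NormedAddCommGroup EG] [NormedSpace ℝ EG] [FiniteDimensional ℝ EG]
  {G : Type*} [TopologicalSpace G] [ChartedSpace EG G] [Group G] [LieGroup 𝓘(ℝ, EG) ∞ G]
  {F : Type*} [NormedAddCommGroup F] [NormedSpace ℝ F]
  {Q : Type*} [TopologicalSpace Q] [ChartedSpace F Q] [MulAction G Q]

variable (EG F G) in
/-- The infinitesimal generator `ξ ↦ ξ_Q(q)`: the derivative at `1` in the direction `ξ ∈ 𝔤 = T_1 G`
of the orbit map `g ↦ g • q`; equivalently `ξ_Q(q) = d/dt|_{t=0} exp(tξ) • q`. -/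
def infGen (q : Q) : GroupLieAlgebra 𝓘(ℝ, EG) G →L[ℝ] TangentSpace 𝓘(ℝ, F) q :=
  (mfderiv 𝓘(ℝ, EG) 𝓘(ℝ, F) (fun g : G => g • q) (1 : G) : EG →L[ℝ] F)

variable (EG G) in
/-- The linear map `η ↦ [η, ξ]` of the Lie algebra of `G`. -/
def bracketRight (ξ : GroupLieAlgebra 𝓘(ℝ, EG) G) :
    GroupLieAlgebra 𝓘(ℝ, EG) G →L[ℝ] GroupLieAlgebra 𝓘(ℝ, EG) G :=
  haveI : LieGroup 𝓘(ℝ, EG) (minSmoothness ℝ 3) G :=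
    LieGroup.of_le (n := ∞) (by
      rw [minSmoothness_of_isRCLikeNormedField]
      exact (inferInstance : ENat.LEInfty (3 : WithTop ℕ∞)).out)
  haveI : FiniteDimensional ℝ (GroupLieAlgebra 𝓘(ℝ, EG) G) :=
    inferInstanceAs (FiniteDimensional ℝ EG)
  haveI : T2Space (GroupLieAlgebra 𝓘(ℝ, EG) G) := inferInstanceAs (T2Space EG)
  haveI : CompleteSpace EG := FiniteDimensional.complete ℝ EG
  LinearMap.toContinuousLinearMap
    { toFun := fun η => ⁅η, ξ⁆
      map_add' := fun η η' => add_lie η η' ξ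
      map_smul' := fun c η => smul_lie c η ξ }

end Action

/-! ## Fields

Throughout, `X` is the `(n+1)`-dimensional base, `Y = X × Q` the trivial bundle, `G` the group and
`𝔤` its Lie algebra. -/

section Fields

/-- The tangent space `T_x X`. -/
abbrev TX (n : ℕ) {X : Type*} [TopologicalSpace X] [ChartedSpace (BaseModel n) X] (x : X) : Type :=
  TangentSpace 𝓘(ℝ, BaseModel n) x

/-- The fibre `Λ^{n+1}_x X` of the bundle of densities. -/
abbrev Vol (n : ℕ) {X : Type*} [TopologicalSpace X] [ChartedSpace (BaseModel n) X] (x : X) : Type :=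
  (TX n x) [⋀^Fin (n + 1)]→L[ℝ] ℝ

variable (n : ℕ)
  (EG : Type*) [NormedAddCommGroup EG] [NormedSpace ℝ EG]
  (G : Type*) [TopologicalSpace G] [ChartedSpace EG G] [Group G]
  (F : Type*) [NormedAddCommGroup F] [NormedSpace ℝ F]
  (Q : Type*) [TopologicalSpace Q] [ChartedSpace F Q]
  {X : Type*} [TopologicalSpace X] [ChartedSpace (BaseModel n) X]

/-- The fibre at `x` of `L(TX, 𝔤)`. -/
abbrev LieForm (x : X) : Type _ := TX n x →L[ℝ] GroupLieAlgebra 𝓘(ℝ, EG) G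

/-- The fibre at `x` of `L(L(TX, 𝔤), Λ^{n+1}X)`. -/
abbrev LieMomentum (x : X) : Type _ := LieForm n EG G x →L[ℝ] Vol n x

variable {Q} in
/-- The fibre at `(x, q)` of the restricted dual jet bundle `Π = L(L(TX, TQ), Λ^{n+1}X)`. -/
abbrev Momentum (x : X) (q : Q) : Type _ :=
  (TX n x →L[ℝ] TangentSpace 𝓘(ℝ, F) q) →L[ℝ] Vol n x

/-- The fibre at `x` of `Π_𝔤 = Π ×_Y L(TX, 𝔤) → X`.  A section of `Π_𝔤` is a dependent function
`ψ : ∀ x, PhaseFiber n EG G F Q x`; only its values on the closure of `U` matter. -/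
structure PhaseFiber (x : X) where
  /-- the configuration `q` -/
  q : Q
  /-- the momentum `w ∈ L(L(T_x X, T_q Q), Λ^{n+1}_x X)` -/
  mom : Momentum n F x q
  /-- the value `σ ∈ L(T_x X, 𝔤)` -/
  σ : LieForm n EG G x

variable {EG G F Q n}

/-- Replace the `L(TX, 𝔤)` component of a section of `Π_𝔤`. -/
def withSigma (ψ : ∀ x : X, PhaseFiber n EG G F Q x) (τ : ∀ x : X, LieForm n EG G x) :
    ∀ x : X, PhaseFiber n EG G F Q x :=
  fun x => ⟨(ψ x).q, (ψ x).mom, τ x⟩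

variable [IsManifold 𝓘(ℝ, BaseModel n) ∞ X] [IsManifold 𝓘(ℝ, F) ∞ Q]

variable (n) in
/-- `T_x X → ℝ^{n+1}`: coordinates of tangent vectors at `x` in the chart at `x₀`. -/
def toCoord (x₀ x : X) : TX n x →L[ℝ] BaseModel n :=
  (tangentCoordChange 𝓘(ℝ, BaseModel n) x x₀ x : BaseModel n →L[ℝ] BaseModel n)

variable (n) in
/-- `ℝ^{n+1} → T_x X`: the tangent vector at `x` with given coordinates in the chart at `x₀`. -/
def fromCoord (x₀ x : X) : BaseModel n →L[ℝ] TX n x :=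
  (tangentCoordChange 𝓘(ℝ, BaseModel n) x₀ x x : BaseModel n →L[ℝ] BaseModel n)

variable (F) in
/-- `F → T_q Q`: the tangent vector at `q` with given coordinates in the chart at `q₀`. -/
def fromCoordQ (q₀ q : Q) : F →L[ℝ] TangentSpace 𝓘(ℝ, F) q :=
  (tangentCoordChange 𝓘(ℝ, F) q₀ q q : F →L[ℝ] F)

/-- Coordinates in the chart at `x₀` of a density at `x`. -/
def volCoord (x₀ x : X) : Vol n x →L[ℝ] (BaseModel n) [⋀^Fin (n + 1)]→L[ℝ] ℝ :=
  ContinuousAlternatingMap.compContinuousLinearMapCLM (fromCoord n x₀ x)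

/-- The density at `x` with given coordinates in the chart at `x₀`. -/
def volOfCoord (x₀ x : X) : ((BaseModel n) [⋀^Fin (n + 1)]→L[ℝ] ℝ) →L[ℝ] Vol n x :=
  ContinuousAlternatingMap.compContinuousLinearMapCLM (toCoord n x₀ x)

/-- Coordinates in the chart at `x₀` of an element of `L(T_x X, 𝔤)`. -/
def lieFormCoord (x₀ x : X) (σ : LieForm n EG G x) : BaseModel n →L[ℝ] EG :=
  σ ∘L fromCoord n x₀ x

/-- The element of `L(T_x X, 𝔤)` with given coordinates in the chart at `x₀`. -/
def lieFormOfCoord (x₀ x : X) (S : BaseModel n →L[ℝ] EG) : LieForm n EG G x :=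
  (show BaseModel n →L[ℝ] GroupLieAlgebra 𝓘(ℝ, EG) G from S) ∘L toCoord n x₀ x

/-- The element of `L(L(T_x X, 𝔤), Λ^{n+1}_x X)` with given coordinates in the chart at `x₀`. -/
def lieMomentumOfCoord (x₀ x : X)
    (N : (BaseModel n →L[ℝ] EG) →L[ℝ] (BaseModel n) [⋀^Fin (n + 1)]→L[ℝ] ℝ) :
    LieMomentum n EG G x :=
  volOfCoord x₀ x ∘L
    (show (BaseModel n →L[ℝ] GroupLieAlgebra 𝓘(ℝ, EG) G) →L[ℝ]
      (BaseModel n) [⋀^Fin (n + 1)]→L[ℝ] ℝ from N) ∘L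
    (fromCoord n x₀ x).precomp (GroupLieAlgebra 𝓘(ℝ, EG) G)

/-- Coordinates in the charts at `x₀`, `q₀` of an element of `L(L(T_x X, T_q Q), Λ^{n+1}_x X)`. -/
def momentumCoord (x₀ x : X) (q₀ q : Q) (w : Momentum n F x q) :
    (BaseModel n →L[ℝ] F) →L[ℝ] (BaseModel n) [⋀^Fin (n + 1)]→L[ℝ] ℝ :=
  volCoord x₀ x ∘L w ∘L
    ((toCoord n x₀ x).precomp (TangentSpace 𝓘(ℝ, F) q)) ∘L
    ((fromCoordQ F q₀ q).postcomp (BaseModel n))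

/-- A family `(ε, x) ↦ Ψ ε x ∈ (Π_𝔤)_x` is smooth on the (open) set `W ⊆ ℝ × X`: all its
components in charts are smooth. -/
structure SmoothFamilyOn (Ψ : ℝ → ∀ x : X, PhaseFiber n EG G F Q x) (W : Set (ℝ × X)) : Prop where
  q : ContMDiffOn (𝓘(ℝ, ℝ).prod 𝓘(ℝ, BaseModel n)) 𝓘(ℝ, F) ∞ (fun p : ℝ × X => (Ψ p.1 p.2).q) W
  σ : ∀ x₀ : X, ContMDiffOn (𝓘(ℝ, ℝ).prod 𝓘(ℝ, BaseModel n)) 𝓘(ℝ, BaseModel n →L[ℝ] EG) ∞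
    (fun p : ℝ × X => lieFormCoord x₀ p.2 (Ψ p.1 p.2).σ)
    (W ∩ {p | p.2 ∈ (chartAt (BaseModel n) x₀).source})
  mom : ∀ (x₀ : X) (q₀ : Q), ContMDiffOn (𝓘(ℝ, ℝ).prod 𝓘(ℝ, BaseModel n))
    𝓘(ℝ, (BaseModel n →L[ℝ] F) →L[ℝ] (BaseModel n) [⋀^Fin (n + 1)]→L[ℝ] ℝ) ∞
    (fun p : ℝ × X => momentumCoord x₀ p.2 q₀ (Ψ p.1 p.2).q (Ψ p.1 p.2).mom)
    (W ∩ {p | p.2 ∈ (chartAt (BaseModel n) x₀).source ∧ (Ψ p.1 p.2).q ∈ (chartAt F q₀).source})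

/-- `ψ` is a smooth section of `Π_𝔤` over the closure of `U`: near every point of the closure it is
the restriction of a smooth section defined on an open set. -/
def IsSmoothSection (U : Set X) (ψ : ∀ x : X, PhaseFiber n EG G F Q x) : Prop :=
  ∀ x ∈ closure U, ∃ W : Set X, IsOpen W ∧ x ∈ W ∧ ∃ ψ' : ∀ x : X, PhaseFiber n EG G F Q x,
    SmoothFamilyOn (fun _ => ψ') (Set.univ ×ˢ W) ∧ ∀ y ∈ W ∩ closure U, ψ' y = ψ y

/-- `Ψ` is a smooth variation of the section `ψ` over the closure of `U`, for `ε` near `0`, whose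
projection to `Q` is fixed on the boundary of `U`. -/
structure IsVariation (U : Set X) (ψ : ∀ x : X, PhaseFiber n EG G F Q x)
    (Ψ : ℝ → ∀ x : X, PhaseFiber n EG G F Q x) : Prop where
  zero : ∀ x ∈ closure U, Ψ 0 x = ψ x
  boundary : ∀ ε : ℝ, ∀ x ∈ frontier U, (Ψ ε x).q = (ψ x).q
  smooth : ∀ x ∈ closure U, ∃ W : Set (ℝ × X), IsOpen W ∧ ((0 : ℝ), x) ∈ W ∧
    ∃ Ψ' : ℝ → ∀ x : X, PhaseFiber n EG G F Q x,
      SmoothFamilyOn Ψ' W ∧ ∀ p ∈ W, p.2 ∈ closure U → Ψ' p.1 p.2 = Ψ p.1 p.2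

/-- `ψ` is a critical section of the action functional `S` over `U`: `d/dε|_{ε=0} S(Ψ_ε) = 0` for
all variations `Ψ_ε` of `ψ`. -/
def IsCritical (U : Set X) (S : (∀ x : X, PhaseFiber n EG G F Q x) → ℝ)
    (ψ : ∀ x : X, PhaseFiber n EG G F Q x) : Prop :=
  ∀ Ψ : ℝ → ∀ x : X, PhaseFiber n EG G F Q x, IsVariation U ψ Ψ →
    HasDerivAt (fun ε => S (Ψ ε)) 0 0

/-! ## Lagrangian densities -/

variable (n EG G X) in
/-- A map `ℓ : L(TX, 𝔤) → Λ^{n+1}X` covering the identity of `X`. -/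
abbrev Density : Type _ := ∀ x : X, LieForm n EG G x → Vol n x

/-- Smoothness of a map `ℓ : L(TX, 𝔤) → Λ^{n+1}X` covering the identity. -/
def Density.IsSmooth (ℓ : Density n EG G X) : Prop :=
  ∀ x₀ : X, ContMDiffOn (𝓘(ℝ, BaseModel n).prod 𝓘(ℝ, BaseModel n →L[ℝ] EG))
    𝓘(ℝ, (BaseModel n) [⋀^Fin (n + 1)]→L[ℝ] ℝ) ∞
    (fun p : X × (BaseModel n →L[ℝ] EG) =>
      volCoord x₀ p.1 (ℓ p.1 (lieFormOfCoord x₀ p.1 p.2)))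
    ((chartAt (BaseModel n) x₀).source ×ˢ Set.univ)

/-- The fibre derivative `δℓ/δσ ∈ L(L(T_x X, 𝔤), Λ^{n+1}_x X)`. -/
def Density.fiberDeriv (ℓ : Density n EG G X) (x : X) (σ : LieForm n EG G x) :
    LieMomentum n EG G x :=
  fderiv ℝ (ℓ x) σ

/-- The inverse of the fibre derivative (used when the latter is bijective). -/
def Density.legendreInv (ℓ : Density n EG G X) (x : X) (ν : LieMomentum n EG G x) :
    LieForm n EG G x :=
  Function.invFun (ℓ.fiberDeriv x) ν

/-- `ℓ` is hyperregular: the fibre derivative `L(TX, 𝔤) → L(L(TX, 𝔤), Λ^{n+1}X)` is a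
diffeomorphism, i.e. it is bijective on every fibre and its inverse is smooth. -/
structure Density.IsHyperregular (ℓ : Density n EG G X) : Prop where
  bijective : ∀ x : X, Function.Bijective (ℓ.fiberDeriv x)
  smooth_inv : ∀ x₀ : X, ContMDiffOn
    (𝓘(ℝ, BaseModel n).prod
      𝓘(ℝ, (BaseModel n →L[ℝ] EG) →L[ℝ] (BaseModel n) [⋀^Fin (n + 1)]→L[ℝ] ℝ))
    𝓘(ℝ, BaseModel n →L[ℝ] EG) ∞
    (fun p : X × ((BaseModel n →L[ℝ] EG) →L[ℝ] (BaseModel n) [⋀^Fin (n + 1)]→L[ℝ] ℝ) =>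
      lieFormCoord x₀ p.1 (ℓ.legendreInv p.1 (lieMomentumOfCoord x₀ p.1 p.2)))
    ((chartAt (BaseModel n) x₀).source ×ˢ Set.univ)

/-- The Hamiltonian `h : L(L(TX, 𝔤), Λ^{n+1}X) → Λ^{n+1}X` associated to a hyperregular `ℓ` by
Legendre transformation: `h(ν) = ⟨ν, σ⟩ - ℓ(σ)` where `δℓ/δσ = ν`. -/
def Density.hamiltonian (ℓ : Density n EG G X) (x : X) (ν : LieMomentum n EG G x) : Vol n x :=
  ν (ℓ.legendreInv x ν) - ℓ x (ℓ.legendreInv x ν)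

end Fields

/-! ## The covariant Clebsch variational principle on `Y = X × Q` -/

section Clebsch

variable {n : ℕ}
  {EG : Type*} [NormedAddCommGroup EG] [NormedSpace ℝ EG] [FiniteDimensional ℝ EG]
  {G : Type*} [TopologicalSpace G] [ChartedSpace EG G] [Group G] [LieGroup 𝓘(ℝ, EG) ∞ G]
  {F : Type*} [NormedAddCommGroup F] [NormedSpace ℝ F] [FiniteDimensional ℝ F]
  {Q : Type*} [TopologicalSpace Q] [ChartedSpace F Q] [IsManifold 𝓘(ℝ, F) ∞ Q] [MulAction G Q]
  {X : Type*} [TopologicalSpace X] [ChartedSpace (BaseModel n) X]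
  [IsManifold 𝓘(ℝ, BaseModel n) ∞ X]

/-- The model with corners of `Y = X × Q`. -/
abbrev modelY (n : ℕ) (F : Type*) [NormedAddCommGroup F] [NormedSpace ℝ F] :
    ModelWithCorners ℝ (BaseModel n × F) (ModelProd (BaseModel n) F) :=
  𝓘(ℝ, BaseModel n).prod 𝓘(ℝ, F)

/-- The fibre at `(x, q)` of the bundle `Λ^{n+1} Y`, where `T_{(x,q)}Y = T_x X × T_q Q`. -/
abbrev FormY (n : ℕ) (F : Type*) [NormedAddCommGroup F] [NormedSpace ℝ F] : Type _ :=
  (BaseModel n × F) [⋀^Fin (n + 1)]→L[ℝ] ℝ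

/-- The section `s^γ : Π → J¹Y*` defined by the trivial connection `γ : TY → TQ`.  Elements of
`J¹Y*` are identified with the elements of `Λ^{n+1} Y` which vanish on pairs of vertical vectors,
and `s^γ(v ⊗ α ⊗ μ) = γ*α ∧ i_v μ`. -/
def dualJetLift (x : X) (q : Q) (w : Momentum n F x q) : FormY n F :=
  wedgeContract (ContinuousLinearMap.snd ℝ (BaseModel n) F)
    (ContinuousAlternatingMap.compContinuousLinearMapCLM
        (ContinuousLinearMap.fst ℝ (BaseModel n) F) ∘L contract (V := F) w)

/-- The map `𝒥(z) ∈ L(𝔤, ΛⁿY)`, `𝒥(z)(ξ) = i_{ξ_Y} z`, where `ξ_Y = (0, ξ_Q)`. -/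
def covMomentumMap (q : Q) (z : FormY n F) :
    GroupLieAlgebra 𝓘(ℝ, EG) G →L[ℝ] (BaseModel n × F) [⋀^Fin n]→L[ℝ] ℝ :=
  z.curryLeft ∘L ContinuousLinearMap.inr ℝ (BaseModel n) F ∘L
    (show GroupLieAlgebra 𝓘(ℝ, EG) G →L[ℝ] F from infGen EG G F q)

/-- The bilinear map `(z, σ) ↦ π*σ ∧ 𝒥(z)` with values in `J¹Y*`. -/
def jTilde (x : X) (q : Q) (z : FormY n F) (σ : LieForm n EG G x) : FormY n F :=
  wedgeContract (V := EG)
    (show BaseModel n × F →L[ℝ] EG from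
      (show BaseModel n →L[ℝ] EG from σ) ∘L ContinuousLinearMap.fst ℝ (BaseModel n) F)
    (show EG →L[ℝ] (BaseModel n × F) [⋀^Fin n]→L[ℝ] ℝ from covMomentumMap (EG := EG) (G := G) q z)

/-- The section `e ∘ ψ : X → J¹Y* ⊆ Λ^{n+1} Y`, where
`e(ω, σ) = s^γ(ω) - j(ω, σ) + π_{X,Y}^* ℓ(σ)`. -/
def clebschSection (ℓ : Density n EG G X) (ψ : ∀ x : X, PhaseFiber n EG G F Q x) (x : X) :
    FormBundle (modelY n F) (X × Q) (n + 1) :=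
  ⟨(x, (ψ x).q), show FormY n F from
    dualJetLift x (ψ x).q (ψ x).mom
      - jTilde x (ψ x).q (dualJetLift x (ψ x).q (ψ x).mom) (ψ x).σ
      + ContinuousAlternatingMap.compContinuousLinearMap
          (show (BaseModel n) [⋀^Fin (n + 1)]→L[ℝ] ℝ from ℓ x (ψ x).σ)
          (ContinuousLinearMap.fst ℝ (BaseModel n) F)⟩

/-- The integrand `ψ^* Θ_e = (e ∘ ψ)^* Θ` of the covariant Clebsch variational principle. -/
def clebschForm (ℓ : Density n EG G X) (ψ : ∀ x : X, PhaseFiber n EG G F Q x) (x : X) : Vol n x :=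
  ContinuousAlternatingMap.compContinuousLinearMap
    (canonicalForm (modelY n F) (n + 1) (clebschSection ℓ ψ x))
    (mfderiv 𝓘(ℝ, BaseModel n) ((modelY n F).prod 𝓘(ℝ, FormY n F)) (clebschSection ℓ ψ) x)

/-- `dq(x) ∈ L(T_x X, T_{q(x)} Q)`. -/
def dq (ψ : ∀ x : X, PhaseFiber n EG G F Q x) (x : X) :
    TX n x →L[ℝ] TangentSpace 𝓘(ℝ, F) (ψ x).q :=
  mfderiv 𝓘(ℝ, BaseModel n) 𝓘(ℝ, F) (fun y : X => (ψ y).q) x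

/-- `σ_Q(q)(x) ∈ L(T_x X, T_{q(x)} Q)`, the map `v ↦ (σ(x)v)_Q(q(x))`. -/
def sigmaQ (ψ : ∀ x : X, PhaseFiber n EG G F Q x) (x : X) :
    TX n x →L[ℝ] TangentSpace 𝓘(ℝ, F) (ψ x).q :=
  infGen EG G F (ψ x).q ∘L (ψ x).σ

/-- The integrand `ℓ(σ) + ⟨ω, dq - σ_Q(q)⟩`. -/
def reducedForm (ℓ : Density n EG G X) (ψ : ∀ x : X, PhaseFiber n EG G F Q x) (x : X) : Vol n x :=
  ℓ x (ψ x).σ + (ψ x).mom (dq ψ x - sigmaQ ψ x)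

section Action

variable [T2Space X] [SigmaCompactSpace X]

/-- The action functional `∫_U ψ^* Θ_e` of the covariant Clebsch variational principle. -/
def clebschAction (ℓ : Density n EG G X) (U : Set X) (ψ : ∀ x : X, PhaseFiber n EG G F Q x) : ℝ :=
  formIntegral n U (clebschForm ℓ ψ)

/-- The action functional `∫_U ℓ(σ) + ⟨ω, dq - σ_Q(q)⟩`. -/
def reducedAction (ℓ : Density n EG G X) (U : Set X) (ψ : ∀ x : X, PhaseFiber n EG G F Q x) : ℝ :=
  formIntegral n U (reducedForm ℓ ψ)

end Action

/-! ## Covariant momentum map and divergences -/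

/-- The covariant momentum map `𝔧 : Π → L(L(TX, 𝔤), Λ^{n+1}X)`,
`𝔧(v ⊗ α_q ⊗ μ) = v ⊗ 𝐉(α_q) ⊗ μ`, i.e. `⟨𝔧(ω), σ⟩ = ⟨ω, σ_Q(q)⟩`. -/
def momentumMap (x : X) (q : Q) (w : Momentum n F x q) : LieMomentum n EG G x :=
  w ∘L (infGen EG G F q).postcomp (TX n x)

/-- The divergence of a section `ν` of `L(L(TX, 𝔤), Λ^{n+1}X) = TX ⊗ 𝔤* ⊗ Λ^{n+1}X`, evaluated on
`ξ ∈ 𝔤`; in coordinates `∂_μ ν_α^μ ξ^α d^{n+1}x`. -/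
def divLie (ν : ∀ x : X, LieMomentum n EG G x) (x : X) (ξ : GroupLieAlgebra 𝓘(ℝ, EG) G) :
    Vol n x :=
  extDerivAt 𝓘(ℝ, BaseModel n) (fun y : X => contract (V := EG) (ν y) ξ) x

/-- The covariant Euler–Poincaré equations `div δℓ/δσ + ad*_σ δℓ/δσ = 0` on `U`, where
`⟨ad*_σ ν, ξ⟩ = ⟨ν, [σ, ξ]⟩`. -/
def EulerPoincare (ℓ : Density n EG G X) (U : Set X) (σ : ∀ x : X, LieForm n EG G x) : Prop :=
  ∀ x ∈ U, ∀ ξ : GroupLieAlgebra 𝓘(ℝ, EG) G,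
    divLie (fun y => ℓ.fiberDeriv y (σ y)) x ξ
      + ℓ.fiberDeriv x (σ x) (bracketRight EG G ξ ∘L σ x) = 0

/-- The exterior derivative `dσ(x)(u, v)` of the `𝔤`-valued one-form `σ`, normalised by
`dσ(u, v) = u(σ(v)) - v(σ(u)) - σ([u, v])`. -/
def dSigma (ψ : ∀ x : X, PhaseFiber n EG G F Q x) (x : X) (u v : TX n x) :
    GroupLieAlgebra 𝓘(ℝ, EG) G :=
  extDerivAt 𝓘(ℝ, BaseModel n) (W := EG) (fun y : X =>
    ContinuousAlternatingMap.ofSubsingleton ℝ (BaseModel n) EG (0 : Fin 1) (ψ y).σ) x ![u, v]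

/-- The compatibility condition `(dσ - [σ, σ])_Q(q) = 0` on `U`, where
`[σ, σ](u, v) = [σ u, σ v]`. -/
def Compatible (U : Set X) (ψ : ∀ x : X, PhaseFiber n EG G F Q x) : Prop :=
  ∀ x ∈ U, ∀ u v : TX n x,
    infGen EG G F (ψ x).q
      (dSigma ψ x u v - ⁅(ψ x).σ u, (ψ x).σ v⁆) = 0

/-! ## Covariant derivatives -/

section Connection

variable (cov : CovariantDerivative 𝓘(ℝ, F) F (TangentSpace 𝓘(ℝ, F) : Q → Type _))

/-- The vector field near `q₀` with constant components in the chart at `q₀` and value `b` at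
`q₀`. -/
abbrev constField {q₀ : Q} (b : TangentSpace 𝓘(ℝ, F) q₀) (q : Q) : TangentSpace 𝓘(ℝ, F) q :=
  fromCoordQ F q₀ q b

/-- `constField` is differentiable at the base point. -/
theorem mdifferentiableAt_constField {q₀ : Q} (b : TangentSpace 𝓘(ℝ, F) q₀) :
    MDifferentiableAt 𝓘(ℝ, F) 𝓘(ℝ, F).tangent
      (fun q : Q => (⟨q, constField b q⟩ : TangentBundle 𝓘(ℝ, F) Q)) q₀ := by
  refine (FiberBundle.mdifferentiableAt_extend 𝓘(ℝ, F) F b).congr_of_eventuallyEq ?_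
  have hmem := (chart_source_mem_nhds F q₀)
  filter_upwards [hmem] with q hq
  set t := trivializationAt F (TangentSpace 𝓘(ℝ, F) : Q → Type _) q₀ with ht
  have hq' : q ∈ t.baseSet := hq
  have h1 := TangentBundle.symmL_trivializationAt_eq_core (I := 𝓘(ℝ, F)) hq
  have h2 : (t ⟨q₀, b⟩).2 = b := by
    exact tangentCoordChange_self (I := 𝓘(ℝ, F)) (mem_extChartAt_source q₀)
  have h3 : FiberBundle.extend F b q = t.symmL ℝ q b := by
    change t.symm q (t ⟨q₀, b⟩).2 = _
    rw [h2]
    exact (t.symmL_apply (R := ℝ) hq' b).symm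
  rw [h3, h1]
  rfl

/-- The endomorphism `c ↦ ∇_b c` of `T_q Q`, where `c` is extended with constant components in
the chart at `q` (the Christoffel symbols of the connection at `q`). -/
def christoffel (q : Q) (b : TangentSpace 𝓘(ℝ, F) q) :
    TangentSpace 𝓘(ℝ, F) q →L[ℝ] TangentSpace 𝓘(ℝ, F) q :=
  haveI : FiniteDimensional ℝ (TangentSpace 𝓘(ℝ, F) q) := inferInstanceAs (FiniteDimensional ℝ F)
  haveI : T2Space (TangentSpace 𝓘(ℝ, F) q) := inferInstanceAs (T2Space F)
  LinearMap.toContinuousLinearMap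
    { toFun := fun c => cov (constField c) q b
      map_add' := fun c c' => by
        have h : (constField (c + c') : ∀ q' : Q, TangentSpace 𝓘(ℝ, F) q')
            = constField c + constField c' := funext fun q' => map_add (fromCoordQ F q q') _ _
        rw [h, cov.isCovariantDerivativeOnUniv.add
          (mdifferentiableAt_constField c) (mdifferentiableAt_constField c')]
        rfl
      map_smul' := fun a c => by
        have h : (constField (a • c) : ∀ q' : Q, TangentSpace 𝓘(ℝ, F) q')
            = a • constField c := funext fun q' => map_smul (fromCoordQ F q q') _ _
        rw [h, cov.isCovariantDerivativeOnUniv.smul_const a (mdifferentiableAt_constField c)]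
        rfl }

/-- The covariant derivative `∇̃_v f(x) = D^∇/Dε|_{ε=0} f(c(ε))`, `ċ(0) = v`, of a vector field
`f : X → TQ` along `q : X → Q`: the sum of the derivative of the components of `f` in the chart
at `q(x)` and of the connection term. -/
def covAlong (q : X → Q) (f : ∀ x : X, TangentSpace 𝓘(ℝ, F) (q x)) (x : X) :
    TX n x →L[ℝ] TangentSpace 𝓘(ℝ, F) (q x) :=
  (show TX n x →L[ℝ] TangentSpace 𝓘(ℝ, F) (q x) from mfderiv 𝓘(ℝ, BaseModel n) 𝓘(ℝ, F)
      (fun y : X => (tangentCoordChange 𝓘(ℝ, F) (q y) (q x) (q y) : F →L[ℝ] F) (f y)) x)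
    + cov (constField (f x)) (q x) ∘L mfderiv 𝓘(ℝ, BaseModel n) 𝓘(ℝ, F) q x

/-- The covariant divergence of a section `ω` of `Π` covering `q`, evaluated on `b ∈ T_{q(x)} Q`:
`⟨div^∇ ω, f⟩ = div⟨ω, f⟩ - ⟨ω, ∇̃ f⟩`, where `f` is any vector field along `q` with `f(x) = b`
(here, the one with constant components in the chart at `q(x)`; the value does not depend on it).
In coordinates, `(∂_μ ω_A^μ - Γ^B_{CA} ∂_μ q^C ω_B^μ) b^A d^{n+1}x`. -/
def covDiv (ψ : ∀ x : X, PhaseFiber n EG G F Q x) (x : X) (b : TangentSpace 𝓘(ℝ, F) (ψ x).q) :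
    Vol n x :=
  extDerivAt 𝓘(ℝ, BaseModel n)
      (fun y : X => contract (V := F) (ψ y).mom (constField b (ψ y).q)) x
    - (ψ x).mom (covAlong cov (fun y : X => (ψ y).q) (fun y : X => constField b (ψ y).q) x)

/-- `∇_b σ_Q ∈ L(T_x X, T_q Q)`, the linear map `a ↦ ∇_b (σ a)_Q`, for `σ ∈ L(T_x X, 𝔤)` and
`b ∈ T_q Q` (written in the standard basis of `T_x X = ℝ^{n+1}`). -/
def nablaGen (x : X) (q : Q) (σ : LieForm n EG G x) (b : TangentSpace 𝓘(ℝ, F) q) :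
    TX n x →L[ℝ] TangentSpace 𝓘(ℝ, F) q :=
  ∑ μ : Fin (n + 1), ContinuousLinearMap.smulRight (stdCovec n μ)
    (cov (fun q' : Q => infGen EG G F q' (σ (stdVec n μ))) q b)

/-- The stationarity conditions
`div^∇ ω = -⟨ω, ∇σ_Q⟩`, `dq = σ_Q(q)`, `δℓ/δσ = 𝔧(ω)` on `U`. -/
structure Stationary (ℓ : Density n EG G X) (U : Set X)
    (ψ : ∀ x : X, PhaseFiber n EG G F Q x) : Prop where
  div_eq : ∀ x ∈ U, ∀ b : TangentSpace 𝓘(ℝ, F) (ψ x).q,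
    covDiv cov ψ x b = - (ψ x).mom (nablaGen cov x (ψ x).q (ψ x).σ b)
  dq_eq : ∀ x ∈ U, dq ψ x = sigmaQ ψ x
  fiberDeriv_eq : ∀ x ∈ U, ℓ.fiberDeriv x (ψ x).σ = momentumMap x (ψ x).q (ψ x).mom

/-! ## The collective Hamiltonian and the covariant Hamilton equations -/

variable (F) in
/-- The collective Hamiltonian `H = h ∘ 𝔧 : Π → Λ^{n+1}X`. -/
def collectiveH (ℓ : Density n EG G X) (x : X) (q : Q) (w : Momentum n F x q) : Vol n x :=
  ℓ.hamiltonian x (momentumMap x q w)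

/-- The element of `L(L(T_x X, T_{q'} Q), Λ^{n+1}_x X)`, for `q'` near `q`, with the same components
as `w` in the chart at `q`. -/
def constMomentum (x : X) {q : Q} (w : Momentum n F x q) (q' : Q) : Momentum n F x q' :=
  w ∘L ContinuousLinearMap.postcomp (TX n x)
    (show TangentSpace 𝓘(ℝ, F) q' →L[ℝ] TangentSpace 𝓘(ℝ, F) q from
      (tangentCoordChange 𝓘(ℝ, F) q' q q' : F →L[ℝ] F))

/-- The partial derivative `∂^∇H/∂q` in the direction `b ∈ T_q Q` of `H : Π → Λ^{n+1}X`, i.e. the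
derivative, at fixed `x`, along the horizontal lift of `b` to `Π` with respect to the connection:
in the chart at `q` the horizontal lift at `ω` is `(b, A ↦ ω(Γ_b ∘ A))`. -/
def partialNabla (Hm : ∀ (x : X) (q : Q), Momentum n F x q → Vol n x) (x : X) (q : Q)
    (w : Momentum n F x q) (b : TangentSpace 𝓘(ℝ, F) q) : Vol n x :=
  (show Vol n x from
    mfderiv 𝓘(ℝ, F) 𝓘(ℝ, (BaseModel n) [⋀^Fin (n + 1)]→L[ℝ] ℝ)
      (fun q' : Q => show (BaseModel n) [⋀^Fin (n + 1)]→L[ℝ] ℝ from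
        Hm x q' (constMomentum x w q')) q b)
  + fderiv ℝ (Hm x q) w (w ∘L ContinuousLinearMap.postcomp (TX n x) (christoffel cov q b))

/-- The canonical covariant Hamilton equations `dq = ∂H/∂ω`, `div^∇ ω = -∂^∇H/∂q` on `U`, where
`∂H/∂ω ∈ L(T_x X, T_q Q)` is defined by `⟨η, ∂H/∂ω⟩ = D_ω H · η` for all
`η ∈ L(L(T_x X, T_q Q), Λ^{n+1}_x X)`. -/
structure Hamilton (Hm : ∀ (x : X) (q : Q), Momentum n F x q → Vol n x) (U : Set X)
    (ψ : ∀ x : X, PhaseFiber n EG G F Q x) : Prop where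
  dq_eq : ∀ x ∈ U, ∀ η : Momentum n F x (ψ x).q,
    η (dq ψ x) = fderiv ℝ (Hm x (ψ x).q) (ψ x).mom η
  div_eq : ∀ x ∈ U, ∀ b : TangentSpace 𝓘(ℝ, F) (ψ x).q,
    covDiv cov ψ x b = - partialNabla cov Hm x (ψ x).q (ψ x).mom b

/-- The relation `σ = δh/δν` at `ν = 𝔧(ω)` on `U`, where `δh/δν ∈ L(T_x X, 𝔤)` is defined by
`⟨ν', δh/δν⟩ = D h(ν) · ν'` for all `ν'`. -/
def SigmaEqDh (ℓ : Density n EG G X) (U : Set X)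
    (ψ : ∀ x : X, PhaseFiber n EG G F Q x) : Prop :=
  ∀ x ∈ U, ∀ ν' : LieMomentum n EG G x,
    ν' (ψ x).σ = fderiv ℝ (ℓ.hamiltonian x) (momentumMap x (ψ x).q (ψ x).mom) ν'

end Connection

end Clebsch
end
end CovariantClebsch

open CovariantClebsch

set_option linter.unusedSectionVars false

namespace CovariantClebsch

/-! ### Multilinear algebra of top-degree forms and of the contraction. -/

section Algebra

variable {n : ℕ} {V W : Type*} [NormedAddCommGroup V] [NormedSpace ℝ V]
  [NormedAddCommGroup W] [NormedSpace ℝ W]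

/-! The form of the action is a matter of algebra. The canonical form `Θ` sees a tangent vector only
through its projection to `Y`, so `ψ^* Θ_e` at `x` is the value `e(ψ x)` pulled back along `u ↦ (u,
dq u)`. For a top-degree form `β` one has `α ∧ i_v β = α(v) β`; hence wedging undoes the
contraction, `s^γ(ω)` pulls back to `⟨ω, dq⟩`, and `σ ∧ 𝒥(s^γ(ω))` to `⟨ω, σ_Q(q)⟩`
(`clebschElement_comp_graphMap`, `SmoothFamilyOn.clebschForm_eq`). By compactness of the closure of
`U`, a variation is smooth on all of `U` once `ε` is small, so the two actions agree near `ε = 0`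
along every variation.

In charts the integrand is `L(z, S) + P(DQ - A(Q) S)`, with `A` the infinitesimal generator. Its
first variation is an expression linear in `(δq, δσ, δω)` plus the divergence of the flux `⟨ω, · ⊗
δq⟩`; symmetry of second derivatives is what turns `P(D δQ)` into a divergence
(`hasDerivAt_localIntegrand`). The flux vanishes on the frontier of `U`, but that frontier may be
arbitrarily irregular. The divergence theorem is therefore proved by truncation: `f - δ η(f/δ)` is
compactly supported inside the open set whenever `f` vanishes on the frontier, and the gradient of
`f` vanishes almost everywhere on `{f = 0}` (`setIntegral_fderiv_eq_zero`). A partition of unity,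
whose differentials add up to zero, globalises this to `IsAdmissibleFlux.formIntegral_eq_zero`.
Conversely, perturbations by bump functions in charts and the fundamental lemma of the calculus of
variations make the linear expression vanish pointwise (`eulerCoord_of_isCritical`). Its three slots
are the three equations of `EulerLagrange`, stated without a connection. A torsion-free connection
adds the term `Γ_b ∘ dq` to one side of the divergence equation and `Γ_b ∘ σ_Q` to the other; these
coincide because `dq = σ_Q` (`covDiv_add_nablaGen`).

For the Euler–Poincaré equations, differentiating `(g h) • q = g • (h • q)` shows that generators of
a left action reverse brackets: `[η, ξ]_Q = D_{ξ_Q} η_Q - D_{η_Q} ξ_Q` in a chart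
(`infGen_bracket`). Since `⟨𝔧(ω), ξ⟩ = ⟨ω, ξ_Q(q)⟩`, the Leibniz rule with `dq = σ_Q` expresses the
divergence of `𝔧(ω) = δℓ/δσ` through `div ω` and `D_{σ_Q} ξ_Q`; the divergence equation and the
bracket identity leave exactly `-⟨𝔧(ω), [σ, ξ]⟩`. The compatibility condition is the symmetry of
`D²q` when `dq = σ_Q(q)`, rewritten with the same identity.

For the Hamiltonian form, the derivative of a Legendre transform is the inverse Legendre map. With
`τ = δh/δν` at `𝔧(ω)`, the chain rule gives `∂H/∂ω = τ_Q` and `∂^∇H/∂q = ⟨ω, ∇τ_Q⟩`. Thus the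
Hamilton equations for `ω` are the first two stationarity equations for `(ω, τ)`, and the third
holds by the choice of `τ` (`hamilton_iff_stationary`). -/

theorem stdCovec_stdVec (μ ν : Fin (n + 1)) :
    stdCovec n μ (stdVec n ν) = if μ = ν then 1 else 0 := by
  simp [stdCovec, stdVec]

theorem sum_stdCovec_smul_stdVec (u : BaseModel n) :
    ∑ μ, stdCovec n μ u • stdVec n μ = u := by
  have := (EuclideanSpace.basisFun (Fin (n + 1)) ℝ).sum_repr u
  simpa [stdCovec, stdVec] using this

/-- A linear map is the sum of its columns. -/
theorem sum_smulRight_stdCovec (A : BaseModel n →L[ℝ] V) :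
    ∑ μ, (stdCovec n μ).smulRight (A (stdVec n μ)) = A := by
  ext u
  conv_rhs => rw [← sum_stdCovec_smul_stdVec u]
  simp

theorem basisFun_toBasis_eq_stdVec :
    (⇑(EuclideanSpace.basisFun (Fin (n + 1)) ℝ).toBasis) = stdVec n := by
  funext i; simp [stdVec]

/-- Two top-degree forms are equal when they agree on the standard basis. -/
theorem top_form_ext {α β : (BaseModel n) [⋀^Fin (n + 1)]→L[ℝ] ℝ}
    (h : α (stdVec n) = β (stdVec n)) : α = β := by
  apply ContinuousAlternatingMap.toAlternatingMap_injective
  refine (EuclideanSpace.basisFun (Fin (n + 1)) ℝ).toBasis.ext_alternating fun v hv => ?_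
  rw [basisFun_toBasis_eq_stdVec]
  let σ : Equiv.Perm (Fin (n + 1)) :=
    Equiv.ofBijective v (Finite.injective_iff_bijective.1 hv)
  have e : (fun i => stdVec n (v i)) = stdVec n ∘ σ := rfl
  rw [e, AlternatingMap.map_perm, AlternatingMap.map_perm]
  congr 1

/-- Evaluation of top-degree forms on the standard basis. -/
noncomputable def evalStd (n : ℕ) : ((BaseModel n) [⋀^Fin (n + 1)]→L[ℝ] ℝ) →L[ℝ] ℝ :=
  ContinuousAlternatingMap.apply ℝ (BaseModel n) ℝ (stdVec n)

@[simp] theorem evalStd_apply (α : (BaseModel n) [⋀^Fin (n + 1)]→L[ℝ] ℝ) :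
    evalStd n α = α (stdVec n) := rfl

/-- Top-degree forms are multiples of the determinant in the standard basis. This is the source of
every Jacobian below: in the change of charts for integrals and in the transformation law of
momenta. -/
theorem top_form_apply_comp (β : (BaseModel n) [⋀^Fin (n + 1)]→L[ℝ] ℝ)
    (A : BaseModel n →L[ℝ] BaseModel n) :
    β (fun μ => A (stdVec n μ)) = A.det * β (stdVec n) := by
  let b := (EuclideanSpace.basisFun (Fin (n + 1)) ℝ).toBasis
  have h := β.toAlternatingMap.eq_smul_basis_det b
  have h1 : ∀ v, β v = β b * b.det v := fun v => by
    have := congrArg (fun f => f v) h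
    simpa using this
  have h2 : (fun μ => A (stdVec n μ)) = (A : BaseModel n →ₗ[ℝ] BaseModel n) ∘ b := by
    funext μ; simp [b, stdVec]
  rw [h1, h2, Module.Basis.det_comp, Module.Basis.det_self, basisFun_toBasis_eq_stdVec]
  simp [ContinuousLinearMap.det]
  ring

/-- `α ∧ i_e β = α(e) β` for forms `β` of top degree. -/
theorem alternatize_smulRight_curryLeft (β : (BaseModel n) [⋀^Fin (n + 1)]→L[ℝ] ℝ)
    (α : BaseModel n →L[ℝ] ℝ) (e : BaseModel n) :
    ContinuousAlternatingMap.alternatizeUncurryFin (α.smulRight (β.curryLeft e)) = α e • β := by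
  apply top_form_ext
  rw [ContinuousAlternatingMap.alternatizeUncurryFin_apply]
  have key : ∀ i : Fin (n + 1), (-1 : ℤ) ^ (i : ℕ) • (α.smulRight (β.curryLeft e)) (stdVec n i)
      (i.removeNth (stdVec n)) = α (stdVec n i) * (stdCovec n i e * β (stdVec n)) := by
    intro i
    have h1 : (α.smulRight (β.curryLeft e)) (stdVec n i) (i.removeNth (stdVec n)) =
        α (stdVec n i) * β (Matrix.vecCons e (i.removeNth (stdVec n))) := rfl
    -- Moving `e` from the front to place `i` produces the sign `(-1)^i`, which cancels the sign of
    -- the alternation.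
    have h2 := β.neg_one_pow_smul_map_insertNth i e (i.removeNth (stdVec n))
    rw [Fin.insertNth_removeNth] at h2
    -- With `e` in place `i`, only its `i`-th coordinate survives: any other basis vector would
    -- occur twice.
    have h3 : β (Function.update (stdVec n) i e) = stdCovec n i e * β (stdVec n) := by
      conv_lhs => rw [← sum_stdCovec_smul_stdVec e]
      have := β.toAlternatingMap.map_update_sum (t := Finset.univ) (i := i)
        (g := fun k => stdCovec n k e • stdVec n k) (m := stdVec n)
      refine this.trans ?_
      rw [Finset.sum_eq_single i]
      · rw [AlternatingMap.map_update_smul]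
        simp
      · intro k _ hk
        rw [AlternatingMap.map_update_smul, AlternatingMap.map_update_self _ _ (Ne.symm hk), smul_zero]
      · simp
    rw [h1, ← h2, h3]
    have : ((-1 : ℤ) ^ (i : ℕ)) * (-1) ^ (i : ℕ) = 1 := by
      rw [← mul_pow]; simp
    simp only [zsmul_eq_mul]
    have h5 : (((-1 : ℤ) ^ (i : ℕ) : ℤ) : ℝ) * (((-1 : ℤ) ^ (i : ℕ) : ℤ) : ℝ) = 1 := by
      exact_mod_cast this
    linear_combination (α (stdVec n i) * (stdCovec n i e * β (stdVec n))) * h5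
  rw [Finset.sum_congr rfl fun i _ => key i]
  have : α e = ∑ i, α (stdVec n i) * stdCovec n i e := by
    conv_lhs => rw [← sum_stdCovec_smul_stdVec e]
    simp [mul_comm]
  simp [this, Finset.sum_mul, mul_assoc]

theorem contract_apply (ν : (BaseModel n →L[ℝ] V) →L[ℝ] (BaseModel n) [⋀^Fin (n + 1)]→L[ℝ] ℝ)
    (v : V) :
    contract ν v = ∑ μ, (ν ((stdCovec n μ).smulRight v)).curryLeft (stdVec n μ) := by
  simp [contract]

/-- Alternation is natural in the vector arguments, so the pull-back acts on the two factors
separately, while the contracted index in `V` is untouched. -/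
theorem wedgeContract_comp {k : ℕ} {W' : Type*} [NormedAddCommGroup W'] [NormedSpace ℝ W']
    (θ : W →L[ℝ] V) (β : V →L[ℝ] W [⋀^Fin k]→L[ℝ] ℝ) (g : W' →L[ℝ] W) :
    (wedgeContract θ β).compContinuousLinearMap g =
      wedgeContract (θ ∘L g) (ContinuousAlternatingMap.compContinuousLinearMapCLM g ∘L β) := by
  ext v
  simp [wedgeContract, ContinuousAlternatingMap.alternatizeUncurryFin_apply]
  rfl

theorem alternatizeUncurryFin_sum {k : ℕ} {ι : Type*} (s : Finset ι)
    (f : ι → W →L[ℝ] W [⋀^Fin k]→L[ℝ] ℝ) :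
    ContinuousAlternatingMap.alternatizeUncurryFin (∑ i ∈ s, f i) =
      ∑ i ∈ s, ContinuousAlternatingMap.alternatizeUncurryFin (f i) := by
  simpa only [ContinuousAlternatingMap.alternatizeUncurryFinCLM_apply] using
    map_sum (ContinuousAlternatingMap.alternatizeUncurryFinCLM ℝ W ℝ (n := k)) f s

/-- The divergence form of a sum of contracted columns. -/
theorem alternatize_contract_columns
    (N : Fin (n + 1) → BaseModel n →L[ℝ] (BaseModel n) [⋀^Fin (n + 1)]→L[ℝ] ℝ) :
    ContinuousAlternatingMap.alternatizeUncurryFin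
      (∑ μ, (ContinuousLinearMap.apply ℝ ((BaseModel n) [⋀^Fin n]→L[ℝ] ℝ) (stdVec n μ)) ∘L
      (ContinuousAlternatingMap.curryLeftLI (𝕜 := ℝ) (E := BaseModel n) (F := ℝ)
        (n := n)).toContinuousLinearMap ∘L N μ) = ∑ μ, N μ (stdVec n μ) := by
  rw [alternatizeUncurryFin_sum]
  refine Finset.sum_congr rfl fun μ _ => ?_
  -- Splitting `N μ` into columns brings each term to the form `dx^k ∧ i_{e_μ} β = δ_{kμ} β`.
  have h : (ContinuousLinearMap.apply ℝ ((BaseModel n) [⋀^Fin n]→L[ℝ] ℝ) (stdVec n μ)) ∘L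
      (ContinuousAlternatingMap.curryLeftLI (𝕜 := ℝ) (E := BaseModel n) (F := ℝ)
        (n := n)).toContinuousLinearMap ∘L N μ =
      ∑ k, (stdCovec n k).smulRight ((N μ (stdVec n k)).curryLeft (stdVec n μ)) := by
    refine (sum_smulRight_stdCovec _).symm.trans ?_
    rfl
  rw [h, alternatizeUncurryFin_sum,
    Finset.sum_congr rfl fun k _ => alternatize_smulRight_curryLeft _ _ _]
  simp [stdCovec_stdVec]

/-- The contraction is inverted by the wedge product. -/
theorem wedgeContract_contract
    (ν : (BaseModel n →L[ℝ] V) →L[ℝ] (BaseModel n) [⋀^Fin (n + 1)]→L[ℝ] ℝ)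
    (A : BaseModel n →L[ℝ] V) : wedgeContract A (contract ν) = ν A := by
  have h := alternatize_contract_columns (n := n) (fun μ =>
    ν ∘L (ContinuousLinearMap.smulRightL ℝ (BaseModel n) V (stdCovec n μ)) ∘L A)
  have e : contract ν ∘L A = (∑ μ, (ContinuousLinearMap.apply ℝ ((BaseModel n) [⋀^Fin n]→L[ℝ] ℝ)
      (stdVec n μ)) ∘L (ContinuousAlternatingMap.curryLeftLI (𝕜 := ℝ) (E := BaseModel n) (F := ℝ)
        (n := n)).toContinuousLinearMap ∘L (ν ∘L (ContinuousLinearMap.smulRightL ℝ (BaseModel n) V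
          (stdCovec n μ)) ∘L A)) := by
    ext u v
    simp [contract]
  unfold wedgeContract
  rw [e, h]
  conv_rhs => rw [← sum_smulRight_stdCovec A, map_sum]
  rfl

/-- The graph `u ↦ (u, A u)`. -/
abbrev graphMap (A : BaseModel n →L[ℝ] V) : BaseModel n →L[ℝ] BaseModel n × V :=
  (ContinuousLinearMap.id ℝ (BaseModel n)).prod A

/-- On the graph of `A` the vertical projection becomes `A`, and wedging with `A` inverts the
contraction. For `A = dq` this is the term `⟨ω, dq⟩` of the action. -/
theorem lift_comp_graphMap
    (ν : (BaseModel n →L[ℝ] V) →L[ℝ] (BaseModel n) [⋀^Fin (n + 1)]→L[ℝ] ℝ)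
    (A : BaseModel n →L[ℝ] V) :
    (wedgeContract (ContinuousLinearMap.snd ℝ (BaseModel n) V)
      (ContinuousAlternatingMap.compContinuousLinearMapCLM
        (ContinuousLinearMap.fst ℝ (BaseModel n) V) ∘L contract ν)).compContinuousLinearMap
        (graphMap A) = ν A := by
  rw [wedgeContract_comp, ← wedgeContract_contract ν A]
  rfl

/-- Interior product of the lift with a vertical vector. -/
theorem lift_curryLeft_inr
    (ν : (BaseModel n →L[ℝ] V) →L[ℝ] (BaseModel n) [⋀^Fin (n + 1)]→L[ℝ] ℝ) (c : V) :
    (wedgeContract (ContinuousLinearMap.snd ℝ (BaseModel n) V)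
      (ContinuousAlternatingMap.compContinuousLinearMapCLM
        (ContinuousLinearMap.fst ℝ (BaseModel n) V) ∘L contract ν)).curryLeft (0, c) =
      (contract ν c).compContinuousLinearMap (ContinuousLinearMap.fst ℝ (BaseModel n) V) := by
  ext u
  rw [ContinuousAlternatingMap.curryLeft_apply_apply, wedgeContract,
    ContinuousAlternatingMap.alternatizeUncurryFin_apply, Fin.sum_univ_succ]
  have h0 : (0 : Fin (n + 1)).removeNth (Matrix.vecCons ((0 : BaseModel n), c) u) = u := by
    funext i; rfl
  rw [Finset.sum_eq_zero, h0, add_zero]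
  · simp
  · intro i _
    have hn : 0 < n := by have := i.2; omega
    obtain ⟨m, rfl⟩ : ∃ m, n = m + 1 := ⟨n - 1, by omega⟩
    -- Removing any slot but the first leaves `(0, c)` among the arguments, and the projection to
    -- the base kills it. Only the zeroth term of the alternation contributes.
    have : ∀ x : V, ((contract ν x).compContinuousLinearMap
        (ContinuousLinearMap.fst ℝ (BaseModel (m + 1)) V))
        (i.succ.removeNth (Matrix.vecCons ((0 : BaseModel (m + 1)), c) u)) = 0 := fun x => by
      refine ContinuousAlternatingMap.map_coord_zero (contract ν x) (0 : Fin (m + 1)) ?_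
      rfl
    have h := this (u i).2
    simp only [ContinuousLinearMap.comp_apply]
    refine (smul_eq_zero_of_right _ ?_)
    exact h

end Algebra

end CovariantClebsch

namespace CovariantClebsch

open MeasureTheory Filter Set

/-! ### Differentiation under the integral and a divergence theorem without boundary regularity. -/

section Analysis

variable {E : Type*} [NormedAddCommGroup E] [NormedSpace ℝ E] [FiniteDimensional ℝ E]
  [MeasurableSpace E] [BorelSpace E] {m : Measure E} [m.IsAddHaarMeasure]

/-- Local bounds near a compact set are uniform. -/
theorem exists_bound_of_locally_bounded {V K : Set E} (hK : IsCompact K) {g : E → ℝ}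
    (hb : ∀ y ∈ K, ∃ C, ∀ᶠ z in 𝓝[V] y, |g z| ≤ C) : ∃ C, ∀ z ∈ K ∩ V, |g z| ≤ C := by
  refine hK.induction_on (p := fun s => ∃ C, ∀ z ∈ s ∩ V, |g z| ≤ C) ⟨0, by simp⟩ ?_ ?_ ?_
  · rintro s t hst ⟨C, hC⟩
    exact ⟨C, fun z hz => hC z ⟨hst hz.1, hz.2⟩⟩
  · rintro s t ⟨C, hC⟩ ⟨C', hC'⟩
    refine ⟨max C C', fun z hz => ?_⟩
    rcases hz.1 with h | h
    · exact (hC z ⟨h, hz.2⟩).trans (le_max_left _ _)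
    · exact (hC' z ⟨h, hz.2⟩).trans (le_max_right _ _)
  · intro y hy
    obtain ⟨C, hC⟩ := hb y hy
    rw [eventually_nhdsWithin_iff] at hC
    exact ⟨_, mem_nhdsWithin_of_mem_nhds hC, C, fun z hz => hz.1 hz.2⟩

/-- Continuity on `V` says nothing near the frontier, so boundedness is asked relative to `V` at
every point of `K`, frontier points included. Compactness of `K` makes the bound uniform, and the
integrand vanishes off `K`. -/
theorem integrableOn_of_locally_bounded {V K : Set E} (hV : MeasurableSet V) (hK : IsCompact K)
    {g : E → ℝ} (hg : ContinuousOn g V) (h0 : ∀ y ∈ V, y ∉ K → g y = 0)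
    (hb : ∀ y ∈ K, ∃ C, ∀ᶠ z in 𝓝[V] y, |g z| ≤ C) : IntegrableOn g V m := by
  obtain ⟨C, hC⟩ := exists_bound_of_locally_bounded hK hb
  have h1 : IntegrableOn g (K ∩ V) m := by
    have : IsFiniteMeasure (m.restrict (K ∩ V)) :=
      ⟨by simpa using (measure_mono inter_subset_left).trans_lt hK.measure_lt_top⟩
    refine Integrable.of_bound (C := C) ?_ ?_
    · exact (hg.mono inter_subset_right).aestronglyMeasurable
        (hK.measurableSet.inter hV)
    · exact (ae_restrict_iff' (hK.measurableSet.inter hV)).2 (Eventually.of_forall hC)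
  have h2 : IntegrableOn g (V \ K) m := by
    refine (integrableOn_congr_fun (f := fun _ => (0 : ℝ)) ?_ (hV.diff hK.measurableSet)).1
      integrableOn_zero
    exact fun y hy => (h0 y hy.1 hy.2).symm
  exact (h1.union h2).mono_set fun y hy => by
    by_cases h : y ∈ K
    · exact Or.inl ⟨h, hy⟩
    · exact Or.inr ⟨hy, h⟩

/-- Local structure of an integrand which is the restriction of a smooth function near `(0, y)`. -/
theorem eventually_family_regular {V : Set E} (hV : IsOpen V) {r : ℝ → E → ℝ} {y : E}
    {r' : ℝ × E → ℝ} (hr' : ContDiffAt ℝ 1 r' (0, y))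
    (h : ∀ᶠ p in 𝓝 ((0 : ℝ), y), p.2 ∈ V → r p.1 p.2 = r' p) :
    ∃ C, ∀ᶠ p in 𝓝 ((0 : ℝ), y), p.2 ∈ V → ContinuousAt (r p.1) p.2 ∧
      HasDerivAt (fun ε => r ε p.2) (fderiv ℝ r' p (1, 0)) p.1 ∧
      |fderiv ℝ r' p (1, 0)| ≤ C ∧ |r p.1 p.2| ≤ C ∧
      ContinuousAt (fun z => deriv (fun ε => r ε z) p.1) p.2 := by
  have hev := (hr'.eventually (by simp)).and h.eventually_nhds
  have hcd : ContinuousAt (fun p => fderiv ℝ r' p (1, 0)) ((0 : ℝ), y) :=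
    ((hr'.fderiv_right (m := 0) (by simp)).continuousAt.clm_apply continuousAt_const)
  have hc : ContinuousAt r' ((0 : ℝ), y) := hr'.continuousAt
  -- This constant strictly exceeds both `|∂_ε r'|` and `|r'|` at `(0, y)`, so a single `C` bounds
  -- the function and its derivative nearby.
  have hb1 := hcd.abs.eventually_lt continuousAt_const
    (show |fderiv ℝ r' (0, y) (1, 0)| < |fderiv ℝ r' (0, y) (1, 0)| + 1 + |r' (0, y)| by
      have := abs_nonneg (r' (0, y)); linarith)
  have hb2 := hc.abs.eventually_lt continuousAt_const
    (show |r' (0, y)| < |fderiv ℝ r' (0, y) (1, 0)| + 1 + |r' (0, y)| by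
      have := abs_nonneg (fderiv ℝ r' (0, y) (1, 0)); linarith)
  have hder : ∀ p : ℝ × E, ContDiffAt ℝ 1 r' p → (∀ᶠ p in 𝓝 p, p.2 ∈ V → r p.1 p.2 = r' p) →
      p.2 ∈ V → HasDerivAt (fun ε => r ε p.2) (fderiv ℝ r' p (1, 0)) p.1 := by
    intro p hp1 hp2 hpV
    have hd : HasFDerivAt r' (fderiv ℝ r' p) p := (hp1.differentiableAt (by simp)).hasFDerivAt
    have hl : HasDerivAt (fun ε : ℝ => (ε, p.2)) ((1 : ℝ), (0 : E)) p.1 :=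
      (hasDerivAt_id p.1).prodMk (hasDerivAt_const p.1 p.2)
    have := HasFDerivAt.comp_hasDerivAt (x := p.1) (f := fun ε : ℝ => (ε, p.2)) (l := r') hd hl
    refine this.congr_of_eventuallyEq ?_
    have ht : Tendsto (fun ε : ℝ => (ε, p.2)) (𝓝 p.1) (𝓝 p) := by
      have : ContinuousAt (fun ε : ℝ => (ε, p.2)) p.1 := by fun_prop
      exact this
    filter_upwards [ht.eventually hp2] with ε hε
    exact hε hpV
  refine ⟨|fderiv ℝ r' (0, y) (1, 0)| + 1 + |r' (0, y)|, ?_⟩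
  filter_upwards [hev.eventually_nhds, hb1, hb2] with p hp h1 h2 hpV
  have hp0 := hp.self_of_nhds
  have ht : Tendsto (fun z : E => (p.1, z)) (𝓝 p.2) (𝓝 p) := by
    have : ContinuousAt (fun z : E => (p.1, z)) p.2 := by fun_prop
    exact this
  have hVn : ∀ᶠ z in 𝓝 p.2, z ∈ V := hV.mem_nhds hpV
  refine ⟨?_, hder p hp0.1 hp0.2 hpV, h1.le, ?_, ?_⟩
  · have : ContinuousAt (fun z => r' (p.1, z)) p.2 :=
      ContinuousAt.comp (f := fun z : E => (p.1, z)) (g := r') hp0.1.continuousAt ht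
    refine this.congr ?_
    filter_upwards [ht.eventually hp0.2, hVn] with z hz hzV
    exact (hz hzV).symm
  · rw [hp0.2.self_of_nhds hpV]; exact h2.le
  · have : ContinuousAt (fun z => fderiv ℝ r' (p.1, z) (1, 0)) p.2 := by
      have h3 : ContinuousAt (fun p => fderiv ℝ r' p (1, 0)) p :=
        ((hp0.1.fderiv_right (m := 0) (by simp)).continuousAt.clm_apply continuousAt_const)
      exact ContinuousAt.comp (f := fun z : E => (p.1, z)) h3 ht
    refine this.congr ?_
    filter_upwards [ht.eventually hp, hVn] with z hz hzV
    exact (hder (p.1, z) hz.1 hz.2 hzV).deriv.symm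

/-- Differentiation under the integral sign, for integrands which are smooth up to the closure. -/
theorem hasDerivAt_setIntegral_of_smooth_up_to_closure {V K : Set E} (hV : IsOpen V)
    (hK : IsCompact K) {r : ℝ → E → ℝ} (h0 : ∀ ε, ∀ y ∈ V, y ∉ K → r ε y = 0)
    (hloc : ∀ y ∈ K, ∃ r' : ℝ × E → ℝ, ContDiffAt ℝ 1 r' (0, y) ∧
      ∀ᶠ p in 𝓝 ((0 : ℝ), y), p.2 ∈ V → r p.1 p.2 = r' p) :
    HasDerivAt (fun ε => ∫ y in V, r ε y ∂m) (∫ y in V, deriv (fun ε => r ε y) 0 ∂m) 0 := by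
  -- The local statement holds on a product neighbourhood of `(0, y)`; compact induction over `K`
  -- gives one `δ` and one `C` for all points.
  have huni : ∃ δ > 0, ∃ C, ∀ ε, |ε| < δ → ∀ z ∈ K ∩ V, ContinuousAt (r ε) z ∧
      DifferentiableAt ℝ (fun ε => r ε z) ε ∧ |deriv (fun ε => r ε z) ε| ≤ C ∧ |r ε z| ≤ C ∧
      ContinuousAt (fun z => deriv (fun ε => r ε z) ε) z := by
    refine hK.induction_on (p := fun s => ∃ δ > 0, ∃ C, ∀ ε, |ε| < δ → ∀ z ∈ s ∩ V,
      ContinuousAt (r ε) z ∧ DifferentiableAt ℝ (fun ε => r ε z) ε ∧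
      |deriv (fun ε => r ε z) ε| ≤ C ∧ |r ε z| ≤ C ∧
      ContinuousAt (fun z => deriv (fun ε => r ε z) ε) z) ⟨1, one_pos, 0, by simp⟩ ?_ ?_ ?_
    · rintro s t hst ⟨δ, hδ, C, hC⟩
      exact ⟨δ, hδ, C, fun ε hε z hz => hC ε hε z ⟨hst hz.1, hz.2⟩⟩
    · rintro s t ⟨δ, hδ, C, hC⟩ ⟨δ', hδ', C', hC'⟩
      refine ⟨min δ δ', lt_min hδ hδ', max C C', fun ε hε z hz => ?_⟩
      rcases hz.1 with h | h
      · obtain ⟨a, b, c, d, e⟩ := hC ε (hε.trans_le (min_le_left _ _)) z ⟨h, hz.2⟩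
        exact ⟨a, b, c.trans (le_max_left _ _), d.trans (le_max_left _ _), e⟩
      · obtain ⟨a, b, c, d, e⟩ := hC' ε (hε.trans_le (min_le_right _ _)) z ⟨h, hz.2⟩
        exact ⟨a, b, c.trans (le_max_right _ _), d.trans (le_max_right _ _), e⟩
    · intro y hy
      obtain ⟨r', hr', h⟩ := hloc y hy
      obtain ⟨C, hC⟩ := eventually_family_regular hV hr' h
      rw [nhds_prod_eq] at hC
      obtain ⟨P, hP, R, hR, hPR⟩ := eventually_prod_iff.1 hC
      obtain ⟨δ, hδ, hδP⟩ := Metric.eventually_nhds_iff.1 hP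
      refine ⟨{z | R z}, mem_nhdsWithin_of_mem_nhds hR, δ, hδ, C, fun ε hε z hz => ?_⟩
      obtain ⟨a, b, c, d, e⟩ := hPR (hδP (by simpa using hε)) hz.1 hz.2
      exact ⟨a, b.differentiableAt, by rw [b.deriv]; exact c, d, e⟩
  obtain ⟨δ, hδ, C, hC⟩ := huni
  have hout : ∀ ε, ∀ z ∈ V, z ∉ K → r ε =ᶠ[𝓝 z] fun _ => 0 := fun ε z hz hzK => by
    filter_upwards [hV.mem_nhds hz, hK.isClosed.isOpen_compl.mem_nhds hzK] with w hw hwK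
    exact h0 ε w hw hwK
  have hdout : ∀ ε, ∀ z ∈ V, z ∉ K → deriv (fun ε => r ε z) ε = 0 := fun ε z hz hzK => by
    have : (fun ε => r ε z) = fun _ => 0 := funext fun ε => h0 ε z hz hzK
    rw [this]; simp
  have hcont : ∀ ε, |ε| < δ → ContinuousOn (r ε) V := fun ε hε z hz => by
    by_cases hzK : z ∈ K
    · exact (hC ε hε z ⟨hzK, hz⟩).1.continuousWithinAt
    · exact (continuousAt_const.congr (hout ε z hz hzK).symm).continuousWithinAt
  have hcont' : ContinuousOn (fun z => deriv (fun ε => r ε z) 0) V := fun z hz => by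
    by_cases hzK : z ∈ K
    · exact (hC 0 (by simpa using hδ) z ⟨hzK, hz⟩).2.2.2.2.continuousWithinAt
    · refine ContinuousAt.continuousWithinAt ?_
      refine (continuousAt_const (y := (0 : ℝ))).congr ?_
      filter_upwards [hV.mem_nhds hz, hK.isClosed.isOpen_compl.mem_nhds hzK] with w hw hwK
      exact (hdout 0 w hw hwK).symm
  have hae : ∀ {p : E → Prop}, (∀ z ∈ V, p z) → ∀ᵐ z ∂m.restrict V, p z := fun h =>
    (ae_restrict_iff' hV.measurableSet).2 (Eventually.of_forall h)
  -- The dominating function is a constant on `K` and zero elsewhere. The `max` with `0` keeps the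
  -- constant nonnegative even if `K ∩ V` is empty.
  refine (hasDerivAt_integral_of_dominated_loc_of_deriv_le (s := Metric.ball 0 δ)
    (F' := fun ε z => deriv (fun ε => r ε z) ε) (bound := K.indicator fun _ => max C 0)
    (Metric.ball_mem_nhds 0 hδ) ?_ ?_ ?_ ?_ ?_ ?_).2
  · filter_upwards [Metric.ball_mem_nhds (0 : ℝ) hδ] with ε hε
    exact (hcont ε (by simpa using hε)).aestronglyMeasurable hV.measurableSet
  · refine integrableOn_of_locally_bounded hV.measurableSet hK (hcont 0 (by simpa using hδ)) (h0 0)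
      fun y hy => ?_
    obtain ⟨r', hr', h⟩ := hloc y hy
    obtain ⟨C, hC⟩ := eventually_family_regular hV hr' h
    refine ⟨C, ?_⟩
    rw [eventually_nhdsWithin_iff]
    have ht : Tendsto (fun z : E => ((0 : ℝ), z)) (𝓝 y) (𝓝 (0, y)) := by
      have : ContinuousAt (fun z : E => ((0 : ℝ), z)) y := by fun_prop
      exact this
    filter_upwards [ht.eventually hC] with z hz hzV
    exact (hz hzV).2.2.2.1
  · exact hcont'.aestronglyMeasurable hV.measurableSet
  · refine hae fun z hz ε hε => ?_
    by_cases hzK : z ∈ K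
    · simp only [indicator_of_mem hzK]
      exact (hC ε (by simpa using hε) z ⟨hzK, hz⟩).2.2.1.trans (le_max_left _ _)
    · simp only [indicator_of_notMem hzK]
      rw [hdout ε z hz hzK]; simp
  · refine Integrable.integrableOn ?_
    exact (integrableOn_const (hK.measure_lt_top.ne)).integrable_indicator hK.measurableSet
  · refine hae fun z hz ε hε => ?_
    by_cases hzK : z ∈ K
    · exact (hC ε (by simpa using hε) z ⟨hzK, hz⟩).2.1.hasDerivAt
    · have : (fun ε => r ε z) = fun _ => 0 := funext fun ε => h0 ε z hz hzK
      simp only [this]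
      simpa using hasDerivAt_const ε (0 : ℝ)

/-- The derivative of a compactly supported `C^1` function has zero integral. -/
theorem integral_fderiv_eq_zero {g : E → ℝ} (hg : ContDiff ℝ 1 g) (hc : HasCompactSupport g)
    (e : E) : ∫ y, fderiv ℝ g y e ∂m = 0 := by
  have h1 : Integrable (fun y => fderiv ℝ g y e) m :=
    (((hg.continuous_fderiv (by simp)).clm_apply continuous_const).integrable_of_hasCompactSupport
      ((hc.fderiv (𝕜 := ℝ)).comp_left (g := fun L : E →L[ℝ] ℝ => L e) (by simp)))
  have := integral_mul_fderiv_eq_neg_fderiv_mul_of_integrable (μ := m) (f := fun _ : E => (1 : ℝ))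
    (g := g) (v := e) (by simp) (by simpa using h1)
    (by simpa using hg.continuous.integrable_of_hasCompactSupport hc)
    (fun _ _ => by simp) (fun x _ => (hg.differentiable (by simp)) x)
  simpa using this

/-- A function vanishing outside a compact subset of the open set `V`, `C^1` on `V`, is `C^1`. -/
theorem contDiff_of_support {V : Set E} (hV : IsOpen V) {g : E → ℝ} {K : Set E} (hK : IsClosed K)
    (hKV : K ⊆ V) (hg : ContDiffOn ℝ 1 g V) (h0 : ∀ y, y ∉ K → g y = 0) : ContDiff ℝ 1 g := by
  rw [contDiff_iff_contDiffAt]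
  intro y
  by_cases hy : y ∈ V
  · exact hg.contDiffAt (hV.mem_nhds hy)
  · refine (contDiffAt_const (c := (0 : ℝ))).congr_of_eventuallyEq ?_
    filter_upwards [hK.isOpen_compl.mem_nhds fun h => hy (hKV h)] with z hz
    exact h0 z hz

/-- A smooth compactly supported function on `ℝ` which is the identity near `0`. -/
theorem exists_local_identity : ∃ η : ℝ → ℝ, ContDiff ℝ ∞ η ∧ (∀ t, |t| ≤ 1 → η t = t) ∧
    (∀ t, 2 ≤ |t| → η t = 0) := by
  let b : ContDiffBump (0 : ℝ) := ⟨1, 2, one_pos, one_lt_two⟩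
  refine ⟨fun t => t * b t, contDiff_id.mul b.contDiff, fun t ht => ?_, fun t ht => ?_⟩
  · change t * b t = t
    rw [b.one_of_mem_closedBall (by simpa [b] using ht), mul_one]
  · have : b t = 0 := b.zero_of_le_dist (by simpa [b] using ht)
    change t * b t = 0
    rw [this, mul_zero]

/-- **Divergence theorem on an arbitrary open set**, for a function which is `C^1` up to the closure
and vanishes on the frontier. -/
theorem setIntegral_fderiv_eq_zero {V K : Set E} (hV : IsOpen V) (hK : IsCompact K) {f : E → ℝ}
    (h0 : ∀ y ∈ V, y ∉ K → f y = 0)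
    (hloc : ∀ y ∈ K, ∃ f' : E → ℝ, ContDiffAt ℝ 1 f' y ∧ (∀ᶠ z in 𝓝 y, z ∈ V → f z = f' z) ∧
      (y ∉ V → f' y = 0)) (e : E) :
    IntegrableOn (fun y => fderiv ℝ f y e) V m ∧ ∫ y in V, fderiv ℝ f y e ∂m = 0 := by
  -- The truncation `δ η(f/δ)` equals `f` where `|f| ≤ δ` and is bounded by a multiple of `δ`. So `f
  -- - δ η(f/δ)` lives where `|f|` is at least `δ`, away from the frontier, and its derivative `(1 -
  -- η'(f/δ)) ∂f` tends to `∂f` off the zero set of `f` as `δ → 0`.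
  obtain ⟨η, hη, hη1, hη2⟩ := exists_local_identity
  have hη_d : ∀ t, HasDerivAt η (deriv η t) t := fun t =>
    (hη.differentiable (by simp) t).hasDerivAt
  have hη_c : Continuous (deriv η) := hη.continuous_deriv (by simp)
  have hη0 : deriv η 0 = 1 := by
    have : η =ᶠ[𝓝 0] id := by
      filter_upwards [Metric.ball_mem_nhds (0 : ℝ) one_pos] with t ht
      exact hη1 t (by simpa using (Metric.mem_ball.1 ht).le)
    rw [this.deriv_eq]; simp
  have hη_far : ∀ t, 2 < |t| → deriv η t = 0 := fun t ht => by
    have : η =ᶠ[𝓝 t] fun _ => 0 := by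
      filter_upwards [(continuous_abs.isOpen_preimage _ isOpen_Ioi).mem_nhds ht] with s hs
      exact hη2 s (le_of_lt hs)
    rw [this.deriv_eq]; simp
  obtain ⟨M, hM⟩ : ∃ M, ∀ t, |deriv η t| ≤ M := by
    obtain ⟨M, hM⟩ := (isCompact_Icc (a := (-2 : ℝ)) (b := 2)).exists_bound_of_continuousOn
      hη_c.continuousOn
    refine ⟨max M 0, fun t => ?_⟩
    by_cases ht : 2 < |t|
    · rw [hη_far t ht]; simp
    · exact (hM t (abs_le.1 (not_lt.1 ht))).trans (le_max_left _ _)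
  obtain ⟨M', hM'⟩ : ∃ M, ∀ t, |η t| ≤ M := by
    obtain ⟨M, hM⟩ := (isCompact_Icc (a := (-2 : ℝ)) (b := 2)).exists_bound_of_continuousOn
      hη.continuous.continuousOn
    refine ⟨max M 0, fun t => ?_⟩
    by_cases ht : 2 ≤ |t|
    · rw [hη2 t ht]; simp
    · exact (hM t (abs_le.1 (not_le.1 ht).le)).trans (le_max_left _ _)
  -- regularity of `f`
  have hzero : ∀ y ∈ V, y ∉ K → f =ᶠ[𝓝 y] fun _ => 0 := fun y hy hyK => by
    filter_upwards [hV.mem_nhds hy, hK.isClosed.isOpen_compl.mem_nhds hyK] with z hz hzK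
    exact h0 z hz hzK
  have hf1 : ContDiffOn ℝ 1 f V := fun y hy => by
    refine ContDiffAt.contDiffWithinAt ?_
    by_cases hyK : y ∈ K
    · obtain ⟨f', hf', hff', -⟩ := hloc y hyK
      refine hf'.congr_of_eventuallyEq ?_
      filter_upwards [hff', hV.mem_nhds hy] with z hz hzV using hz hzV
    · exact contDiffAt_const.congr_of_eventuallyEq (hzero y hy hyK)
  have hfd : ContinuousOn (fun y => fderiv ℝ f y e) V :=
    (hf1.continuousOn_fderiv_of_isOpen hV (by simp)).clm_apply continuousOn_const
  have hfd0 : ∀ y ∈ V, y ∉ K → fderiv ℝ f y e = 0 := fun y hy hyK => by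
    rw [(hzero y hy hyK).fderiv_eq]; simp
  have hint : IntegrableOn (fun y => fderiv ℝ f y e) V m := by
    refine integrableOn_of_locally_bounded hV.measurableSet hK hfd hfd0 fun y hy => ?_
    obtain ⟨f', hf', hff', -⟩ := hloc y hy
    refine ⟨|fderiv ℝ f' y e| + 1, ?_⟩
    have hc : ContinuousAt (fun y => fderiv ℝ f' y e) y :=
      ((hf'.fderiv_right (m := 0) (by simp)).continuousAt.clm_apply continuousAt_const)
    rw [eventually_nhdsWithin_iff]
    filter_upwards [hff'.eventually_nhds, hc.abs.eventually_lt continuousAt_const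
      (show |fderiv ℝ f' y e| < |fderiv ℝ f' y e| + 1 by linarith)] with z hz hz2 hzV
    have : f =ᶠ[𝓝 z] f' := by
      filter_upwards [hz, hV.mem_nhds hzV] with w hw hwV using hw hwV
    rw [this.fderiv_eq]; exact hz2.le
  refine ⟨hint, ?_⟩
  -- the extension by zero
  let g : E → ℝ := V.indicator f
  have hgV : ∀ y ∈ V, g y = f y := fun y hy => indicator_of_mem hy f
  have hgn : ∀ y ∉ V, g y = 0 := fun y hy => indicator_of_notMem hy f
  have hg1 : ContDiffOn ℝ 1 g V := hf1.congr hgV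
  have hgeq : ∀ y ∈ V, g =ᶠ[𝓝 y] f := fun y hy => by
    filter_upwards [hV.mem_nhds hy] with z hz using hgV z hz
  -- The vanishing of `f'` at frontier points gives continuity only. The gradient may jump there, so
  -- the extension cannot be integrated by parts directly.
  have hgc : Continuous g := by
    rw [continuous_iff_continuousAt]
    intro y
    by_cases hy : y ∈ V
    · exact hg1.continuousOn.continuousAt (hV.mem_nhds hy)
    · by_cases hyK : y ∈ K
      · obtain ⟨f', hf', hff', h3⟩ := hloc y hyK
        have hc := hf'.continuousAt
        rw [ContinuousAt, h3 hy] at hc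
        rw [ContinuousAt, hgn y hy]
        rw [Metric.tendsto_nhds] at hc ⊢
        intro δ hδ
        filter_upwards [hc δ hδ, hff'] with z hz hz2
        by_cases hzV : z ∈ V
        · rw [hgV z hzV, hz2 hzV]; exact hz
        · rw [hgn z hzV]; simpa using hδ
      · refine (continuousAt_const (y := (0 : ℝ))).congr ?_
        filter_upwards [hK.isClosed.isOpen_compl.mem_nhds hyK] with z hz
        by_cases hzV : z ∈ V
        · rw [hgV z hzV, h0 z hzV hz]
        · rw [hgn z hzV]
  have hgK : ∀ y, y ∉ K → g y = 0 := fun y hy => by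
    by_cases hyV : y ∈ V
    · rw [hgV y hyV, h0 y hyV hy]
    · exact hgn y hyV
  have hgd : ∀ y ∈ V, HasFDerivAt g (fderiv ℝ f y) y := fun y hy =>
    ((hf1.contDiffAt (hV.mem_nhds hy)).differentiableAt (by simp)).hasFDerivAt.congr_of_eventuallyEq
      (hgeq y hy)
  have hηg : ∀ δ > 0, ∀ y ∈ V, HasFDerivAt (fun z => δ * η (g z / δ))
      (deriv η (f y / δ) • fderiv ℝ f y) y := fun δ hδ y hy => by
    have h1 : HasFDerivAt (fun z => g z / δ) (δ⁻¹ • fderiv ℝ f y) y := by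
      simpa only [div_eq_mul_inv, mul_comm, smul_eq_mul] using (hgd y hy).const_mul δ⁻¹
    have h2 := ((hη_d (g y / δ)).comp_hasFDerivAt y h1).const_mul δ
    rw [hgV y hy] at h2
    refine h2.congr_fderiv (ContinuousLinearMap.ext fun v => Eq.symm ?_)
    change deriv η (f y / δ) * fderiv ℝ f y v =
      δ * (deriv η (f y / δ) * (δ⁻¹ * fderiv ℝ f y v))
    field_simp
  have hη1' : ContDiff ℝ 1 η := hη.of_le (by simp)
  have hηgC : ∀ δ : ℝ, ContDiffOn ℝ 1 (fun z => δ * η (g z / δ)) V := fun δ =>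
    contDiffOn_const.mul (hη1'.comp_contDiffOn (hg1.div_const δ))
  -- away from the zero set
  have hA : ∀ δ > 0, ∫ y in V, (1 - deriv η (f y / δ)) * fderiv ℝ f y e ∂m = 0 := by
    intro δ hδ
    -- `G` vanishes where `|g| < δ`, and `{|g| ≥ δ}` is closed and contained in `V`. Hence `G` is
    -- `C^1` on the whole space.
    let G : E → ℝ := fun z => g z - δ * η (g z / δ)
    have hKδ : IsClosed {z | δ ≤ |g z|} := isClosed_le continuous_const hgc.abs
    have hKV : {z | δ ≤ |g z|} ⊆ V := fun z hz => by
      by_contra h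
      have hz' : δ ≤ |g z| := hz
      rw [hgn z h] at hz'
      simp at hz'; linarith
    have hG0 : ∀ z, z ∉ {z | δ ≤ |g z|} → G z = 0 := fun z hz => by
      have hz' : |g z| < δ := not_le.1 hz
      have : |g z / δ| ≤ 1 := by
        rw [abs_div, abs_of_pos hδ, div_le_one hδ]; exact hz'.le
      simp only [G, hη1 _ this]
      field_simp
      ring
    have hG : ContDiff ℝ 1 G := contDiff_of_support hV hKδ hKV (hg1.sub (hηgC δ)) hG0
    have hGc : HasCompactSupport G := HasCompactSupport.intro hK fun y hy => by
      refine hG0 y ?_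
      simp [hgK y hy, hδ]
    have h1 := integral_fderiv_eq_zero (m := m) hG hGc e
    rw [← h1, ← integral_indicator hV.measurableSet]
    refine integral_congr_ae (Eventually.of_forall fun y => ?_)
    by_cases hy : y ∈ V
    · simp only [indicator_of_mem hy]
      have hGd : HasFDerivAt G _ y := (hgd y hy).sub (hηg δ hδ y hy)
      rw [hGd.fderiv]
      simp; ring
    · simp only [indicator_of_notMem hy]
      have : G =ᶠ[𝓝 y] fun _ => 0 := by
        filter_upwards [hKδ.isOpen_compl.mem_nhds fun h => hy (hKV h)] with z hz using hG0 z hz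
      rw [this.fderiv_eq]; simp
  -- on the zero set
  have hlim : ∀ y, Tendsto (fun k : ℕ => deriv η (f y / (1 / ((k : ℝ) + 1)))) atTop
      (𝓝 ({z | f z = 0}.indicator (fun _ => (1 : ℝ)) y)) := by
    intro y
    by_cases hy : f y = 0
    · simp [hy, hη0, indicator]
    · have : {z | f z = 0}.indicator (fun _ => (1 : ℝ)) y = 0 := by simp [hy]
      rw [this]
      refine tendsto_const_nhds.congr' ?_
      obtain ⟨N, hN⟩ := exists_nat_gt (2 / |f y|)
      filter_upwards [eventually_ge_atTop N] with k hk
      refine (hη_far _ ?_).symm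
      have hfy : 0 < |f y| := abs_pos.2 hy
      have : (N : ℝ) ≤ k := by exact_mod_cast hk
      rw [div_div_eq_mul_div, div_one, abs_mul, abs_of_pos (show (0 : ℝ) < k + 1 by positivity)]
      rw [div_lt_iff₀ hfy] at hN
      nlinarith
  have hpos : ∀ k : ℕ, (0 : ℝ) < 1 / ((k : ℝ) + 1) := fun k => by positivity
  have hfm : ∀ k : ℕ, AEStronglyMeasurable (fun y => deriv η (f y / (1 / ((k : ℝ) + 1))))
      (m.restrict V) := fun k =>
    ((hη_c.comp_continuousOn (hf1.continuousOn.div_const _))).aestronglyMeasurable hV.measurableSet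
  -- The gradient of `f` vanishes almost everywhere on its zero set. Against a test function, the
  -- derivative of `δ η(f/δ)` tends to `1_{f = 0} ∂f` by dominated convergence, and to zero after
  -- integration by parts because `|δ η| ≤ δ M'`.
  have hB : ∀ᵐ y ∂m, y ∈ V → {z | f z = 0}.indicator (fun y => fderiv ℝ f y e) y = 0 := by
    have hmeas : AEStronglyMeasurable ({z | f z = 0}.indicator (fun y => fderiv ℝ f y e))
        (m.restrict V) := by
      refine aestronglyMeasurable_of_tendsto_ae (u := atTop)
        (f := fun (k : ℕ) y => deriv η (f y / (1 / ((k : ℝ) + 1))) * fderiv ℝ f y e) ?_ ?_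
      · exact fun k => (hfm k).mul hint.aestronglyMeasurable
      · refine Eventually.of_forall fun y => ?_
        have := (hlim y).mul_const (fderiv ℝ f y e)
        convert this using 2
        by_cases hy : f y = 0 <;> simp [hy]
    have hbound : ∀ y, ‖{z | f z = 0}.indicator (fun y => fderiv ℝ f y e) y‖ ≤
        ‖fderiv ℝ f y e‖ := fun y => norm_indicator_le_norm_self _ _
    have hint' : IntegrableOn ({z | f z = 0}.indicator (fun y => fderiv ℝ f y e)) V m :=
      Integrable.mono hint hmeas (Eventually.of_forall hbound)
    refine hV.ae_eq_zero_of_integral_contDiff_smul_eq_zero hint'.locallyIntegrableOn ?_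
    intro χ hχ hχc hχV
    have hχ1 : ContDiff ℝ 1 χ := hχ.of_le (by simp)
    -- integration by parts against the truncation
    have hk : ∀ δ > 0, ∫ y in V, χ y * (deriv η (f y / δ) * fderiv ℝ f y e) ∂m =
        - ∫ y in V, fderiv ℝ χ y e * (δ * η (f y / δ)) ∂m := by
      intro δ hδ
      let G : E → ℝ := fun z => χ z * (δ * η (g z / δ))
      have hG0 : ∀ z, z ∉ tsupport χ → G z = 0 := fun z hz => by
        simp [G, image_eq_zero_of_notMem_tsupport hz]
      have hG : ContDiff ℝ 1 G := contDiff_of_support hV (isClosed_tsupport χ) hχV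
        (hχ1.contDiffOn.mul (hηgC δ)) hG0
      have hGc : HasCompactSupport G := HasCompactSupport.intro hχc.isCompact hG0
      have h1 := integral_fderiv_eq_zero (m := m) hG hGc e
      have h2 : ∫ y in V, (χ y * (deriv η (f y / δ) * fderiv ℝ f y e) +
          fderiv ℝ χ y e * (δ * η (f y / δ))) ∂m = 0 := by
        rw [← h1, ← integral_indicator hV.measurableSet]
        refine integral_congr_ae (Eventually.of_forall fun y => ?_)
        by_cases hy : y ∈ V
        · simp only [indicator_of_mem hy]
          have hGd : HasFDerivAt G _ y :=
            ((hχ1.differentiable (by simp) y).hasFDerivAt).mul (hηg δ hδ y hy)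
          rw [hGd.fderiv]
          simp [hgV y hy]; ring
        · simp only [indicator_of_notMem hy]
          have : G =ᶠ[𝓝 y] fun _ => 0 := by
            filter_upwards [(isClosed_tsupport χ).isOpen_compl.mem_nhds fun h => hy (hχV h)] with
              z hz using hG0 z hz
          rw [this.fderiv_eq]; simp
      have hcχ : HasCompactSupport fun y => fderiv ℝ χ y e :=
        (hχc.fderiv (𝕜 := ℝ)).comp_left (g := fun L : E →L[ℝ] ℝ => L e) (by simp)
      rw [integral_add] at h2
      · linarith
      · refine integrableOn_of_locally_bounded hV.measurableSet hχc.isCompact ?_ ?_ ?_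
        · exact hχ.continuous.continuousOn.mul
            ((hη_c.comp_continuousOn (hf1.continuousOn.div_const _)).mul hfd)
        · intro y _ hy; simp [image_eq_zero_of_notMem_tsupport hy]
        · intro y hy
          have hc : ContinuousAt (fun y => χ y * (deriv η (f y / δ) * fderiv ℝ f y e)) y :=
            (hχ.continuous.continuousOn.mul
            ((hη_c.comp_continuousOn (hf1.continuousOn.div_const _)).mul hfd)).continuousAt
              (hV.mem_nhds (hχV hy))
          refine ⟨_, nhdsWithin_le_nhds ((hc.abs.eventually_lt continuousAt_const
            (lt_add_one _)).mono fun _ h => h.le)⟩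
      · refine integrableOn_of_locally_bounded hV.measurableSet hcχ.isCompact ?_ ?_ ?_
        · exact (((hχ1.continuous_fderiv (by simp)).clm_apply continuous_const).continuousOn).mul
            (continuousOn_const.mul (hη.continuous.comp_continuousOn (hf1.continuousOn.div_const _)))
        · intro y _ hy; simp [image_eq_zero_of_notMem_tsupport hy]
        · intro y hy
          have hc : ContinuousAt (fun y => fderiv ℝ χ y e * (δ * η (g y / δ))) y :=
            (((hχ1.continuous_fderiv (by simp)).clm_apply continuous_const).mul
              (continuous_const.mul (hη.continuous.comp (hgc.div_const δ)))).continuousAt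
          refine ⟨|fderiv ℝ χ y e * (δ * η (g y / δ))| + 1, ?_⟩
          rw [eventually_nhdsWithin_iff]
          filter_upwards [hc.abs.eventually_lt continuousAt_const (lt_add_one _)] with z hz hzV
          rw [hgV z hzV] at hz
          exact hz.le
    have hl1 : Tendsto (fun k : ℕ => ∫ y in V, χ y *
        (deriv η (f y / (1 / ((k : ℝ) + 1))) * fderiv ℝ f y e) ∂m) atTop
        (𝓝 (∫ y in V, χ y * {z | f z = 0}.indicator (fun y => fderiv ℝ f y e) y ∂m)) := by
      obtain ⟨Cχ, hCχ⟩ := hχc.exists_bound_of_continuous hχ.continuous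
      refine tendsto_integral_of_dominated_convergence
        (fun y => Cχ * (M * ‖fderiv ℝ f y e‖)) ?_ ?_ ?_ ?_
      · exact fun k => (hχ.continuous.aestronglyMeasurable).mul
          ((hfm k).mul hint.aestronglyMeasurable)
      · exact (hint.norm.const_mul M).const_mul Cχ
      · refine fun k => Eventually.of_forall fun y => ?_
        rw [norm_mul, norm_mul]
        have h1 := hM (f y / (1 / ((k : ℝ) + 1)))
        have h2 := hCχ y
        gcongr
        · exact (norm_nonneg _).trans h2
        · exact h1
      · refine Eventually.of_forall fun y => ?_
        refine Tendsto.const_mul _ ?_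
        have := (hlim y).mul_const (fderiv ℝ f y e)
        convert this using 2
        by_cases hy : f y = 0 <;> simp [hy]
    have hl2 : Tendsto (fun k : ℕ => - ∫ y in V, fderiv ℝ χ y e *
        (1 / ((k : ℝ) + 1) * η (f y / (1 / ((k : ℝ) + 1)))) ∂m) atTop (𝓝 0) := by
      have hcχ : Integrable (fun y => fderiv ℝ χ y e) m :=
        ((hχ1.continuous_fderiv (by simp)).clm_apply
          continuous_const).integrable_of_hasCompactSupport
          ((hχc.fderiv (𝕜 := ℝ)).comp_left (g := fun L : E →L[ℝ] ℝ => L e) (by simp))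
      have hM'0 : 0 ≤ M' := (abs_nonneg _).trans (hM' 0)
      rw [← neg_zero]
      refine Tendsto.neg ?_
      have hz : Tendsto (fun k : ℕ => (1 / ((k : ℝ) + 1)) * (M' * ∫ y in V, ‖fderiv ℝ χ y e‖ ∂m))
          atTop (𝓝 0) := by
        simpa using tendsto_one_div_add_atTop_nhds_zero_nat.mul_const
          (M' * ∫ y in V, ‖fderiv ℝ χ y e‖ ∂m)
      refine squeeze_zero_norm (fun k => ?_) hz
      rw [← mul_assoc, ← integral_const_mul]
      refine norm_integral_le_of_norm_le ((hcχ.norm.restrict).const_mul _)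
        (Eventually.of_forall fun y => ?_)
      rw [norm_mul, norm_mul, Real.norm_of_nonneg (hpos k).le, mul_comm]
      gcongr
      exact hM' _
    have hl3 : ∫ y in V, χ y * {z | f z = 0}.indicator (fun y => fderiv ℝ f y e) y ∂m = 0 := by
      refine tendsto_nhds_unique hl1 (hl2.congr fun k => ?_)
      exact (hk _ (hpos k)).symm
    refine Eq.trans ?_ hl3
    rw [← integral_indicator hV.measurableSet]
    refine integral_congr_ae (Eventually.of_forall fun y => ?_)
    by_cases hy : y ∈ V
    · simp only [indicator_of_mem hy, smul_eq_mul]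
    · simp [indicator_of_notMem hy, image_eq_zero_of_notMem_tsupport fun h => hy (hχV h)]
  -- The factor converges to the indicator of `{f ≠ 0}`. By the previous step, nothing is lost on
  -- the complement.
  have hlimA : Tendsto (fun k : ℕ => ∫ y in V, (1 - deriv η (f y / (1 / ((k : ℝ) + 1)))) *
      fderiv ℝ f y e ∂m) atTop (𝓝 (∫ y in V, fderiv ℝ f y e ∂m)) := by
    refine tendsto_integral_of_dominated_convergence
      (fun y => (1 + M) * ‖fderiv ℝ f y e‖) ?_ ?_ ?_ ?_
    · exact fun k => (aestronglyMeasurable_const.sub (hfm k)).mul hint.aestronglyMeasurable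
    · exact hint.norm.const_mul _
    · refine fun k => Eventually.of_forall fun y => ?_
      rw [norm_mul]
      gcongr
      refine (norm_sub_le _ _).trans ?_
      rw [norm_one]
      gcongr
      exact hM _
    · refine (ae_restrict_iff' hV.measurableSet).2 ?_
      filter_upwards [hB] with y hy hyV
      have h1 := ((hlim y).const_sub 1).mul_const (fderiv ℝ f y e)
      convert h1 using 2
      have h2 := hy hyV
      by_cases hfy : f y = 0
      · have : fderiv ℝ f y e = 0 := by simpa [hfy] using h2
        simp [this]
      · simp [hfy]
  refine tendsto_nhds_unique hlimA ?_
  simp only [hA _ (hpos _)]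
  exact tendsto_const_nhds

end Analysis

end CovariantClebsch

namespace CovariantClebsch

open MeasureTheory Filter Set

/-! ### Transition maps and the cocycle of tangent coordinate changes. -/

section Charts

variable {E : Type*} [NormedAddCommGroup E] [NormedSpace ℝ E]
  {M : Type*} [TopologicalSpace M] [ChartedSpace E M] [IsManifold 𝓘(ℝ, E) ∞ M]

theorem tangentCoordChange_comp_apply {x y z w : M} (hx : w ∈ (chartAt E x).source)
    (hy : w ∈ (chartAt E y).source) (hz : w ∈ (chartAt E z).source) (v : E) :
    tangentCoordChange 𝓘(ℝ, E) y z w (tangentCoordChange 𝓘(ℝ, E) x y w v) =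
      tangentCoordChange 𝓘(ℝ, E) x z w v :=
  tangentCoordChange_comp (by simp only [extChartAt_source]; exact ⟨⟨hx, hy⟩, hz⟩)

theorem tangentCoordChange_self_clm {x w : M} (hx : w ∈ (chartAt E x).source) :
    (tangentCoordChange 𝓘(ℝ, E) x x w : E →L[ℝ] E) = ContinuousLinearMap.id ℝ E :=
  ContinuousLinearMap.ext fun _ => tangentCoordChange_self (by simpa using hx)

theorem hasFDerivAt_chart_transition {x y w : M} (hx : w ∈ (chartAt E x).source)
    (hy : w ∈ (chartAt E y).source) :
    HasFDerivAt (extChartAt 𝓘(ℝ, E) y ∘ (extChartAt 𝓘(ℝ, E) x).symm)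
      (tangentCoordChange 𝓘(ℝ, E) x y w : E →L[ℝ] E) (extChartAt 𝓘(ℝ, E) x w) := by
  have := hasFDerivWithinAt_tangentCoordChange (I := 𝓘(ℝ, E)) (x := x) (y := y) (z := w)
    (by simp only [extChartAt_source]; exact ⟨hx, hy⟩)
  simpa only [modelWithCornersSelf_coe, range_id, hasFDerivWithinAt_univ] using this

theorem contDiffAt_chart_transition {x y w : M} (hx : w ∈ (chartAt E x).source)
    (hy : w ∈ (chartAt E y).source) :
    ContDiffAt ℝ ∞ (extChartAt 𝓘(ℝ, E) y ∘ (extChartAt 𝓘(ℝ, E) x).symm)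
      (extChartAt 𝓘(ℝ, E) x w) := by
  have := contDiffWithinAt_ext_coord_change (I := 𝓘(ℝ, E)) (n := ∞) y x
    (y := extChartAt 𝓘(ℝ, E) x w) (by
      rw [PartialEquiv.trans_source, PartialEquiv.symm_source]
      refine ⟨(extChartAt 𝓘(ℝ, E) x).map_source (by simpa using hx), ?_⟩
      rw [mem_preimage, (extChartAt 𝓘(ℝ, E) x).left_inv (by simpa using hx)]
      simpa using hy)
  simpa only [modelWithCornersSelf_coe, range_id, contDiffWithinAt_univ] using this

end Charts

/-! ### Integrals of densities and their independence of the chart. -/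

section Integration

variable {n : ℕ} {X : Type*} [TopologicalSpace X] [ChartedSpace (BaseModel n) X]
    [IsManifold 𝓘(ℝ, BaseModel n) ∞ X]

/-- The part of `U` in the chart at `i`, in coordinates. -/
def chartDomain (i : X) (U : Set X) : Set (BaseModel n) :=
  (extChartAt 𝓘(ℝ, BaseModel n) i).target ∩ (extChartAt 𝓘(ℝ, BaseModel n) i).symm ⁻¹' U

/-- The component of a density in the chart at `i`. -/
noncomputable def chartDensity (i : X) (β : ∀ x : X, Vol n x) (y : BaseModel n) : ℝ :=
  β ((extChartAt 𝓘(ℝ, BaseModel n) i).symm y) (fun μ =>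
    fromCoord n i ((extChartAt 𝓘(ℝ, BaseModel n) i).symm y) (stdVec n μ))

theorem isOpen_chartDomain (i : X) {U : Set X} (hU : IsOpen U) :
    IsOpen (chartDomain (n := n) i U) :=
  (continuousOn_extChartAt_symm i).isOpen_inter_preimage
    (isOpen_extChartAt_target i) hU

theorem mem_chartDomain_iff {i : X} {U : Set X} {x : X}
    (hx : x ∈ (chartAt (BaseModel n) i).source) :
    extChartAt 𝓘(ℝ, BaseModel n) i x ∈ chartDomain i U ↔ x ∈ U := by
  have hx' : x ∈ (extChartAt 𝓘(ℝ, BaseModel n) i).source := by simpa using hx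
  simp only [chartDomain, mem_inter_iff, (extChartAt 𝓘(ℝ, BaseModel n) i).map_source hx', true_and,
    mem_preimage, (extChartAt 𝓘(ℝ, BaseModel n) i).left_inv hx']

theorem exists_of_mem_chartDomain {i : X} {U : Set X} {y : BaseModel n}
    (hy : y ∈ chartDomain i U) : ∃ x ∈ U, x ∈ (chartAt (BaseModel n) i).source ∧
      extChartAt 𝓘(ℝ, BaseModel n) i x = y :=
  ⟨_, hy.2, by simpa using (extChartAt 𝓘(ℝ, BaseModel n) i).map_target hy.1,
    (extChartAt 𝓘(ℝ, BaseModel n) i).right_inv hy.1⟩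

theorem extChartAt_symm_apply {i x : X} (hx : x ∈ (chartAt (BaseModel n) i).source) :
    (extChartAt 𝓘(ℝ, BaseModel n) i).symm (extChartAt 𝓘(ℝ, BaseModel n) i x) = x :=
  (extChartAt 𝓘(ℝ, BaseModel n) i).left_inv (by simpa using hx)

theorem chartDensity_extChartAt {i x : X} (hx : x ∈ (chartAt (BaseModel n) i).source)
    (β : ∀ x : X, Vol n x) : chartDensity i β (extChartAt 𝓘(ℝ, BaseModel n) i x) =
      β x (fun μ => fromCoord n i x (stdVec n μ)) := by
  rw [chartDensity, extChartAt_symm_apply hx]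

theorem formIntegral_eq [T2Space X] [SigmaCompactSpace X] (U : Set X) (β : ∀ x : X, Vol n x) :
    formIntegral n U β = ∑ᶠ i : X, ∫ y in chartDomain i U,
      chartPartition n X i ((extChartAt 𝓘(ℝ, BaseModel n) i).symm y) * chartDensity i β y := rfl

/-- A density on `U` is regular if its components are continuous, and bounded near the closure. -/
def IsRegularDensity (U : Set X) (β : ∀ x : X, Vol n x) : Prop :=
  ∀ i : X, ContinuousOn (chartDensity i β) (chartDomain i U) ∧
    ∀ x ∈ closure U, x ∈ (chartAt (BaseModel n) i).source → ∃ C,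
      ∀ᶠ z in 𝓝[chartDomain i U] (extChartAt 𝓘(ℝ, BaseModel n) i x), |chartDensity i β z| ≤ C

theorem isCompact_image_chart {K : Set X} (hK : IsCompact K) {i : X}
    (hKi : K ⊆ (chartAt (BaseModel n) i).source) :
    IsCompact (extChartAt 𝓘(ℝ, BaseModel n) i '' K) :=
  hK.image_of_continuousOn ((continuousOn_extChartAt i).mono (by simpa using hKi))

/-- Regular densities, multiplied with compactly supported continuous functions, are integrable. -/
theorem IsRegularDensity.integrableOn {U : Set X} (hU : IsOpen U) {β : ∀ x : X, Vol n x}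
    (hβ : IsRegularDensity U β) {i : X} {K : Set X} (hK : IsCompact K)
    (hKi : K ⊆ (chartAt (BaseModel n) i).source) (hKU : K ⊆ closure U) {g : X → ℝ}
    (hg : Continuous g) (h0 : ∀ x ∈ U, x ∈ (chartAt (BaseModel n) i).source → x ∉ K → g x * chartDensity i β
      (extChartAt 𝓘(ℝ, BaseModel n) i x) = 0) :
    IntegrableOn (fun y => g ((extChartAt 𝓘(ℝ, BaseModel n) i).symm y) * chartDensity i β y)
      (chartDomain i U) := by
  have hgc : ∀ y ∈ (extChartAt 𝓘(ℝ, BaseModel n) i).target, ContinuousAt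
      (fun y => g ((extChartAt 𝓘(ℝ, BaseModel n) i).symm y)) y := fun y hy =>
    hg.continuousAt.comp (continuousAt_extChartAt_symm'' hy)
  refine integrableOn_of_locally_bounded (isOpen_chartDomain i hU).measurableSet
    (isCompact_image_chart hK hKi) ?_ ?_ ?_
  · exact (show ContinuousOn _ _ from fun y hy => (hgc y hy.1).continuousWithinAt).mul (hβ i).1
  · intro y hy hyK
    obtain ⟨x, hxU, hxi, rfl⟩ := exists_of_mem_chartDomain hy
    rw [extChartAt_symm_apply hxi]
    exact h0 x hxU hxi fun h => hyK ⟨x, h, rfl⟩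
  · rintro _ ⟨x, hx, rfl⟩
    obtain ⟨C, hC⟩ := (hβ i).2 x (hKU hx) (hKi hx)
    have hb := (hgc _ ((extChartAt 𝓘(ℝ, BaseModel n) i).map_source
      (by simpa using hKi hx))).abs.eventually_lt continuousAt_const (lt_add_one _)
    refine ⟨(|g ((extChartAt 𝓘(ℝ, BaseModel n) i).symm (extChartAt 𝓘(ℝ, BaseModel n) i x))| + 1) * C,
      ?_⟩
    filter_upwards [hC, nhdsWithin_le_nhds hb] with z hz1 hz2
    rw [abs_mul]
    exact mul_le_mul hz2.le hz1 (abs_nonneg _) (by positivity)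

/-- Change of charts in the integral of a density. -/
theorem setIntegral_chart_change [OrientedAtlas n X] {U : Set X} (hU : IsOpen U) (i j : X)
    (β : ∀ x : X, Vol n x) (g : X → ℝ)
    (h0 : ∀ x ∈ U, g x ≠ 0 → β x ≠ 0 → x ∈ (chartAt (BaseModel n) i).source ∧
      x ∈ (chartAt (BaseModel n) j).source) :
    ∫ y in chartDomain i U, g ((extChartAt 𝓘(ℝ, BaseModel n) i).symm y) * chartDensity i β y =
      ∫ y in chartDomain j U, g ((extChartAt 𝓘(ℝ, BaseModel n) j).symm y) *
        chartDensity j β y := by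
  -- Both integrals may be restricted to the overlap of the two charts, since the integrand vanishes
  -- elsewhere.
  have hres : ∀ k l : X, (∀ x ∈ U, g x ≠ 0 → β x ≠ 0 → x ∈ (chartAt (BaseModel n) l).source) →
      ∫ y in chartDomain k U, g ((extChartAt 𝓘(ℝ, BaseModel n) k).symm y) * chartDensity k β y =
      ∫ y in chartDomain k (U ∩ (chartAt (BaseModel n) l).source),
        g ((extChartAt 𝓘(ℝ, BaseModel n) k).symm y) * chartDensity k β y := by
    intro k l h
    refine setIntegral_eq_of_subset_of_forall_sdiff_eq_zero
      (isOpen_chartDomain k hU).measurableSet (fun y hy => ⟨hy.1, hy.2.1⟩) ?_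
    rintro y ⟨hy, hy2⟩
    obtain ⟨x, hxU, hxk, rfl⟩ := exists_of_mem_chartDomain hy
    rw [extChartAt_symm_apply hxk, chartDensity_extChartAt hxk]
    by_contra hne
    refine hy2 ((mem_chartDomain_iff hxk).2 ⟨hxU, h x hxU ?_ ?_⟩)
    · rintro hg0
      simp [hg0] at hne
    · rintro hb0
      refine hne ?_
      rw [hb0]
      exact mul_zero _
  rw [hres i j fun x hx h1 h2 => (h0 x hx h1 h2).2, hres j i fun x hx h1 h2 => (h0 x hx h1 h2).1]
  let S : Set (BaseModel n) := chartDomain i (U ∩ (chartAt (BaseModel n) j).source)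
  let φ := extChartAt 𝓘(ℝ, BaseModel n) j ∘ (extChartAt 𝓘(ℝ, BaseModel n) i).symm
  have himg : φ '' S = chartDomain j (U ∩ (chartAt (BaseModel n) i).source) := by
    ext z
    constructor
    · rintro ⟨y, hy, rfl⟩
      obtain ⟨x, hxU, hxi, rfl⟩ := exists_of_mem_chartDomain hy
      simp only [φ, Function.comp_apply, extChartAt_symm_apply hxi]
      exact (mem_chartDomain_iff hxU.2).2 ⟨hxU.1, hxi⟩
    · intro hz
      obtain ⟨x, hxU, hxj, rfl⟩ := exists_of_mem_chartDomain hz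
      refine ⟨extChartAt 𝓘(ℝ, BaseModel n) i x, (mem_chartDomain_iff hxU.2).2 ⟨hxU.1, hxj⟩, ?_⟩
      simp only [φ, Function.comp_apply, extChartAt_symm_apply hxU.2]
  have hSm : MeasurableSet S :=
    (isOpen_chartDomain i (hU.inter (chartAt (BaseModel n) j).open_source)).measurableSet
  have hderiv : ∀ y ∈ S, HasFDerivWithinAt φ (tangentCoordChange 𝓘(ℝ, BaseModel n) i j
      ((extChartAt 𝓘(ℝ, BaseModel n) i).symm y) : BaseModel n →L[ℝ] BaseModel n) S y := by
    intro y hy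
    obtain ⟨x, hxU, hxi, rfl⟩ := exists_of_mem_chartDomain hy
    rw [extChartAt_symm_apply hxi]
    exact (hasFDerivAt_chart_transition hxi hxU.2).hasFDerivWithinAt
  have hinj : InjOn φ S := by
    intro y hy z hz hyz
    obtain ⟨x, hxU, hxi, rfl⟩ := exists_of_mem_chartDomain hy
    obtain ⟨w, hwU, hwi, rfl⟩ := exists_of_mem_chartDomain hz
    simp only [φ, Function.comp_apply, extChartAt_symm_apply hxi, extChartAt_symm_apply hwi] at hyz
    have := (extChartAt 𝓘(ℝ, BaseModel n) j).injOn (by simpa using hxU.2) (by simpa using hwU.2) hyz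
    rw [this]
  rw [← himg, integral_image_eq_integral_abs_det_fderiv_smul volume hSm hderiv hinj]
  refine setIntegral_congr_fun hSm fun y hy => ?_
  obtain ⟨x, hxU, hxi, rfl⟩ := exists_of_mem_chartDomain hy
  -- The orientation enters here: the absolute Jacobian of the change of variables is the Jacobian
  -- itself, which is the factor by which a top-degree form transforms.
  have hdet := OrientedAtlas.det_pos i j x hxi hxU.2
  simp only [φ, Function.comp_apply, extChartAt_symm_apply hxi, chartDensity_extChartAt hxi,
    extChartAt_symm_apply hxU.2, chartDensity_extChartAt hxU.2, smul_eq_mul, abs_of_pos hdet]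
  have h1 : (β x) (fun μ => fromCoord n i x (stdVec n μ)) =
      (tangentCoordChange 𝓘(ℝ, BaseModel n) i j x : BaseModel n →L[ℝ] BaseModel n).det *
        (β x) (fun μ => fromCoord n j x (stdVec n μ)) := by
    have := top_form_apply_comp (volCoord j x (β x)) (tangentCoordChange 𝓘(ℝ, BaseModel n) i j x)
    refine Eq.trans ?_ this
    refine congrArg (β x) (funext fun μ => ?_)
    exact (tangentCoordChange_comp_apply hxi hxU.2 (mem_chart_source _ x) (stdVec n μ)).symm
  rw [h1]; ring

section Global

variable [T2Space X] [SigmaCompactSpace X]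

theorem tsupport_chartPartition_subset (i : X) :
    tsupport (chartPartition n X i) ⊆ (chartAt (BaseModel n) i).source :=
  Classical.choose_spec (SmoothPartitionOfUnity.exists_isSubordinate_chartAt_source
    𝓘(ℝ, BaseModel n) X) i

/-- Finitely many members of the partition of unity are nonzero on a compact set. -/
theorem finite_support_chartPartition {K : Set X} (hK : IsCompact K) :
    {i : X | (Function.support (chartPartition n X i) ∩ K).Nonempty}.Finite :=
  (chartPartition n X).locallyFinite.finite_nonempty_inter_compact hK

/-- The finite set of charts meeting a compact set. -/
noncomputable def chartFinset {K : Set X} (hK : IsCompact K) : Finset X :=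
  (finite_support_chartPartition (n := n) hK).toFinset

theorem chartPartition_eq_zero {K : Set X} (hK : IsCompact K) {i : X}
    (hi : i ∉ chartFinset (n := n) hK) {x : X} (hx : x ∈ K) : chartPartition n X i x = 0 := by
  by_contra h
  exact hi ((finite_support_chartPartition hK).mem_toFinset.2 ⟨x, h, hx⟩)

theorem sum_chartPartition {K : Set X} (hK : IsCompact K) {x : X} (hx : x ∈ K) :
    ∑ i ∈ chartFinset (n := n) hK, chartPartition n X i x = 1 := by
  rw [← (chartPartition n X).sum_eq_one (mem_univ x)]
  refine (finsum_eq_sum_of_support_subset _ fun i hi => ?_).symm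
  by_contra h
  exact hi (chartPartition_eq_zero hK h hx)

/-- A `finsum` is zero by default when infinitely many terms are nonzero. Local finiteness of the
partition and compactness of `K` confine the nonzero integrals to a finite set of charts depending
only on `K`. -/
theorem formIntegral_eq_sum {U : Set X} {K : Set X} (hK : IsCompact K) {β : ∀ x : X, Vol n x}
    (h0 : ∀ x ∈ U, x ∉ K → β x = 0) : formIntegral n U β =
      ∑ i ∈ chartFinset (n := n) hK, ∫ y in chartDomain i U,
      chartPartition n X i ((extChartAt 𝓘(ℝ, BaseModel n) i).symm y) * chartDensity i β y := by
  rw [formIntegral_eq]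
  refine finsum_eq_sum_of_support_subset _ fun i hi => ?_
  by_contra h
  refine hi (setIntegral_eq_zero_of_forall_eq_zero fun y hy => ?_)
  by_cases hyK : (extChartAt 𝓘(ℝ, BaseModel n) i).symm y ∈ K
  · rw [chartPartition_eq_zero hK h hyK, zero_mul]
  · rw [chartDensity, h0 _ hy.2 hyK]; exact mul_zero _

theorem isClosed_tsupport_inter {U : Set X} (hUc : IsCompact (closure U)) (i : X) :
    IsCompact (tsupport (chartPartition n X i) ∩ closure U) :=
  hUc.inter_left (isClosed_tsupport _)

variable [OrientedAtlas n X]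

/-- The integral of a regular density supported in a chart domain is computed in that chart. -/
theorem formIntegral_eq_chart {U : Set X} (hU : IsOpen U) {β : ∀ x : X, Vol n x}
    (hβ : IsRegularDensity U β) {K : Set X} (hK : IsCompact K) (hKU : K ⊆ closure U) {i : X}
    (hKi : K ⊆ (chartAt (BaseModel n) i).source) (h0 : ∀ x ∈ U, x ∉ K → β x = 0) :
    formIntegral n U β = ∫ y in chartDomain i U, chartDensity i β y := by
  have hd0 : ∀ x ∈ U, x ∉ K → x ∈ (chartAt (BaseModel n) i).source →
      chartDensity i β (extChartAt 𝓘(ℝ, BaseModel n) i x) = 0 := fun x hx hxK hxi => by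
    rw [chartDensity_extChartAt hxi, h0 x hx hxK]; rfl
  rw [formIntegral_eq_sum hK h0]
  -- Each product of `β` with a member of the partition is supported in both charts, so every piece
  -- can be moved to the chart at `i`, where the members of the partition add up to one on `K`.
  have h1 : ∀ j ∈ chartFinset (n := n) hK, ∫ y in chartDomain j U,
      chartPartition n X j ((extChartAt 𝓘(ℝ, BaseModel n) j).symm y) * chartDensity j β y =
      ∫ y in chartDomain i U,
      chartPartition n X j ((extChartAt 𝓘(ℝ, BaseModel n) i).symm y) * chartDensity i β y := by
    intro j _
    refine setIntegral_chart_change hU j i β (chartPartition n X j) fun x hx h1 h2 => ⟨?_, ?_⟩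
    · exact tsupport_chartPartition_subset j (subset_tsupport _ h1)
    · exact hKi (by by_contra h; exact h2 (h0 x hx h))
  rw [Finset.sum_congr rfl h1, ← integral_finsetSum]
  · refine setIntegral_congr_fun (isOpen_chartDomain i hU).measurableSet fun y hy => ?_
    obtain ⟨x, hxU, hxi, rfl⟩ := exists_of_mem_chartDomain hy
    rw [← Finset.sum_mul, extChartAt_symm_apply hxi]
    by_cases hxK : x ∈ K
    · rw [sum_chartPartition hK hxK, one_mul]
    · rw [hd0 x hxU hxK hxi, mul_zero]
  · intro j _
    refine hβ.integrableOn hU hK hKi hKU (chartPartition n X j).2.continuous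
      fun x hx hxi hxK => ?_
    rw [hd0 x hx hxK hxi, mul_zero]

end Global

end Integration

end CovariantClebsch

namespace CovariantClebsch

open MeasureTheory Filter Set

/-! ### Derivatives of maps between manifolds, in arbitrary charts. -/

section Coord

variable {E : Type*} [NormedAddCommGroup E] [NormedSpace ℝ E]
  {M : Type*} [TopologicalSpace M] [ChartedSpace E M] [IsManifold 𝓘(ℝ, E) ∞ M]
  {E' : Type*} [NormedAddCommGroup E'] [NormedSpace ℝ E']
  {N : Type*} [TopologicalSpace N] [ChartedSpace E' N] [IsManifold 𝓘(ℝ, E') ∞ N]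
  {W : Type*} [NormedAddCommGroup W] [NormedSpace ℝ W]

theorem extChartAt_symm_extChartAt {j x : M} (hx : x ∈ (chartAt E j).source) :
    (extChartAt 𝓘(ℝ, E) j).symm (extChartAt 𝓘(ℝ, E) j x) = x :=
  (extChartAt 𝓘(ℝ, E) j).left_inv (by simpa using hx)

theorem tendsto_extChartAt_symm {j x : M} (hx : x ∈ (chartAt E j).source) :
    Tendsto (extChartAt 𝓘(ℝ, E) j).symm (𝓝 (extChartAt 𝓘(ℝ, E) j x)) (𝓝 x) := by
  have := continuousAt_extChartAt_symm' (I := 𝓘(ℝ, E)) (x := j) (x' := x) (by simpa using hx)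
  rw [ContinuousAt, extChartAt_symm_extChartAt hx] at this
  exact this

theorem eventually_extChartAt_symm {j x : M} (hx : x ∈ (chartAt E j).source) {p : M → Prop}
    (hp : ∀ᶠ z in 𝓝 x, p z) :
    ∀ᶠ y in 𝓝 (extChartAt 𝓘(ℝ, E) j x), p ((extChartAt 𝓘(ℝ, E) j).symm y) :=
  (tendsto_extChartAt_symm hx).eventually hp

/-- The derivative of the coordinate expression of a map between manifolds. -/
theorem hasFDerivAt_coord {f : M → N} {x : M} (hf : MDifferentiableAt 𝓘(ℝ, E) 𝓘(ℝ, E') f x)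
    {j : M} {k : N} (hx : x ∈ (chartAt E j).source) (hfx : f x ∈ (chartAt E' k).source) :
    HasFDerivAt (extChartAt 𝓘(ℝ, E') k ∘ f ∘ (extChartAt 𝓘(ℝ, E) j).symm)
      ((tangentCoordChange 𝓘(ℝ, E') (f x) k (f x) : E' →L[ℝ] E') ∘L
        (mfderiv 𝓘(ℝ, E) 𝓘(ℝ, E') f x : E →L[ℝ] E') ∘L
        (tangentCoordChange 𝓘(ℝ, E) j x x : E →L[ℝ] E)) (extChartAt 𝓘(ℝ, E) j x) := by
  have h1 : HasFDerivAt (extChartAt 𝓘(ℝ, E') (f x) ∘ f ∘ (extChartAt 𝓘(ℝ, E) x).symm)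
      (mfderiv 𝓘(ℝ, E) 𝓘(ℝ, E') f x : E →L[ℝ] E') (extChartAt 𝓘(ℝ, E) x x) := by
    have h0 : HasFDerivWithinAt (extChartAt 𝓘(ℝ, E') (f x) ∘ f ∘ (extChartAt 𝓘(ℝ, E) x).symm)
        (mfderiv 𝓘(ℝ, E) 𝓘(ℝ, E') f x : E →L[ℝ] E') (range 𝓘(ℝ, E))
        (extChartAt 𝓘(ℝ, E) x x) := hf.hasMFDerivAt.2
    rw [modelWithCornersSelf_coe, range_id] at h0
    exact hasFDerivWithinAt_univ.1 h0
  have h2 := hasFDerivAt_chart_transition hx (mem_chart_source E x)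
  have h3 := hasFDerivAt_chart_transition (mem_chart_source E' (f x)) hfx
  have e1 : extChartAt 𝓘(ℝ, E) x x = (extChartAt 𝓘(ℝ, E) x ∘ (extChartAt 𝓘(ℝ, E) j).symm)
      (extChartAt 𝓘(ℝ, E) j x) := by
    simp only [Function.comp_apply, extChartAt_symm_extChartAt hx]
  rw [e1] at h1
  have h4 := h1.comp _ h2
  have e2 : extChartAt 𝓘(ℝ, E') (f x) (f x) =
      ((extChartAt 𝓘(ℝ, E') (f x) ∘ f ∘ (extChartAt 𝓘(ℝ, E) x).symm) ∘
        extChartAt 𝓘(ℝ, E) x ∘ (extChartAt 𝓘(ℝ, E) j).symm) (extChartAt 𝓘(ℝ, E) j x) := by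
    simp only [Function.comp_apply, extChartAt_symm_extChartAt hx,
      extChartAt_symm_extChartAt (mem_chart_source E x)]
  rw [e2] at h3
  refine (h3.comp _ h4).congr_of_eventuallyEq ?_
  filter_upwards [eventually_extChartAt_symm hx ((chartAt E x).open_source.mem_nhds
    (mem_chart_source E x)), eventually_extChartAt_symm hx (hf.continuousAt.eventually
    ((chartAt E' (f x)).open_source.mem_nhds (mem_chart_source E' (f x))))] with y hy1 hy2
  simp only [Function.comp_apply]
  rw [extChartAt_symm_extChartAt hy1, extChartAt_symm_extChartAt hy2]

theorem hasFDerivAt_coord_vector {f : M → W} {x : M}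
    (hf : MDifferentiableAt 𝓘(ℝ, E) 𝓘(ℝ, W) f x)
    {j : M} (hx : x ∈ (chartAt E j).source) :
    HasFDerivAt (f ∘ (extChartAt 𝓘(ℝ, E) j).symm)
      ((mfderiv 𝓘(ℝ, E) 𝓘(ℝ, W) f x : E →L[ℝ] W) ∘L
        (tangentCoordChange 𝓘(ℝ, E) j x x : E →L[ℝ] E)) (extChartAt 𝓘(ℝ, E) j x) := by
  have := hasFDerivAt_coord hf (k := f x) hx (mem_chart_source W (f x))
  rw [tangentCoordChange_self_clm (mem_chart_source W (f x))] at this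
  exact this

end Coord

/-! ### Stokes' theorem for fluxes vanishing on an arbitrary frontier. -/

section Stokes

variable {n : ℕ} {X : Type*} [TopologicalSpace X] [ChartedSpace (BaseModel n) X]
    [IsManifold 𝓘(ℝ, BaseModel n) ∞ X]

theorem toCoord_fromCoord {i x : X} (hx : x ∈ (chartAt (BaseModel n) i).source)
    (v : BaseModel n) : toCoord n i x (fromCoord n i x v) = v := by
  refine (tangentCoordChange_comp_apply hx (mem_chart_source _ x) hx v).trans ?_
  rw [tangentCoordChange_self_clm hx]; rfl

theorem fromCoord_toCoord {i x : X} (hx : x ∈ (chartAt (BaseModel n) i).source)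
    (v : TX n x) : fromCoord n i x (toCoord n i x v) = v := by
  refine (tangentCoordChange_comp_apply (mem_chart_source _ x) hx (mem_chart_source _ x) v).trans ?_
  rw [tangentCoordChange_self_clm (mem_chart_source _ x)]; rfl

/-- The components in the chart at `i` of a section of `TX ⊗ Λ^{n+1}X`. -/
noncomputable def vectorDensity (i : X) (a : ∀ x : X, (TX n x →L[ℝ] ℝ) →L[ℝ] Vol n x)
    (μ : Fin (n + 1)) (y : BaseModel n) : ℝ :=
  chartDensity i (fun x => a x (stdCovec n μ ∘L toCoord n i x)) y

/-- Expanding `θ` in coordinate covectors gives `a(θ) = θ_μ a^μ`. The identity is pointwise and asks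
no regularity of `θ` or `a`. -/
theorem chartDensity_vector {i x : X} (hx : x ∈ (chartAt (BaseModel n) i).source)
    (a : ∀ x : X, (TX n x →L[ℝ] ℝ) →L[ℝ] Vol n x) (θ : ∀ x : X, TX n x →L[ℝ] ℝ) :
    chartDensity i (fun x => a x (θ x)) (extChartAt 𝓘(ℝ, BaseModel n) i x) =
      ∑ μ, θ x (fromCoord n i x (stdVec n μ)) *
        vectorDensity i a μ (extChartAt 𝓘(ℝ, BaseModel n) i x) := by
  simp only [vectorDensity, chartDensity_extChartAt hx]
  have hθ : θ x = ∑ μ, θ x (fromCoord n i x (stdVec n μ)) • (stdCovec n μ ∘L toCoord n i x) := by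
    refine ContinuousLinearMap.ext fun v => ?_
    conv_lhs => rw [← fromCoord_toCoord hx v, ← sum_stdCovec_smul_stdVec (toCoord n i x v)]
    rw [map_sum, map_sum, _root_.sum_apply]
    refine Finset.sum_congr rfl fun μ _ => ?_
    rw [map_smul, map_smul]
    exact mul_comm _ _
  conv_lhs => rw [hθ, map_sum]
  rw [ContinuousAlternatingMap.sum_apply]
  refine Finset.sum_congr rfl fun μ _ => ?_
  rw [map_smul]
  rfl

/-- A section of `TX ⊗ Λ^{n+1}X` which is `C^1` up to the closure of `U` and vanishes on the
frontier. -/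
def IsAdmissibleFlux (U : Set X) (a : ∀ x : X, (TX n x →L[ℝ] ℝ) →L[ℝ] Vol n x) : Prop :=
  ∀ i x, x ∈ closure U → x ∈ (chartAt (BaseModel n) i).source → ∀ μ, ∃ f' : BaseModel n → ℝ,
    ContDiffAt ℝ 1 f' (extChartAt 𝓘(ℝ, BaseModel n) i x) ∧
    (∀ᶠ z in 𝓝 (extChartAt 𝓘(ℝ, BaseModel n) i x), z ∈ chartDomain i U →
      vectorDensity i a μ z = f' z) ∧
    (x ∉ U → f' (extChartAt 𝓘(ℝ, BaseModel n) i x) = 0)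

theorem IsAdmissibleFlux.contDiffOn {U : Set X} (hU : IsOpen U)
    {a : ∀ x : X, (TX n x →L[ℝ] ℝ) →L[ℝ] Vol n x} (ha : IsAdmissibleFlux U a) (i : X)
    (μ : Fin (n + 1)) : ContDiffOn ℝ 1 (vectorDensity i a μ) (chartDomain i U) := by
  intro y hy
  obtain ⟨x, hxU, hxi, rfl⟩ := exists_of_mem_chartDomain hy
  obtain ⟨f', hf', h, -⟩ := ha i x (subset_closure hxU) hxi μ
  refine (hf'.congr_of_eventuallyEq ?_).contDiffWithinAt
  filter_upwards [h, (isOpen_chartDomain i hU).mem_nhds hy] with z hz hzU using hz hzU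

/-- Regularity only asks for bounds at the closure, and those are inherited from any local extension
`g` that is continuous at the point in question. At frontier points the extension need not have any
meaning as a density. -/
theorem isRegularDensity_of_local {U : Set X} (hU : IsOpen U) {β : ∀ x : X, Vol n x}
    (h : ∀ i x, x ∈ closure U → x ∈ (chartAt (BaseModel n) i).source → ∃ g : BaseModel n → ℝ,
      ContinuousAt g (extChartAt 𝓘(ℝ, BaseModel n) i x) ∧
      ∀ᶠ z in 𝓝 (extChartAt 𝓘(ℝ, BaseModel n) i x), z ∈ chartDomain i U →
        chartDensity i β z = g z) : IsRegularDensity U β := by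
  intro i
  refine ⟨fun y hy => ?_, fun x hx hxi => ?_⟩
  · obtain ⟨x, hxU, hxi, rfl⟩ := exists_of_mem_chartDomain hy
    obtain ⟨g, hg, hgβ⟩ := h i x (subset_closure hxU) hxi
    refine (hg.congr ?_).continuousWithinAt
    filter_upwards [hgβ, (isOpen_chartDomain i hU).mem_nhds hy] with z hz hzU using (hz hzU).symm
  · obtain ⟨g, hg, hgβ⟩ := h i x hx hxi
    refine ⟨|g (extChartAt 𝓘(ℝ, BaseModel n) i x)| + 1, ?_⟩
    rw [eventually_nhdsWithin_iff]
    filter_upwards [hgβ, hg.abs.eventually_lt continuousAt_const (lt_add_one _)] with z hz hz2 hzU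
    rw [hz hzU]; exact hz2.le

theorem contDiffAt_coord_function {g : X → ℝ} (hg : ContMDiff 𝓘(ℝ, BaseModel n) 𝓘(ℝ, ℝ) ∞ g)
    {i x : X} (hx : x ∈ (chartAt (BaseModel n) i).source) :
    ContDiffAt ℝ ∞ (g ∘ (extChartAt 𝓘(ℝ, BaseModel n) i).symm)
      (extChartAt 𝓘(ℝ, BaseModel n) i x) := by
  have h2 := (contMDiffAt_iff_of_mem_source (x' := x) (x := i) (y := g x) (by simpa using hx)
    (by simp)).1 (hg x)
  have h3 := h2.2
  rw [modelWithCornersSelf_coe, range_id, contDiffWithinAt_univ] at h3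
  exact h3

/-- The differential of a function on `X`. -/
noncomputable def differential (g : X → ℝ) (x : X) : TX n x →L[ℝ] ℝ :=
  (mfderiv 𝓘(ℝ, BaseModel n) 𝓘(ℝ, ℝ) g x : BaseModel n →L[ℝ] ℝ)

theorem hasFDerivAt_coord_function {g : X → ℝ} {x : X}
    (hg : MDifferentiableAt 𝓘(ℝ, BaseModel n) 𝓘(ℝ, ℝ) g x)
    {i : X} (hx : x ∈ (chartAt (BaseModel n) i).source) :
    HasFDerivAt (g ∘ (extChartAt 𝓘(ℝ, BaseModel n) i).symm)
      (differential g x ∘L fromCoord n i x) (extChartAt 𝓘(ℝ, BaseModel n) i x) :=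
  hasFDerivAt_coord_vector hg hx

theorem differential_eq_zero {g : X → ℝ} {x : X} (hx : x ∉ tsupport g) :
    differential (n := n) g x = 0 := by
  have h : g =ᶠ[𝓝 x] fun _ => 0 := by
    filter_upwards [(isClosed_tsupport g).isOpen_compl.mem_nhds hx] with z hz
    exact image_eq_zero_of_notMem_tsupport hz
  have h2 : mfderiv 𝓘(ℝ, BaseModel n) 𝓘(ℝ, ℝ) g x = mfderiv 𝓘(ℝ, BaseModel n) 𝓘(ℝ, ℝ)
      (fun _ : X => (0 : ℝ)) x := h.mfderiv_eq
  rw [mfderiv_const] at h2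
  exact h2

/-- The density `a(dg)` is regular. -/
theorem IsAdmissibleFlux.isRegularDensity {U : Set X} (hU : IsOpen U)
    {a : ∀ x : X, (TX n x →L[ℝ] ℝ) →L[ℝ] Vol n x} (ha : IsAdmissibleFlux U a)
    {g : X → ℝ} (hg : ContMDiff 𝓘(ℝ, BaseModel n) 𝓘(ℝ, ℝ) ∞ g) :
    IsRegularDensity U (fun x => a x (differential g x)) := by
  refine isRegularDensity_of_local hU fun i x hx hxi => ?_
  choose f' hf' hff' _ using fun μ => ha i x hx hxi μ
  have hgc := contDiffAt_coord_function hg hxi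
  refine ⟨fun z => ∑ μ, fderiv ℝ (g ∘ (extChartAt 𝓘(ℝ, BaseModel n) i).symm) z (stdVec n μ) *
    f' μ z, ?_, ?_⟩
  · refine tendsto_finsetSum _ fun μ _ => ?_
    exact ((hgc.fderiv_right (m := 0) (by simp)).continuousAt.clm_apply continuousAt_const).mul
      (hf' μ).continuousAt
  · filter_upwards [Filter.eventually_all.2 hff'] with z hz hzU
    obtain ⟨w, hwU, hwi, rfl⟩ := exists_of_mem_chartDomain hzU
    rw [chartDensity_vector hwi]
    refine Finset.sum_congr rfl fun μ _ => ?_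
    rw [hz μ hzU, (hasFDerivAt_coord_function ((hg w).mdifferentiableAt (by simp)) hwi).fderiv]
    rfl

/-- Over `U` the components of the flux coincide with those of local `C^1` extensions, so `∂_μ a^μ`
has continuous local extensions up to the closure. -/
theorem IsAdmissibleFlux.isRegularDensity_div {U : Set X} (hU : IsOpen U)
    {a : ∀ x : X, (TX n x →L[ℝ] ℝ) →L[ℝ] Vol n x} (ha : IsAdmissibleFlux U a)
    {D : ∀ x : X, Vol n x} (hD : ∀ i x, x ∈ U → x ∈ (chartAt (BaseModel n) i).source →
      chartDensity i D (extChartAt 𝓘(ℝ, BaseModel n) i x) =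
        ∑ μ, fderiv ℝ (vectorDensity i a μ) (extChartAt 𝓘(ℝ, BaseModel n) i x) (stdVec n μ)) :
    IsRegularDensity U D := by
  refine isRegularDensity_of_local hU fun i x hx hxi => ?_
  choose f' hf' hff' _ using fun μ => ha i x hx hxi μ
  refine ⟨fun z => ∑ μ, fderiv ℝ (f' μ) z (stdVec n μ), ?_, ?_⟩
  · refine tendsto_finsetSum _ fun μ _ => ?_
    exact ((hf' μ).fderiv_right (m := 0) (by simp)).continuousAt.clm_apply continuousAt_const
  · filter_upwards [(Filter.eventually_all.2 hff').eventually_nhds] with z hz hzU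
    have hVn := (isOpen_chartDomain i hU).mem_nhds hzU
    obtain ⟨w, hwU, hwi, rfl⟩ := exists_of_mem_chartDomain hzU
    rw [hD i w hwU hwi]
    refine Finset.sum_congr rfl fun μ _ => ?_
    have : vectorDensity i a μ =ᶠ[𝓝 (extChartAt 𝓘(ℝ, BaseModel n) i w)] f' μ := by
      filter_upwards [hz, hVn] with y hy hyV using hy μ hyV
    rw [this.fderiv_eq]

/-- The divergence theorem for the product of a flux with a member of the partition of unity. -/
theorem IsAdmissibleFlux.setIntegral_chart [T2Space X] {U : Set X} (hU : IsOpen U)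
    (hUc : IsCompact (closure U))
    {a : ∀ x : X, (TX n x →L[ℝ] ℝ) →L[ℝ] Vol n x} (ha : IsAdmissibleFlux U a)
    {D : ∀ x : X, Vol n x} (hD : ∀ i x, x ∈ U → x ∈ (chartAt (BaseModel n) i).source →
      chartDensity i D (extChartAt 𝓘(ℝ, BaseModel n) i x) =
        ∑ μ, fderiv ℝ (vectorDensity i a μ) (extChartAt 𝓘(ℝ, BaseModel n) i x) (stdVec n μ))
    {g : X → ℝ} (hg : ContMDiff 𝓘(ℝ, BaseModel n) 𝓘(ℝ, ℝ) ∞ g) {i : X}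
    (hgi : tsupport g ⊆ (chartAt (BaseModel n) i).source) :
    ∫ y in chartDomain i U, g ((extChartAt 𝓘(ℝ, BaseModel n) i).symm y) * chartDensity i D y =
      - ∫ y in chartDomain i U,
        chartDensity i (fun x => a x (differential g x)) y := by
  have hK : IsCompact (tsupport g ∩ closure U) := hUc.inter_left (isClosed_tsupport _)
  have hKi : tsupport g ∩ closure U ⊆ (chartAt (BaseModel n) i).source :=
    inter_subset_left.trans hgi
  let G : Fin (n + 1) → BaseModel n → ℝ := fun μ y =>
    g ((extChartAt 𝓘(ℝ, BaseModel n) i).symm y) * vectorDensity i a μ y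
  have hG : ∀ μ, IntegrableOn (fun y => fderiv ℝ (G μ) y (stdVec n μ)) (chartDomain i U) ∧
      ∫ y in chartDomain i U, fderiv ℝ (G μ) y (stdVec n μ) = 0 := by
    intro μ
    refine setIntegral_fderiv_eq_zero (isOpen_chartDomain i hU) (isCompact_image_chart hK hKi)
      ?_ ?_ _
    · intro y hy hyK
      obtain ⟨x, hxU, hxi, rfl⟩ := exists_of_mem_chartDomain hy
      simp only [G]
      rw [extChartAt_symm_apply hxi, image_eq_zero_of_notMem_tsupport (f := g), zero_mul]
      exact fun h => hyK ⟨x, ⟨h, subset_closure hxU⟩, rfl⟩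
    · rintro _ ⟨x, hx, rfl⟩
      obtain ⟨f', hf', hff', h0⟩ := ha i x hx.2 (hKi hx) μ
      refine ⟨fun y => g ((extChartAt 𝓘(ℝ, BaseModel n) i).symm y) * f' y, ?_, ?_, ?_⟩
      · exact ((contDiffAt_coord_function hg (hKi hx)).of_le (by simp)).mul hf'
      · filter_upwards [hff'] with z hz hzU
        simp only [G]
        rw [hz hzU]
      · intro hxU
        rw [mem_chartDomain_iff (hKi hx)] at hxU
        simp only [h0 hxU, mul_zero]
  -- Leibniz rule: `∂_μ (g a^μ)` is `g` times the divergence plus `a(dg)`, and each summand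
  -- integrates to zero by the Euclidean divergence theorem.
  have h1 : ∫ y in chartDomain i U, (g ((extChartAt 𝓘(ℝ, BaseModel n) i).symm y) *
      chartDensity i D y +
      chartDensity i (fun x => a x (differential g x)) y) = 0 := by
    have h2 : ∫ y in chartDomain i U, ∑ μ, fderiv ℝ (G μ) y (stdVec n μ) = 0 := by
      rw [integral_finsetSum _ fun μ _ => (hG μ).1]
      exact Finset.sum_eq_zero fun μ _ => (hG μ).2
    rw [← h2]
    refine setIntegral_congr_fun (isOpen_chartDomain i hU).measurableSet fun y hy => ?_
    have hVn := (isOpen_chartDomain i hU).mem_nhds hy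
    obtain ⟨x, hxU, hxi, rfl⟩ := exists_of_mem_chartDomain hy
    rw [chartDensity_vector hxi, hD i x hxU hxi, extChartAt_symm_apply hxi, Finset.mul_sum,
      ← Finset.sum_add_distrib]
    refine Finset.sum_congr rfl fun μ _ => ?_
    have hgd := hasFDerivAt_coord_function ((hg x).mdifferentiableAt (by simp)) hxi
    have had := ((ha.contDiffOn hU i μ).contDiffAt hVn).differentiableAt (by simp)
    have hGd : HasFDerivAt (G μ) _ _ := hgd.mul had.hasFDerivAt
    rw [hGd.fderiv]
    simp only [Function.comp_apply, extChartAt_symm_apply hxi]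
    change g x * _ + _ = g x * _ + _ * _
    rw [mul_comm (vectorDensity i a μ _)]
    rfl
  have hI1 : IntegrableOn (fun y => g ((extChartAt 𝓘(ℝ, BaseModel n) i).symm y) *
      chartDensity i D y) (chartDomain i U) := by
    refine (ha.isRegularDensity_div hU hD).integrableOn hU hK hKi inter_subset_right
      hg.continuous fun x hxU _ hxK => ?_
    rw [image_eq_zero_of_notMem_tsupport (f := g), zero_mul]
    exact fun h => hxK ⟨h, subset_closure hxU⟩
  have hI2 : IntegrableOn (fun y => chartDensity i
      (fun x => a x (differential g x)) y) (chartDomain i U) := by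
    have := (ha.isRegularDensity hU hg).integrableOn hU hK hKi inter_subset_right
      (continuous_const (y := (1 : ℝ))) fun x hxU hxi hxK => ?_
    · simpa using this
    · rw [one_mul, chartDensity_vector hxi, differential_eq_zero fun h =>
        hxK ⟨h, subset_closure hxU⟩]
      exact Finset.sum_eq_zero fun μ _ => zero_mul _
  rw [integral_add hI1 hI2] at h1
  linarith

/-- **Stokes' theorem** on an arbitrary relatively compact open set, for a flux which is `C^1` up to
the closure and vanishes on the frontier. -/
theorem IsAdmissibleFlux.formIntegral_eq_zero [T2Space X] [SigmaCompactSpace X] [OrientedAtlas n X]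
    {U : Set X} (hU : IsOpen U) (hUc : IsCompact (closure U))
    {a : ∀ x : X, (TX n x →L[ℝ] ℝ) →L[ℝ] Vol n x} (ha : IsAdmissibleFlux U a)
    {D : ∀ x : X, Vol n x} (hD : ∀ i x, x ∈ U → x ∈ (chartAt (BaseModel n) i).source →
      chartDensity i D (extChartAt 𝓘(ℝ, BaseModel n) i x) =
        ∑ μ, fderiv ℝ (vectorDensity i a μ) (extChartAt 𝓘(ℝ, BaseModel n) i x) (stdVec n μ)) :
    formIntegral n U D = 0 := by
  have hsm : ∀ i : X, ContMDiff 𝓘(ℝ, BaseModel n) 𝓘(ℝ, ℝ) ∞ (chartPartition n X i) :=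
    fun i => (chartPartition n X i).2
  have hout : ∀ x ∈ U, x ∉ closure U → False := fun x hx h => h (subset_closure hx)
  let β : X → ∀ x : X, Vol n x := fun i x => a x (differential (chartPartition n X i) x)
  have hβ : ∀ i, IsRegularDensity U (β i) := fun i => ha.isRegularDensity hU (hsm i)
  rw [formIntegral_eq_sum hUc fun x hx h => (hout x hx h).elim]
  -- Integration by parts replaces the `i`-th piece by `-∫ a(dχ_i)`, with `χ_i` the members of the
  -- partition. This integral, computed in the chart at `i`, is spread again over all charts so that
  -- the sum over `i` can be taken first.
  have h1 : ∀ i ∈ chartFinset (n := n) hUc, ∫ y in chartDomain i U,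
      chartPartition n X i ((extChartAt 𝓘(ℝ, BaseModel n) i).symm y) * chartDensity i D y =
      - ∑ j ∈ chartFinset (n := n) hUc, ∫ y in chartDomain j U,
        chartPartition n X j ((extChartAt 𝓘(ℝ, BaseModel n) j).symm y) *
          chartDensity j (β i) y := by
    intro i _
    rw [ha.setIntegral_chart hU hUc hD (hsm i) (tsupport_chartPartition_subset i),
      ← formIntegral_eq_sum hUc fun x hx h => (hout x hx h).elim]
    refine congrArg Neg.neg (formIntegral_eq_chart hU (hβ i)
      (hUc.inter_left (isClosed_tsupport (chartPartition n X i))) inter_subset_right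
      (inter_subset_left.trans (tsupport_chartPartition_subset i)) fun x hx hxK => ?_).symm
    simp only [β]
    rw [differential_eq_zero fun h => hxK ⟨h, subset_closure hx⟩, map_zero]
  rw [Finset.sum_congr rfl h1, Finset.sum_neg_distrib, Finset.sum_comm, neg_eq_zero]
  refine Finset.sum_eq_zero fun j _ => ?_
  rw [← integral_finsetSum]
  · refine setIntegral_eq_zero_of_forall_eq_zero fun y hy => ?_
    obtain ⟨x, hxU, hxj, rfl⟩ := exists_of_mem_chartDomain hy
    rw [← Finset.mul_sum]
    refine mul_eq_zero_of_right _ ?_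
    -- The finite sum of the members of the partition equals one on `U`, a neighbourhood of `x`, so
    -- its differential is zero.
    have hsum : ∑ i ∈ chartFinset (n := n) hUc, differential (n := n) (chartPartition n X i) x =
        0 := by
      have hd : ∀ i, MDifferentiableAt 𝓘(ℝ, BaseModel n) 𝓘(ℝ, ℝ) (chartPartition n X i) x :=
        fun i => (hsm i x).mdifferentiableAt (by simp)
      have h2 := HasFDerivAt.fun_sum (u := chartFinset (n := n) hUc)
        fun i _ => hasFDerivAt_coord_function (hd i) (mem_chart_source (BaseModel n) x)
      have h3 : (fun y => ∑ i ∈ chartFinset (n := n) hUc, (chartPartition n X i ∘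
          (extChartAt 𝓘(ℝ, BaseModel n) x).symm) y) =ᶠ[𝓝 (extChartAt 𝓘(ℝ, BaseModel n) x x)]
          fun _ => 1 := by
        filter_upwards [eventually_extChartAt_symm (mem_chart_source (BaseModel n) x)
          (hU.mem_nhds hxU)] with z hz
        exact sum_chartPartition hUc (subset_closure hz)
      have h4 := h2.unique ((hasFDerivAt_const (1 : ℝ) _).congr_of_eventuallyEq h3)
      have h5 : (fromCoord n x x : BaseModel n →L[ℝ] TX n x) =
          ContinuousLinearMap.id ℝ (BaseModel n) :=
        tangentCoordChange_self_clm (mem_chart_source _ x)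
      rw [h5] at h4
      exact h4
    have h6 : ∀ i, chartDensity j (β i) (extChartAt 𝓘(ℝ, BaseModel n) j x) =
        ∑ μ, differential (chartPartition n X i) x (fromCoord n j x (stdVec n μ)) *
        vectorDensity j a μ (extChartAt 𝓘(ℝ, BaseModel n) j x) := fun i =>
      chartDensity_vector hxj a fun x => differential (chartPartition n X i) x
    simp only [h6]
    rw [Finset.sum_comm]
    refine Finset.sum_eq_zero fun μ _ => ?_
    rw [← Finset.sum_mul, ← _root_.sum_apply, hsum]
    exact zero_mul _
  · intro i _
    refine (hβ i).integrableOn hU (hUc.inter_left (isClosed_tsupport (chartPartition n X j)))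
      (inter_subset_left.trans (tsupport_chartPartition_subset j)) inter_subset_right
      (hsm j).continuous fun x hx _ hxK => ?_
    rw [image_eq_zero_of_notMem_tsupport (f := chartPartition n X j), zero_mul]
    exact fun h => hxK ⟨h, subset_closure hx⟩

end Stokes

end CovariantClebsch

namespace CovariantClebsch

open Filter Set

/-! ### First variation of `L(z, S) + P(DQ - A(Q) S)` in Euclidean coordinates. -/

section FirstVariation

variable {n : ℕ} {F K V : Type*} [NormedAddCommGroup F] [NormedSpace ℝ F]
  [NormedAddCommGroup K] [NormedSpace ℝ K] [NormedAddCommGroup V] [NormedSpace ℝ V]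

/-- The integrand `L(z, S) + P(DQ - A(Q) S)` in coordinates. -/
noncomputable def localIntegrand (L : BaseModel n × (BaseModel n →L[ℝ] K) → V) (A : F → K →L[ℝ] F)
    (Q : BaseModel n → F) (S : BaseModel n → BaseModel n →L[ℝ] K)
    (P : BaseModel n → (BaseModel n →L[ℝ] F) →L[ℝ] V) (z : BaseModel n) : V :=
  L (z, S z) + P z (fderiv ℝ Q z - A (Q z) ∘L S z)

/-- The Euler–Lagrange expression of the integrand `L(z, S) + P(DQ - A(Q) S)`. -/
noncomputable def localEuler (L : BaseModel n × (BaseModel n →L[ℝ] K) → V) (A : F → K →L[ℝ] F)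
    (Q : BaseModel n → F) (S : BaseModel n → BaseModel n →L[ℝ] K)
    (P : BaseModel n → (BaseModel n →L[ℝ] F) →L[ℝ] V) (z : BaseModel n)
    (b : F) (s : BaseModel n →L[ℝ] K) (w : (BaseModel n →L[ℝ] F) →L[ℝ] V) : V :=
  (fderiv ℝ (fun s => L (z, s)) (S z) s - P z (A (Q z) ∘L s))
    + w (fderiv ℝ Q z - A (Q z) ∘L S z)
    - (∑ μ, fderiv ℝ P z (stdVec n μ) ((stdCovec n μ).smulRight b) +
      P z (fderiv ℝ A (Q z) b ∘L S z))

variable {L : BaseModel n × (BaseModel n →L[ℝ] K) → V} {A : F → K →L[ℝ] F}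
  {Q : ℝ × BaseModel n → F} {S : ℝ × BaseModel n → BaseModel n →L[ℝ] K}
  {P : ℝ × BaseModel n → (BaseModel n →L[ℝ] F) →L[ℝ] V} {y : BaseModel n}

theorem hasFDerivAt_slice {W : Type*} [NormedAddCommGroup W] [NormedSpace ℝ W]
    {f : ℝ × BaseModel n → W} {p : ℝ × BaseModel n} (hf : DifferentiableAt ℝ f p) :
    HasFDerivAt (fun z => f (p.1, z)) (fderiv ℝ f p ∘L ContinuousLinearMap.inr ℝ ℝ (BaseModel n))
      p.2 := by
  have h : HasFDerivAt (fun z : BaseModel n => (p.1, z))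
    (ContinuousLinearMap.inr ℝ ℝ (BaseModel n)) p.2 := hasFDerivAt_prodMk_right p.1 p.2
  exact HasFDerivAt.comp (g := f) p.2 hf.hasFDerivAt h

theorem hasDerivAt_slice {W : Type*} [NormedAddCommGroup W] [NormedSpace ℝ W]
    {f : ℝ × BaseModel n → W} {p : ℝ × BaseModel n} (hf : DifferentiableAt ℝ f p) :
    HasDerivAt (fun ε => f (ε, p.2)) (fderiv ℝ f p (1, 0)) p.1 := by
  have hl : HasDerivAt (fun ε : ℝ => (ε, p.2)) ((1 : ℝ), (0 : BaseModel n)) p.1 :=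
    (hasDerivAt_id p.1).prodMk (hasDerivAt_const p.1 p.2)
  exact HasFDerivAt.comp_hasDerivAt (x := p.1) (f := fun ε : ℝ => (ε, p.2)) (l := f)
    hf.hasFDerivAt hl

/-- The derivative of the slice `z ↦ Q(ε, z)` is a component of the joint derivative of `Q`. In this
form smoothness in `(ε, z)` together is visible. -/
theorem eventually_localIntegrand_eq (hQ : ContDiffAt ℝ ∞ Q (0, y)) :
    ∀ᶠ p in 𝓝 ((0 : ℝ), y), localIntegrand L A (fun z => Q (p.1, z)) (fun z => S (p.1, z))
      (fun z => P (p.1, z)) p.2 = L (p.2, S p) +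
        P p (fderiv ℝ Q p ∘L ContinuousLinearMap.inr ℝ ℝ (BaseModel n) - A (Q p) ∘L S p) := by
  filter_upwards [(hQ.of_le (show (1 : WithTop ℕ∞) ≤ ∞ by simp)).eventually (by simp)] with p hp
  rw [localIntegrand, (hasFDerivAt_slice (hp.differentiableAt (by simp))).fderiv]

theorem contDiffAt_localIntegrand (hQ : ContDiffAt ℝ ∞ Q (0, y)) (hS : ContDiffAt ℝ ∞ S (0, y))
    (hP : ContDiffAt ℝ ∞ P (0, y)) (hA : ContDiffAt ℝ ∞ A (Q (0, y)))
    (hL : ContDiffAt ℝ ∞ L (y, S (0, y))) :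
    ContDiffAt ℝ ∞ (fun p : ℝ × BaseModel n => localIntegrand L A (fun z => Q (p.1, z))
      (fun z => S (p.1, z)) (fun z => P (p.1, z)) p.2) (0, y) := by
  refine ContDiffAt.congr_of_eventuallyEq ?_ (eventually_localIntegrand_eq hQ)
  have h1 : ContDiffAt ℝ ∞ (fun p : ℝ × BaseModel n => L (p.2, S p)) (0, y) :=
    ContDiffAt.comp (g := L) (0, y) hL (contDiffAt_snd.prodMk hS)
  have h2 : ContDiffAt ℝ ∞ (fun p : ℝ × BaseModel n => A (Q p)) (0, y) := hA.comp (0, y) hQ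
  have h3 : ContDiffAt ℝ ∞ (fderiv ℝ Q) (0, y) := hQ.fderiv_right (by simp)
  exact h1.add (hP.clm_apply ((h3.clm_comp contDiffAt_const).sub (h2.clm_comp hS)))

/-- **First variation formula** in coordinates. -/
theorem hasDerivAt_localIntegrand (hQ : ContDiffAt ℝ ∞ Q (0, y)) (hS : ContDiffAt ℝ ∞ S (0, y))
    (hP : ContDiffAt ℝ ∞ P (0, y)) (hA : ContDiffAt ℝ ∞ A (Q (0, y)))
    (hL : ContDiffAt ℝ ∞ L (y, S (0, y))) :
    HasDerivAt (fun ε => localIntegrand L A (fun z => Q (ε, z)) (fun z => S (ε, z))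
        (fun z => P (ε, z)) y)
      (localEuler L A (fun z => Q (0, z)) (fun z => S (0, z)) (fun z => P (0, z)) y
        (deriv (fun ε => Q (ε, y)) 0) (deriv (fun ε => S (ε, y)) 0) (deriv (fun ε => P (ε, y)) 0) +
      ∑ μ, fderiv ℝ (fun z => P (0, z) ((stdCovec n μ).smulRight (deriv (fun ε => Q (ε, z)) 0)))
        y (stdVec n μ)) 0 := by
  have one_le : (1 : WithTop ℕ∞) ≤ ∞ := by simp
  have hQd := hQ.differentiableAt (by simp)
  have hSd := hS.differentiableAt (by simp)
  have hPd := hP.differentiableAt (by simp)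
  have hAd := hA.differentiableAt (by simp)
  have hLd := hL.differentiableAt (by simp)
  have hDQ : ContDiffAt ℝ ∞ (fderiv ℝ Q) (0, y) := hQ.fderiv_right (by simp)
  have hDQd := hDQ.differentiableAt (by simp)
  have hQe := hasDerivAt_slice hQd
  have hSe := hasDerivAt_slice hSd
  have hPe := hasDerivAt_slice hPd
  have hDQe := hasDerivAt_slice hDQd
  simp only at hQe hSe hPe hDQe
  have ht : Tendsto (fun ε : ℝ => (ε, y)) (𝓝 0) (𝓝 (0, y)) := by
    have : ContinuousAt (fun ε : ℝ => (ε, y)) 0 := by fun_prop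
    exact this
  have htz : Tendsto (fun z : BaseModel n => ((0 : ℝ), z)) (𝓝 y) (𝓝 (0, y)) := by
    have : ContinuousAt (fun z : BaseModel n => ((0 : ℝ), z)) y := by fun_prop
    exact this
  -- derivative of each term
  have hL1 : HasDerivAt (fun ε => L (y, S (ε, y)))
      (fderiv ℝ (fun s => L (y, s)) (S (0, y)) (fderiv ℝ S (0, y) (1, 0))) 0 := by
    have h1 : HasFDerivAt (fun s => L (y, s)) (fderiv ℝ L (y, S (0, y)) ∘L
        ContinuousLinearMap.inr ℝ (BaseModel n) _) (S (0, y)) :=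
      HasFDerivAt.comp (g := L) (S (0, y)) hLd.hasFDerivAt (hasFDerivAt_prodMk_right y (S (0, y)))
    rw [h1.fderiv]
    exact HasFDerivAt.comp_hasDerivAt (x := (0 : ℝ)) (f := fun ε => S (ε, y))
      (l := fun s => L (y, s)) h1 hSe
  have hA1 : HasDerivAt (fun ε => A (Q (ε, y)))
      (fderiv ℝ A (Q (0, y)) (fderiv ℝ Q (0, y) (1, 0))) 0 :=
    HasFDerivAt.comp_hasDerivAt (x := (0 : ℝ)) (f := fun ε => Q (ε, y)) (l := A)
      hAd.hasFDerivAt hQe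
  have hAS := hA1.clm_comp hSe
  have hDQ1 := hDQe.clm_comp
    (hasDerivAt_const (0 : ℝ) (ContinuousLinearMap.inr ℝ ℝ (BaseModel n)))
  have htot := hL1.add (hPe.clm_apply (hDQ1.sub hAS))
  have hcongr := htot.congr_of_eventuallyEq
    (f₁ := fun ε => localIntegrand L A (fun z => Q (ε, z)) (fun z => S (ε, z))
        (fun z => P (ε, z)) y) (by
      filter_upwards [ht.eventually (eventually_localIntegrand_eq (L := L) (A := A) (S := S)
        (P := P) hQ)] with ε hε
      exact hε)
  refine hcongr.congr_deriv ?_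
  -- the divergence term
  have hdQ : (fun z => deriv (fun ε => Q (ε, z)) 0) =ᶠ[𝓝 y] fun z => fderiv ℝ Q (0, z) (1, 0) := by
    filter_upwards [htz.eventually ((hQ.of_le one_le).eventually (by simp))] with z hz
    exact (hasDerivAt_slice (hz.differentiableAt (by simp))).deriv
  have hdQ' : HasFDerivAt (fun z => deriv (fun ε => Q (ε, z)) 0)
      ((ContinuousLinearMap.apply ℝ F ((1 : ℝ), (0 : BaseModel n))) ∘L
        (fderiv ℝ (fderiv ℝ Q) (0, y) ∘L ContinuousLinearMap.inr ℝ ℝ (BaseModel n))) y := by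
    have := (ContinuousLinearMap.apply ℝ F ((1 : ℝ), (0 : BaseModel n))).hasFDerivAt.comp y
      (hasFDerivAt_slice hDQd)
    exact this.congr_of_eventuallyEq hdQ
  have hPy : HasFDerivAt (fun z => P (0, z)) (fderiv ℝ (fun z => P (0, z)) y) y :=
    (hasFDerivAt_slice hPd).differentiableAt.hasFDerivAt
  have hdiv : ∀ μ, fderiv ℝ (fun z => P (0, z)
      ((stdCovec n μ).smulRight (deriv (fun ε => Q (ε, z)) 0))) y (stdVec n μ) =
      P (0, y) ((stdCovec n μ).smulRight (fderiv ℝ (fderiv ℝ Q) (0, y) (0, stdVec n μ) (1, 0))) +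
      fderiv ℝ (fun z => P (0, z)) y (stdVec n μ)
        ((stdCovec n μ).smulRight (deriv (fun ε => Q (ε, y)) 0)) := by
    intro μ
    have h1 := ((ContinuousLinearMap.smulRightL ℝ (BaseModel n) F (stdCovec n μ)).hasFDerivAt).comp
      y hdQ'
    have h2 := hPy.clm_apply h1
    have h3 := h2.fderiv
    refine (congrArg (fun T => T (stdVec n μ)) h3).trans ?_
    rfl
  -- The derivatives in `ε` and in `z` commute, so `P(∂_ε DQ) = P(D δQ)`. This is the divergence of
  -- `P(· ⊗ δQ)` minus the term in which `P` is differentiated.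
  have hsymm : IsSymmSndFDerivAt ℝ Q (0, y) := hQ.isSymmSndFDerivAt (by
    rw [minSmoothness_of_isRCLikeNormedField]
    exact (inferInstance : ENat.LEInfty (2 : WithTop ℕ∞)).out)
  have hcol : ∑ μ, P (0, y) ((stdCovec n μ).smulRight
      (fderiv ℝ (fderiv ℝ Q) (0, y) (0, stdVec n μ) (1, 0))) =
      P (0, y) (fderiv ℝ (fderiv ℝ Q) (0, y) (1, 0) ∘L
        ContinuousLinearMap.inr ℝ ℝ (BaseModel n)) := by
    rw [← map_sum]
    congr 1
    rw [← sum_smulRight_stdCovec (fderiv ℝ (fderiv ℝ Q) (0, y) (1, 0) ∘L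
        ContinuousLinearMap.inr ℝ ℝ (BaseModel n))]
    refine Finset.sum_congr rfl fun μ _ => ?_
    rw [hsymm.eq]
    rfl
  have hQ0 := (hasFDerivAt_slice hQd).fderiv
  simp only at hQ0
  rw [Finset.sum_congr rfl fun μ _ => hdiv μ, Finset.sum_add_distrib, hcol, localEuler, hQ0,
    hQe.deriv, hSe.deriv, hPe.deriv]
  simp only [map_sub, map_add, ContinuousLinearMap.comp_zero, add_zero, Pi.sub_apply]
  abel

end FirstVariation

end CovariantClebsch

namespace CovariantClebsch

open Filter Set

/-! ### Sections, generators and Lagrangians in charts, and their smoothness. -/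

section Coordinates

variable {n : ℕ}
  {EG : Type*} [NormedAddCommGroup EG] [NormedSpace ℝ EG] [FiniteDimensional ℝ EG]
  {G : Type*} [TopologicalSpace G] [ChartedSpace EG G] [Group G] [LieGroup 𝓘(ℝ, EG) ∞ G]
  {F : Type*} [NormedAddCommGroup F] [NormedSpace ℝ F] [FiniteDimensional ℝ F]
  {Q : Type*} [TopologicalSpace Q] [ChartedSpace F Q] [IsManifold 𝓘(ℝ, F) ∞ Q] [MulAction G Q]
  {X : Type*} [TopologicalSpace X] [ChartedSpace (BaseModel n) X]
  [IsManifold 𝓘(ℝ, BaseModel n) ∞ X]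

/-- The configuration component of a section in the charts at `i` and `k`. -/
noncomputable def coordQ (i : X) (k : Q) (ψ : ∀ x : X, PhaseFiber n EG G F Q x)
    (z : BaseModel n) : F :=
  extChartAt 𝓘(ℝ, F) k (ψ ((extChartAt 𝓘(ℝ, BaseModel n) i).symm z)).q

/-- The Lie algebra component of a section in the chart at `i`. -/
noncomputable def coordS (i : X) (ψ : ∀ x : X, PhaseFiber n EG G F Q x)
    (z : BaseModel n) : BaseModel n →L[ℝ] EG :=
  lieFormCoord i ((extChartAt 𝓘(ℝ, BaseModel n) i).symm z)
    (ψ ((extChartAt 𝓘(ℝ, BaseModel n) i).symm z)).σ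

/-- The momentum component of a section in the charts at `i` and `k`. -/
noncomputable def coordP (i : X) (k : Q) (ψ : ∀ x : X, PhaseFiber n EG G F Q x)
    (z : BaseModel n) : (BaseModel n →L[ℝ] F) →L[ℝ] (BaseModel n) [⋀^Fin (n + 1)]→L[ℝ] ℝ :=
  momentumCoord i ((extChartAt 𝓘(ℝ, BaseModel n) i).symm z) k
    (ψ ((extChartAt 𝓘(ℝ, BaseModel n) i).symm z)).q
    (ψ ((extChartAt 𝓘(ℝ, BaseModel n) i).symm z)).mom

variable (EG G) in
/-- The infinitesimal generator in the chart at `k`. -/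
noncomputable def infGenCoord (k : Q) (a : F) : EG →L[ℝ] F :=
  (tangentCoordChange 𝓘(ℝ, F) ((extChartAt 𝓘(ℝ, F) k).symm a) k
    ((extChartAt 𝓘(ℝ, F) k).symm a) : F →L[ℝ] F) ∘L
    (show EG →L[ℝ] F from infGen EG G F ((extChartAt 𝓘(ℝ, F) k).symm a))

/-- A Lagrangian density in the chart at `i`. -/
noncomputable def lagCoord (i : X) (ℓ : Density n EG G X)
    (p : BaseModel n × (BaseModel n →L[ℝ] EG)) : (BaseModel n) [⋀^Fin (n + 1)]→L[ℝ] ℝ :=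
  volCoord i ((extChartAt 𝓘(ℝ, BaseModel n) i).symm p.1)
    (ℓ ((extChartAt 𝓘(ℝ, BaseModel n) i).symm p.1)
      (lieFormOfCoord i ((extChartAt 𝓘(ℝ, BaseModel n) i).symm p.1) p.2))

theorem coordQ_extChartAt {i : X} {x : X} (hx : x ∈ (chartAt (BaseModel n) i).source) (k : Q)
    (ψ : ∀ x : X, PhaseFiber n EG G F Q x) :
    coordQ i k ψ (extChartAt 𝓘(ℝ, BaseModel n) i x) = extChartAt 𝓘(ℝ, F) k (ψ x).q := by
  rw [coordQ, extChartAt_symm_apply hx]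

theorem coordS_extChartAt {i : X} {x : X} (hx : x ∈ (chartAt (BaseModel n) i).source)
    (ψ : ∀ x : X, PhaseFiber n EG G F Q x) :
    coordS i ψ (extChartAt 𝓘(ℝ, BaseModel n) i x) = lieFormCoord i x (ψ x).σ := by
  rw [coordS, extChartAt_symm_apply hx]

theorem coordP_extChartAt {i : X} {x : X} (hx : x ∈ (chartAt (BaseModel n) i).source) (k : Q)
    (ψ : ∀ x : X, PhaseFiber n EG G F Q x) :
    coordP i k ψ (extChartAt 𝓘(ℝ, BaseModel n) i x) = momentumCoord i x k (ψ x).q (ψ x).mom := by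
  rw [coordP, extChartAt_symm_apply hx]

theorem infGenCoord_extChartAt {k q : Q} (hq : q ∈ (chartAt F k).source) :
    infGenCoord EG G k (extChartAt 𝓘(ℝ, F) k q) =
      (tangentCoordChange 𝓘(ℝ, F) q k q : F →L[ℝ] F) ∘L
        (show EG →L[ℝ] F from infGen EG G F q) := by
  rw [infGenCoord, extChartAt_symm_extChartAt hq]

theorem lagCoord_extChartAt {i x : X} (hx : x ∈ (chartAt (BaseModel n) i).source)
    (ℓ : Density n EG G X) (S : BaseModel n →L[ℝ] EG) :
    lagCoord i ℓ (extChartAt 𝓘(ℝ, BaseModel n) i x, S) =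
      volCoord i x (ℓ x (lieFormOfCoord i x S)) := by
  change volCoord i ((extChartAt 𝓘(ℝ, BaseModel n) i).symm (extChartAt 𝓘(ℝ, BaseModel n) i x)) _ = _
  rw [extChartAt_symm_apply hx]

theorem lieFormOfCoord_lieFormCoord {i x : X} (hx : x ∈ (chartAt (BaseModel n) i).source)
    (σ : LieForm n EG G x) : lieFormOfCoord i x (lieFormCoord i x σ) = σ :=
  ContinuousLinearMap.ext fun v => congrArg σ (fromCoord_toCoord hx v)

theorem lieFormCoord_lieFormOfCoord {i x : X} (hx : x ∈ (chartAt (BaseModel n) i).source)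
    (S : BaseModel n →L[ℝ] EG) :
    lieFormCoord (EG := EG) (G := G) i x (lieFormOfCoord i x S) = S :=
  ContinuousLinearMap.ext fun v => congrArg S (toCoord_fromCoord hx v)

theorem fromCoordQ_coord {k q : Q} (hq : q ∈ (chartAt F k).source) (v : F) :
    fromCoordQ F k q ((tangentCoordChange 𝓘(ℝ, F) q k q : F →L[ℝ] F) v) = v := by
  refine (tangentCoordChange_comp_apply (mem_chart_source _ q) hq (mem_chart_source _ q) v).trans ?_
  rw [tangentCoordChange_self_clm (mem_chart_source _ q)]; rfl

theorem coord_fromCoordQ {k q : Q} (hq : q ∈ (chartAt F k).source) (v : F) :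
    (tangentCoordChange 𝓘(ℝ, F) q k q : F →L[ℝ] F) (fromCoordQ F k q v) = v := by
  refine (tangentCoordChange_comp_apply hq (mem_chart_source _ q) hq v).trans ?_
  rw [tangentCoordChange_self_clm hq]; rfl

/-- The momentum in coordinates, applied to a tensor in coordinates. -/
theorem momentumCoord_apply {i x : X} (hx : x ∈ (chartAt (BaseModel n) i).source)
    {k q : Q} (hq : q ∈ (chartAt F k).source) (w : Momentum n F x q)
    (B : TX n x →L[ℝ] TangentSpace 𝓘(ℝ, F) q) :
    momentumCoord i x k q w ((tangentCoordChange 𝓘(ℝ, F) q k q : F →L[ℝ] F) ∘L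
      (show BaseModel n →L[ℝ] F from B ∘L fromCoord n i x)) = volCoord i x (w B) := by
  have h : fromCoordQ F k q ∘L ((tangentCoordChange 𝓘(ℝ, F) q k q : F →L[ℝ] F) ∘L
      (show BaseModel n →L[ℝ] F from B ∘L fromCoord n i x)) ∘L toCoord n i x = B :=
    ContinuousLinearMap.ext fun v =>
      (fromCoordQ_coord hq _).trans (congrArg B (fromCoord_toCoord hx v))
  exact congrArg (fun B => volCoord i x (w B)) h

theorem chartDensity_eq_evalStd {i x : X} (hx : x ∈ (chartAt (BaseModel n) i).source)
    (β : ∀ x : X, Vol n x) :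
    chartDensity i β (extChartAt 𝓘(ℝ, BaseModel n) i x) = evalStd n (volCoord i x (β x)) := by
  rw [chartDensity_extChartAt hx, evalStd_apply]
  rfl

theorem volOfCoord_volCoord {i x : X} (hx : x ∈ (chartAt (BaseModel n) i).source)
    (β : Vol n x) : volOfCoord i x (volCoord i x β) = β := by
  refine ContinuousAlternatingMap.ext fun v => ?_
  exact congrArg β (funext fun m => fromCoord_toCoord hx (v m))

theorem volCoord_volOfCoord {i x : X} (hx : x ∈ (chartAt (BaseModel n) i).source)
    (β : (BaseModel n) [⋀^Fin (n + 1)]→L[ℝ] ℝ) : volCoord i x (volOfCoord i x β) = β := by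
  refine ContinuousAlternatingMap.ext fun v => ?_
  exact congrArg β (funext fun m => toCoord_fromCoord hx (v m))

/-- The differential of the configuration component in coordinates. -/
theorem hasFDerivAt_coordQ {ψ : ∀ x : X, PhaseFiber n EG G F Q x} {x : X}
    (hψ : MDifferentiableAt 𝓘(ℝ, BaseModel n) 𝓘(ℝ, F) (fun y => (ψ y).q) x)
    {i : X} (hx : x ∈ (chartAt (BaseModel n) i).source) {k : Q}
    (hk : (ψ x).q ∈ (chartAt F k).source) :
    HasFDerivAt (coordQ i k ψ) ((tangentCoordChange 𝓘(ℝ, F) (ψ x).q k (ψ x).q : F →L[ℝ] F) ∘L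
      (show BaseModel n →L[ℝ] F from dq ψ x ∘L fromCoord n i x))
      (extChartAt 𝓘(ℝ, BaseModel n) i x) :=
  hasFDerivAt_coord hψ hx hk

/-- The generator of the Lie algebra component in coordinates. -/
theorem infGenCoord_comp_coordS {ψ : ∀ x : X, PhaseFiber n EG G F Q x} {i x : X}
    (hx : x ∈ (chartAt (BaseModel n) i).source) {k : Q} (hk : (ψ x).q ∈ (chartAt F k).source) :
    infGenCoord EG G k (coordQ i k ψ (extChartAt 𝓘(ℝ, BaseModel n) i x)) ∘L
      coordS i ψ (extChartAt 𝓘(ℝ, BaseModel n) i x) =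
      (tangentCoordChange 𝓘(ℝ, F) (ψ x).q k (ψ x).q : F →L[ℝ] F) ∘L
      (show BaseModel n →L[ℝ] F from sigmaQ ψ x ∘L fromCoord n i x) := by
  rw [coordQ_extChartAt hx, coordS_extChartAt hx, infGenCoord_extChartAt hk]
  rfl

/-- The integrand `ℓ(σ) + ⟨w, dq - σ_Q⟩` in coordinates. -/
theorem volCoord_reducedForm (ℓ : Density n EG G X) {ψ : ∀ x : X, PhaseFiber n EG G F Q x} {x : X}
    (hψ : MDifferentiableAt 𝓘(ℝ, BaseModel n) 𝓘(ℝ, F) (fun y => (ψ y).q) x)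
    {i : X} (hx : x ∈ (chartAt (BaseModel n) i).source) {k : Q}
    (hk : (ψ x).q ∈ (chartAt F k).source) :
    volCoord i x (reducedForm ℓ ψ x) = localIntegrand (lagCoord i ℓ) (infGenCoord EG G k)
      (coordQ i k ψ) (coordS i ψ) (coordP i k ψ) (extChartAt 𝓘(ℝ, BaseModel n) i x) := by
  rw [localIntegrand, infGenCoord_comp_coordS hx hk, (hasFDerivAt_coordQ hψ hx hk).fderiv,
    coordS_extChartAt hx, coordP_extChartAt hx, lagCoord_extChartAt hx,
    lieFormOfCoord_lieFormCoord hx, map_sub, momentumCoord_apply hx hk, momentumCoord_apply hx hk,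
    reducedForm, map_add, map_sub, map_sub]

/-! ### Smoothness -/

theorem contDiffAt_of_contMDiffAt_prod {E₁ E₂ W : Type*} [NormedAddCommGroup E₁] [NormedSpace ℝ E₁]
    [NormedAddCommGroup E₂] [NormedSpace ℝ E₂] [NormedAddCommGroup W] [NormedSpace ℝ W]
    {g : E₁ × E₂ → W} {p : E₁ × E₂}
    (h : ContMDiffAt (𝓘(ℝ, E₁).prod 𝓘(ℝ, E₂)) 𝓘(ℝ, W) ∞ g p) : ContDiffAt ℝ ∞ g p := by
  rw [← contMDiffAt_iff_contDiffAt, modelWithCornersSelf_prod, ← chartedSpaceSelf_prod]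
  exact h

theorem contMDiffAt_extChartAt_symm {E M : Type*} [NormedAddCommGroup E] [NormedSpace ℝ E]
    [TopologicalSpace M] [ChartedSpace E M] [IsManifold 𝓘(ℝ, E) ∞ M] {j x : M}
    (hx : x ∈ (chartAt E j).source) :
    ContMDiffAt 𝓘(ℝ, E) 𝓘(ℝ, E) ∞ (extChartAt 𝓘(ℝ, E) j).symm (extChartAt 𝓘(ℝ, E) j x) :=
  (contMDiffOn_extChartAt_symm j).contMDiffAt ((isOpen_extChartAt_target j).mem_nhds
    ((extChartAt 𝓘(ℝ, E) j).map_source (by simpa using hx)))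

theorem contMDiffAt_coord_family {W : Type*} [NormedAddCommGroup W] [NormedSpace ℝ W]
    {f : ℝ × X → W} {ε : ℝ} {i x : X} (hx : x ∈ (chartAt (BaseModel n) i).source)
    (hf : ContMDiffAt (𝓘(ℝ, ℝ).prod 𝓘(ℝ, BaseModel n)) 𝓘(ℝ, W) ∞ f (ε, x)) :
    ContDiffAt ℝ ∞ (fun p : ℝ × BaseModel n =>
      f (p.1, (extChartAt 𝓘(ℝ, BaseModel n) i).symm p.2)) (ε, extChartAt 𝓘(ℝ, BaseModel n) i x) := by
  have h2 : ContMDiffAt (𝓘(ℝ, ℝ).prod 𝓘(ℝ, BaseModel n)) (𝓘(ℝ, ℝ).prod 𝓘(ℝ, BaseModel n)) ∞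
      (fun p : ℝ × BaseModel n => (p.1, (extChartAt 𝓘(ℝ, BaseModel n) i).symm p.2))
      (ε, extChartAt 𝓘(ℝ, BaseModel n) i x) :=
    contMDiffAt_fst.prodMk ((contMDiffAt_extChartAt_symm hx).comp
      (ε, extChartAt 𝓘(ℝ, BaseModel n) i x) contMDiffAt_snd)
  have h3 : ContMDiffAt (𝓘(ℝ, ℝ).prod 𝓘(ℝ, BaseModel n)) 𝓘(ℝ, W) ∞ (fun p : ℝ × BaseModel n =>
      f (p.1, (extChartAt 𝓘(ℝ, BaseModel n) i).symm p.2)) (ε, extChartAt 𝓘(ℝ, BaseModel n) i x) :=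
    ContMDiffAt.comp (g := f) _ (by simpa only [extChartAt_symm_apply hx] using hf) h2
  exact contDiffAt_of_contMDiffAt_prod h3

variable {Ψ : ℝ → ∀ x : X, PhaseFiber n EG G F Q x} {W : Set (ℝ × X)} {ε : ℝ} {x i : X} {k : Q}

theorem SmoothFamilyOn.contMDiffAt_q (hΨ : SmoothFamilyOn Ψ W) (hW : IsOpen W) (h : (ε, x) ∈ W) :
    ContMDiffAt (𝓘(ℝ, ℝ).prod 𝓘(ℝ, BaseModel n)) 𝓘(ℝ, F) ∞ (fun p : ℝ × X => (Ψ p.1 p.2).q)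
      (ε, x) :=
  hΨ.q.contMDiffAt (hW.mem_nhds h)

theorem SmoothFamilyOn.contDiffAt_coordQ (hΨ : SmoothFamilyOn Ψ W) (hW : IsOpen W)
    (h : (ε, x) ∈ W) (hx : x ∈ (chartAt (BaseModel n) i).source)
    (hk : (Ψ ε x).q ∈ (chartAt F k).source) :
    ContDiffAt ℝ ∞ (fun p : ℝ × BaseModel n => coordQ i k (Ψ p.1) p.2)
      (ε, extChartAt 𝓘(ℝ, BaseModel n) i x) := by
  refine contMDiffAt_coord_family hx (f := fun p => extChartAt 𝓘(ℝ, F) k (Ψ p.1 p.2).q) ?_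
  exact (contMDiffAt_extChartAt' (x := k) (x' := (Ψ ε x).q) hk).comp (ε, x)
    (hΨ.contMDiffAt_q hW h)

theorem SmoothFamilyOn.contDiffAt_coordS (hΨ : SmoothFamilyOn Ψ W) (hW : IsOpen W)
    (h : (ε, x) ∈ W) (hx : x ∈ (chartAt (BaseModel n) i).source) :
    ContDiffAt ℝ ∞ (fun p : ℝ × BaseModel n => coordS i (Ψ p.1) p.2)
      (ε, extChartAt 𝓘(ℝ, BaseModel n) i x) := by
  refine contMDiffAt_coord_family hx (f := fun p => lieFormCoord i p.2 (Ψ p.1 p.2).σ) ?_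
  refine (hΨ.σ i).contMDiffAt (inter_mem (hW.mem_nhds h) ?_)
  exact continuousAt_snd.preimage_mem_nhds ((chartAt (BaseModel n) i).open_source.mem_nhds hx)

theorem SmoothFamilyOn.contDiffAt_coordP (hΨ : SmoothFamilyOn Ψ W) (hW : IsOpen W)
    (h : (ε, x) ∈ W) (hx : x ∈ (chartAt (BaseModel n) i).source)
    (hk : (Ψ ε x).q ∈ (chartAt F k).source) :
    ContDiffAt ℝ ∞ (fun p : ℝ × BaseModel n => coordP i k (Ψ p.1) p.2)
      (ε, extChartAt 𝓘(ℝ, BaseModel n) i x) := by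
  refine contMDiffAt_coord_family hx
    (f := fun p => momentumCoord i p.2 k (Ψ p.1 p.2).q (Ψ p.1 p.2).mom) ?_
  refine (hΨ.mom i k).contMDiffAt (inter_mem (hW.mem_nhds h) (inter_mem ?_ ?_))
  · exact continuousAt_snd.preimage_mem_nhds ((chartAt (BaseModel n) i).open_source.mem_nhds hx)
  · exact (hΨ.contMDiffAt_q hW h).continuousAt.preimage_mem_nhds
      ((chartAt F k).open_source.mem_nhds hk)

theorem SmoothFamilyOn.mdifferentiableAt_q (hΨ : SmoothFamilyOn Ψ W) (hW : IsOpen W)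
    (h : (ε, x) ∈ W) :
    MDifferentiableAt 𝓘(ℝ, BaseModel n) 𝓘(ℝ, F) (fun y => (Ψ ε y).q) x := by
  have h1 : ContMDiffAt 𝓘(ℝ, BaseModel n) (𝓘(ℝ, ℝ).prod 𝓘(ℝ, BaseModel n)) ∞
      (fun y : X => (ε, y)) x := contMDiffAt_const.prodMk contMDiffAt_id
  exact ((hΨ.contMDiffAt_q hW h).comp x h1).mdifferentiableAt (by simp)

theorem contDiffAt_lagCoord {ℓ : Density n EG G X} (hℓ : ℓ.IsSmooth)
    (hx : x ∈ (chartAt (BaseModel n) i).source) (S : BaseModel n →L[ℝ] EG) :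
    ContDiffAt ℝ ∞ (lagCoord i ℓ) (extChartAt 𝓘(ℝ, BaseModel n) i x, S) := by
  have h2 : ContMDiffAt (𝓘(ℝ, BaseModel n).prod 𝓘(ℝ, BaseModel n →L[ℝ] EG))
      (𝓘(ℝ, BaseModel n).prod 𝓘(ℝ, BaseModel n →L[ℝ] EG)) ∞
      (fun p : BaseModel n × (BaseModel n →L[ℝ] EG) =>
        ((extChartAt 𝓘(ℝ, BaseModel n) i).symm p.1, p.2))
      (extChartAt 𝓘(ℝ, BaseModel n) i x, S) :=
    ((contMDiffAt_extChartAt_symm hx).comp (extChartAt 𝓘(ℝ, BaseModel n) i x, S)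
      contMDiffAt_fst).prodMk contMDiffAt_snd
  set f : X × (BaseModel n →L[ℝ] EG) → (BaseModel n) [⋀^Fin (n + 1)]→L[ℝ] ℝ :=
    fun p => volCoord i p.1 (ℓ p.1 (lieFormOfCoord i p.1 p.2)) with hf
  have h3 : ContMDiffAt (𝓘(ℝ, BaseModel n).prod 𝓘(ℝ, BaseModel n →L[ℝ] EG))
      𝓘(ℝ, (BaseModel n) [⋀^Fin (n + 1)]→L[ℝ] ℝ) ∞ f (x, S) := (hℓ i).contMDiffAt
    (((chartAt (BaseModel n) i).open_source.prod isOpen_univ).mem_nhds ⟨hx, mem_univ _⟩)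
  have h5 : lagCoord i ℓ = fun p => f ((extChartAt 𝓘(ℝ, BaseModel n) i).symm p.1, p.2) := by
    funext p; rfl
  clear_value f
  rw [h5]
  have h4 : ContMDiffAt (𝓘(ℝ, BaseModel n).prod 𝓘(ℝ, BaseModel n →L[ℝ] EG))
      𝓘(ℝ, (BaseModel n) [⋀^Fin (n + 1)]→L[ℝ] ℝ) ∞
      (fun p : BaseModel n × (BaseModel n →L[ℝ] EG) =>
        f ((extChartAt 𝓘(ℝ, BaseModel n) i).symm p.1, p.2))
      (extChartAt 𝓘(ℝ, BaseModel n) i x, S) :=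
    ContMDiffAt.comp (g := f) _ (by simpa only [extChartAt_symm_apply hx] using h3) h2
  exact contDiffAt_of_contMDiffAt_prod h4

variable (EG G) in
/-- The action in the charts at `1` and `k`. -/
noncomputable def actionCoord (k : Q) (p : EG × F) : F :=
  extChartAt 𝓘(ℝ, F) k
    ((extChartAt 𝓘(ℝ, EG) (1 : G)).symm p.1 • (extChartAt 𝓘(ℝ, F) k).symm p.2)

theorem contDiffAt_actionCoord
    (hact : ContMDiff (𝓘(ℝ, EG).prod 𝓘(ℝ, F)) 𝓘(ℝ, F) ∞ (fun p : G × Q => p.1 • p.2))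
    {r : Q} (hr : r ∈ (chartAt F k).source) :
    ContDiffAt ℝ ∞ (actionCoord EG G k)
      (extChartAt 𝓘(ℝ, EG) (1 : G) 1, extChartAt 𝓘(ℝ, F) k r) := by
  set g₀ : EG := extChartAt 𝓘(ℝ, EG) (1 : G) 1 with hg₀
  have hs1 : ContMDiffAt 𝓘(ℝ, EG) 𝓘(ℝ, EG) ∞ (extChartAt 𝓘(ℝ, EG) (1 : G)).symm g₀ :=
    contMDiffAt_extChartAt_symm (mem_chart_source EG (1 : G))
  have hs2 : ContMDiffAt 𝓘(ℝ, F) 𝓘(ℝ, F) ∞ (extChartAt 𝓘(ℝ, F) k).symm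
      (extChartAt 𝓘(ℝ, F) k r) := contMDiffAt_extChartAt_symm hr
  have h2 : ContMDiffAt (𝓘(ℝ, EG).prod 𝓘(ℝ, F)) (𝓘(ℝ, EG).prod 𝓘(ℝ, F)) ∞
      (fun p : EG × F => ((extChartAt 𝓘(ℝ, EG) (1 : G)).symm p.1,
        (extChartAt 𝓘(ℝ, F) k).symm p.2)) (g₀, extChartAt 𝓘(ℝ, F) k r) :=
    (hs1.comp (g₀, extChartAt 𝓘(ℝ, F) k r) contMDiffAt_fst).prodMk
      (hs2.comp (g₀, extChartAt 𝓘(ℝ, F) k r) contMDiffAt_snd)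
  have h3 : ContMDiffAt (𝓘(ℝ, EG).prod 𝓘(ℝ, F)) 𝓘(ℝ, F) ∞ (fun p : EG × F =>
      (extChartAt 𝓘(ℝ, EG) (1 : G)).symm p.1 • (extChartAt 𝓘(ℝ, F) k).symm p.2)
      (g₀, extChartAt 𝓘(ℝ, F) k r) := hact.contMDiffAt.comp _ h2
  have h4 : ContMDiffAt (𝓘(ℝ, EG).prod 𝓘(ℝ, F)) 𝓘(ℝ, F) ∞ (actionCoord EG G k)
      (g₀, extChartAt 𝓘(ℝ, F) k r) := by
    refine ContMDiffAt.comp (g := extChartAt 𝓘(ℝ, F) k) _ (contMDiffAt_extChartAt' ?_) h3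
    simp only [hg₀, extChartAt_to_inv, one_smul, extChartAt_symm_extChartAt hr]
    exact hr
  exact contDiffAt_of_contMDiffAt_prod h4

/-- A generator is the velocity of an orbit at the identity, hence the partial derivative of the
action in the group variable. Smoothness of the action thereby gives smooth dependence of the
generators on the point. -/
theorem infGenCoord_eq_fderiv
    (hact : ContMDiff (𝓘(ℝ, EG).prod 𝓘(ℝ, F)) 𝓘(ℝ, F) ∞ (fun p : G × Q => p.1 • p.2))
    {r : Q} (hr : r ∈ (chartAt F k).source) :
    infGenCoord EG G k (extChartAt 𝓘(ℝ, F) k r) =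
      fderiv ℝ (actionCoord EG G k) (extChartAt 𝓘(ℝ, EG) (1 : G) 1, extChartAt 𝓘(ℝ, F) k r) ∘L
        ContinuousLinearMap.inl ℝ EG F := by
  set g₀ : EG := extChartAt 𝓘(ℝ, EG) (1 : G) 1 with hg₀
  have h6 : HasFDerivAt (fun g => actionCoord EG G k (g, extChartAt 𝓘(ℝ, F) k r))
      (fderiv ℝ (actionCoord EG G k) (g₀, extChartAt 𝓘(ℝ, F) k r) ∘L
        ContinuousLinearMap.inl ℝ EG F) g₀ :=
    HasFDerivAt.comp (g := actionCoord EG G k) g₀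
      ((contDiffAt_actionCoord hact hr).differentiableAt (by simp)).hasFDerivAt
      (hasFDerivAt_prodMk_left g₀ _)
  have horb : MDifferentiableAt 𝓘(ℝ, EG) 𝓘(ℝ, F) (fun g : G => g • r) 1 := by
    have h7 : ContMDiffAt 𝓘(ℝ, EG) (𝓘(ℝ, EG).prod 𝓘(ℝ, F)) ∞ (fun g : G => (g, r)) 1 :=
      contMDiffAt_id.prodMk contMDiffAt_const
    exact ((hact.contMDiffAt (x := ((1 : G), r))).comp (1 : G) h7).mdifferentiableAt (by simp)
  have h8 := hasFDerivAt_coord horb (j := (1 : G)) (k := k) (mem_chart_source EG (1 : G))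
    (by simpa using hr)
  have h9 : (extChartAt 𝓘(ℝ, F) k ∘ (fun g : G => g • r) ∘ (extChartAt 𝓘(ℝ, EG) (1 : G)).symm) =
      fun g => actionCoord EG G k (g, extChartAt 𝓘(ℝ, F) k r) := by
    funext g
    simp only [actionCoord, Function.comp_apply, extChartAt_symm_extChartAt hr]
  rw [h9] at h8
  rw [infGenCoord_extChartAt hr, ← h8.unique h6,
    tangentCoordChange_self_clm (mem_chart_source EG (1 : G)), infGen]
  simp only [one_smul]
  rfl

theorem infGenCoord_eventuallyEq
    (hact : ContMDiff (𝓘(ℝ, EG).prod 𝓘(ℝ, F)) 𝓘(ℝ, F) ∞ (fun p : G × Q => p.1 • p.2))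
    {q : Q} (hq : q ∈ (chartAt F k).source) :
    infGenCoord EG G k =ᶠ[𝓝 (extChartAt 𝓘(ℝ, F) k q)] fun a =>
      fderiv ℝ (actionCoord EG G k) (extChartAt 𝓘(ℝ, EG) (1 : G) 1, a) ∘L
        ContinuousLinearMap.inl ℝ EG F := by
  filter_upwards [(isOpen_extChartAt_target (I := 𝓘(ℝ, F)) k).mem_nhds
    ((extChartAt 𝓘(ℝ, F) k).map_source (by simpa using hq))] with a ha
  obtain ⟨r, hr, rfl⟩ : ∃ r ∈ (chartAt F k).source, extChartAt 𝓘(ℝ, F) k r = a :=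
    ⟨_, by simpa using (extChartAt 𝓘(ℝ, F) k).map_target ha,
      (extChartAt 𝓘(ℝ, F) k).right_inv ha⟩
  exact infGenCoord_eq_fderiv hact hr

/-- The infinitesimal generator depends smoothly on the point. -/
theorem contDiffAt_infGenCoord
    (hact : ContMDiff (𝓘(ℝ, EG).prod 𝓘(ℝ, F)) 𝓘(ℝ, F) ∞ (fun p : G × Q => p.1 • p.2))
    {q : Q} (hq : q ∈ (chartAt F k).source) :
    ContDiffAt ℝ ∞ (infGenCoord EG G k) (extChartAt 𝓘(ℝ, F) k q) := by
  refine ContDiffAt.congr_of_eventuallyEq ?_ (infGenCoord_eventuallyEq hact hq)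
  have h4 : ContDiffAt ℝ ∞ (fderiv ℝ (actionCoord EG G k))
      (extChartAt 𝓘(ℝ, EG) (1 : G) 1, extChartAt 𝓘(ℝ, F) k q) :=
    (contDiffAt_actionCoord hact hq).fderiv_right (by simp)
  have h5 : ContDiffAt ℝ ∞ (fun a : F => (extChartAt 𝓘(ℝ, EG) (1 : G) 1, a))
      (extChartAt 𝓘(ℝ, F) k q) := contDiffAt_const.prodMk contDiffAt_id
  exact (ContDiffAt.comp (g := fderiv ℝ (actionCoord EG G k)) _ h4 h5).clm_comp contDiffAt_const

end Coordinates

end CovariantClebsch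

namespace CovariantClebsch

open Filter Set

/-! ### The element `e(ω, σ)`: its value on a graph and its behaviour under linear changes. -/

section ClebschAlgebra

variable {n : ℕ} {K V : Type*} [NormedAddCommGroup K] [NormedSpace ℝ K]
  [NormedAddCommGroup V] [NormedSpace ℝ V]

/-- The contraction does not depend on the choice of coordinates. -/
theorem contract_naturality {V' : Type*} [NormedAddCommGroup V'] [NormedSpace ℝ V']
    (ν : (BaseModel n →L[ℝ] V) →L[ℝ] (BaseModel n) [⋀^Fin (n + 1)]→L[ℝ] ℝ)
    {C C' : BaseModel n →L[ℝ] BaseModel n} (hC : ∀ v, C (C' v) = v) (D : V' →L[ℝ] V) (v : V') :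
    (contract ν (D v)).compContinuousLinearMap C =
      contract (ContinuousAlternatingMap.compContinuousLinearMapCLM C ∘L ν ∘L
        (ContinuousLinearMap.precomp V C') ∘L (D.postcomp (BaseModel n))) v := by
  rw [contract_apply, contract_apply]
  -- The standard basis is expanded in the transported vectors `C e_l`. The transported covectors in
  -- `h2` have the same coefficients, so the contracted sums agree.
  have h1 : ∀ μ, stdVec n μ = ∑ l, stdCovec n l (C' (stdVec n μ)) • C (stdVec n l) := fun μ => by
    conv_lhs => rw [← hC (stdVec n μ), ← sum_stdCovec_smul_stdVec (C' (stdVec n μ))]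
    rw [map_sum]
    exact Finset.sum_congr rfl fun l _ => map_smul _ _ _
  have h2 : ∀ l, ((D.postcomp (BaseModel n)) ((stdCovec n l).smulRight v)) ∘L C' =
      ∑ μ, stdCovec n l (C' (stdVec n μ)) • (stdCovec n μ).smulRight (D v) := fun l => by
    rw [← sum_smulRight_stdCovec (((D.postcomp (BaseModel n)) ((stdCovec n l).smulRight v)) ∘L C')]
    refine Finset.sum_congr rfl fun μ _ => ?_
    ext u
    simp [smul_smul, mul_comm]
  ext m
  have e1 : (∑ μ, (ν ((stdCovec n μ).smulRight (D v))).curryLeft (stdVec n μ)).compContinuousLinearMap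
      C m = ∑ μ, ν ((stdCovec n μ).smulRight (D v)) (Matrix.vecCons (stdVec n μ) (C ∘ m)) := by
    simp [ContinuousAlternatingMap.sum_apply]
  have e2 : ∀ l, ((ContinuousAlternatingMap.compContinuousLinearMapCLM C ∘L ν ∘L
        (ContinuousLinearMap.precomp V C') ∘L (D.postcomp (BaseModel n)))
          ((stdCovec n l).smulRight v)).curryLeft (stdVec n l) m =
      ∑ μ, stdCovec n l (C' (stdVec n μ)) *
        ν ((stdCovec n μ).smulRight (D v)) (Matrix.vecCons (C (stdVec n l)) (C ∘ m)) := by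
    intro l
    have e3 : ((ContinuousAlternatingMap.compContinuousLinearMapCLM C ∘L ν ∘L
        (ContinuousLinearMap.precomp V C') ∘L (D.postcomp (BaseModel n)))
          ((stdCovec n l).smulRight v)).curryLeft (stdVec n l) m =
        ν (((D.postcomp (BaseModel n)) ((stdCovec n l).smulRight v)) ∘L C')
          (C ∘ Matrix.vecCons (stdVec n l) m) := rfl
    have e4 : C ∘ Matrix.vecCons (stdVec n l) m = Matrix.vecCons (C (stdVec n l)) (C ∘ m) := by
      funext j
      refine Fin.cases ?_ (fun j => ?_) j <;> rfl
    rw [e3, e4, h2, map_sum, ContinuousAlternatingMap.sum_apply]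
    refine Finset.sum_congr rfl fun μ _ => ?_
    rw [map_smul]
    rfl
  rw [e1, ContinuousAlternatingMap.sum_apply, Finset.sum_congr rfl fun l _ => e2 l,
    Finset.sum_comm]
  refine Finset.sum_congr rfl fun μ _ => ?_
  have h3 := congrArg (fun u => (ν ((stdCovec n μ).smulRight (D v))).curryLeft u (C ∘ m)) (h1 μ)
  simp only [map_sum, map_smul, ContinuousAlternatingMap.sum_apply,
    ContinuousAlternatingMap.smul_apply, smul_eq_mul] at h3
  exact h3

/-- The value of `e` in terms of the components of its argument. -/
noncomputable def clebschElement
    (P : (BaseModel n →L[ℝ] V) →L[ℝ] (BaseModel n) [⋀^Fin (n + 1)]→L[ℝ] ℝ)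
    (S : BaseModel n →L[ℝ] K) (A : K →L[ℝ] V) (l : (BaseModel n) [⋀^Fin (n + 1)]→L[ℝ] ℝ) :
    (BaseModel n × V) [⋀^Fin (n + 1)]→L[ℝ] ℝ :=
  wedgeContract (ContinuousLinearMap.snd ℝ (BaseModel n) V)
      (ContinuousAlternatingMap.compContinuousLinearMapCLM
        (ContinuousLinearMap.fst ℝ (BaseModel n) V) ∘L contract P) -
    wedgeContract (S ∘L ContinuousLinearMap.fst ℝ (BaseModel n) V)
      ((wedgeContract (ContinuousLinearMap.snd ℝ (BaseModel n) V)
        (ContinuousAlternatingMap.compContinuousLinearMapCLM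
          (ContinuousLinearMap.fst ℝ (BaseModel n) V) ∘L contract P)).curryLeft ∘L
        ContinuousLinearMap.inr ℝ (BaseModel n) V ∘L A) +
    l.compContinuousLinearMap (ContinuousLinearMap.fst ℝ (BaseModel n) V)

/-- The interior product of `s^γ(ω)` with a vertical vector removes its only vertical factor. So
`𝒥(s^γ(ω))`, and hence `σ ∧ 𝒥(s^γ(ω))`, is pulled back from the base. -/
theorem lift_comp_inr
    (P : (BaseModel n →L[ℝ] V) →L[ℝ] (BaseModel n) [⋀^Fin (n + 1)]→L[ℝ] ℝ) (A : K →L[ℝ] V) :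
    (wedgeContract (ContinuousLinearMap.snd ℝ (BaseModel n) V)
        (ContinuousAlternatingMap.compContinuousLinearMapCLM
          (ContinuousLinearMap.fst ℝ (BaseModel n) V) ∘L contract P)).curryLeft ∘L
        ContinuousLinearMap.inr ℝ (BaseModel n) V ∘L A =
      ContinuousAlternatingMap.compContinuousLinearMapCLM
        (ContinuousLinearMap.fst ℝ (BaseModel n) V) ∘L contract P ∘L A :=
  ContinuousLinearMap.ext fun ξ => lift_curryLeft_inr P (A ξ)

/-- On a graph all three terms of `e` become top-degree forms on the base. In the first two the
wedge undoes the contraction, leaving `P(B)` and `P(A ∘ S)`. With `B = dq` this is the integrand of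
the reduced principle. -/
theorem clebschElement_comp_graphMap
    (P : (BaseModel n →L[ℝ] V) →L[ℝ] (BaseModel n) [⋀^Fin (n + 1)]→L[ℝ] ℝ)
    (S : BaseModel n →L[ℝ] K) (A : K →L[ℝ] V) (l : (BaseModel n) [⋀^Fin (n + 1)]→L[ℝ] ℝ)
    (B : BaseModel n →L[ℝ] V) :
    (clebschElement P S A l).compContinuousLinearMap (graphMap B) = l + P (B - A ∘L S) := by
  have h1 := lift_comp_graphMap P B
  have h2 : (wedgeContract (S ∘L ContinuousLinearMap.fst ℝ (BaseModel n) V)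
      (ContinuousAlternatingMap.compContinuousLinearMapCLM
        (ContinuousLinearMap.fst ℝ (BaseModel n) V) ∘L contract P ∘L A)).compContinuousLinearMap
        (graphMap B) = P (A ∘L S) := by
    rw [wedgeContract_comp, ← wedgeContract_contract P (A ∘L S)]
    rfl
  rw [clebschElement, lift_comp_inr, map_sub, ← h1, ← h2]
  ext v
  simp only [ContinuousAlternatingMap.add_apply, ContinuousAlternatingMap.sub_apply,
    ContinuousAlternatingMap.compContinuousLinearMap_apply]
  have : l ((ContinuousLinearMap.fst ℝ (BaseModel n) V) ∘ (graphMap B) ∘ v) = l v := rfl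
  rw [this]
  abel

/-- Every operation in `e` commutes with product changes of coordinates. Since form bundles are
trivialised by pull-back, this identifies the fibre coordinate of `e ∘ ψ` with `e` evaluated on the
coordinates of `ψ`. -/
theorem clebschElement_naturality {V' : Type*} [NormedAddCommGroup V'] [NormedSpace ℝ V']
    (P : (BaseModel n →L[ℝ] V) →L[ℝ] (BaseModel n) [⋀^Fin (n + 1)]→L[ℝ] ℝ)
    (S : BaseModel n →L[ℝ] K) (A : K →L[ℝ] V') (l : (BaseModel n) [⋀^Fin (n + 1)]→L[ℝ] ℝ)
    {C C' : BaseModel n →L[ℝ] BaseModel n} (hC : ∀ v, C (C' v) = v) (D : V' →L[ℝ] V) :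
    (clebschElement P S (D ∘L A) l).compContinuousLinearMap (C.prodMap D) =
      clebschElement (ContinuousAlternatingMap.compContinuousLinearMapCLM C ∘L P ∘L
        (ContinuousLinearMap.precomp V C') ∘L (D.postcomp (BaseModel n))) (S ∘L C) A
        (l.compContinuousLinearMap C) := by
  have h0 : ContinuousAlternatingMap.compContinuousLinearMapCLM (C.prodMap D) ∘L
      ContinuousAlternatingMap.compContinuousLinearMapCLM
        (ContinuousLinearMap.fst ℝ (BaseModel n) V) ∘L contract P ∘L D =
      ContinuousAlternatingMap.compContinuousLinearMapCLM
        (ContinuousLinearMap.fst ℝ (BaseModel n) V') ∘L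
        contract (ContinuousAlternatingMap.compContinuousLinearMapCLM C ∘L P ∘L
        (ContinuousLinearMap.precomp V C') ∘L (D.postcomp (BaseModel n))) := by
    refine ContinuousLinearMap.ext fun v => ?_
    refine Eq.trans ?_ (congrArg (ContinuousAlternatingMap.compContinuousLinearMapCLM
        (ContinuousLinearMap.fst ℝ (BaseModel n) V')) (contract_naturality P hC D v))
    rfl
  have h1 := wedgeContract_comp (ContinuousLinearMap.snd ℝ (BaseModel n) V)
      (ContinuousAlternatingMap.compContinuousLinearMapCLM
        (ContinuousLinearMap.fst ℝ (BaseModel n) V) ∘L contract P) (C.prodMap D)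
  have h2 := wedgeContract_comp (S ∘L ContinuousLinearMap.fst ℝ (BaseModel n) V)
      (ContinuousAlternatingMap.compContinuousLinearMapCLM
        (ContinuousLinearMap.fst ℝ (BaseModel n) V) ∘L contract P ∘L D ∘L A) (C.prodMap D)
  have h3 : wedgeContract (ContinuousLinearMap.snd ℝ (BaseModel n) V ∘L C.prodMap D)
      (ContinuousAlternatingMap.compContinuousLinearMapCLM (C.prodMap D) ∘L
      (ContinuousAlternatingMap.compContinuousLinearMapCLM
        (ContinuousLinearMap.fst ℝ (BaseModel n) V) ∘L contract P)) =
      wedgeContract (ContinuousLinearMap.snd ℝ (BaseModel n) V')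
      (ContinuousAlternatingMap.compContinuousLinearMapCLM (C.prodMap D) ∘L
      ContinuousAlternatingMap.compContinuousLinearMapCLM
        (ContinuousLinearMap.fst ℝ (BaseModel n) V) ∘L contract P ∘L D) := rfl
  have h4 : ContinuousAlternatingMap.compContinuousLinearMapCLM (C.prodMap D) ∘L
      (ContinuousAlternatingMap.compContinuousLinearMapCLM
        (ContinuousLinearMap.fst ℝ (BaseModel n) V) ∘L contract P ∘L D ∘L A) =
      (ContinuousAlternatingMap.compContinuousLinearMapCLM (C.prodMap D) ∘L
      ContinuousAlternatingMap.compContinuousLinearMapCLM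
        (ContinuousLinearMap.fst ℝ (BaseModel n) V) ∘L contract P ∘L D) ∘L A := rfl
  rw [h3, h0] at h1
  rw [h4, h0] at h2
  rw [clebschElement, lift_comp_inr, clebschElement, lift_comp_inr, ← h1]
  refine Eq.trans ?_ (congrArg (fun T => _ - T + _) h2)
  rfl

variable {E : Type*} [NormedAddCommGroup E] [NormedSpace ℝ E]

theorem contDiffAt_alternatize {k : ℕ} {W : Type*} [NormedAddCommGroup W] [NormedSpace ℝ W]
    {f : E → W →L[ℝ] W [⋀^Fin k]→L[ℝ] ℝ} {y : E} (hf : ContDiffAt ℝ ∞ f y) :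
    ContDiffAt ℝ ∞ (fun z => ContinuousAlternatingMap.alternatizeUncurryFin (f z)) y :=
  ContDiffAt.comp (g := ContinuousAlternatingMap.alternatizeUncurryFinCLM ℝ W ℝ (n := k)) y
    (ContinuousLinearMap.contDiff _).contDiffAt hf

/-- After `lift_comp_inr` no interior product of a wedge remains: the data enter only through
compositions and fixed continuous linear operations, from which smoothness can be read off. -/
theorem clebschElement_eq
    (P : (BaseModel n →L[ℝ] V) →L[ℝ] (BaseModel n) [⋀^Fin (n + 1)]→L[ℝ] ℝ)
    (S : BaseModel n →L[ℝ] K) (A : K →L[ℝ] V) (l : (BaseModel n) [⋀^Fin (n + 1)]→L[ℝ] ℝ) :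
    clebschElement P S A l = ContinuousAlternatingMap.alternatizeUncurryFin
      ((ContinuousAlternatingMap.compContinuousLinearMapCLM
        (ContinuousLinearMap.fst ℝ (BaseModel n) V) ∘L contract P) ∘L
        ContinuousLinearMap.snd ℝ (BaseModel n) V) -
      ContinuousAlternatingMap.alternatizeUncurryFin
      ((ContinuousAlternatingMap.compContinuousLinearMapCLM
        (ContinuousLinearMap.fst ℝ (BaseModel n) V) ∘L contract P) ∘L A ∘L S ∘L
        ContinuousLinearMap.fst ℝ (BaseModel n) V) +
      ContinuousAlternatingMap.compContinuousLinearMapCLM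
        (ContinuousLinearMap.fst ℝ (BaseModel n) V) l := by
  rw [clebschElement, lift_comp_inr]
  rfl

theorem contDiffAt_clebschElement
    {P : E → (BaseModel n →L[ℝ] V) →L[ℝ] (BaseModel n) [⋀^Fin (n + 1)]→L[ℝ] ℝ}
    {S : E → BaseModel n →L[ℝ] K} {A : E → K →L[ℝ] V}
    {l : E → (BaseModel n) [⋀^Fin (n + 1)]→L[ℝ] ℝ} {y : E}
    (hP : ContDiffAt ℝ ∞ P y) (hS : ContDiffAt ℝ ∞ S y) (hA : ContDiffAt ℝ ∞ A y)
    (hl : ContDiffAt ℝ ∞ l y) :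
    ContDiffAt ℝ ∞ (fun z => clebschElement (P z) (S z) (A z) (l z)) y := by
  have hc : ContDiffAt ℝ ∞ (fun z => contract (P z)) y := by
    unfold contract
    refine ContDiffAt.sum fun μ _ => ?_
    have h0 := hP.clm_comp
      (contDiffAt_const (c := ContinuousLinearMap.smulRightL ℝ (BaseModel n) V (stdCovec n μ)))
    have h0' := (contDiffAt_const (c := (ContinuousLinearMap.apply ℝ
      ((BaseModel n) [⋀^Fin n]→L[ℝ] ℝ) (stdVec n μ)) ∘L (ContinuousAlternatingMap.curryLeftLI
      (𝕜 := ℝ) (E := BaseModel n) (F := ℝ) (n := n)).toContinuousLinearMap)).clm_comp h0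
    exact h0'
  have h1 : ContDiffAt ℝ ∞ (fun z => (ContinuousAlternatingMap.compContinuousLinearMapCLM
        (ContinuousLinearMap.fst ℝ (BaseModel n) V) :
        ((BaseModel n) [⋀^Fin n]→L[ℝ] ℝ) →L[ℝ] (BaseModel n × V) [⋀^Fin n]→L[ℝ] ℝ) ∘L
          contract (P z)) y :=
    contDiffAt_const.clm_comp hc
  simp only [clebschElement_eq]
  refine ((contDiffAt_alternatize (h1.clm_comp contDiffAt_const)).sub
    (contDiffAt_alternatize (h1.clm_comp (hA.clm_comp (hS.clm_comp contDiffAt_const))))).add ?_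
  exact ContDiffAt.comp (g := ContinuousAlternatingMap.compContinuousLinearMapCLM
      (ContinuousLinearMap.fst ℝ (BaseModel n) V)) y (ContinuousLinearMap.contDiff _).contDiffAt hl

end ClebschAlgebra

/-! ### The pull-back of the canonical form along `e ∘ ψ`. -/

section ClebschForm

variable {n : ℕ}
  {EG : Type*} [NormedAddCommGroup EG] [NormedSpace ℝ EG] [FiniteDimensional ℝ EG]
  {G : Type*} [TopologicalSpace G] [ChartedSpace EG G] [Group G] [LieGroup 𝓘(ℝ, EG) ∞ G]
  {F : Type*} [NormedAddCommGroup F] [NormedSpace ℝ F] [FiniteDimensional ℝ F]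
  {Q : Type*} [TopologicalSpace Q] [ChartedSpace F Q] [IsManifold 𝓘(ℝ, F) ∞ Q] [MulAction G Q]
  {X : Type*} [TopologicalSpace X] [ChartedSpace (BaseModel n) X]
  [IsManifold 𝓘(ℝ, BaseModel n) ∞ X]

/-- Charts of a product are products of charts, so a transition map is a product map and its
derivative is block diagonal. -/
theorem tangentCoordChange_prod (y y' z : X × Q)
    (h1 : z.1 ∈ (chartAt (BaseModel n) y.1).source) (h1' : z.1 ∈ (chartAt (BaseModel n) y'.1).source)
    (h2 : z.2 ∈ (chartAt F y.2).source) (h2' : z.2 ∈ (chartAt F y'.2).source) :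
    (tangentCoordChange (modelY n F) y y' z : BaseModel n × F →L[ℝ] BaseModel n × F) =
      ContinuousLinearMap.prodMap
        (tangentCoordChange 𝓘(ℝ, BaseModel n) y.1 y'.1 z.1 : BaseModel n →L[ℝ] BaseModel n)
        (tangentCoordChange 𝓘(ℝ, F) y.2 y'.2 z.2 : F →L[ℝ] F) := by
  have h := hasFDerivWithinAt_tangentCoordChange (I := modelY n F) (x := y) (y := y') (z := z)
    (by simp only [extChartAt_source, prodChartedSpace_chartAt]; exact ⟨⟨h1, h2⟩, ⟨h1', h2'⟩⟩)
  have hr : range (modelY n F) = univ := by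
    rw [ModelWithCorners.range_eq_univ]
  rw [hr, hasFDerivWithinAt_univ] at h
  refine h.unique ?_
  exact HasFDerivAt.prodMap (extChartAt (modelY n F) y z)
    (hasFDerivAt_chart_transition h1 h1') (hasFDerivAt_chart_transition h2 h2')

variable {Ψ : ℝ → ∀ x : X, PhaseFiber n EG G F Q x} {W : Set (ℝ × X)} {ε : ℝ} {x : X}

/-- `clebschForm` uses `mfderiv` of `e ∘ ψ`, which is zero by default for a non-differentiable map;
the chain rule for the projection is available only after this check. It is made in the
trivialisation at `x`, where naturality turns the fibre part into a smooth function of the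
coordinates of `q`, `σ` and `ω`. -/
theorem SmoothFamilyOn.mdifferentiableAt_clebschSection
    (hact : ContMDiff (𝓘(ℝ, EG).prod 𝓘(ℝ, F)) 𝓘(ℝ, F) ∞ (fun p : G × Q => p.1 • p.2))
    {ℓ : Density n EG G X} (hℓ : ℓ.IsSmooth)
    (hΨ : SmoothFamilyOn Ψ W) (hW : IsOpen W) (h : (ε, x) ∈ W) :
    MDifferentiableAt 𝓘(ℝ, BaseModel n) ((modelY n F).prod 𝓘(ℝ, FormY n F))
      (clebschSection ℓ (Ψ ε)) x := by
  rw [mdifferentiableAt_totalSpace]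
  have hq := hΨ.mdifferentiableAt_q hW h
  refine ⟨mdifferentiableAt_id.prodMk hq, ?_⟩
  set ψ := Ψ ε
  set k := (ψ x).q with hk
  have hxs := mem_chart_source (BaseModel n) x
  have hks := mem_chart_source F k
  have hslice : ContDiffAt ℝ ∞ (fun z : BaseModel n => (ε, z)) (extChartAt 𝓘(ℝ, BaseModel n) x x) :=
    contDiffAt_const.prodMk contDiffAt_id
  have hQ : ContDiffAt ℝ ∞ (coordQ x k ψ) (extChartAt 𝓘(ℝ, BaseModel n) x x) :=
    (hΨ.contDiffAt_coordQ hW h hxs hks).comp _ hslice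
  have hS : ContDiffAt ℝ ∞ (coordS x ψ) (extChartAt 𝓘(ℝ, BaseModel n) x x) :=
    (hΨ.contDiffAt_coordS hW h hxs).comp _ hslice
  have hP : ContDiffAt ℝ ∞ (coordP x k ψ) (extChartAt 𝓘(ℝ, BaseModel n) x x) :=
    (hΨ.contDiffAt_coordP hW h hxs hks).comp _ hslice
  have hA : ContDiffAt ℝ ∞ (fun z => infGenCoord EG G k (coordQ x k ψ z))
      (extChartAt 𝓘(ℝ, BaseModel n) x x) := by
    refine ContDiffAt.comp (g := infGenCoord EG G k) _ ?_ hQ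
    rw [coordQ_extChartAt hxs]
    exact contDiffAt_infGenCoord hact hks
  have hL : ContDiffAt ℝ ∞ (fun z => lagCoord x ℓ (z, coordS x ψ z))
      (extChartAt 𝓘(ℝ, BaseModel n) x x) :=
    ContDiffAt.comp (g := lagCoord x ℓ) _ (contDiffAt_lagCoord hℓ hxs _)
      (contDiffAt_id.prodMk hS)
  have hZ := (contDiffAt_clebschElement hP hS hA hL).differentiableAt (by simp)
  have hM : MDifferentiableAt 𝓘(ℝ, BaseModel n) 𝓘(ℝ, FormY n F)
      ((fun z => clebschElement (coordP x k ψ z) (coordS x ψ z)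
        (infGenCoord EG G k (coordQ x k ψ z)) (lagCoord x ℓ (z, coordS x ψ z))) ∘
        extChartAt 𝓘(ℝ, BaseModel n) x) x :=
    hZ.mdifferentiableAt.comp x (mdifferentiableAt_extChartAt hxs)
  refine hM.congr_of_eventuallyEq ?_
  filter_upwards [(chartAt (BaseModel n) x).open_source.mem_nhds hxs,
    hq.continuousAt.preimage_mem_nhds ((chartAt F k).open_source.mem_nhds hks)] with y hy hyk
  replace hyk : (ψ y).q ∈ (chartAt F k).source := hyk
  simp only [Function.comp_apply]
  rw [coordQ_extChartAt hy, coordS_extChartAt hy, coordP_extChartAt hy, lagCoord_extChartAt hy,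
    lieFormOfCoord_lieFormCoord hy, infGenCoord_extChartAt hyk]
  have hT := tangentCoordChange_prod (n := n) (F := F) (x, k) (y, (ψ y).q) (y, (ψ y).q) hy
    (mem_chart_source _ y) hyk (mem_chart_source _ _)
  -- The generator is written as its coordinate expression in the chart at `k` followed by the
  -- return to `T_q Q`: the factorisation `D ∘ A` required by naturality.
  have hA' : (show EG →L[ℝ] F from infGen EG G F (ψ y).q) =
      (show F →L[ℝ] F from fromCoordQ F k (ψ y).q) ∘L
      ((tangentCoordChange 𝓘(ℝ, F) (ψ y).q k (ψ y).q : F →L[ℝ] F) ∘L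
        (show EG →L[ℝ] F from infGen EG G F (ψ y).q)) :=
    ContinuousLinearMap.ext fun ξ => (fromCoordQ_coord hyk _).symm
  have hnat := clebschElement_naturality (V := F) (V' := F) (K := EG) (ψ y).mom (ψ y).σ
    ((tangentCoordChange 𝓘(ℝ, F) (ψ y).q k (ψ y).q : F →L[ℝ] F) ∘L
        (show EG →L[ℝ] F from infGen EG G F (ψ y).q)) (ℓ y (ψ y).σ)
    (C := fromCoord n x y) (C' := toCoord n x y) (fromCoord_toCoord hy) (fromCoordQ F k (ψ y).q)
  refine Eq.trans ?_ hnat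
  have hA'' : (show F →L[ℝ] F from fromCoordQ F k (ψ y).q) ∘L
      ((tangentCoordChange 𝓘(ℝ, F) (ψ y).q k (ψ y).q : F →L[ℝ] F) ∘L
        (show EG →L[ℝ] F from infGen EG G F (ψ y).q)) =
        (show EG →L[ℝ] F from infGen EG G F (ψ y).q) := hA'.symm
  refine Eq.trans ?_ (congrArg (fun T : EG →L[ℝ] F => (clebschElement (V := F) (K := EG)
    (ψ y).mom (ψ y).σ T (ℓ y (ψ y).σ)).compContinuousLinearMap
      (ContinuousLinearMap.prodMap (fromCoord n x y) (fromCoordQ F k (ψ y).q))) hA')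
  refine Eq.trans ?_ (congrArg (fun T => (clebschElement (V := F) (K := EG)
    (ψ y).mom (ψ y).σ (show EG →L[ℝ] F from infGen EG G F (ψ y).q)
      (ℓ y (ψ y).σ)).compContinuousLinearMap T) hT)
  rfl

/-- The integrand of the covariant Clebsch variational principle. -/
theorem SmoothFamilyOn.clebschForm_eq
    (hact : ContMDiff (𝓘(ℝ, EG).prod 𝓘(ℝ, F)) 𝓘(ℝ, F) ∞ (fun p : G × Q => p.1 • p.2))
    {ℓ : Density n EG G X} (hℓ : ℓ.IsSmooth)
    (hΨ : SmoothFamilyOn Ψ W) (hW : IsOpen W) (h : (ε, x) ∈ W) :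
    clebschForm ℓ (Ψ ε) x = reducedForm ℓ (Ψ ε) x := by
  have hd := hΨ.mdifferentiableAt_clebschSection hact hℓ hW h
  have hq := hΨ.mdifferentiableAt_q hW h
  have hp : MDifferentiableAt ((modelY n F).prod 𝓘(ℝ, FormY n F)) (modelY n F)
      (fun w : FormBundle (modelY n F) (X × Q) (n + 1) => w.proj) (clebschSection ℓ (Ψ ε) x) :=
    Bundle.mdifferentiableAt_proj _
  -- `Θ` depends on a tangent vector through `Tπ` alone, and `π ∘ e ∘ ψ` is `x ↦ (x, q(x))`. The
  -- pull-back is therefore along the graph of `dq`.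
  have hc := mfderiv_comp x hp hd
  have hc' : mfderiv 𝓘(ℝ, BaseModel n) (modelY n F) (fun y => (y, (Ψ ε y).q)) x =
      (mfderiv 𝓘(ℝ, BaseModel n) 𝓘(ℝ, BaseModel n) id x).prod
        (mfderiv 𝓘(ℝ, BaseModel n) 𝓘(ℝ, F) (fun y => (Ψ ε y).q) x) :=
    mdifferentiableAt_id.mfderiv_prod hq
  have hT : ((mfderiv ((modelY n F).prod 𝓘(ℝ, FormY n F)) (modelY n F)
      (fun w : FormBundle (modelY n F) (X × Q) (n + 1) => w.proj) (clebschSection ℓ (Ψ ε) x)) ∘L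
      mfderiv 𝓘(ℝ, BaseModel n) ((modelY n F).prod 𝓘(ℝ, FormY n F)) (clebschSection ℓ (Ψ ε)) x :
        BaseModel n →L[ℝ] BaseModel n × F) = graphMap (V := F) (show BaseModel n →L[ℝ] F from dq (Ψ ε) x) := by
    refine hc.symm.trans (hc'.trans ?_)
    rw [mfderiv_id]
    rfl
  refine Eq.trans ?_ (clebschElement_comp_graphMap (V := F) (K := EG) (Ψ ε x).mom (Ψ ε x).σ
    (show EG →L[ℝ] F from infGen EG G F (Ψ ε x).q) (ℓ x (Ψ ε x).σ) (dq (Ψ ε) x))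
  refine Eq.trans ?_ (congrArg (fun T : BaseModel n →L[ℝ] BaseModel n × F =>
    (clebschElement (V := F) (K := EG) (Ψ ε x).mom (Ψ ε x).σ
    (show EG →L[ℝ] F from infGen EG G F (Ψ ε x).q) (ℓ x (Ψ ε x).σ)).compContinuousLinearMap T) hT)
  rfl

end ClebschForm

end CovariantClebsch

namespace CovariantClebsch

open Filter Set MeasureTheory

/-! ### Variations, equality of the two principles, and the derivative of the action. -/

section Variation

variable {n : ℕ}
  {EG : Type*} [NormedAddCommGroup EG] [NormedSpace ℝ EG] [FiniteDimensional ℝ EG]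
  {G : Type*} [TopologicalSpace G] [ChartedSpace EG G] [Group G] [LieGroup 𝓘(ℝ, EG) ∞ G]
  {F : Type*} [NormedAddCommGroup F] [NormedSpace ℝ F] [FiniteDimensional ℝ F]
  {Q : Type*} [TopologicalSpace Q] [ChartedSpace F Q] [IsManifold 𝓘(ℝ, F) ∞ Q] [MulAction G Q]
  {X : Type*} [TopologicalSpace X] [ChartedSpace (BaseModel n) X]
  [IsManifold 𝓘(ℝ, BaseModel n) ∞ X]

variable {Ψ Ψ' : ℝ → ∀ x : X, PhaseFiber n EG G F Q x} {W : Set (ℝ × X)} {ε : ℝ} {x i : X} {k : Q}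
  {ψ ψ' : ∀ x : X, PhaseFiber n EG G F Q x} {U : Set X}

theorem SmoothFamilyOn.mono {W' : Set (ℝ × X)} (hΨ : SmoothFamilyOn Ψ W) (h : W' ⊆ W) :
    SmoothFamilyOn Ψ W' :=
  ⟨hΨ.q.mono h, fun x₀ => (hΨ.σ x₀).mono (inter_subset_inter_left _ h),
    fun x₀ q₀ => (hΨ.mom x₀ q₀).mono (inter_subset_inter_left _ h)⟩

theorem SmoothFamilyOn.congr (hΨ : SmoothFamilyOn Ψ' W) (h : ∀ p ∈ W, Ψ' p.1 p.2 = Ψ p.1 p.2) :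
    SmoothFamilyOn Ψ W := by
  refine ⟨hΨ.q.congr fun p hp => by rw [h p hp], fun x₀ => (hΨ.σ x₀).congr fun p hp => by
    rw [h p hp.1], fun x₀ q₀ => ?_⟩
  have hset : W ∩ {p | p.2 ∈ (chartAt (BaseModel n) x₀).source ∧
      (Ψ p.1 p.2).q ∈ (chartAt F q₀).source} = W ∩ {p | p.2 ∈ (chartAt (BaseModel n) x₀).source ∧
      (Ψ' p.1 p.2).q ∈ (chartAt F q₀).source} := by
    ext p
    refine and_congr_right fun hp => ?_
    simp only [mem_ofPred_eq, h p hp]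
  rw [hset]
  exact (hΨ.mom x₀ q₀).congr fun p hp => by rw [h p hp.1]

/-- Extensions matter only at the frontier: over the open set `U` the extension coincides with the
variation itself. -/
theorem IsVariation.exists_smoothFamilyOn (hU : IsOpen U) (hΨ : IsVariation U ψ Ψ) (hx : x ∈ U) :
    ∃ W : Set (ℝ × X), IsOpen W ∧ ((0 : ℝ), x) ∈ W ∧ SmoothFamilyOn Ψ W := by
  obtain ⟨W, hW, hxW, Ψ', hΨ', h⟩ := hΨ.smooth x (subset_closure hx)
  refine ⟨W ∩ {p | p.2 ∈ U}, hW.inter (hU.preimage continuous_snd), ⟨hxW, hx⟩, ?_⟩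
  exact (hΨ'.mono inter_subset_left).congr fun p hp => h p hp.1 (subset_closure hp.2)

/-- Each point of the closure has its own range of `ε` on which the extension lives. Compactness of
the closure yields a common range. -/
theorem IsVariation.eventually_smoothFamilyOn (hU : IsOpen U) (hUc : IsCompact (closure U))
    (hΨ : IsVariation U ψ Ψ) : ∀ᶠ ε : ℝ in 𝓝 0, ∀ x ∈ U, ∃ W : Set (ℝ × X), IsOpen W ∧
      (ε, x) ∈ W ∧ SmoothFamilyOn Ψ W := by
  have : ∀ᶠ ε : ℝ in 𝓝 0, ∀ x ∈ closure U, x ∈ U → ∃ W : Set (ℝ × X), IsOpen W ∧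
      (ε, x) ∈ W ∧ SmoothFamilyOn Ψ W := by
    refine hUc.eventually_forall_of_forall_eventually fun x hx => ?_
    obtain ⟨W, hW, hxW, Ψ', hΨ', h⟩ := hΨ.smooth x hx
    filter_upwards [hW.mem_nhds hxW] with p hp hpU
    refine ⟨W ∩ {p | p.2 ∈ U}, hW.inter (hU.preimage continuous_snd), ⟨hp, hpU⟩, ?_⟩
    exact (hΨ'.mono inter_subset_left).congr fun p hp => h p hp.1 (subset_closure hp.2)
  filter_upwards [this] with ε h x hx using h x (subset_closure hx) hx

/-- A section is smooth up to the closure exactly when it is a constant variation of itself. -/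
theorem IsSmoothSection.isVariation (hψ : IsSmoothSection U ψ) :
    IsVariation U ψ (fun _ => ψ) where
  zero _ _ := rfl
  boundary _ _ _ := rfl
  smooth x hx := by
    obtain ⟨W, hW, hxW, ψ', hψ', h⟩ := hψ x hx
    exact ⟨univ ×ˢ W, isOpen_univ.prod hW, ⟨mem_univ _, hxW⟩, fun _ => ψ', hψ',
      fun p hp hpU => h p.2 ⟨hp.2, hpU⟩⟩

theorem reducedForm_congr (ℓ : Density n EG G X) (h : ∀ᶠ y in 𝓝 x, ψ y = ψ' y) :
    reducedForm ℓ ψ x = reducedForm ℓ ψ' x := by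
  have hq : (fun y => (ψ y).q) =ᶠ[𝓝 x] fun y => (ψ' y).q := by
    filter_upwards [h] with y hy
    rw [hy]
  -- The type of the momentum depends on `q(x)`. Treating the value at `x` and the derivative, taken
  -- in model spaces, as independent arguments allows each to be replaced separately.
  let aux : PhaseFiber n EG G F Q x → (BaseModel n →L[ℝ] F) → Vol n x := fun p B =>
    ℓ x p.σ + p.mom ((show TX n x →L[ℝ] TangentSpace 𝓘(ℝ, F) p.q from B) - infGen EG G F p.q ∘L p.σ)
  have h1 : reducedForm ℓ ψ x = aux (ψ x) (mfderiv 𝓘(ℝ, BaseModel n) 𝓘(ℝ, F) (fun y => (ψ y).q) x) :=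
    rfl
  have h2 : reducedForm ℓ ψ' x =
      aux (ψ' x) (mfderiv 𝓘(ℝ, BaseModel n) 𝓘(ℝ, F) (fun y => (ψ' y).q) x) := rfl
  have h3 : (mfderiv 𝓘(ℝ, BaseModel n) 𝓘(ℝ, F) (fun y => (ψ y).q) x : BaseModel n →L[ℝ] F) =
    mfderiv 𝓘(ℝ, BaseModel n) 𝓘(ℝ, F) (fun y => (ψ' y).q) x := hq.mfderiv_eq
  rw [h1, h2, ← h.self_of_nhds]
  exact congrArg (aux (ψ x)) h3

theorem formIntegral_congr [T2Space X] [SigmaCompactSpace X] {β β' : ∀ x : X, Vol n x}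
    (hU : IsOpen U) (h : ∀ x ∈ U, β x = β' x) : formIntegral n U β = formIntegral n U β' := by
  rw [formIntegral_eq, formIntegral_eq]
  refine finsum_congr fun i => ?_
  refine setIntegral_congr_fun (isOpen_chartDomain i hU).measurableSet fun y hy => ?_
  simp only [chartDensity, h _ hy.2]

/-- Critical sections of the covariant Clebsch principle are those of the reduced action. -/
theorem isCritical_clebschAction_iff [T2Space X] [SigmaCompactSpace X]
    (hact : ContMDiff (𝓘(ℝ, EG).prod 𝓘(ℝ, F)) 𝓘(ℝ, F) ∞ (fun p : G × Q => p.1 • p.2))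
    {ℓ : Density n EG G X} (hℓ : ℓ.IsSmooth) (hU : IsOpen U) (hUc : IsCompact (closure U)) :
    IsCritical U (clebschAction ℓ U) ψ ↔ IsCritical U (reducedAction ℓ U) ψ := by
  refine forall_congr' fun Ψ => forall_congr' fun hΨ => ?_
  -- The two integrands are known to agree only where the varied section is smooth, that is, for
  -- small `ε`; criticality depends only on the germ at `ε = 0`.
  have : (fun ε => clebschAction ℓ U (Ψ ε)) =ᶠ[𝓝 0] fun ε => reducedAction ℓ U (Ψ ε) := by
    filter_upwards [hΨ.eventually_smoothFamilyOn hU hUc] with ε hε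
    refine formIntegral_congr hU fun x hx => ?_
    obtain ⟨W, hW, hxW, h⟩ := hε x hx
    exact h.clebschForm_eq hact hℓ hW hxW
  exact this.hasDerivAt_iff

/-! ### The derivative of the action -/

/-- The derivative of the integrand along a variation. -/
noncomputable def variationForm (ℓ : Density n EG G X)
    (Ψ : ℝ → ∀ x : X, PhaseFiber n EG G F Q x) (x : X) : Vol n x :=
  volOfCoord x x (deriv (fun ε => volCoord x x (reducedForm ℓ (Ψ ε) x)) 0)

/-- The variation of the configuration in the charts at `i` and `k`. -/
noncomputable def varQ (i : X) (k : Q) (Ψ : ℝ → ∀ x : X, PhaseFiber n EG G F Q x)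
    (z : BaseModel n) : F := deriv (fun ε => coordQ i k (Ψ ε) z) 0

/-- The Euler–Lagrange expression of a section in the charts at `i` and `k`. -/
noncomputable def eulerCoord (ℓ : Density n EG G X) (i : X) (k : Q)
    (ψ : ∀ x : X, PhaseFiber n EG G F Q x) (z : BaseModel n) (b : F) (s : BaseModel n →L[ℝ] EG)
    (w : (BaseModel n →L[ℝ] F) →L[ℝ] (BaseModel n) [⋀^Fin (n + 1)]→L[ℝ] ℝ) :
    (BaseModel n) [⋀^Fin (n + 1)]→L[ℝ] ℝ :=
  localEuler (lagCoord i ℓ) (infGenCoord EG G k) (coordQ i k ψ) (coordS i ψ) (coordP i k ψ) z b s w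

theorem SmoothFamilyOn.eventually_mem (hΨ : SmoothFamilyOn Ψ W) (hW : IsOpen W) (h : (ε, x) ∈ W)
    (hk : (Ψ ε x).q ∈ (chartAt F k).source) :
    ∀ᶠ p in 𝓝 (ε, x), p ∈ W ∧ (Ψ p.1 p.2).q ∈ (chartAt F k).source :=
  (show ∀ᶠ p in 𝓝 (ε, x), p ∈ W from hW.mem_nhds h).and ((hΨ.contMDiffAt_q hW h).continuousAt.eventually
    ((chartAt F k).open_source.mem_nhds hk))

theorem tendsto_coord_family (hx : x ∈ (chartAt (BaseModel n) i).source) :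
    Tendsto (fun p : ℝ × BaseModel n => (p.1, (extChartAt 𝓘(ℝ, BaseModel n) i).symm p.2))
      (𝓝 (ε, extChartAt 𝓘(ℝ, BaseModel n) i x)) (𝓝 (ε, x)) := by
  rw [nhds_prod_eq, nhds_prod_eq]
  exact tendsto_id.prodMap (tendsto_extChartAt_symm hx)

theorem eventually_mem_target (hx : x ∈ (chartAt (BaseModel n) i).source) :
    ∀ᶠ z in 𝓝 (extChartAt 𝓘(ℝ, BaseModel n) i x), ∃ y ∈ (chartAt (BaseModel n) i).source,
      extChartAt 𝓘(ℝ, BaseModel n) i y = z := by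
  filter_upwards [(isOpen_extChartAt_target (I := 𝓘(ℝ, BaseModel n)) i).mem_nhds
    ((extChartAt 𝓘(ℝ, BaseModel n) i).map_source (by simpa using hx))] with z hz
  exact ⟨_, by simpa using (extChartAt 𝓘(ℝ, BaseModel n) i).map_target hz,
    (extChartAt 𝓘(ℝ, BaseModel n) i).right_inv hz⟩

/-- The integrand of a smooth family in coordinates. -/
theorem SmoothFamilyOn.eventually_chartDensity (hΨ : SmoothFamilyOn Ψ W) (hW : IsOpen W)
    (h : (ε, x) ∈ W) (ℓ : Density n EG G X) (hx : x ∈ (chartAt (BaseModel n) i).source)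
    (hk : (Ψ ε x).q ∈ (chartAt F k).source) :
    ∀ᶠ p in 𝓝 (ε, extChartAt 𝓘(ℝ, BaseModel n) i x),
      chartDensity i (reducedForm ℓ (Ψ p.1)) p.2 = evalStd n (localIntegrand (lagCoord i ℓ)
        (infGenCoord EG G k) (coordQ i k (Ψ p.1)) (coordS i (Ψ p.1)) (coordP i k (Ψ p.1)) p.2) := by
  filter_upwards [(tendsto_coord_family hx).eventually (hΨ.eventually_mem hW h hk),
    (continuousAt_snd (p := (ε, extChartAt 𝓘(ℝ, BaseModel n) i x))).eventually
      (eventually_mem_target hx)] with p hp hy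
  obtain ⟨ε', z⟩ := p
  obtain ⟨y, hy, rfl⟩ := hy
  dsimp only at hp
  rw [extChartAt_symm_apply hy] at hp
  rw [chartDensity_eq_evalStd hy, volCoord_reducedForm ℓ (hΨ.mdifferentiableAt_q hW hp.1) hy hp.2]

theorem SmoothFamilyOn.contDiffAt_localIntegrand (hΨ : SmoothFamilyOn Ψ W) (hW : IsOpen W)
    (hact : ContMDiff (𝓘(ℝ, EG).prod 𝓘(ℝ, F)) 𝓘(ℝ, F) ∞ (fun p : G × Q => p.1 • p.2))
    {ℓ : Density n EG G X} (hℓ : ℓ.IsSmooth)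
    (h : ((0 : ℝ), x) ∈ W) (hx : x ∈ (chartAt (BaseModel n) i).source)
    (hk : (Ψ 0 x).q ∈ (chartAt F k).source) :
    ContDiffAt ℝ ∞ (fun p : ℝ × BaseModel n => localIntegrand (lagCoord i ℓ)
        (infGenCoord EG G k) (coordQ i k (Ψ p.1)) (coordS i (Ψ p.1)) (coordP i k (Ψ p.1)) p.2)
      (0, extChartAt 𝓘(ℝ, BaseModel n) i x) := by
  have hA : ContDiffAt ℝ ∞ (infGenCoord EG G k)
      (coordQ i k (Ψ 0) (extChartAt 𝓘(ℝ, BaseModel n) i x)) := by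
    rw [coordQ_extChartAt hx]
    exact contDiffAt_infGenCoord hact hk
  have hL := contDiffAt_lagCoord hℓ hx (coordS i (Ψ 0) (extChartAt 𝓘(ℝ, BaseModel n) i x))
  exact CovariantClebsch.contDiffAt_localIntegrand (Q := fun p => coordQ i k (Ψ p.1) p.2)
    (S := fun p => coordS i (Ψ p.1) p.2) (P := fun p => coordP i k (Ψ p.1) p.2)
    (A := infGenCoord EG G k) (L := lagCoord i ℓ)
    (hΨ.contDiffAt_coordQ hW h hx hk)
    (hΨ.contDiffAt_coordS hW h hx) (hΨ.contDiffAt_coordP hW h hx hk) hA hL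

/-- The first variation of the integrand of a smooth family, in coordinates. -/
theorem SmoothFamilyOn.hasDerivAt_localIntegrand (hΨ : SmoothFamilyOn Ψ W) (hW : IsOpen W)
    (hact : ContMDiff (𝓘(ℝ, EG).prod 𝓘(ℝ, F)) 𝓘(ℝ, F) ∞ (fun p : G × Q => p.1 • p.2))
    {ℓ : Density n EG G X} (hℓ : ℓ.IsSmooth)
    (h : ((0 : ℝ), x) ∈ W) (hx : x ∈ (chartAt (BaseModel n) i).source)
    (hk : (Ψ 0 x).q ∈ (chartAt F k).source) :
    HasDerivAt (fun ε => localIntegrand (lagCoord i ℓ)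
        (infGenCoord EG G k) (coordQ i k (Ψ ε)) (coordS i (Ψ ε)) (coordP i k (Ψ ε))
          (extChartAt 𝓘(ℝ, BaseModel n) i x))
      (eulerCoord ℓ i k (Ψ 0) (extChartAt 𝓘(ℝ, BaseModel n) i x)
        (varQ i k Ψ (extChartAt 𝓘(ℝ, BaseModel n) i x))
        (deriv (fun ε => coordS i (Ψ ε) (extChartAt 𝓘(ℝ, BaseModel n) i x)) 0)
        (deriv (fun ε => coordP i k (Ψ ε) (extChartAt 𝓘(ℝ, BaseModel n) i x)) 0) +
      ∑ μ, fderiv ℝ (fun z => coordP i k (Ψ 0) z ((stdCovec n μ).smulRight (varQ i k Ψ z)))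
        (extChartAt 𝓘(ℝ, BaseModel n) i x) (stdVec n μ)) 0 := by
  have hA : ContDiffAt ℝ ∞ (infGenCoord EG G k)
      (coordQ i k (Ψ 0) (extChartAt 𝓘(ℝ, BaseModel n) i x)) := by
    rw [coordQ_extChartAt hx]
    exact contDiffAt_infGenCoord hact hk
  have hL := contDiffAt_lagCoord hℓ hx (coordS i (Ψ 0) (extChartAt 𝓘(ℝ, BaseModel n) i x))
  exact CovariantClebsch.hasDerivAt_localIntegrand (Q := fun p => coordQ i k (Ψ p.1) p.2)
    (S := fun p => coordS i (Ψ p.1) p.2) (P := fun p => coordP i k (Ψ p.1) p.2)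
    (A := infGenCoord EG G k) (L := lagCoord i ℓ)
    (hΨ.contDiffAt_coordQ hW h hx hk)
    (hΨ.contDiffAt_coordS hW h hx) (hΨ.contDiffAt_coordP hW h hx hk) hA hL

theorem tendsto_prodMk_zero (z : BaseModel n) :
    Tendsto (fun ε : ℝ => (ε, z)) (𝓝 0) (𝓝 (0, z)) := by
  have : ContinuousAt (fun ε : ℝ => (ε, z)) 0 := by fun_prop
  exact this

/-- The first variation of the integrand, in coordinates. -/
theorem SmoothFamilyOn.chartDensity_variationForm (hΨ : SmoothFamilyOn Ψ W) (hW : IsOpen W)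
    (hact : ContMDiff (𝓘(ℝ, EG).prod 𝓘(ℝ, F)) 𝓘(ℝ, F) ∞ (fun p : G × Q => p.1 • p.2))
    {ℓ : Density n EG G X} (hℓ : ℓ.IsSmooth)
    (h : ((0 : ℝ), x) ∈ W) (hx : x ∈ (chartAt (BaseModel n) i).source) :
    chartDensity i (variationForm ℓ Ψ) (extChartAt 𝓘(ℝ, BaseModel n) i x) =
      deriv (fun ε => chartDensity i (reducedForm ℓ (Ψ ε)) (extChartAt 𝓘(ℝ, BaseModel n) i x)) 0 := by
  have hxs := mem_chart_source (BaseModel n) x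
  have hks := mem_chart_source F (Ψ 0 x).q
  have hd := (hΨ.hasDerivAt_localIntegrand hW hact hℓ h hxs hks).differentiableAt
  have he : ∀ᶠ ε : ℝ in 𝓝 0, volCoord x x (reducedForm ℓ (Ψ ε) x) = localIntegrand (lagCoord x ℓ)
        (infGenCoord EG G (Ψ 0 x).q) (coordQ x (Ψ 0 x).q (Ψ ε)) (coordS x (Ψ ε))
        (coordP x (Ψ 0 x).q (Ψ ε)) (extChartAt 𝓘(ℝ, BaseModel n) x x) := by
    have ht : Tendsto (fun ε : ℝ => (ε, x)) (𝓝 0) (𝓝 (0, x)) := by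
      have : ContinuousAt (fun ε : ℝ => (ε, x)) 0 := by fun_prop
      exact this
    filter_upwards [ht.eventually (hΨ.eventually_mem hW h hks)] with ε hε
    exact volCoord_reducedForm ℓ (hΨ.mdifferentiableAt_q hW hε.1) hxs hε.2
  have hd' : DifferentiableAt ℝ (fun ε => volCoord x x (reducedForm ℓ (Ψ ε) x)) 0 :=
    hd.congr_of_eventuallyEq he
  -- `variationForm` differentiates in the preferred chart at `x`. Passing to the chart at `i` is a
  -- linear map not depending on `ε`, so it commutes with the derivative.
  let T : ((BaseModel n) [⋀^Fin (n + 1)]→L[ℝ] ℝ) →L[ℝ] ℝ :=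
    evalStd n ∘L (volCoord i x ∘L volOfCoord x x :
      ((BaseModel n) [⋀^Fin (n + 1)]→L[ℝ] ℝ) →L[ℝ] (BaseModel n) [⋀^Fin (n + 1)]→L[ℝ] ℝ)
  have h1 : ∀ ε, chartDensity i (reducedForm ℓ (Ψ ε)) (extChartAt 𝓘(ℝ, BaseModel n) i x) =
      T (volCoord x x (reducedForm ℓ (Ψ ε) x)) := fun ε => by
    rw [chartDensity_eq_evalStd hx]
    exact congrArg (fun β => evalStd n (volCoord i x β)) (volOfCoord_volCoord hxs _).symm
  simp only [h1]
  rw [chartDensity_eq_evalStd hx]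
  exact (T.hasFDerivAt.comp_hasDerivAt (0 : ℝ) hd'.hasDerivAt).deriv.symm

/-- The action is differentiable along a variation. -/
theorem IsVariation.hasDerivAt_reducedAction [T2Space X] [SigmaCompactSpace X]
    (hact : ContMDiff (𝓘(ℝ, EG).prod 𝓘(ℝ, F)) 𝓘(ℝ, F) ∞ (fun p : G × Q => p.1 • p.2))
    {ℓ : Density n EG G X} (hℓ : ℓ.IsSmooth) (hU : IsOpen U) (hUc : IsCompact (closure U))
    (hΨ : IsVariation U ψ Ψ) :
    HasDerivAt (fun ε => reducedAction ℓ U (Ψ ε)) (formIntegral n U (variationForm ℓ Ψ)) 0 := by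
  have hout : ∀ x ∈ U, x ∉ closure U → False := fun x hx h => h (subset_closure hx)
  have h1 : ∀ β : ∀ x : X, Vol n x, formIntegral n U β = ∑ i ∈ chartFinset (n := n) hUc,
      ∫ y in chartDomain i U,
      chartPartition n X i ((extChartAt 𝓘(ℝ, BaseModel n) i).symm y) * chartDensity i β y :=
    fun β => formIntegral_eq_sum hUc fun x hx h => (hout x hx h).elim
  simp only [reducedAction, h1]
  refine HasDerivAt.fun_sum fun i _ => ?_
  have hKi : tsupport (chartPartition n X i) ∩ closure U ⊆ (chartAt (BaseModel n) i).source :=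
    inter_subset_left.trans (tsupport_chartPartition_subset i)
  refine (hasDerivAt_setIntegral_of_smooth_up_to_closure (isOpen_chartDomain i hU)
    (isCompact_image_chart (isClosed_tsupport_inter hUc i) hKi)
    (r := fun ε y => chartPartition n X i ((extChartAt 𝓘(ℝ, BaseModel n) i).symm y) *
      chartDensity i (reducedForm ℓ (Ψ ε)) y) ?_ ?_).congr_deriv ?_
  · intro ε y hy hyK
    obtain ⟨x, hxU, hxi, rfl⟩ := exists_of_mem_chartDomain hy
    rw [extChartAt_symm_apply hxi, image_eq_zero_of_notMem_tsupport (f := chartPartition n X i),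
      zero_mul]
    exact fun h => hyK ⟨x, ⟨h, subset_closure hxU⟩, rfl⟩
  · rintro _ ⟨x, hx, rfl⟩
    have hxi := hKi hx
    -- The point may lie on the frontier, so the integrand is compared with that of a smooth
    -- extension. Over `U` the two families agree on neighbourhoods, so the derivatives of `q` agree
    -- as well.
    obtain ⟨W, hW, hxW, Ψ', hΨ', hΨΨ'⟩ := hΨ.smooth x hx.2
    have hks := mem_chart_source F (Ψ' 0 x).q
    refine ⟨fun p => chartPartition n X i ((extChartAt 𝓘(ℝ, BaseModel n) i).symm p.2) *
      evalStd n (localIntegrand (lagCoord i ℓ) (infGenCoord EG G (Ψ' 0 x).q)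
        (coordQ i (Ψ' 0 x).q (Ψ' p.1)) (coordS i (Ψ' p.1)) (coordP i (Ψ' 0 x).q (Ψ' p.1)) p.2),
      ?_, ?_⟩
    · have e1 : ContDiffAt ℝ ∞ (fun p : ℝ × BaseModel n =>
          chartPartition n X i ((extChartAt 𝓘(ℝ, BaseModel n) i).symm p.2))
          (0, extChartAt 𝓘(ℝ, BaseModel n) i x) :=
        ContDiffAt.comp (g := chartPartition n X i ∘ (extChartAt 𝓘(ℝ, BaseModel n) i).symm)
          (f := Prod.snd) _ (contDiffAt_coord_function (chartPartition n X i).2 hxi) contDiffAt_snd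
      have e2 := (evalStd n).contDiff.contDiffAt.comp _
        (hΨ'.contDiffAt_localIntegrand hW hact hℓ hxW hxi hks)
      exact (e1.mul e2).of_le (by simp)
    · filter_upwards [hΨ'.eventually_chartDensity hW hxW ℓ hxi hks,
        (tendsto_coord_family hxi).eventually (hW.mem_nhds hxW)] with p hp hpW hpU
      rw [← hp]
      congr 1
      simp only [chartDensity]
      have : ∀ᶠ y in 𝓝 ((extChartAt 𝓘(ℝ, BaseModel n) i).symm p.2), Ψ p.1 y = Ψ' p.1 y := by
        have hsl : ContinuousAt (fun y : X => (p.1, y))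
          ((extChartAt 𝓘(ℝ, BaseModel n) i).symm p.2) := by fun_prop
        filter_upwards [hsl.preimage_mem_nhds (hW.mem_nhds hpW), hU.mem_nhds hpU.2] with y hy hyU
        exact (hΨΨ' _ hy (subset_closure hyU)).symm
      rw [reducedForm_congr ℓ this]
  · refine setIntegral_congr_fun (isOpen_chartDomain i hU).measurableSet fun y hy => ?_
    obtain ⟨x, hxU, hxi, rfl⟩ := exists_of_mem_chartDomain hy
    obtain ⟨W, hW, hxW, hsm⟩ := hΨ.exists_smoothFamilyOn hU hxU
    rw [hsm.chartDensity_variationForm hW hact hℓ hxW hxi]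
    have hks := mem_chart_source F (Ψ 0 x).q
    have hd := (hsm.hasDerivAt_localIntegrand hW hact hℓ hxW hxi hks).differentiableAt
    have hd' : DifferentiableAt ℝ (fun ε => chartDensity i (reducedForm ℓ (Ψ ε))
        (extChartAt 𝓘(ℝ, BaseModel n) i x)) 0 := by
      refine ((evalStd n).differentiableAt.comp (0 : ℝ) hd).congr_of_eventuallyEq ?_
      exact (tendsto_prodMk_zero _).eventually (hsm.eventually_chartDensity hW hxW ℓ hxi hks)
    exact (hd'.hasDerivAt.const_mul _).deriv

end Variation

end CovariantClebsch

/-! ### The boundary flux of the first variation, and criticality of Euler–Lagrange solutions. -/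

namespace CovariantClebsch

open Filter Set MeasureTheory

theorem contDiffAt_deriv_slice {n : ℕ} {W : Type*} [NormedAddCommGroup W] [NormedSpace ℝ W]
    {f : ℝ × BaseModel n → W} {y : BaseModel n} (hf : ContDiffAt ℝ ∞ f (0, y)) :
    ContDiffAt ℝ ∞ (fun z => deriv (fun ε => f (ε, z)) 0) y := by
  have htz : Tendsto (fun z : BaseModel n => ((0 : ℝ), z)) (𝓝 y) (𝓝 (0, y)) := by
    have : ContinuousAt (fun z : BaseModel n => ((0 : ℝ), z)) y := by fun_prop
    exact this
  have h1 : (fun z => deriv (fun ε => f (ε, z)) 0) =ᶠ[𝓝 y] fun z => fderiv ℝ f (0, z) (1, 0) := by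
    filter_upwards [htz.eventually ((hf.of_le (show (1 : WithTop ℕ∞) ≤ ∞ by simp)).eventually
      (by simp))] with z hz
    exact (hasDerivAt_slice (hz.differentiableAt (by simp))).deriv
  refine ContDiffAt.congr_of_eventuallyEq ?_ h1
  have h2 : ContDiffAt ℝ ∞ (fderiv ℝ f) (0, y) := hf.fderiv_right (by simp)
  have h3 : ContDiffAt ℝ ∞ (fun z : BaseModel n => ((0 : ℝ), z)) y :=
    contDiffAt_const.prodMk contDiffAt_id
  exact (ContDiffAt.comp (g := fderiv ℝ f) y h2 h3).clm_apply contDiffAt_const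

section Flux

variable {n : ℕ}
  {EG : Type*} [NormedAddCommGroup EG] [NormedSpace ℝ EG] [FiniteDimensional ℝ EG]
  {G : Type*} [TopologicalSpace G] [ChartedSpace EG G] [Group G] [LieGroup 𝓘(ℝ, EG) ∞ G]
  {F : Type*} [NormedAddCommGroup F] [NormedSpace ℝ F] [FiniteDimensional ℝ F]
  {Q : Type*} [TopologicalSpace Q] [ChartedSpace F Q] [IsManifold 𝓘(ℝ, F) ∞ Q] [MulAction G Q]
  {X : Type*} [TopologicalSpace X] [ChartedSpace (BaseModel n) X]
  [IsManifold 𝓘(ℝ, BaseModel n) ∞ X]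

variable {Ψ Ψ' : ℝ → ∀ x : X, PhaseFiber n EG G F Q x} {W : Set (ℝ × X)} {ε : ℝ} {x i : X} {k : Q}
  {ψ ψ' : ∀ x : X, PhaseFiber n EG G F Q x} {U : Set X}

/-- The variation `δq(x) ∈ T_{q(x)} Q` of the configuration. -/
noncomputable def varVec (Ψ : ℝ → ∀ x : X, PhaseFiber n EG G F Q x) (x : X) : F :=
  deriv (fun ε => extChartAt 𝓘(ℝ, F) (Ψ 0 x).q (Ψ ε x).q) 0

/-- The boundary term `θ ↦ ⟨w, θ ⊗ δq⟩` of the first variation. -/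
noncomputable def varFlux (Ψ : ℝ → ∀ x : X, PhaseFiber n EG G F Q x) (x : X) :
    (TX n x →L[ℝ] ℝ) →L[ℝ] Vol n x :=
  (show (BaseModel n →L[ℝ] F) →L[ℝ] (BaseModel n) [⋀^Fin (n + 1)]→L[ℝ] ℝ from (Ψ 0 x).mom) ∘L
    (ContinuousLinearMap.smulRightL ℝ (BaseModel n) F).flip (varVec Ψ x)

/-- By the chain rule, the velocities of the curve `ε ↦ q_ε(x)` in two charts are related by the
derivative of the transition map: `δq` is a tangent vector. -/
theorem SmoothFamilyOn.varQ_eq (hΨ : SmoothFamilyOn Ψ W) (hW : IsOpen W) (h : ((0 : ℝ), x) ∈ W)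
    (hx : x ∈ (chartAt (BaseModel n) i).source) (hk : (Ψ 0 x).q ∈ (chartAt F k).source) :
    varQ i k Ψ (extChartAt 𝓘(ℝ, BaseModel n) i x) =
      (tangentCoordChange 𝓘(ℝ, F) (Ψ 0 x).q k (Ψ 0 x).q : F →L[ℝ] F) (varVec Ψ x) := by
  have hks := mem_chart_source F (Ψ 0 x).q
  have hd : ∀ l, (Ψ 0 x).q ∈ (chartAt F l).source →
      DifferentiableAt ℝ (fun ε => extChartAt 𝓘(ℝ, F) l (Ψ ε x).q) 0 := fun l hl => by
    have h1 := (hasDerivAt_slice ((hΨ.contDiffAt_coordQ hW h hx hl).differentiableAt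
      (by simp))).differentiableAt
    simpa only [coordQ_extChartAt hx] using h1
  have h2 := hasFDerivAt_chart_transition hks hk
  have h3 := HasFDerivAt.comp_hasDerivAt (x := (0 : ℝ))
    (f := fun ε => extChartAt 𝓘(ℝ, F) (Ψ 0 x).q (Ψ ε x).q) h2 (hd _ hks).hasDerivAt
  simp only [varQ, coordQ_extChartAt hx]
  refine HasDerivAt.deriv (h3.congr_of_eventuallyEq ?_)
  have ht : Tendsto (fun ε : ℝ => (ε, x)) (𝓝 0) (𝓝 (0, x)) := by
    have : ContinuousAt (fun ε : ℝ => (ε, x)) 0 := by fun_prop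
    exact this
  filter_upwards [ht.eventually (hΨ.eventually_mem hW h hks)] with ε hε
  simp only [Function.comp_apply]
  rw [extChartAt_symm_extChartAt hε.2]

/-- The invariantly defined flux has components `P^μ_A δQ^A`, precisely the quantity under the
divergence in the first variation formula. -/
theorem SmoothFamilyOn.vectorDensity_varFlux (hΨ : SmoothFamilyOn Ψ W) (hW : IsOpen W)
    (h : ((0 : ℝ), x) ∈ W) (hx : x ∈ (chartAt (BaseModel n) i).source)
    (hk : (Ψ 0 x).q ∈ (chartAt F k).source) (μ : Fin (n + 1)) :
    vectorDensity i (varFlux Ψ) μ (extChartAt 𝓘(ℝ, BaseModel n) i x) =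
      evalStd n (coordP i k (Ψ 0) (extChartAt 𝓘(ℝ, BaseModel n) i x)
        ((stdCovec n μ).smulRight (varQ i k Ψ (extChartAt 𝓘(ℝ, BaseModel n) i x)))) := by
  rw [vectorDensity, chartDensity_eq_evalStd hx, coordP_extChartAt hx, hΨ.varQ_eq hW h hx hk]
  let B : TX n x →L[ℝ] TangentSpace 𝓘(ℝ, F) (Ψ 0 x).q :=
    (show BaseModel n →L[ℝ] F from
      (show BaseModel n →L[ℝ] ℝ from stdCovec n μ ∘L toCoord n i x).smulRight (varVec Ψ x))
  have h1 := momentumCoord_apply hx hk (Ψ 0 x).mom B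
  have h2 : (tangentCoordChange 𝓘(ℝ, F) (Ψ 0 x).q k (Ψ 0 x).q : F →L[ℝ] F) ∘L
      (show BaseModel n →L[ℝ] F from B ∘L fromCoord n i x) = (stdCovec n μ).smulRight
      ((tangentCoordChange 𝓘(ℝ, F) (Ψ 0 x).q k (Ψ 0 x).q : F →L[ℝ] F) (varVec Ψ x)) := by
    refine ContinuousLinearMap.ext fun v => ?_
    refine (map_smul (tangentCoordChange 𝓘(ℝ, F) (Ψ 0 x).q k (Ψ 0 x).q : F →L[ℝ] F)
      (stdCovec n μ (toCoord n i x (fromCoord n i x v))) (varVec Ψ x)).trans ?_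
    rw [toCoord_fromCoord hx]
    rfl
  rw [h2] at h1
  rw [h1]
  rfl

/-- The boundary term of the first variation is an admissible flux. -/
theorem IsVariation.isAdmissibleFlux (hU : IsOpen U) (hΨ : IsVariation U ψ Ψ) :
    IsAdmissibleFlux U (varFlux Ψ) := by
  intro i x hx hxi μ
  obtain ⟨W, hW, hxW, Ψ', hΨ', hΨΨ'⟩ := hΨ.smooth x hx
  set k := (Ψ' 0 x).q with hk
  have hks : (Ψ' 0 x).q ∈ (chartAt F k).source := mem_chart_source F _
  refine ⟨fun z => evalStd n (coordP i k (Ψ' 0) z ((stdCovec n μ).smulRight (varQ i k Ψ' z))),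
    ?_, ?_, ?_⟩
  · have hP : ContDiffAt ℝ ∞ (coordP i k (Ψ' 0)) (extChartAt 𝓘(ℝ, BaseModel n) i x) :=
      ContDiffAt.comp (g := fun p : ℝ × BaseModel n => coordP i k (Ψ' p.1) p.2)
        (f := fun z => ((0 : ℝ), z)) _
        (hΨ'.contDiffAt_coordP hW hxW hxi hks) (contDiffAt_const.prodMk contDiffAt_id)
    have hQ : ContDiffAt ℝ ∞ (varQ i k Ψ') (extChartAt 𝓘(ℝ, BaseModel n) i x) :=
      contDiffAt_deriv_slice (hΨ'.contDiffAt_coordQ hW hxW hxi hks)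
    have hS : ContDiffAt ℝ ∞ (fun z => (stdCovec n μ).smulRight (varQ i k Ψ' z))
        (extChartAt 𝓘(ℝ, BaseModel n) i x) :=
      (ContinuousLinearMap.smulRightL ℝ (BaseModel n) F (stdCovec n μ)).contDiff.contDiffAt.comp
        _ hQ
    exact ((evalStd n).contDiff.contDiffAt.comp _ (hP.clm_apply hS)).of_le (by simp)
  · have ht : Tendsto (fun z : BaseModel n => ((0 : ℝ), z)) (𝓝 (extChartAt 𝓘(ℝ, BaseModel n) i x))
        (𝓝 (0, extChartAt 𝓘(ℝ, BaseModel n) i x)) := by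
      have : ContinuousAt (fun z : BaseModel n => ((0 : ℝ), z))
        (extChartAt 𝓘(ℝ, BaseModel n) i x) := by fun_prop
      exact this
    filter_upwards [(ht.eventually ((tendsto_coord_family hxi).eventually
      (hΨ'.eventually_mem hW hxW hks)))] with z hz hzU
    obtain ⟨y, hyU, hyi, rfl⟩ := exists_of_mem_chartDomain hzU
    rw [extChartAt_symm_apply hyi] at hz
    obtain ⟨W₁, hW₁, hyW₁, hsm⟩ := hΨ.exists_smoothFamilyOn hU hyU
    have hty : Tendsto (fun ε : ℝ => (ε, y)) (𝓝 0) (𝓝 (0, y)) := by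
      have : ContinuousAt (fun ε : ℝ => (ε, y)) 0 := by fun_prop
      exact this
    have heq : ∀ᶠ ε : ℝ in 𝓝 0, Ψ' ε y = Ψ ε y := by
      filter_upwards [hty.eventually (hW.mem_nhds hz.1)] with ε hε
      exact hΨΨ' _ hε (subset_closure hyU)
    have h0 : Ψ' 0 y = Ψ 0 y := heq.self_of_nhds
    rw [hsm.vectorDensity_varFlux hW₁ hyW₁ hyi (k := k) (by rw [← h0]; exact hz.2),
      coordP_extChartAt hyi, coordP_extChartAt hyi, h0]
    have hv : varQ i k Ψ (extChartAt 𝓘(ℝ, BaseModel n) i y) =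
        varQ i k Ψ' (extChartAt 𝓘(ℝ, BaseModel n) i y) := by
      simp only [varQ, coordQ_extChartAt hyi]
      refine Filter.EventuallyEq.deriv_eq ?_
      filter_upwards [heq] with ε hε
      rw [hε]
    rw [hv]
  -- A point of the closure outside the open set `U` lies on its frontier, where `q_ε` is fixed.
  -- Hence `δq`, and with it the flux of the extension, vanishes there.
  · intro hxU
    have hfr : x ∈ frontier U := by
      rw [hU.frontier_eq]; exact ⟨hx, hxU⟩
    have hv : varQ i k Ψ' (extChartAt 𝓘(ℝ, BaseModel n) i x) = 0 := by
      simp only [varQ, coordQ_extChartAt hxi]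
      have htx : Tendsto (fun ε : ℝ => (ε, x)) (𝓝 0) (𝓝 (0, x)) := by
        have : ContinuousAt (fun ε : ℝ => (ε, x)) 0 := by fun_prop
        exact this
      have : (fun ε => extChartAt 𝓘(ℝ, F) k (Ψ' ε x).q) =ᶠ[𝓝 0]
          fun _ => extChartAt 𝓘(ℝ, F) k (ψ x).q := by
        filter_upwards [htx.eventually (hW.mem_nhds hxW)] with ε hε
        rw [hΨΨ' _ hε hx, hΨ.boundary ε x hfr]
      rw [this.deriv_eq, deriv_const]
    simp only [hv]
    rw [ContinuousLinearMap.smulRight_zero, map_zero, map_zero]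

/-- The Euler–Lagrange expression involves values and first derivatives at the point, so it depends
only on the germ. A variation at `ε = 0` is known to agree with the section on the closure of `U`
only. -/
theorem eulerCoord_congr (ℓ : Density n EG G X) (h : ∀ᶠ y in 𝓝 x, ψ y = ψ' y)
    (hx : x ∈ (chartAt (BaseModel n) i).source) (k : Q) (b : F) (s : BaseModel n →L[ℝ] EG)
    (w : (BaseModel n →L[ℝ] F) →L[ℝ] (BaseModel n) [⋀^Fin (n + 1)]→L[ℝ] ℝ) :
    eulerCoord ℓ i k ψ (extChartAt 𝓘(ℝ, BaseModel n) i x) b s w =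
      eulerCoord ℓ i k ψ' (extChartAt 𝓘(ℝ, BaseModel n) i x) b s w := by
  have h1 := eventually_extChartAt_symm hx h
  have hQ : coordQ i k ψ =ᶠ[𝓝 (extChartAt 𝓘(ℝ, BaseModel n) i x)] coordQ i k ψ' := by
    filter_upwards [h1] with z hz
    rw [coordQ, hz, coordQ]
  have hP : coordP i k ψ =ᶠ[𝓝 (extChartAt 𝓘(ℝ, BaseModel n) i x)] coordP i k ψ' := by
    filter_upwards [h1] with z hz
    rw [coordP, hz, coordP]
  have hS : coordS i ψ =ᶠ[𝓝 (extChartAt 𝓘(ℝ, BaseModel n) i x)] coordS i ψ' := by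
    filter_upwards [h1] with z hz
    rw [coordS, hz, coordS]
  rw [eulerCoord, eulerCoord, localEuler, localEuler, hQ.fderiv_eq, hP.fderiv_eq,
    hQ.self_of_nhds, hP.self_of_nhds, hS.self_of_nhds]

theorem SmoothFamilyOn.differentiableAt_flux (hΨ : SmoothFamilyOn Ψ W) (hW : IsOpen W)
    (h : ((0 : ℝ), x) ∈ W) (hx : x ∈ (chartAt (BaseModel n) i).source)
    (hk : (Ψ 0 x).q ∈ (chartAt F k).source) (μ : Fin (n + 1)) :
    ContDiffAt ℝ ∞ (fun z => coordP i k (Ψ 0) z ((stdCovec n μ).smulRight (varQ i k Ψ z)))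
      (extChartAt 𝓘(ℝ, BaseModel n) i x) := by
  have hP : ContDiffAt ℝ ∞ (coordP i k (Ψ 0)) (extChartAt 𝓘(ℝ, BaseModel n) i x) :=
    ContDiffAt.comp (g := fun p : ℝ × BaseModel n => coordP i k (Ψ p.1) p.2)
      (f := fun z => ((0 : ℝ), z)) _
      (hΨ.contDiffAt_coordP hW h hx hk) (contDiffAt_const.prodMk contDiffAt_id)
  have hQ : ContDiffAt ℝ ∞ (varQ i k Ψ) (extChartAt 𝓘(ℝ, BaseModel n) i x) :=
    contDiffAt_deriv_slice (hΨ.contDiffAt_coordQ hW h hx hk)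
  have hS : ContDiffAt ℝ ∞ (fun z => (stdCovec n μ).smulRight (varQ i k Ψ z))
      (extChartAt 𝓘(ℝ, BaseModel n) i x) :=
    (ContinuousLinearMap.smulRightL ℝ (BaseModel n) F (stdCovec n μ)).contDiff.contDiffAt.comp
      _ hQ
  exact hP.clm_apply hS

/-- The first variation of the integrand: Euler–Lagrange expression and divergence. -/
theorem SmoothFamilyOn.chartDensity_variationForm_eq (hΨ : SmoothFamilyOn Ψ W) (hW : IsOpen W)
    (hact : ContMDiff (𝓘(ℝ, EG).prod 𝓘(ℝ, F)) 𝓘(ℝ, F) ∞ (fun p : G × Q => p.1 • p.2))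
    {ℓ : Density n EG G X} (hℓ : ℓ.IsSmooth)
    (h : ((0 : ℝ), x) ∈ W) (hx : x ∈ (chartAt (BaseModel n) i).source)
    (hk : (Ψ 0 x).q ∈ (chartAt F k).source) :
    chartDensity i (variationForm ℓ Ψ) (extChartAt 𝓘(ℝ, BaseModel n) i x) =
      evalStd n (eulerCoord ℓ i k (Ψ 0) (extChartAt 𝓘(ℝ, BaseModel n) i x)
        (varQ i k Ψ (extChartAt 𝓘(ℝ, BaseModel n) i x))
        (deriv (fun ε => coordS i (Ψ ε) (extChartAt 𝓘(ℝ, BaseModel n) i x)) 0)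
        (deriv (fun ε => coordP i k (Ψ ε) (extChartAt 𝓘(ℝ, BaseModel n) i x)) 0)) +
      ∑ μ, fderiv ℝ (fun z => evalStd n (coordP i k (Ψ 0) z
        ((stdCovec n μ).smulRight (varQ i k Ψ z))))
        (extChartAt 𝓘(ℝ, BaseModel n) i x) (stdVec n μ) := by
  rw [hΨ.chartDensity_variationForm hW hact hℓ h hx]
  have h1 := (evalStd n).hasFDerivAt.comp_hasDerivAt (0 : ℝ)
    (hΨ.hasDerivAt_localIntegrand hW hact hℓ h hx hk)
  have h2 := h1.congr_of_eventuallyEq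
    (f₁ := fun ε => chartDensity i (reducedForm ℓ (Ψ ε)) (extChartAt 𝓘(ℝ, BaseModel n) i x))
    ((tendsto_prodMk_zero _).eventually (hΨ.eventually_chartDensity hW h ℓ hx hk))
  rw [h2.deriv, map_add, map_sum]
  refine congrArg₂ _ rfl (Finset.sum_congr rfl fun μ _ => ?_)
  have h3 := ((evalStd n).hasFDerivAt.comp (extChartAt 𝓘(ℝ, BaseModel n) i x)
    ((hΨ.differentiableAt_flux hW h hx hk μ).differentiableAt (by simp)).hasFDerivAt).fderiv
  exact (congrArg (fun T => T (stdVec n μ)) h3).symm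

theorem SmoothFamilyOn.eventually_vectorDensity_varFlux (hΨ : SmoothFamilyOn Ψ W) (hW : IsOpen W)
    (h : ((0 : ℝ), x) ∈ W) (hx : x ∈ (chartAt (BaseModel n) i).source)
    (hk : (Ψ 0 x).q ∈ (chartAt F k).source) (μ : Fin (n + 1)) :
    vectorDensity i (varFlux Ψ) μ =ᶠ[𝓝 (extChartAt 𝓘(ℝ, BaseModel n) i x)] fun z =>
      evalStd n (coordP i k (Ψ 0) z ((stdCovec n μ).smulRight (varQ i k Ψ z))) := by
  have ht : Tendsto (fun z : BaseModel n => ((0 : ℝ), z)) (𝓝 (extChartAt 𝓘(ℝ, BaseModel n) i x))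
      (𝓝 (0, extChartAt 𝓘(ℝ, BaseModel n) i x)) := by
    have : ContinuousAt (fun z : BaseModel n => ((0 : ℝ), z))
      (extChartAt 𝓘(ℝ, BaseModel n) i x) := by fun_prop
    exact this
  filter_upwards [eventually_mem_target hx, ht.eventually ((tendsto_coord_family hx).eventually
    (hΨ.eventually_mem hW h hk))] with z hz hzW
  obtain ⟨y, hy, rfl⟩ := hz
  rw [extChartAt_symm_apply hy] at hzW
  exact hΨ.vectorDensity_varFlux hW hzW.1 hy hzW.2 μ

/-- Solutions of the Euler–Lagrange equations are critical. -/
theorem isCritical_of_eulerCoord [T2Space X] [SigmaCompactSpace X] [OrientedAtlas n X]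
    (hact : ContMDiff (𝓘(ℝ, EG).prod 𝓘(ℝ, F)) 𝓘(ℝ, F) ∞ (fun p : G × Q => p.1 • p.2))
    {ℓ : Density n EG G X} (hℓ : ℓ.IsSmooth) (hU : IsOpen U) (hUc : IsCompact (closure U))
    (hE : ∀ x ∈ U, ∀ i, x ∈ (chartAt (BaseModel n) i).source → ∀ b s w,
      eulerCoord ℓ i (ψ x).q ψ (extChartAt 𝓘(ℝ, BaseModel n) i x) b s w = 0) :
    IsCritical U (reducedAction ℓ U) ψ := by
  intro Ψ hΨ
  refine (hΨ.hasDerivAt_reducedAction hact hℓ hU hUc).congr_deriv ?_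
  -- Once the Euler–Lagrange expression is zero, the first variation is the divergence of an
  -- admissible flux in every chart.
  refine (hΨ.isAdmissibleFlux hU).formIntegral_eq_zero hU hUc fun i x hx hxi => ?_
  obtain ⟨W, hW, hxW, hsm⟩ := hΨ.exists_smoothFamilyOn hU hx
  have h0 : Ψ 0 x = ψ x := hΨ.zero x (subset_closure hx)
  have hk : (Ψ 0 x).q ∈ (chartAt F (ψ x).q).source := by
    rw [h0]; exact mem_chart_source F _
  have hev : ∀ᶠ y in 𝓝 x, Ψ 0 y = ψ y := by
    filter_upwards [hU.mem_nhds hx] with y hy using hΨ.zero y (subset_closure hy)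
  rw [hsm.chartDensity_variationForm_eq hW hact hℓ hxW hxi hk,
    eulerCoord_congr ℓ hev hxi, hE x hx i hxi, map_zero, zero_add]
  refine Finset.sum_congr rfl fun μ _ => ?_
  rw [(hsm.eventually_vectorDensity_varFlux hW hxW hxi hk μ).fderiv_eq]

end Flux

end CovariantClebsch

/-! ### Perturbing a section inside one pair of charts. -/

namespace CovariantClebsch

open Filter Set MeasureTheory

theorem contMDiffAt_tangentCoordChange {E M : Type*} [NormedAddCommGroup E] [NormedSpace ℝ E]
    [TopologicalSpace M] [ChartedSpace E M] [IsManifold 𝓘(ℝ, E) ∞ M] {i j x : M}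
    (hi : x ∈ (chartAt E i).source) (hj : x ∈ (chartAt E j).source) :
    ContMDiffAt 𝓘(ℝ, E) 𝓘(ℝ, E →L[ℝ] E) ∞
      (fun y => (tangentCoordChange 𝓘(ℝ, E) i j y : E →L[ℝ] E)) x := by
  have h1 : ContDiffAt ℝ ∞ (fderiv ℝ (extChartAt 𝓘(ℝ, E) j ∘ (extChartAt 𝓘(ℝ, E) i).symm))
      (extChartAt 𝓘(ℝ, E) i x) := (contDiffAt_chart_transition hi hj).fderiv_right (by simp)
  have h2 : ContMDiffAt 𝓘(ℝ, E) 𝓘(ℝ, E →L[ℝ] E) ∞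
      (fderiv ℝ (extChartAt 𝓘(ℝ, E) j ∘ (extChartAt 𝓘(ℝ, E) i).symm) ∘ extChartAt 𝓘(ℝ, E) i) x :=
    ContMDiffAt.comp x h1.contMDiffAt (contMDiffAt_extChartAt' hi)
  refine h2.congr_of_eventuallyEq ?_
  filter_upwards [(chartAt E i).open_source.mem_nhds hi, (chartAt E j).open_source.mem_nhds hj]
    with y hyi hyj
  exact (hasFDerivAt_chart_transition hyi hyj).fderiv.symm

/-- The determinant is a polynomial in the matrix entries. It is needed because momenta take values
in densities, whose transition functions are Jacobians. -/
theorem contDiff_det (n : ℕ) : ContDiff ℝ ∞ (fun A : BaseModel n →L[ℝ] BaseModel n => A.det) := by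
  have h : (fun A : BaseModel n →L[ℝ] BaseModel n => A.det) = fun A =>
      (Matrix.of fun μ ν => stdCovec n μ (A (stdVec n ν))).det := by
    funext A
    rw [ContinuousLinearMap.det, ← LinearMap.det_toMatrix
      (EuclideanSpace.basisFun (Fin (n + 1)) ℝ).toBasis]
    congr 1
  rw [h]
  simp only [Matrix.det_apply, Matrix.of_apply]
  refine ContDiff.sum fun σ _ => ContDiff.const_smul _ (contDiff_prod fun μ _ => ?_)
  exact (stdCovec n (σ μ)).contDiff.comp (contDiff_id.clm_apply contDiff_const)

section ChartFamilies

variable {n : ℕ}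
  {EG : Type*} [NormedAddCommGroup EG] [NormedSpace ℝ EG] [FiniteDimensional ℝ EG]
  {G : Type*} [TopologicalSpace G] [ChartedSpace EG G] [Group G] [LieGroup 𝓘(ℝ, EG) ∞ G]
  {F : Type*} [NormedAddCommGroup F] [NormedSpace ℝ F] [FiniteDimensional ℝ F]
  {Q : Type*} [TopologicalSpace Q] [ChartedSpace F Q] [IsManifold 𝓘(ℝ, F) ∞ Q] [MulAction G Q]
  {X : Type*} [TopologicalSpace X] [ChartedSpace (BaseModel n) X]
  [IsManifold 𝓘(ℝ, BaseModel n) ∞ X]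

variable {Ψ : ℝ → ∀ x : X, PhaseFiber n EG G F Q x} {W : Set (ℝ × X)} {ε : ℝ} {x i : X} {k : Q}
  {ψ : ∀ x : X, PhaseFiber n EG G F Q x} {U : Set X}

theorem lieFormCoord_change {x₀ y : X} (hi : y ∈ (chartAt (BaseModel n) i).source)
    (h₀ : y ∈ (chartAt (BaseModel n) x₀).source) (σ : LieForm n EG G y) :
    lieFormCoord x₀ y σ = lieFormCoord i y σ ∘L
      (tangentCoordChange 𝓘(ℝ, BaseModel n) x₀ i y : BaseModel n →L[ℝ] BaseModel n) :=
  ContinuousLinearMap.ext fun v => congrArg σ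
    (tangentCoordChange_comp_apply h₀ hi (mem_chart_source _ y) v).symm

/-- The argument in `L(TX, TQ)` changes by composition on both sides, and the value, a density, by
the Jacobian. Written with the operators of composition, every factor is visibly smooth in the
point. -/
theorem momentumCoord_change {x₀ y : X} (hi : y ∈ (chartAt (BaseModel n) i).source)
    (h₀ : y ∈ (chartAt (BaseModel n) x₀).source) {q₀ q : Q} (hk : q ∈ (chartAt F k).source)
    (hq₀ : q ∈ (chartAt F q₀).source) (w : Momentum n F y q) :
    momentumCoord x₀ y q₀ q w =
      (tangentCoordChange 𝓘(ℝ, BaseModel n) x₀ i y : BaseModel n →L[ℝ] BaseModel n).det •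
      (momentumCoord i y k q w ∘L
        (ContinuousLinearMap.compL ℝ (BaseModel n) F F
          (tangentCoordChange 𝓘(ℝ, F) q₀ k q : F →L[ℝ] F)) ∘L
        ((ContinuousLinearMap.compL ℝ (BaseModel n) (BaseModel n) F).flip
          (tangentCoordChange 𝓘(ℝ, BaseModel n) i x₀ y : BaseModel n →L[ℝ] BaseModel n))) := by
  refine ContinuousLinearMap.ext fun A => top_form_ext ?_
  let B : TX n y →L[ℝ] TangentSpace 𝓘(ℝ, F) q := fromCoordQ F q₀ q ∘L A ∘L toCoord n x₀ y
  have hB : (fromCoordQ F k q ∘L ((tangentCoordChange 𝓘(ℝ, F) q₀ k q : F →L[ℝ] F) ∘L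
      A ∘L (tangentCoordChange 𝓘(ℝ, BaseModel n) i x₀ y : BaseModel n →L[ℝ] BaseModel n)) ∘L
      toCoord n i y : TX n y →L[ℝ] TangentSpace 𝓘(ℝ, F) q) = B := by
    refine ContinuousLinearMap.ext fun v => ?_
    refine (tangentCoordChange_comp_apply hq₀ hk (mem_chart_source _ q) _).trans ?_
    exact congrArg (fun u => fromCoordQ F q₀ q (A u))
      (tangentCoordChange_comp_apply (mem_chart_source _ y) hi h₀ v)
  have h1 := top_form_apply_comp (volCoord i y (w B))
    (tangentCoordChange 𝓘(ℝ, BaseModel n) x₀ i y : BaseModel n →L[ℝ] BaseModel n)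
  have h2 : (volCoord i y (w B)) (fun μ => (tangentCoordChange 𝓘(ℝ, BaseModel n) x₀ i y :
      BaseModel n →L[ℝ] BaseModel n) (stdVec n μ)) = (volCoord x₀ y (w B)) (stdVec n) :=
    congrArg (w B) (funext fun μ =>
      tangentCoordChange_comp_apply h₀ hi (mem_chart_source _ y) (stdVec n μ))
  have h3 : (momentumCoord x₀ y q₀ q w A) (stdVec n) = (volCoord x₀ y (w B)) (stdVec n) := rfl
  rw [h3, ← h2, h1, ← hB]
  rfl

/-- Smoothness of a family can be checked in one pair of charts. -/
theorem smoothFamilyOn_of_chart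
    (hWi : ∀ p ∈ W, p.2 ∈ (chartAt (BaseModel n) i).source)
    (hWk : ∀ p ∈ W, (Ψ p.1 p.2).q ∈ (chartAt F k).source)
    (hq : ∀ p ∈ W, ContMDiffAt (𝓘(ℝ, ℝ).prod 𝓘(ℝ, BaseModel n)) 𝓘(ℝ, F) ∞
      (fun p : ℝ × X => (Ψ p.1 p.2).q) p)
    (hS : ∀ p ∈ W, ContMDiffAt (𝓘(ℝ, ℝ).prod 𝓘(ℝ, BaseModel n)) 𝓘(ℝ, BaseModel n →L[ℝ] EG) ∞
      (fun p : ℝ × X => lieFormCoord i p.2 (Ψ p.1 p.2).σ) p)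
    (hP : ∀ p ∈ W, ContMDiffAt (𝓘(ℝ, ℝ).prod 𝓘(ℝ, BaseModel n))
      𝓘(ℝ, (BaseModel n →L[ℝ] F) →L[ℝ] (BaseModel n) [⋀^Fin (n + 1)]→L[ℝ] ℝ) ∞
      (fun p : ℝ × X => momentumCoord i p.2 k (Ψ p.1 p.2).q (Ψ p.1 p.2).mom) p) :
    SmoothFamilyOn Ψ W := by
  have hcc : ∀ (a b : X) (p : ℝ × X), p.2 ∈ (chartAt (BaseModel n) a).source →
      p.2 ∈ (chartAt (BaseModel n) b).source → ContMDiffAt (𝓘(ℝ, ℝ).prod 𝓘(ℝ, BaseModel n))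
        𝓘(ℝ, BaseModel n →L[ℝ] BaseModel n) ∞ (fun p : ℝ × X =>
          (tangentCoordChange 𝓘(ℝ, BaseModel n) a b p.2 : BaseModel n →L[ℝ] BaseModel n)) p :=
    fun a b p ha hb => (contMDiffAt_tangentCoordChange ha hb).comp p contMDiffAt_snd
  refine ⟨fun p hp => (hq p hp).contMDiffWithinAt, fun x₀ => ?_, fun x₀ q₀ => ?_⟩
  · have h1 : ∀ p ∈ W ∩ {p | p.2 ∈ (chartAt (BaseModel n) x₀).source},
        lieFormCoord x₀ p.2 (Ψ p.1 p.2).σ = lieFormCoord i p.2 (Ψ p.1 p.2).σ ∘L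
      (tangentCoordChange 𝓘(ℝ, BaseModel n) x₀ i p.2 : BaseModel n →L[ℝ] BaseModel n) :=
      fun p hp => lieFormCoord_change (hWi p hp.1) hp.2 _
    refine ContMDiffOn.congr (fun p hp => ContMDiffAt.contMDiffWithinAt ?_) h1
    exact (hS p hp.1).clm_comp (hcc x₀ i p hp.2 (hWi p hp.1))
  · have h1 : ∀ p ∈ W ∩ {p | p.2 ∈ (chartAt (BaseModel n) x₀).source ∧
        (Ψ p.1 p.2).q ∈ (chartAt F q₀).source},
        momentumCoord x₀ p.2 q₀ (Ψ p.1 p.2).q (Ψ p.1 p.2).mom = _ :=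
      fun p hp => momentumCoord_change (hWi p hp.1) hp.2.1 (hWk p hp.1) hp.2.2 _
    refine ContMDiffOn.congr (fun p hp => ContMDiffAt.contMDiffWithinAt ?_) h1
    have hd : ContMDiffAt (𝓘(ℝ, ℝ).prod 𝓘(ℝ, BaseModel n)) 𝓘(ℝ, ℝ) ∞ (fun p : ℝ × X =>
        (tangentCoordChange 𝓘(ℝ, BaseModel n) x₀ i p.2 : BaseModel n →L[ℝ] BaseModel n).det) p :=
      ContMDiffAt.comp (g := fun A : BaseModel n →L[ℝ] BaseModel n => A.det) p
        (contDiff_det n).contMDiff.contMDiffAt (hcc x₀ i p hp.2.1 (hWi p hp.1))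
    have ht : ContMDiffAt (𝓘(ℝ, ℝ).prod 𝓘(ℝ, BaseModel n)) 𝓘(ℝ, F →L[ℝ] F) ∞ (fun p : ℝ × X =>
        (tangentCoordChange 𝓘(ℝ, F) q₀ k (Ψ p.1 p.2).q : F →L[ℝ] F)) p :=
      ContMDiffAt.comp (g := fun q : Q => (tangentCoordChange 𝓘(ℝ, F) q₀ k q : F →L[ℝ] F)) p
        (contMDiffAt_tangentCoordChange hp.2.2 (hWk p hp.1)) (hq p hp.1)
    have ht' : ContMDiffAt (𝓘(ℝ, ℝ).prod 𝓘(ℝ, BaseModel n))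
        𝓘(ℝ, (BaseModel n →L[ℝ] F) →L[ℝ] (BaseModel n →L[ℝ] F)) ∞ (fun p : ℝ × X =>
        ContinuousLinearMap.compL ℝ (BaseModel n) F F
          (tangentCoordChange 𝓘(ℝ, F) q₀ k (Ψ p.1 p.2).q : F →L[ℝ] F)) p :=
      ContMDiffAt.comp (g := ContinuousLinearMap.compL ℝ (BaseModel n) F F) p
        (ContinuousLinearMap.contMDiff _).contMDiffAt ht
    have hc' : ContMDiffAt (𝓘(ℝ, ℝ).prod 𝓘(ℝ, BaseModel n))
        𝓘(ℝ, (BaseModel n →L[ℝ] F) →L[ℝ] (BaseModel n →L[ℝ] F)) ∞ (fun p : ℝ × X =>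
        (ContinuousLinearMap.compL ℝ (BaseModel n) (BaseModel n) F).flip
          (tangentCoordChange 𝓘(ℝ, BaseModel n) i x₀ p.2 : BaseModel n →L[ℝ] BaseModel n)) p :=
      ContMDiffAt.comp (g := (ContinuousLinearMap.compL ℝ (BaseModel n) (BaseModel n) F).flip) p
        (ContinuousLinearMap.contMDiff _).contMDiffAt (hcc i x₀ p (hWi p hp.1) hp.2.1)
    exact hd.smul ((hP p hp.1).clm_comp (ht'.clm_comp hc'))

/-- The momentum with given coordinates in the charts at `i` and `k`. -/
noncomputable def momentumOfCoord (i y : X) (k q : Q)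
    (P : (BaseModel n →L[ℝ] F) →L[ℝ] (BaseModel n) [⋀^Fin (n + 1)]→L[ℝ] ℝ) : Momentum n F y q :=
  volOfCoord i y ∘L (show (BaseModel n →L[ℝ] F) →L[ℝ] (BaseModel n) [⋀^Fin (n + 1)]→L[ℝ] ℝ from P ∘L
    (ContinuousLinearMap.compL ℝ (BaseModel n) F F
      (tangentCoordChange 𝓘(ℝ, F) q k q : F →L[ℝ] F)) ∘L
    ((ContinuousLinearMap.compL ℝ (BaseModel n) (BaseModel n) F).flip
      (fromCoord n i y : BaseModel n →L[ℝ] BaseModel n)))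

theorem momentumCoord_momentumOfCoord {y : X} (hi : y ∈ (chartAt (BaseModel n) i).source) {q : Q}
    (hk : q ∈ (chartAt F k).source)
    (P : (BaseModel n →L[ℝ] F) →L[ℝ] (BaseModel n) [⋀^Fin (n + 1)]→L[ℝ] ℝ) :
    momentumCoord i y k q (momentumOfCoord i y k q P) = P := by
  refine ContinuousLinearMap.ext fun A => ?_
  refine (volCoord_volOfCoord hi _).trans (congrArg P (ContinuousLinearMap.ext fun v => ?_))
  refine (coord_fromCoordQ hk _).trans (congrArg A (toCoord_fromCoord hi v))

theorem momentumOfCoord_momentumCoord {y : X} (hi : y ∈ (chartAt (BaseModel n) i).source) {q : Q}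
    (hk : q ∈ (chartAt F k).source) (w : Momentum n F y q) :
    momentumOfCoord i y k q (momentumCoord i y k q w) = w := by
  refine ContinuousLinearMap.ext fun A => ?_
  refine (congrArg (volOfCoord i y) (momentumCoord_apply hi hk w A)).trans
    (volOfCoord_volCoord hi _)

/-- Perturbation of a section in the charts at `i` and `k`. -/
noncomputable def bumpSection (i : X) (k : Q) (χ : BaseModel n → ℝ)
    (ψ : ∀ x : X, PhaseFiber n EG G F Q x) (b : F) (s : BaseModel n →L[ℝ] EG)
    (w : (BaseModel n →L[ℝ] F) →L[ℝ] (BaseModel n) [⋀^Fin (n + 1)]→L[ℝ] ℝ) (ε : ℝ) (y : X) :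
    PhaseFiber n EG G F Q y :=
  ⟨(extChartAt 𝓘(ℝ, F) k).symm (extChartAt 𝓘(ℝ, F) k (ψ y).q +
      (ε * χ (extChartAt 𝓘(ℝ, BaseModel n) i y)) • b),
    momentumOfCoord i y k _ (momentumCoord i y k (ψ y).q (ψ y).mom +
      (ε * χ (extChartAt 𝓘(ℝ, BaseModel n) i y)) • w),
    lieFormOfCoord i y (lieFormCoord i y (ψ y).σ +
      (ε * χ (extChartAt 𝓘(ℝ, BaseModel n) i y)) • s)⟩

theorem bumpSection_eq {χ : BaseModel n → ℝ} {b : F} {s : BaseModel n →L[ℝ] EG}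
    {w : (BaseModel n →L[ℝ] F) →L[ℝ] (BaseModel n) [⋀^Fin (n + 1)]→L[ℝ] ℝ} {y : X}
    (hi : y ∈ (chartAt (BaseModel n) i).source) (hk : (ψ y).q ∈ (chartAt F k).source)
    (h : ε * χ (extChartAt 𝓘(ℝ, BaseModel n) i y) = 0) :
    bumpSection i k χ ψ b s w ε y = ψ y := by
  -- The momentum component lives over the reconstructed configuration, equal to the original one
  -- only by a theorem. Generalising that configuration permits the substitution.
  have key : ∀ (p : PhaseFiber n EG G F Q y) (q' : Q), q' = p.q → p.q ∈ (chartAt F k).source →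
      (⟨q', momentumOfCoord i y k q' (momentumCoord i y k p.q p.mom),
        lieFormOfCoord i y (lieFormCoord i y p.σ)⟩ : PhaseFiber n EG G F Q y) = p := by
    rintro ⟨q, m, σ⟩ q' rfl hq
    simp only [momentumOfCoord_momentumCoord hi hq, lieFormOfCoord_lieFormCoord hi]
  unfold bumpSection
  have hw : momentumCoord i y k (ψ y).q (ψ y).mom + (0 : ℝ) • w =
      momentumCoord i y k (ψ y).q (ψ y).mom := by
    refine ContinuousLinearMap.ext fun A => ?_
    change momentumCoord i y k (ψ y).q (ψ y).mom A + (0 : ℝ) • w A = _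
    rw [zero_smul, add_zero]
  rw [h, zero_smul, zero_smul, hw, add_zero, add_zero]
  exact key (ψ y) _ (extChartAt_symm_extChartAt hk) hk

/-- The part of `U` where a section can be perturbed in the charts at `i` and `k`. -/
def chartPart (U : Set X) (i : X) (k : Q) (ψ : ∀ x : X, PhaseFiber n EG G F Q x) : Set X :=
  {y | y ∈ U ∧ y ∈ (chartAt (BaseModel n) i).source ∧ (ψ y).q ∈ (chartAt F k).source}

theorem IsSmoothSection.exists_smoothFamilyOn (hU : IsOpen U) (hψ : IsSmoothSection U ψ)
    (hx : x ∈ U) : ∃ W : Set (ℝ × X), IsOpen W ∧ (∀ ε : ℝ, (ε, x) ∈ W) ∧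
      SmoothFamilyOn (fun _ => ψ) W := by
  obtain ⟨W, hW, hxW, ψ', hψ', h⟩ := hψ x (subset_closure hx)
  refine ⟨univ ×ˢ (W ∩ U), isOpen_univ.prod (hW.inter hU), fun ε => ⟨mem_univ _, hxW, hx⟩, ?_⟩
  exact (hψ'.mono (prod_mono_right inter_subset_left)).congr fun p hp =>
    h p.2 ⟨hp.2.1, subset_closure hp.2.2⟩

theorem IsSmoothSection.isOpen_chartPart (hU : IsOpen U) (hψ : IsSmoothSection U ψ) (i : X)
    (k : Q) : IsOpen (chartPart U i k ψ) := by
  refine isOpen_iff_mem_nhds.2 fun x hx => ?_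
  obtain ⟨W, hW, hxW, hsm⟩ := hψ.exists_smoothFamilyOn hU hx.1
  exact inter_mem (hU.mem_nhds hx.1) (inter_mem ((chartAt (BaseModel n) i).open_source.mem_nhds
    hx.2.1) ((hsm.mdifferentiableAt_q hW (hxW 0)).continuousAt.preimage_mem_nhds
      ((chartAt F k).open_source.mem_nhds hx.2.2)))

open Classical in
/-- The variation of a section by a perturbation supported in the charts at `i` and `k`. -/
noncomputable def bumpVariation (U : Set X) (i : X) (k : Q) (χ : BaseModel n → ℝ)
    (ψ : ∀ x : X, PhaseFiber n EG G F Q x) (b : F) (s : BaseModel n →L[ℝ] EG)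
    (w : (BaseModel n →L[ℝ] F) →L[ℝ] (BaseModel n) [⋀^Fin (n + 1)]→L[ℝ] ℝ) (ε : ℝ) (y : X) :
    PhaseFiber n EG G F Q y :=
  if y ∈ chartPart U i k ψ then bumpSection i k χ ψ b s w ε y else ψ y

section Bump

variable {χ : BaseModel n → ℝ} {b : F} {s : BaseModel n →L[ℝ] EG}
    {w : (BaseModel n →L[ℝ] F) →L[ℝ] (BaseModel n) [⋀^Fin (n + 1)]→L[ℝ] ℝ}

theorem bumpVariation_of_mem {y : X} (hy : y ∈ chartPart U i k ψ) :
    bumpVariation U i k χ ψ b s w ε y = bumpSection i k χ ψ b s w ε y := if_pos hy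

theorem bumpVariation_eq {y : X}
    (h : y ∈ chartPart U i k ψ → ε * χ (extChartAt 𝓘(ℝ, BaseModel n) i y) = 0) :
    bumpVariation U i k χ ψ b s w ε y = ψ y := by
  by_cases hy : y ∈ chartPart U i k ψ
  · rw [bumpVariation_of_mem hy, bumpSection_eq hy.2.1 hy.2.2 (h hy)]
  · exact if_neg hy

/-- The support of the perturbation, as a subset of `X`. -/
theorem isCompact_bumpSupport (hχc : HasCompactSupport χ)
    (hχ : tsupport χ ⊆ chartDomain i (chartPart U i k ψ)) :
    IsCompact ((extChartAt 𝓘(ℝ, BaseModel n) i).symm '' tsupport χ) :=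
  hχc.isCompact.image_of_continuousOn ((continuousOn_extChartAt_symm i).mono fun _ hy =>
    (hχ hy).1)

theorem bumpSupport_subset (hχ : tsupport χ ⊆ chartDomain i (chartPart U i k ψ)) :
    (extChartAt 𝓘(ℝ, BaseModel n) i).symm '' tsupport χ ⊆ chartPart U i k ψ := by
  rintro _ ⟨y, hy, rfl⟩
  exact (hχ hy).2

theorem bumpVariation_eq_of_notMem {y : X}
    (hy : y ∉ (extChartAt 𝓘(ℝ, BaseModel n) i).symm '' tsupport χ) :
    bumpVariation U i k χ ψ b s w ε y = ψ y := by
  refine bumpVariation_eq fun hyN => ?_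
  rw [image_eq_zero_of_notMem_tsupport (f := χ), mul_zero]
  exact fun h => hy ⟨_, h, extChartAt_symm_apply hyN.2.1⟩

/-- The perturbation has compact support inside `chartPart`, itself a subset of `U`. Near points of
`chartPart` the family is smooth by its coordinate formula; near all other points of the closure it
is constant in `ε`. In particular nothing moves on the frontier. -/
theorem isVariation_bumpVariation [T2Space X] (hU : IsOpen U) (hψ : IsSmoothSection U ψ)
    (hχs : ContDiff ℝ ∞ χ) (hχc : HasCompactSupport χ)
    (hχ : tsupport χ ⊆ chartDomain i (chartPart U i k ψ)) :
    IsVariation U ψ (bumpVariation U i k χ ψ b s w) where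
  zero x _ := bumpVariation_eq fun _ => zero_mul _
  boundary ε x hx := by
    rw [bumpVariation_eq fun h => ?_]
    rw [hU.frontier_eq] at hx
    exact (hx.2 h.1).elim
  smooth x hx := by
    by_cases hxN : x ∈ chartPart U i k ψ
    · set N := chartPart U i k ψ with hN
      have hNo : IsOpen N := hψ.isOpen_chartPart hU i k
      set f : ℝ × X → F := fun p => extChartAt 𝓘(ℝ, F) k (ψ p.2).q +
        (p.1 * χ (extChartAt 𝓘(ℝ, BaseModel n) i p.2)) • b with hf
      have hc : ∀ p : ℝ × X, p.2 ∈ N → ContMDiffAt (𝓘(ℝ, ℝ).prod 𝓘(ℝ, BaseModel n)) 𝓘(ℝ, ℝ) ∞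
          (fun p : ℝ × X => p.1 * χ (extChartAt 𝓘(ℝ, BaseModel n) i p.2)) p := fun p hp => by
        have h1 : ContMDiffAt (𝓘(ℝ, ℝ).prod 𝓘(ℝ, BaseModel n)) 𝓘(ℝ, BaseModel n) ∞
            (fun p : ℝ × X => extChartAt 𝓘(ℝ, BaseModel n) i p.2) p :=
          (contMDiffAt_extChartAt' hp.2.1).comp p contMDiffAt_snd
        have h2 : ContMDiffAt (𝓘(ℝ, ℝ).prod 𝓘(ℝ, BaseModel n)) 𝓘(ℝ, ℝ) ∞
            (fun p : ℝ × X => χ (extChartAt 𝓘(ℝ, BaseModel n) i p.2)) p :=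
          ContMDiffAt.comp (g := χ) p hχs.contMDiff.contMDiffAt h1
        have h3 : ContMDiffAt (𝓘(ℝ, ℝ).prod 𝓘(ℝ, BaseModel n)) 𝓘(ℝ, ℝ) ∞
            (fun p : ℝ × X => p.1) p := contMDiffAt_fst
        exact h3.smul h2
      have hfc : ∀ p : ℝ × X, p.2 ∈ N → ContMDiffAt (𝓘(ℝ, ℝ).prod 𝓘(ℝ, BaseModel n)) 𝓘(ℝ, F) ∞
          f p := fun p hp => by
        obtain ⟨W, hW, hpW, hsm⟩ := hψ.exists_smoothFamilyOn hU hp.1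
        have h1 : ContMDiffAt (𝓘(ℝ, ℝ).prod 𝓘(ℝ, BaseModel n)) 𝓘(ℝ, F) ∞
            (fun p : ℝ × X => extChartAt 𝓘(ℝ, F) k (ψ p.2).q) p :=
          (contMDiffAt_extChartAt' (x := k) (x' := (ψ p.2).q) hp.2.2).comp p
            (hsm.contMDiffAt_q hW (hpW p.1))
        exact h1.add ((hc p hp).smul contMDiffAt_const)
      -- For large `ε` the shifted coordinates may leave the chart of `Q`, where the inverse chart
      -- has no meaning. On `W`, an open set containing the slice `ε = 0`, they stay inside.
      set W : Set (ℝ × X) := {p | p.2 ∈ N ∧ f p ∈ (extChartAt 𝓘(ℝ, F) k).target} with hWdef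
      have hWo : IsOpen W := by
        refine isOpen_iff_mem_nhds.2 fun p hp => ?_
        exact inter_mem ((hNo.preimage continuous_snd).mem_nhds hp.1)
          ((hfc p hp.1).continuousAt.preimage_mem_nhds
            ((isOpen_extChartAt_target k).mem_nhds hp.2))
      have hWN : ∀ p ∈ W, p.2 ∈ chartPart U i k ψ := fun p hp => hp.1
      have hqs : ∀ p ∈ W, (extChartAt 𝓘(ℝ, F) k).symm (f p) ∈ (chartAt F k).source := fun p hp => by
        simpa using (extChartAt 𝓘(ℝ, F) k).map_target hp.2
      refine ⟨W, hWo, ⟨hxN, ?_⟩, _, ?_, fun p _ _ => rfl⟩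
      · simp only [hf, zero_mul, zero_smul, add_zero]
        exact (extChartAt 𝓘(ℝ, F) k).map_source (by simpa using hxN.2.2)
      · refine SmoothFamilyOn.congr (Ψ' := bumpSection i k χ ψ b s w) ?_
          fun p hp => (bumpVariation_of_mem (hWN p hp)).symm
        refine smoothFamilyOn_of_chart (i := i) (k := k) (fun p hp => (hWN p hp).2.1) hqs
          ?_ ?_ ?_
        · intro p hp
          have h1 : ContMDiffAt 𝓘(ℝ, F) 𝓘(ℝ, F) ∞ (extChartAt 𝓘(ℝ, F) k).symm (f p) :=
            (contMDiffOn_extChartAt_symm k).contMDiffAt ((isOpen_extChartAt_target k).mem_nhds hp.2)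
          exact ContMDiffAt.comp (g := (extChartAt 𝓘(ℝ, F) k).symm) p h1 (hfc p hp.1)
        · intro p hp
          obtain ⟨W', hW', hpW', hsm⟩ := hψ.exists_smoothFamilyOn hU (hWN p hp).1
          have h1 : ContMDiffAt (𝓘(ℝ, ℝ).prod 𝓘(ℝ, BaseModel n)) 𝓘(ℝ, BaseModel n →L[ℝ] EG) ∞
              (fun p : ℝ × X => lieFormCoord i p.2 (ψ p.2).σ) p :=
            (hsm.σ i).contMDiffAt (inter_mem (hW'.mem_nhds (hpW' p.1))
              (continuousAt_snd.preimage_mem_nhds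
                ((chartAt (BaseModel n) i).open_source.mem_nhds (hWN p hp).2.1)))
          refine (h1.add ((hc p hp.1).smul (contMDiffAt_const (c := s)))).congr_of_eventuallyEq ?_
          filter_upwards [hWo.mem_nhds hp] with p' hp'
          exact lieFormCoord_lieFormOfCoord (hWN p' hp').2.1 _
        · intro p hp
          obtain ⟨W', hW', hpW', hsm⟩ := hψ.exists_smoothFamilyOn hU (hWN p hp).1
          have h1 : ContMDiffAt (𝓘(ℝ, ℝ).prod 𝓘(ℝ, BaseModel n))
              𝓘(ℝ, (BaseModel n →L[ℝ] F) →L[ℝ] (BaseModel n) [⋀^Fin (n + 1)]→L[ℝ] ℝ) ∞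
              (fun p : ℝ × X => momentumCoord i p.2 k (ψ p.2).q (ψ p.2).mom) p :=
            (hsm.mom i k).contMDiffAt (inter_mem (hW'.mem_nhds (hpW' p.1)) (by
              filter_upwards [(hNo.preimage continuous_snd).mem_nhds hp.1] with p' hp'
              exact hp'.2))
          refine (h1.add ((hc p hp.1).smul (contMDiffAt_const (c := w)))).congr_of_eventuallyEq ?_
          filter_upwards [hWo.mem_nhds hp] with p' hp'
          exact momentumCoord_momentumOfCoord (hWN p' hp').2.1 (hqs p' hp') _
    -- The support is compact, hence closed as `X` is Hausdorff, so a point outside `chartPart` has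
    -- a neighbourhood that the perturbation does not reach.
    · have hK := (isCompact_bumpSupport hχc hχ).isClosed
      obtain ⟨W, hW, hxW, Ψ', hΨ', h⟩ := hψ.isVariation.smooth x hx
      refine ⟨W ∩ {p | p.2 ∉ (extChartAt 𝓘(ℝ, BaseModel n) i).symm '' tsupport χ},
        hW.inter (hK.isOpen_compl.preimage continuous_snd),
        ⟨hxW, fun hxK => hxN (bumpSupport_subset hχ hxK)⟩, Ψ', hΨ'.mono inter_subset_left,
        fun p hp hpU => ?_⟩
      rw [h p hp.1 hpU, bumpVariation_eq_of_notMem hp.2]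

end Bump

end ChartFamilies

end CovariantClebsch

/-! ### From criticality to the Euler–Lagrange equations. -/

namespace CovariantClebsch

open Filter Set MeasureTheory

section LocalEuler

variable {n : ℕ} {F K V : Type*} [NormedAddCommGroup F] [NormedSpace ℝ F]
  [NormedAddCommGroup K] [NormedSpace ℝ K] [NormedAddCommGroup V] [NormedSpace ℝ V]
  {L : BaseModel n × (BaseModel n →L[ℝ] K) → V} {A : F → K →L[ℝ] F}
  {Q : BaseModel n → F} {S : BaseModel n → BaseModel n →L[ℝ] K}
  {P : BaseModel n → (BaseModel n →L[ℝ] F) →L[ℝ] V} {y : BaseModel n}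

/-- The expression is linear in the variation. Only homogeneity is needed: it extracts the value of
the bump function as a common factor. -/
theorem localEuler_smul (c : ℝ) (b : F) (s : BaseModel n →L[ℝ] K)
    (w : (BaseModel n →L[ℝ] F) →L[ℝ] V) :
    localEuler L A Q S P y (c • b) (c • s) (c • w) = c • localEuler L A Q S P y b s w := by
  have h1 : ∀ μ, (stdCovec n μ).smulRight (c • b) = c • (stdCovec n μ).smulRight b := fun μ =>
    map_smul (ContinuousLinearMap.smulRightL ℝ (BaseModel n) F (stdCovec n μ)) c b
  simp only [localEuler, h1, map_smul, ContinuousLinearMap.comp_smul, ContinuousLinearMap.smul_comp,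
    _root_.smul_apply, ← Finset.smul_sum]
  module

theorem contDiffAt_localEuler (hQ : ContDiffAt ℝ ∞ Q y) (hS : ContDiffAt ℝ ∞ S y)
    (hP : ContDiffAt ℝ ∞ P y) (hA : ContDiffAt ℝ ∞ A (Q y)) (hL : ContDiffAt ℝ ∞ L (y, S y))
    (b : F) (s : BaseModel n →L[ℝ] K) (w : (BaseModel n →L[ℝ] F) →L[ℝ] V) :
    ContDiffAt ℝ ∞ (fun z => localEuler L A Q S P z b s w) y := by
  have hzS : ContDiffAt ℝ ∞ (fun z => (z, S z)) y := contDiffAt_id.prodMk hS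
  have hAQ : ContDiffAt ℝ ∞ (fun z => A (Q z)) y := hA.comp y hQ
  have hdA : ContDiffAt ℝ ∞ (fun z => fderiv ℝ A (Q z)) y :=
    ContDiffAt.comp (g := fderiv ℝ A) y (hA.fderiv_right (by simp)) hQ
  have hdQ : ContDiffAt ℝ ∞ (fderiv ℝ Q) y := hQ.fderiv_right (by simp)
  have hdP : ∀ (B : BaseModel n →L[ℝ] F) (v : BaseModel n),
      ContDiffAt ℝ ∞ (fun z => fderiv ℝ P z v B) y := fun B v => by
    have h2 : ContDiffAt ℝ ∞ (fun z => P z B) y := hP.clm_apply contDiffAt_const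
    have h3 : ContDiffAt ℝ ∞ (fderiv ℝ (fun z => P z B)) y := h2.fderiv_right (by simp)
    refine (h3.clm_apply (contDiffAt_const (c := v))).congr_of_eventuallyEq ?_
    filter_upwards [(hP.of_le (show (1 : WithTop ℕ∞) ≤ ∞ by simp)).eventually (by simp)] with z hz
    have h4 := (hz.differentiableAt (by simp)).hasFDerivAt.clm_apply (hasFDerivAt_const B z)
    refine Eq.trans ?_ (congrArg (fun T => T v) h4.fderiv).symm
    simp
  have h1 : ContDiffAt ℝ ∞ (fun z => fderiv ℝ (fun s => L (z, s)) (S z) s) y := by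
    have h2 : ContDiffAt ℝ ∞ (fun z => fderiv ℝ L (z, S z) (0, s)) y :=
      (ContDiffAt.comp (g := fderiv ℝ L) y (hL.fderiv_right (by simp)) hzS).clm_apply
        contDiffAt_const
    refine h2.congr_of_eventuallyEq ?_
    filter_upwards [hzS.continuousAt.eventually ((hL.of_le
      (show (1 : WithTop ℕ∞) ≤ ∞ by simp)).eventually (by simp))] with z hz
    have h3 : HasFDerivAt (fun s => L (z, s)) (fderiv ℝ L (z, S z) ∘L
        ContinuousLinearMap.inr ℝ (BaseModel n) _) (S z) :=
      HasFDerivAt.comp (g := L) (S z) (hz.differentiableAt (by simp)).hasFDerivAt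
        (hasFDerivAt_prodMk_right z (S z))
    rw [h3.fderiv]
    rfl
  unfold localEuler
  refine ((h1.sub (hP.clm_apply (hAQ.clm_comp contDiffAt_const))).add
    (contDiffAt_const.clm_apply (hdQ.sub (hAQ.clm_comp hS)))).sub
    ((ContDiffAt.sum fun μ _ => hdP _ _).add
      (hP.clm_apply ((hdA.clm_apply contDiffAt_const).clm_comp hS)))

end LocalEuler

theorem hasDerivAt_add_mul_smul {V : Type*} [NormedAddCommGroup V] [NormedSpace ℝ V] (a w : V)
    (c : ℝ) : HasDerivAt (fun ε : ℝ => a + (ε * c) • w) (c • w) 0 := by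
  have h := (((hasDerivAt_id (0 : ℝ)).mul_const c).smul_const w).const_add a
  rwa [one_mul] at h

section EulerLagrange

variable {n : ℕ}
  {EG : Type*} [NormedAddCommGroup EG] [NormedSpace ℝ EG] [FiniteDimensional ℝ EG]
  {G : Type*} [TopologicalSpace G] [ChartedSpace EG G] [Group G] [LieGroup 𝓘(ℝ, EG) ∞ G]
  {F : Type*} [NormedAddCommGroup F] [NormedSpace ℝ F] [FiniteDimensional ℝ F]
  {Q : Type*} [TopologicalSpace Q] [ChartedSpace F Q] [IsManifold 𝓘(ℝ, F) ∞ Q] [MulAction G Q]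
  {X : Type*} [TopologicalSpace X] [ChartedSpace (BaseModel n) X]
  [IsManifold 𝓘(ℝ, BaseModel n) ∞ X]

variable {Ψ : ℝ → ∀ x : X, PhaseFiber n EG G F Q x} {W : Set (ℝ × X)} {ε : ℝ} {x i : X} {k : Q}
  {ψ : ∀ x : X, PhaseFiber n EG G F Q x} {U : Set X}

theorem IsSmoothSection.contDiffAt_coordQ (hU : IsOpen U) (hψ : IsSmoothSection U ψ) (hxU : x ∈ U)
    (hx : x ∈ (chartAt (BaseModel n) i).source) (hk : (ψ x).q ∈ (chartAt F k).source) :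
    ContDiffAt ℝ ∞ (coordQ i k ψ) (extChartAt 𝓘(ℝ, BaseModel n) i x) := by
  obtain ⟨W, hW, hxW, hsm⟩ := hψ.exists_smoothFamilyOn hU hxU
  exact ContDiffAt.comp (g := fun p : ℝ × BaseModel n => coordQ i k ψ p.2)
    (f := fun z => ((0 : ℝ), z)) _ (hsm.contDiffAt_coordQ hW (hxW 0) hx hk)
    (contDiffAt_const.prodMk contDiffAt_id)

theorem IsSmoothSection.contDiffAt_coordS (hU : IsOpen U) (hψ : IsSmoothSection U ψ) (hxU : x ∈ U)
    (hx : x ∈ (chartAt (BaseModel n) i).source) :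
    ContDiffAt ℝ ∞ (coordS i ψ) (extChartAt 𝓘(ℝ, BaseModel n) i x) := by
  obtain ⟨W, hW, hxW, hsm⟩ := hψ.exists_smoothFamilyOn hU hxU
  exact ContDiffAt.comp (g := fun p : ℝ × BaseModel n => coordS i ψ p.2)
    (f := fun z => ((0 : ℝ), z)) _ (hsm.contDiffAt_coordS hW (hxW 0) hx)
    (contDiffAt_const.prodMk contDiffAt_id)

theorem IsSmoothSection.contDiffAt_coordP (hU : IsOpen U) (hψ : IsSmoothSection U ψ) (hxU : x ∈ U)
    (hx : x ∈ (chartAt (BaseModel n) i).source) (hk : (ψ x).q ∈ (chartAt F k).source) :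
    ContDiffAt ℝ ∞ (coordP i k ψ) (extChartAt 𝓘(ℝ, BaseModel n) i x) := by
  obtain ⟨W, hW, hxW, hsm⟩ := hψ.exists_smoothFamilyOn hU hxU
  exact ContDiffAt.comp (g := fun p : ℝ × BaseModel n => coordP i k ψ p.2)
    (f := fun z => ((0 : ℝ), z)) _ (hsm.contDiffAt_coordP hW (hxW 0) hx hk)
    (contDiffAt_const.prodMk contDiffAt_id)

theorem IsSmoothSection.contDiffAt_eulerCoord
    (hact : ContMDiff (𝓘(ℝ, EG).prod 𝓘(ℝ, F)) 𝓘(ℝ, F) ∞ (fun p : G × Q => p.1 • p.2))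
    {ℓ : Density n EG G X} (hℓ : ℓ.IsSmooth) (hU : IsOpen U) (hψ : IsSmoothSection U ψ)
    (hxU : x ∈ U) (hx : x ∈ (chartAt (BaseModel n) i).source)
    (hk : (ψ x).q ∈ (chartAt F k).source) (b : F) (s : BaseModel n →L[ℝ] EG)
    (w : (BaseModel n →L[ℝ] F) →L[ℝ] (BaseModel n) [⋀^Fin (n + 1)]→L[ℝ] ℝ) :
    ContDiffAt ℝ ∞ (fun z => eulerCoord ℓ i k ψ z b s w) (extChartAt 𝓘(ℝ, BaseModel n) i x) := by
  have hA : ContDiffAt ℝ ∞ (infGenCoord EG G k)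
      (coordQ i k ψ (extChartAt 𝓘(ℝ, BaseModel n) i x)) := by
    rw [coordQ_extChartAt hx]
    exact contDiffAt_infGenCoord hact hk
  exact contDiffAt_localEuler (hψ.contDiffAt_coordQ hU hxU hx hk) (hψ.contDiffAt_coordS hU hxU hx)
    (hψ.contDiffAt_coordP hU hxU hx hk) hA (contDiffAt_lagCoord hℓ hx _) b s w

/-- The derivative of the integrand along a variation is a regular density. -/
theorem IsVariation.isRegularDensity_variationForm
    (hact : ContMDiff (𝓘(ℝ, EG).prod 𝓘(ℝ, F)) 𝓘(ℝ, F) ∞ (fun p : G × Q => p.1 • p.2))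
    {ℓ : Density n EG G X} (hℓ : ℓ.IsSmooth) (hU : IsOpen U) (hΨ : IsVariation U ψ Ψ) :
    IsRegularDensity U (variationForm ℓ Ψ) := by
  refine isRegularDensity_of_local hU fun i x hx hxi => ?_
  obtain ⟨W, hW, hxW, Ψ', hΨ', hΨΨ'⟩ := hΨ.smooth x hx
  set k := (Ψ' 0 x).q
  have hks : (Ψ' 0 x).q ∈ (chartAt F k).source := mem_chart_source F _
  have hc := (evalStd n).contDiff.contDiffAt.comp _
    (hΨ'.contDiffAt_localIntegrand hW hact hℓ hxW hxi hks)
  refine ⟨_, (contDiffAt_deriv_slice hc).continuousAt, ?_⟩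
  have ht : Tendsto (fun z : BaseModel n => ((0 : ℝ), z)) (𝓝 (extChartAt 𝓘(ℝ, BaseModel n) i x))
      (𝓝 (0, extChartAt 𝓘(ℝ, BaseModel n) i x)) := by
    have : ContinuousAt (fun z : BaseModel n => ((0 : ℝ), z))
      (extChartAt 𝓘(ℝ, BaseModel n) i x) := by fun_prop
    exact this
  have hWn : ∀ᶠ p in 𝓝 ((0 : ℝ), extChartAt 𝓘(ℝ, BaseModel n) i x),
      (p.1, (extChartAt 𝓘(ℝ, BaseModel n) i).symm p.2) ∈ W :=
    (tendsto_coord_family hxi).eventually (hW.mem_nhds hxW)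
  filter_upwards [ht.eventually (((hΨ'.eventually_chartDensity hW hxW ℓ hxi hks).and
    hWn).eventually_nhds)] with z hz hzU
  obtain ⟨y, hyU, hyi, rfl⟩ := exists_of_mem_chartDomain hzU
  obtain ⟨W₁, hW₁, hyW₁, hsm⟩ := hΨ.exists_smoothFamilyOn hU hyU
  rw [hsm.chartDensity_variationForm hW₁ hact hℓ hyW₁ hyi]
  refine Filter.EventuallyEq.deriv_eq ?_
  filter_upwards [(tendsto_prodMk_zero _).eventually hz] with ε hε
  refine Eq.trans ?_ hε.1
  have hεW : (ε, y) ∈ W := by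
    have := hε.2
    rwa [extChartAt_symm_apply hyi] at this
  rw [chartDensity_extChartAt hyi, chartDensity_extChartAt hyi]
  have : ∀ᶠ y' in 𝓝 y, Ψ ε y' = Ψ' ε y' := by
    have hsl : ContinuousAt (fun y : X => (ε, y)) y := by fun_prop
    filter_upwards [hsl.preimage_mem_nhds (hW.mem_nhds hεW), hU.mem_nhds hyU] with y' hy' hy'U
    exact (hΨΨ' _ hy' (subset_closure hy'U)).symm
  rw [reducedForm_congr ℓ this]

theorem eulerCoord_smul (ℓ : Density n EG G X) (z : BaseModel n) (c : ℝ) (b : F)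
    (s : BaseModel n →L[ℝ] EG)
    (w : (BaseModel n →L[ℝ] F) →L[ℝ] (BaseModel n) [⋀^Fin (n + 1)]→L[ℝ] ℝ) :
    eulerCoord ℓ i k ψ z (c • b) (c • s) (c • w) = c • eulerCoord ℓ i k ψ z b s w :=
  localEuler_smul (L := lagCoord i ℓ) (A := infGenCoord EG G k) (Q := coordQ i k ψ)
    (S := coordS i ψ) (P := coordP i k ψ) c b s w

section Bump

variable {χ : BaseModel n → ℝ} {b : F} {s : BaseModel n →L[ℝ] EG}
    {w : (BaseModel n →L[ℝ] F) →L[ℝ] (BaseModel n) [⋀^Fin (n + 1)]→L[ℝ] ℝ}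

/-- The first variation along a perturbation supported in a chart. -/
theorem chartDensity_variationForm_bumpVariation [T2Space X]
    (hact : ContMDiff (𝓘(ℝ, EG).prod 𝓘(ℝ, F)) 𝓘(ℝ, F) ∞ (fun p : G × Q => p.1 • p.2))
    {ℓ : Density n EG G X} (hℓ : ℓ.IsSmooth) (hU : IsOpen U) (hψ : IsSmoothSection U ψ)
    (hχs : ContDiff ℝ ∞ χ) (hχc : HasCompactSupport χ)
    (hχ : tsupport χ ⊆ chartDomain i (chartPart U i k ψ)) (hx : x ∈ chartPart U i k ψ) :
    chartDensity i (variationForm ℓ (bumpVariation U i k χ ψ b s w))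
        (extChartAt 𝓘(ℝ, BaseModel n) i x) =
      χ (extChartAt 𝓘(ℝ, BaseModel n) i x) *
        evalStd n (eulerCoord ℓ i k ψ (extChartAt 𝓘(ℝ, BaseModel n) i x) b s w) +
      ∑ μ, fderiv ℝ (fun z => χ z * evalStd n (coordP i k ψ z ((stdCovec n μ).smulRight b)))
        (extChartAt 𝓘(ℝ, BaseModel n) i x) (stdVec n μ) := by
  have hvar := isVariation_bumpVariation (b := b) (s := s) (w := w) hU hψ hχs hχc hχ
  have hNo := hψ.isOpen_chartPart hU i k
  obtain ⟨W, hW, hxW, hsm⟩ := hvar.exists_smoothFamilyOn hU hx.1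
  have h0 : ∀ y, bumpVariation U i k χ ψ b s w 0 y = ψ y := fun y =>
    bumpVariation_eq fun _ => zero_mul _
  -- For small `ε` the perturbed coordinates remain in the chart, so the coordinates of the
  -- perturbed section are the perturbed coordinates.
  have hsmall : ∀ y ∈ chartPart U i k ψ, ∀ᶠ ε : ℝ in 𝓝 0, extChartAt 𝓘(ℝ, F) k (ψ y).q +
      (ε * χ (extChartAt 𝓘(ℝ, BaseModel n) i y)) • b ∈ (extChartAt 𝓘(ℝ, F) k).target := by
    intro y hy
    have hc : ContinuousAt (fun ε : ℝ => extChartAt 𝓘(ℝ, F) k (ψ y).q +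
      (ε * χ (extChartAt 𝓘(ℝ, BaseModel n) i y)) • b) 0 := by fun_prop
    refine hc.preimage_mem_nhds ((isOpen_extChartAt_target k).mem_nhds ?_)
    simp only [zero_mul, zero_smul, add_zero]
    exact (extChartAt 𝓘(ℝ, F) k).map_source (by simpa using hy.2.2)
  have hvQ : ∀ y ∈ chartPart U i k ψ, varQ i k (bumpVariation U i k χ ψ b s w)
      (extChartAt 𝓘(ℝ, BaseModel n) i y) = χ (extChartAt 𝓘(ℝ, BaseModel n) i y) • b := by
    intro y hy
    simp only [varQ, coordQ_extChartAt hy.2.1]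
    have h1 := hasDerivAt_add_mul_smul (extChartAt 𝓘(ℝ, F) k (ψ y).q)
      b (χ (extChartAt 𝓘(ℝ, BaseModel n) i y))
    refine HasDerivAt.deriv (h1.congr_of_eventuallyEq ?_)
    filter_upwards [hsmall y hy] with ε hε
    rw [bumpVariation_of_mem hy]
    exact (extChartAt 𝓘(ℝ, F) k).right_inv hε
  have hvS : deriv (fun ε => coordS i (bumpVariation U i k χ ψ b s w ε)
      (extChartAt 𝓘(ℝ, BaseModel n) i x)) 0 = χ (extChartAt 𝓘(ℝ, BaseModel n) i x) • s := by
    simp only [coordS_extChartAt hx.2.1]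
    have h1 := hasDerivAt_add_mul_smul (lieFormCoord i x (ψ x).σ)
      s (χ (extChartAt 𝓘(ℝ, BaseModel n) i x))
    refine HasDerivAt.deriv (h1.congr_of_eventuallyEq ?_)
    refine Eventually.of_forall fun ε => ?_
    beta_reduce
    rw [bumpVariation_of_mem hx]
    exact lieFormCoord_lieFormOfCoord hx.2.1 _
  have hvP : deriv (fun ε => coordP i k (bumpVariation U i k χ ψ b s w ε)
      (extChartAt 𝓘(ℝ, BaseModel n) i x)) 0 = χ (extChartAt 𝓘(ℝ, BaseModel n) i x) • w := by
    simp only [coordP_extChartAt hx.2.1]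
    have h1 := hasDerivAt_add_mul_smul (momentumCoord i x k (ψ x).q (ψ x).mom)
      w (χ (extChartAt 𝓘(ℝ, BaseModel n) i x))
    refine HasDerivAt.deriv (h1.congr_of_eventuallyEq ?_)
    filter_upwards [hsmall x hx] with ε hε
    rw [bumpVariation_of_mem hx]
    exact momentumCoord_momentumOfCoord hx.2.1
      (by rw [← extChartAt_source 𝓘(ℝ, F)]; exact (extChartAt 𝓘(ℝ, F) k).map_target hε) _
  have hk : (bumpVariation U i k χ ψ b s w 0 x).q ∈ (chartAt F k).source := by
    rw [h0]; exact hx.2.2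
  rw [hsm.chartDensity_variationForm_eq hW hact hℓ hxW hx.2.1 hk, hvQ x hx, hvS, hvP,
    eulerCoord_congr ℓ (Eventually.of_forall h0) hx.2.1]
  refine congrArg₂ _ ?_ (Finset.sum_congr rfl fun μ _ => ?_)
  · rw [eulerCoord_smul, map_smul, smul_eq_mul]
  · have hev : (fun z => evalStd n (coordP i k (bumpVariation U i k χ ψ b s w 0) z
        ((stdCovec n μ).smulRight (varQ i k (bumpVariation U i k χ ψ b s w) z))))
        =ᶠ[𝓝 (extChartAt 𝓘(ℝ, BaseModel n) i x)]
        fun z => χ z * evalStd n (coordP i k ψ z ((stdCovec n μ).smulRight b)) := by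
      filter_upwards [(isOpen_chartDomain i hNo).mem_nhds ((mem_chartDomain_iff hx.2.1).2 hx)]
        with z hz
      obtain ⟨y, hyN, hyi, rfl⟩ := exists_of_mem_chartDomain hz
      have hP0 : coordP i k (bumpVariation U i k χ ψ b s w 0) (extChartAt 𝓘(ℝ, BaseModel n) i y) =
          coordP i k ψ (extChartAt 𝓘(ℝ, BaseModel n) i y) := by
        rw [coordP_extChartAt hyi, coordP_extChartAt hyi, h0]
      rw [hvQ y hyN, hP0]
      have h1 : (stdCovec n μ).smulRight (χ (extChartAt 𝓘(ℝ, BaseModel n) i y) • b) =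
          χ (extChartAt 𝓘(ℝ, BaseModel n) i y) • (stdCovec n μ).smulRight b :=
        map_smul (ContinuousLinearMap.smulRightL ℝ (BaseModel n) F (stdCovec n μ)) _ b
      rw [h1, map_smul, map_smul, smul_eq_mul]
    rw [hev.fderiv_eq]

end Bump

/-- Critical sections satisfy the Euler–Lagrange equations. -/
theorem eulerCoord_of_isCritical [T2Space X] [SigmaCompactSpace X] [OrientedAtlas n X]
    (hact : ContMDiff (𝓘(ℝ, EG).prod 𝓘(ℝ, F)) 𝓘(ℝ, F) ∞ (fun p : G × Q => p.1 • p.2))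
    {ℓ : Density n EG G X} (hℓ : ℓ.IsSmooth) (hU : IsOpen U) (hUc : IsCompact (closure U))
    (hψ : IsSmoothSection U ψ) (hcrit : IsCritical U (reducedAction ℓ U) ψ)
    (hxU : x ∈ U) (hx : x ∈ (chartAt (BaseModel n) i).source)
    (hk : (ψ x).q ∈ (chartAt F k).source) (b : F) (s : BaseModel n →L[ℝ] EG)
    (w : (BaseModel n →L[ℝ] F) →L[ℝ] (BaseModel n) [⋀^Fin (n + 1)]→L[ℝ] ℝ) :
    eulerCoord ℓ i k ψ (extChartAt 𝓘(ℝ, BaseModel n) i x) b s w = 0 := by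
  have hNo := hψ.isOpen_chartPart hU i k
  set N := chartPart U i k ψ with hN
  set V := chartDomain (n := n) i N with hV
  have hVo : IsOpen V := isOpen_chartDomain i hNo
  set e : BaseModel n → ℝ := fun z => evalStd n (eulerCoord ℓ i k ψ z b s w) with he
  have hec : ContinuousOn e V := by
    intro z hz
    obtain ⟨y, hy, hyi, rfl⟩ := exists_of_mem_chartDomain hz
    exact ((evalStd n).continuous.continuousAt.comp
      (hψ.contDiffAt_eulerCoord hact hℓ hU hy.1 hyi hy.2.2 b s w).continuousAt).continuousWithinAt
  -- The test variation is `χ` times the constant direction `(b, s, w)`. Its first variation is `χ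
  -- e` plus the divergence of a field with compact support in `V`, so criticality gives `∫ χ e =
  -- 0`.
  have hint : ∀ χ : BaseModel n → ℝ, ContDiff ℝ ∞ χ → HasCompactSupport χ → tsupport χ ⊆ V →
      ∫ z, χ z • e z = 0 := by
    intro χ hχs hχc hχ
    have hvar := isVariation_bumpVariation (b := b) (s := s) (w := w) hU hψ hχs hχc hχ
    set Ψ := bumpVariation U i k χ ψ b s w with hΨ
    set K := (extChartAt 𝓘(ℝ, BaseModel n) i).symm '' tsupport χ with hKdef
    have hK : IsCompact K := isCompact_bumpSupport hχc hχ
    have hKN : K ⊆ N := bumpSupport_subset hχ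
    have hKU : K ⊆ closure U := fun y hy => subset_closure (hKN hy).1
    have hKi : K ⊆ (chartAt (BaseModel n) i).source := fun y hy => (hKN hy).2.1
    have hreg := hvar.isRegularDensity_variationForm hact hℓ hU
    -- Off the support the family is constant in `ε` on a neighbourhood, so the whole integral can
    -- be computed in the single chart at `i`.
    have hD0 : ∀ y, y ∉ K → variationForm ℓ Ψ y = 0 := by
      intro y hy
      have h1 : ∀ ε, reducedForm ℓ (Ψ ε) y = reducedForm ℓ ψ y := fun ε => by
        refine reducedForm_congr ℓ ?_
        filter_upwards [hK.isClosed.isOpen_compl.mem_nhds hy] with y' hy'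
        exact bumpVariation_eq_of_notMem hy'
      simp only [variationForm, h1, deriv_const]
      exact map_zero _
    have h1 : formIntegral n U (variationForm ℓ Ψ) = 0 :=
      (hvar.hasDerivAt_reducedAction hact hℓ hU hUc).unique (hcrit Ψ hvar)
    rw [formIntegral_eq_chart hU hreg hK hKU hKi fun y _ hy => hD0 y hy] at h1
    have hI : IntegrableOn (chartDensity i (variationForm ℓ Ψ)) (chartDomain i U) := by
      have := hreg.integrableOn hU hK hKi hKU (continuous_const (y := (1 : ℝ)))
        fun y _ hyi hyK => by rw [chartDensity_extChartAt hyi, hD0 y hyK, one_mul]; rfl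
      simpa using this
    have hVU : V ⊆ chartDomain i U := fun z hz => ⟨hz.1, hz.2.1⟩
    rw [setIntegral_eq_of_subset_of_forall_sdiff_eq_zero (isOpen_chartDomain i hU).measurableSet
      hVU] at h1
    swap
    · intro z hz
      obtain ⟨y, hyU, hyi, rfl⟩ := exists_of_mem_chartDomain hz.1
      rw [chartDensity_extChartAt hyi, hD0 y fun hyK => hz.2
        ((mem_chartDomain_iff hyi).2 (hKN hyK))]
      rfl
    let G' : Fin (n + 1) → BaseModel n → ℝ := fun μ z =>
      χ z * evalStd n (coordP i k ψ z ((stdCovec n μ).smulRight b))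
    have hG : ∀ μ, IntegrableOn (fun z => fderiv ℝ (G' μ) z (stdVec n μ)) V ∧
        ∫ z in V, fderiv ℝ (G' μ) z (stdVec n μ) = 0 := by
      intro μ
      refine setIntegral_fderiv_eq_zero hVo hχc.isCompact ?_ ?_ _
      · intro z _ hz
        simp only [G', image_eq_zero_of_notMem_tsupport hz, zero_mul]
      · intro z hz
        refine ⟨G' μ, ?_, Eventually.of_forall fun _ _ => rfl, fun h => (h (hχ hz)).elim⟩
        obtain ⟨y, hy, hyi, rfl⟩ := exists_of_mem_chartDomain (hχ hz)
        have h2 := (hψ.contDiffAt_coordP hU hy.1 hyi hy.2.2).clm_apply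
          (contDiffAt_const (c := (stdCovec n μ).smulRight b))
        exact (hχs.contDiffAt.mul ((evalStd n).contDiff.contDiffAt.comp _ h2)).of_le (by simp)
    have hfe : ∀ z ∈ V, chartDensity i (variationForm ℓ Ψ) z =
        χ z * e z + ∑ μ, fderiv ℝ (G' μ) z (stdVec n μ) := by
      intro z hz
      obtain ⟨y, hy, hyi, rfl⟩ := exists_of_mem_chartDomain hz
      exact chartDensity_variationForm_bumpVariation hact hℓ hU hψ hχs hχc hχ hy
    have hsum : IntegrableOn (fun z => ∑ μ, fderiv ℝ (G' μ) z (stdVec n μ)) V :=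
      integrable_finsetSum _ fun μ _ => (hG μ).1
    have hχe : IntegrableOn (fun z => χ z * e z) V := by
      refine ((hI.mono_set hVU).sub hsum).congr ?_
      refine (ae_restrict_iff' hVo.measurableSet).2 (Eventually.of_forall fun z hz => ?_)
      simp only [Pi.sub_apply, hfe z hz, add_sub_cancel_right]
    rw [setIntegral_congr_fun hVo.measurableSet hfe, integral_add hχe hsum,
      integral_finsetSum _ fun μ _ => (hG μ).1, Finset.sum_eq_zero fun μ _ => (hG μ).2,
      add_zero] at h1
    rw [← h1, setIntegral_eq_integral_of_forall_compl_eq_zero]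
    · rfl
    · intro z hz
      rw [image_eq_zero_of_notMem_tsupport fun h => hz (hχ h), zero_mul]
  -- The fundamental lemma gives vanishing almost everywhere, and continuity upgrades it to every
  -- point. The value on the standard basis then determines the top-degree form.
  have hae : ∀ᵐ z, z ∈ V → e z = 0 := hVo.ae_eq_zero_of_integral_contDiff_smul_eq_zero
    (hec.locallyIntegrableOn hVo.measurableSet) hint
  have hEq : EqOn e (fun _ => 0) V :=
    Measure.eqOn_open_of_ae_eq ((ae_restrict_iff' hVo.measurableSet).2 hae) hVo hec
      continuousOn_const
  refine top_form_ext ?_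
  exact hEq ((mem_chartDomain_iff hx).2 ⟨hxU, hx, hk⟩)

end EulerLagrange

end CovariantClebsch

namespace CovariantClebsch

open Filter Set

/-! ### Covariant derivatives in a chart and the meaning of vanishing torsion. -/

section Connection

variable {F : Type*} [NormedAddCommGroup F] [NormedSpace ℝ F] [FiniteDimensional ℝ F]
  {Q : Type*} [TopologicalSpace Q] [ChartedSpace F Q] [IsManifold 𝓘(ℝ, F) ∞ Q] {q : Q}

theorem constField_self (b : TangentSpace 𝓘(ℝ, F) q) : constField b q = b :=
  congrArg (fun T : F →L[ℝ] F => T b) (tangentCoordChange_self_clm (mem_chart_source F q))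

theorem mfderiv_extChartAt_self :
    mfderiv 𝓘(ℝ, F) 𝓘(ℝ, F) (extChartAt 𝓘(ℝ, F) q) q = ContinuousLinearMap.id ℝ F := by
  have hd : MDifferentiableAt 𝓘(ℝ, F) 𝓘(ℝ, F) (extChartAt 𝓘(ℝ, F) q) q :=
    (contMDiffAt_extChartAt (n := ∞)).mdifferentiableAt (by simp)
  have h1 := hasFDerivAt_coord_vector hd (mem_chart_source F q)
  rw [tangentCoordChange_self_clm (mem_chart_source F q)] at h1
  have h2 : HasFDerivAt (extChartAt 𝓘(ℝ, F) q ∘ (extChartAt 𝓘(ℝ, F) q).symm)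
      (ContinuousLinearMap.id ℝ F) (extChartAt 𝓘(ℝ, F) q q) := by
    refine (hasFDerivAt_id _).congr_of_eventuallyEq ?_
    filter_upwards [(isOpen_extChartAt_target (I := 𝓘(ℝ, F)) q).mem_nhds
      (mem_extChartAt_target q)] with a ha
    exact (extChartAt 𝓘(ℝ, F) q).right_inv ha
  exact HasFDerivAt.unique (𝕜 := ℝ) (E := F) (F := F) h1 h2

theorem mdifferentiableAt_comp_extChartAt {W : Type*} [NormedAddCommGroup W] [NormedSpace ℝ W]
    {g : F → W} (hg : DifferentiableAt ℝ g (extChartAt 𝓘(ℝ, F) q q)) :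
    MDifferentiableAt 𝓘(ℝ, F) 𝓘(ℝ, W) (fun q' : Q => g (extChartAt 𝓘(ℝ, F) q q')) q :=
  MDifferentiableAt.comp (g := g) q hg.mdifferentiableAt
    ((contMDiffAt_extChartAt (n := ∞)).mdifferentiableAt (by simp))

theorem mfderiv_comp_extChartAt {W : Type*} [NormedAddCommGroup W] [NormedSpace ℝ W]
    {g : F → W} (hg : DifferentiableAt ℝ g (extChartAt 𝓘(ℝ, F) q q)) :
    (mfderiv 𝓘(ℝ, F) 𝓘(ℝ, W) (fun q' : Q => g (extChartAt 𝓘(ℝ, F) q q')) q : F →L[ℝ] W) =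
      fderiv ℝ g (extChartAt 𝓘(ℝ, F) q q) := by
  have h := mfderiv_comp (I := 𝓘(ℝ, F)) (I' := 𝓘(ℝ, F)) (I'' := 𝓘(ℝ, W)) (g := g) q
    hg.mdifferentiableAt
    ((contMDiffAt_extChartAt (n := ∞) (I := 𝓘(ℝ, F)) (x := q)).mdifferentiableAt (by simp))
  refine h.trans ?_
  rw [mfderiv_extChartAt_self, mfderiv_eq_fderiv]
  rfl

variable (cov : CovariantDerivative 𝓘(ℝ, F) F (TangentSpace 𝓘(ℝ, F) : Q → Type _))

theorem cov_sum {ι : Type*} (s : Finset ι) {t : ι → ∀ q' : Q, TangentSpace 𝓘(ℝ, F) q'}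
    (ht : ∀ j, MDifferentiableAt 𝓘(ℝ, F) 𝓘(ℝ, F).tangent
      (fun q' : Q => (⟨q', t j q'⟩ : TangentBundle 𝓘(ℝ, F) Q)) q) :
    cov (fun q' => ∑ j ∈ s, t j q') q = ∑ j ∈ s, cov (t j) q := by
  classical
  induction s using Finset.induction_on with
  | empty =>
    simp only [Finset.sum_empty]
    exact cov.isCovariantDerivativeOnUniv.zero (x := q)
  | insert i s hi h =>
    simp only [Finset.sum_insert hi]
    rw [← h]
    exact cov.isCovariantDerivativeOnUniv.add (ht i)
      (MDifferentiableAt.sum_section fun j _ => ht j)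

/-- The covariant derivative of a vector field in terms of its components in a chart. -/
theorem cov_eq_fderiv_add {V : ∀ q' : Q, TangentSpace 𝓘(ℝ, F) q'} {v : F → F}
    (hv : DifferentiableAt ℝ v (extChartAt 𝓘(ℝ, F) q q))
    (hV : ∀ᶠ q' in 𝓝 q, V q' = fromCoordQ F q q' (v (extChartAt 𝓘(ℝ, F) q q')))
    (b : TangentSpace 𝓘(ℝ, F) q) :
    (show F from cov V q b) = fderiv ℝ v (extChartAt 𝓘(ℝ, F) q q) b +
      (show F from christoffel cov q b (V q)) := by
  classical
  -- The field is a sum of coefficient functions times fields that are constant in the chart. The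
  -- Leibniz rule differentiates the coefficients, and the constant fields contribute the
  -- Christoffel term.
  let e := Module.finBasis ℝ F
  let g : Fin (Module.finrank ℝ F) → Q → ℝ := fun j q' => e.coord j (v (extChartAt 𝓘(ℝ, F) q q'))
  let c : ∀ j : Fin (Module.finrank ℝ F), ∀ q' : Q, TangentSpace 𝓘(ℝ, F) q' :=
    fun j => constField (q₀ := q) (e j)
  have hc : ∀ j, MDifferentiableAt 𝓘(ℝ, F) 𝓘(ℝ, F).tangent
      (fun q' : Q => (⟨q', c j q'⟩ : TangentBundle 𝓘(ℝ, F) Q)) q := fun j =>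
    mdifferentiableAt_constField (q₀ := q) (e j)
  have hcq : ∀ j, (c j q : F) = e j := fun j => constField_self (q := q) (e j)
  have hcoord : ∀ j, DifferentiableAt ℝ (fun a => e.coord j (v a)) (extChartAt 𝓘(ℝ, F) q q) :=
    fun j => ((LinearMap.toContinuousLinearMap (e.coord j)).differentiableAt).comp _ hv
  have hg : ∀ j, MDifferentiableAt 𝓘(ℝ, F) 𝓘(ℝ, ℝ) (g j) q := fun j =>
    mdifferentiableAt_comp_extChartAt (hcoord j)
  have hterm : ∀ j, MDifferentiableAt 𝓘(ℝ, F) 𝓘(ℝ, F).tangent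
      (fun q' : Q => (⟨q', (g j • c j) q'⟩ : TangentBundle 𝓘(ℝ, F) Q)) q := fun j =>
    (hg j).smul_section (hc j)
  have hcov1 : ∀ j, (show F from cov (g j • c j) q b) =
      e.coord j (fderiv ℝ v (extChartAt 𝓘(ℝ, F) q q) b) • e j +
        g j q • (show F from christoffel cov q b (e j)) := by
    intro j
    have h1 : (mvfderiv 𝓘(ℝ, F) (g j) q b : ℝ) =
        e.coord j (fderiv ℝ v (extChartAt 𝓘(ℝ, F) q q) b) := by
      have h2 := mfderiv_comp_extChartAt (hcoord j)
      refine (congrArg (fun T : F →L[ℝ] ℝ => T b) h2).trans ?_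
      have h3 := ((LinearMap.toContinuousLinearMap (e.coord j)).hasFDerivAt.comp _
        hv.hasFDerivAt).fderiv
      exact congrArg (fun T : F →L[ℝ] ℝ => T b) h3
    rw [← h1, ← hcq j, add_comm]
    have h5 := cov.isCovariantDerivativeOnUniv.leibniz (hc j) (hg j)
    refine (congrArg (fun T : F →L[ℝ] F => T b) h5).trans ?_
    rw [hcq j]
    rfl
  have hVe : ∀ᶠ q' in 𝓝 q, V q' = ∑ j, (g j • c j) q' := by
    filter_upwards [hV] with q' hq'
    rw [hq']
    have h6 : v (extChartAt 𝓘(ℝ, F) q q') =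
        ∑ j, e.coord j (v (extChartAt 𝓘(ℝ, F) q q')) • e j :=
      (e.sum_repr (v (extChartAt 𝓘(ℝ, F) q q'))).symm
    refine (congrArg (fromCoordQ F q q') h6).trans ?_
    rw [map_sum]
    exact Finset.sum_congr rfl fun j _ => map_smul (fromCoordQ F q q') _ _
  have hsum := MDifferentiableAt.sum_section (s := Finset.univ) fun j _ => hterm j
  have hVd : MDifferentiableAt 𝓘(ℝ, F) 𝓘(ℝ, F).tangent
      (fun q' : Q => (⟨q', V q'⟩ : TangentBundle 𝓘(ℝ, F) Q)) q := by
    refine hsum.congr_of_eventuallyEq ?_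
    filter_upwards [hVe] with q' hq'
    rw [hq']
  have h7 : cov V q = ∑ j, cov (g j • c j) q := by
    rw [← cov_sum cov Finset.univ hterm]
    exact cov.isCovariantDerivativeOnUniv.congr_of_eventuallyEq hVd hsum univ_mem hVe
  have h8 : (show F from cov V q b) = ∑ j, (show F from cov (g j • c j) q b) := by
    refine (congrArg (fun T : F →L[ℝ] F => T b) h7).trans ?_
    exact map_sum (ContinuousLinearMap.apply ℝ F (show F from b))
      (fun j => (show F →L[ℝ] F from cov (g j • c j) q)) Finset.univ
  have h9 : (V q : F) = ∑ j, g j q • e j := by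
    refine (hVe.self_of_nhds).trans ?_
    refine Finset.sum_congr rfl fun j _ => ?_
    exact congrArg (fun a : F => g j q • a) (hcq j)
  have h10 : (show F from christoffel cov q b (V q)) =
      ∑ j, g j q • (show F from christoffel cov q b (e j)) := by
    have hlin : ∀ T : F →L[ℝ] F, T (∑ j, g j q • e j) = ∑ j, g j q • T (e j) := fun T => by
      simp only [map_sum, map_smul]
    exact (congrArg (show F →L[ℝ] F from christoffel cov q b) h9).trans (hlin _)
  rw [h8, Finset.sum_congr rfl fun j _ => hcov1 j, Finset.sum_add_distrib, h10]
  congr 1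
  exact e.sum_repr _

/-- A vector field in the chart at `q`. -/
theorem mpullbackWithin_extChartAt_symm (V : ∀ q' : Q, TangentSpace 𝓘(ℝ, F) q') {r : Q}
    (hr : r ∈ (chartAt F q).source) : (VectorField.mpullbackWithin 𝓘(ℝ, F) 𝓘(ℝ, F)
      (extChartAt 𝓘(ℝ, F) q).symm V (range 𝓘(ℝ, F)) (extChartAt 𝓘(ℝ, F) q r) : F) =
      (tangentCoordChange 𝓘(ℝ, F) r q r : F →L[ℝ] F) (V r) := by
  have h1 : (mfderivWithin 𝓘(ℝ, F) 𝓘(ℝ, F) (extChartAt 𝓘(ℝ, F) q).symm (range 𝓘(ℝ, F))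
      (extChartAt 𝓘(ℝ, F) q r) : F →L[ℝ] F) = (fromCoordQ F q r : F →L[ℝ] F) :=
    (TangentBundle.symmL_trivializationAt hr).symm.trans
      (TangentBundle.symmL_trivializationAt_eq_core hr)
  have h2 : ContinuousLinearMap.inverse (fromCoordQ F q r : F →L[ℝ] F) =
      (tangentCoordChange 𝓘(ℝ, F) r q r : F →L[ℝ] F) :=
    ContinuousLinearMap.inverse_eq
      (ContinuousLinearMap.ext fun v => fromCoordQ_coord hr v)
      (ContinuousLinearMap.ext fun v => coord_fromCoordQ hr v)
  have h3 : (V ((extChartAt 𝓘(ℝ, F) q).symm (extChartAt 𝓘(ℝ, F) q r)) : F) = V r := by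
    rw [extChartAt_symm_extChartAt hr]
  refine (congrArg (ContinuousLinearMap.inverse (mfderivWithin 𝓘(ℝ, F) 𝓘(ℝ, F)
    (extChartAt 𝓘(ℝ, F) q).symm (range 𝓘(ℝ, F)) (extChartAt 𝓘(ℝ, F) q r) : F →L[ℝ] F)) h3).trans ?_
  refine (congrArg (fun T : F →L[ℝ] F => T.inverse (V r)) h1).trans ?_
  exact congrArg (fun T : F →L[ℝ] F => T (V r)) h2

theorem lieBracketWithin_const (b c : F) (s : Set F) (a : F) :
    VectorField.lieBracketWithin ℝ (fun _ => b) (fun _ => c) s a = 0 := by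
  simp [VectorField.lieBracketWithin]

/-- The bracket is computed in the chart at `q`, where both fields are constant near the base point.
With it, vanishing torsion reads as symmetry of the Christoffel symbols. -/
theorem mlieBracket_constField (b c : TangentSpace 𝓘(ℝ, F) q) :
    VectorField.mlieBracket 𝓘(ℝ, F) (constField b : ∀ q', TangentSpace 𝓘(ℝ, F) q')
      (constField c) q = 0 := by
  rw [VectorField.mlieBracket, VectorField.mlieBracketWithin_apply]
  have h : ∀ b : F, (VectorField.mpullbackWithin 𝓘(ℝ, F) 𝓘(ℝ, F)
      (extChartAt 𝓘(ℝ, F) q).symm (constField (q₀ := q) b) (range 𝓘(ℝ, F)) : F → F)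
      =ᶠ[𝓝 (extChartAt 𝓘(ℝ, F) q q)] fun _ => b := fun b => by
    filter_upwards [(isOpen_extChartAt_target (I := 𝓘(ℝ, F)) q).mem_nhds
      (mem_extChartAt_target q)] with a ha
    obtain ⟨r, hr, rfl⟩ : ∃ r ∈ (chartAt F q).source, extChartAt 𝓘(ℝ, F) q r = a :=
      ⟨_, by simpa using (extChartAt 𝓘(ℝ, F) q).map_target ha,
        (extChartAt 𝓘(ℝ, F) q).right_inv ha⟩
    exact (mpullbackWithin_extChartAt_symm _ hr).trans (coord_fromCoordQ hr b)
  have h5 : VectorField.lieBracketWithin ℝ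
      (VectorField.mpullbackWithin 𝓘(ℝ, F) 𝓘(ℝ, F)
        (extChartAt 𝓘(ℝ, F) q).symm (constField (q₀ := q) b) (range 𝓘(ℝ, F)) : F → F)
      (VectorField.mpullbackWithin 𝓘(ℝ, F) 𝓘(ℝ, F)
        (extChartAt 𝓘(ℝ, F) q).symm (constField (q₀ := q) c) (range 𝓘(ℝ, F)) : F → F)
      ((extChartAt 𝓘(ℝ, F) q).symm ⁻¹' univ ∩ range 𝓘(ℝ, F)) (extChartAt 𝓘(ℝ, F) q q) = 0 := by
    have e1 := Filter.EventuallyEq.lieBracketWithin_vectorField_eq (𝕜 := ℝ)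
      ((h b).filter_mono nhdsWithin_le_nhds) (h b).self_of_nhds
      ((h c).filter_mono nhdsWithin_le_nhds) (h c).self_of_nhds
      (s := (extChartAt 𝓘(ℝ, F) q).symm ⁻¹' univ ∩ range 𝓘(ℝ, F))
    exact e1.trans (lieBracketWithin_const _ _ _ _)
  exact (congrArg _ h5).trans (map_zero _)

/-- A torsion-free connection is symmetric. -/
theorem christoffel_symm (hcov : cov.torsion = 0) (b c : TangentSpace 𝓘(ℝ, F) q) :
    christoffel cov q b c = christoffel cov q c b := by
  have h := (cov.torsion_eq_zero_iff.1 hcov) (mdifferentiableAt_constField b)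
    (mdifferentiableAt_constField c)
  simp only [constField_self] at h
  rw [mlieBracket_constField] at h
  exact sub_eq_zero.1 h

end Connection

end CovariantClebsch

namespace CovariantClebsch

open Filter Set

/-! ### Testing with momenta separates vectors. -/

section Separation

variable {n : ℕ}

/-- The standard volume form. -/
noncomputable def stdVol (n : ℕ) : (BaseModel n) [⋀^Fin (n + 1)]→L[ℝ] ℝ :=
  { (EuclideanSpace.basisFun (Fin (n + 1)) ℝ).toBasis.det with
    cont := by
      have h : Continuous fun v : Fin (n + 1) → BaseModel n =>
          (Matrix.of fun μ ν => stdCovec n μ (v ν)).det := by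
        refine Continuous.matrix_det (continuous_matrix fun μ ν => ?_)
        exact (stdCovec n μ).continuous.comp (continuous_apply ν)
      exact h }

theorem stdVol_stdVec : stdVol n (stdVec n) = 1 := by
  have h := (EuclideanSpace.basisFun (Fin (n + 1)) ℝ).toBasis.det_self
  rw [basisFun_toBasis_eq_stdVec] at h
  exact h

/-- Top forms separate points. -/
theorem eq_of_forall_top_form {Z : Type*} [NormedAddCommGroup Z] [NormedSpace ℝ Z] {z z' : Z}
    (h : ∀ w : Z →L[ℝ] (BaseModel n) [⋀^Fin (n + 1)]→L[ℝ] ℝ, w z = w z') : z = z' := by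
  by_contra hne
  -- A functional not vanishing on `z - z'`, multiplied by the standard volume form, is an
  -- admissible test map.
  obtain ⟨f, hf⟩ := SeparatingDual.exists_ne_zero (R := ℝ) (sub_ne_zero.2 hne)
  have h1 := congrArg (evalStd n) (h (f.smulRight (stdVol n)))
  simp only [ContinuousLinearMap.smulRight_apply, map_smul, evalStd_apply, stdVol_stdVec,
    smul_eq_mul, mul_one] at h1
  rw [map_sub, h1, sub_self] at hf
  exact hf rfl

end Separation

/-! ### Divergence as the exterior derivative of the contraction. -/

section ContractDeriv

variable {n : ℕ} {V : Type*} [NormedAddCommGroup V] [NormedSpace ℝ V]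

/-- The divergence is the exterior derivative of the contraction. -/
theorem extDeriv_contract
    {P : BaseModel n → (BaseModel n →L[ℝ] V) →L[ℝ] (BaseModel n) [⋀^Fin (n + 1)]→L[ℝ] ℝ}
    {z : BaseModel n} (hP : DifferentiableAt ℝ P z) (b : V) :
    extDeriv (fun y => contract (P y) b) z =
      ∑ μ, fderiv ℝ P z (stdVec n μ) ((stdCovec n μ).smulRight b) := by
  have hN : ∀ B : BaseModel n →L[ℝ] V, HasFDerivAt (fun y => P y B)
      (fderiv ℝ (fun y => P y B) z) z := fun B =>
    (hP.clm_apply (differentiableAt_const B)).hasFDerivAt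
  have hNv : ∀ (B : BaseModel n →L[ℝ] V) v,
      fderiv ℝ (fun y => P y B) z v = fderiv ℝ P z v B := fun B v => by
    have h := (hP.hasFDerivAt.clm_apply (hasFDerivAt_const B z)).fderiv
    refine (congrArg (fun T => T v) h).trans ?_
    simp
  have h1 : HasFDerivAt (fun y => contract (P y) b)
      (∑ μ, (ContinuousLinearMap.apply ℝ ((BaseModel n) [⋀^Fin n]→L[ℝ] ℝ) (stdVec n μ)) ∘L
      (ContinuousAlternatingMap.curryLeftLI (𝕜 := ℝ) (E := BaseModel n) (F := ℝ)
        (n := n)).toContinuousLinearMap ∘L fderiv ℝ (fun y => P y ((stdCovec n μ).smulRight b)) z)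
        z := by
    have h2 : (fun y => contract (P y) b) = fun y => ∑ μ,
        ((ContinuousLinearMap.apply ℝ ((BaseModel n) [⋀^Fin n]→L[ℝ] ℝ) (stdVec n μ)) ∘L
        (ContinuousAlternatingMap.curryLeftLI (𝕜 := ℝ) (E := BaseModel n) (F := ℝ)
          (n := n)).toContinuousLinearMap) (P y ((stdCovec n μ).smulRight b)) := by
      funext y
      rw [contract_apply]
      rfl
    rw [h2]
    refine HasFDerivAt.fun_sum fun μ _ => ?_
    exact (ContinuousLinearMap.hasFDerivAt _).comp z (hN _)
  rw [extDeriv, h1.fderiv, alternatize_contract_columns]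
  exact Finset.sum_congr rfl fun μ _ => hNv _ _

theorem differentiableAt_contract
    {P : BaseModel n → (BaseModel n →L[ℝ] V) →L[ℝ] (BaseModel n) [⋀^Fin (n + 1)]→L[ℝ] ℝ}
    {z : BaseModel n} (hP : DifferentiableAt ℝ P z) (b : V) :
    DifferentiableAt ℝ (fun y => contract (P y) b) z := by
  have h2 : (fun y => contract (P y) b) = fun y => ∑ μ,
        ((ContinuousLinearMap.apply ℝ ((BaseModel n) [⋀^Fin n]→L[ℝ] ℝ) (stdVec n μ)) ∘L
        (ContinuousAlternatingMap.curryLeftLI (𝕜 := ℝ) (E := BaseModel n) (F := ℝ)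
          (n := n)).toContinuousLinearMap) (P y ((stdCovec n μ).smulRight b)) := by
    funext y
    rw [contract_apply]
    rfl
  rw [h2]
  refine DifferentiableAt.fun_sum fun μ _ => ?_
  exact (ContinuousLinearMap.differentiableAt _).comp z (hP.clm_apply (differentiableAt_const _))

end ContractDeriv

/-! ### Independence of the exterior derivative from the chart. -/

section ChartIndependence

variable {E : Type*} [NormedAddCommGroup E] [NormedSpace ℝ E]
  {M : Type*} [TopologicalSpace M] [ChartedSpace E M] [IsManifold 𝓘(ℝ, E) ∞ M]

/-- A differential form in the chart at `i`. -/
noncomputable def formCoord {k : ℕ} {W : Type*} [NormedAddCommGroup W] [NormedSpace ℝ W] (i : M)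
    (β : ∀ x : M, (TangentSpace 𝓘(ℝ, E) x) [⋀^Fin k]→L[ℝ] W) (z : E) : E [⋀^Fin k]→L[ℝ] W :=
  (show E [⋀^Fin k]→L[ℝ] W from β ((extChartAt 𝓘(ℝ, E) i).symm z)).compContinuousLinearMap
    (tangentCoordChange 𝓘(ℝ, E) i ((extChartAt 𝓘(ℝ, E) i).symm z)
      ((extChartAt 𝓘(ℝ, E) i).symm z) : E →L[ℝ] E)

/-- The exterior derivative may be computed in any chart. -/
theorem extDeriv_formCoord {k : ℕ} {W : Type*} [NormedAddCommGroup W] [NormedSpace ℝ W] {i x : M}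
    (hx : x ∈ (chartAt E i).source)
    (β : ∀ x : M, (TangentSpace 𝓘(ℝ, E) x) [⋀^Fin k]→L[ℝ] W)
    (hβ : DifferentiableAt ℝ (formCoord x β) (extChartAt 𝓘(ℝ, E) x x)) :
    extDeriv (formCoord i β) (extChartAt 𝓘(ℝ, E) i x) =
      (show E [⋀^Fin (k + 1)]→L[ℝ] W from extDerivAt 𝓘(ℝ, E) β x).compContinuousLinearMap
        (tangentCoordChange 𝓘(ℝ, E) i x x : E →L[ℝ] E) := by
  set f : E → E := extChartAt 𝓘(ℝ, E) x ∘ (extChartAt 𝓘(ℝ, E) i).symm with hf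
  have hfx : f (extChartAt 𝓘(ℝ, E) i x) = extChartAt 𝓘(ℝ, E) x x := by
    simp only [hf, Function.comp_apply, extChartAt_symm_extChartAt hx]
  have hfs : ContDiffAt ℝ ∞ f (extChartAt 𝓘(ℝ, E) i x) :=
    contDiffAt_chart_transition hx (mem_chart_source E x)
  -- Near the point, the expression of `β` in the chart at `i` is the pull-back of its expression in
  -- the chart at `x` by the transition map. Exterior derivatives commute with pull-backs.
  have h1 : formCoord i β =ᶠ[𝓝 (extChartAt 𝓘(ℝ, E) i x)] fun z =>
      (formCoord x β (f z)).compContinuousLinearMap (fderiv ℝ f z) := by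
    have ho : IsOpen ((extChartAt 𝓘(ℝ, E) i).target ∩
        (extChartAt 𝓘(ℝ, E) i).symm ⁻¹' (chartAt E x).source) :=
      (continuousOn_extChartAt_symm i).isOpen_inter_preimage
        (isOpen_extChartAt_target i) (chartAt E x).open_source
    filter_upwards [ho.mem_nhds ⟨(extChartAt 𝓘(ℝ, E) i).map_source (by simpa using hx), by
      rw [mem_preimage, extChartAt_symm_extChartAt hx]; exact mem_chart_source E x⟩] with z hz
    obtain ⟨y, hyi, rfl⟩ : ∃ y ∈ (chartAt E i).source, extChartAt 𝓘(ℝ, E) i y = z :=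
      ⟨_, by simpa using (extChartAt 𝓘(ℝ, E) i).map_target hz.1,
        (extChartAt 𝓘(ℝ, E) i).right_inv hz.1⟩
    have hyx : y ∈ (chartAt E x).source := by
      have := hz.2
      rwa [mem_preimage, extChartAt_symm_extChartAt hyi] at this
    rw [(hasFDerivAt_chart_transition hyi hyx).fderiv]
    have hfy : f (extChartAt 𝓘(ℝ, E) i y) = extChartAt 𝓘(ℝ, E) x y := by
      simp only [hf, Function.comp_apply, extChartAt_symm_extChartAt hyi]
    rw [hfy, formCoord, formCoord, extChartAt_symm_extChartAt hyi, extChartAt_symm_extChartAt hyx]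
    refine ContinuousAlternatingMap.ext fun v => ?_
    refine congrArg (show E [⋀^Fin k]→L[ℝ] W from β y) (funext fun m => ?_)
    exact (tangentCoordChange_comp_apply hyi hyx (mem_chart_source _ y) (v m)).symm
  rw [h1.extDeriv_eq]
  have hβ' : DifferentiableAt ℝ (formCoord x β) (f (extChartAt 𝓘(ℝ, E) i x)) := by rwa [hfx]
  have h2 := extDeriv_pullback (r := ∞) hβ' hfs (by
      rw [minSmoothness_of_isRCLikeNormedField]
      exact (inferInstance : ENat.LEInfty (2 : WithTop ℕ∞)).out)
  rw [h2, hfx, (hasFDerivAt_chart_transition hx (mem_chart_source E x)).fderiv]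
  rfl

end ChartIndependence

/-! ### The Euler–Lagrange expression without coordinates. -/

section Equations

variable {n : ℕ}
  {EG : Type*} [NormedAddCommGroup EG] [NormedSpace ℝ EG] [FiniteDimensional ℝ EG]
  {G : Type*} [TopologicalSpace G] [ChartedSpace EG G] [Group G] [LieGroup 𝓘(ℝ, EG) ∞ G]
  {F : Type*} [NormedAddCommGroup F] [NormedSpace ℝ F] [FiniteDimensional ℝ F]
  {Q : Type*} [TopologicalSpace Q] [ChartedSpace F Q] [IsManifold 𝓘(ℝ, F) ∞ Q] [MulAction G Q]
  {X : Type*} [TopologicalSpace X] [ChartedSpace (BaseModel n) X]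
  [IsManifold 𝓘(ℝ, BaseModel n) ∞ X]

variable {x i : X} {k : Q} {ψ : ∀ x : X, PhaseFiber n EG G F Q x} {U : Set X}

variable (ψ k) in
/-- The `n`-form `⟨w, f⟩`, where `f` has constant components `b` in the chart at `k`. -/
noncomputable def momentumForm (b : F) (y : X) :
    (TangentSpace 𝓘(ℝ, BaseModel n) y) [⋀^Fin n]→L[ℝ] ℝ :=
  contract (V := F) (ψ y).mom (fromCoordQ F k (ψ y).q b)

/-- Naturality of the contraction: pairing the momentum with a field of constant components in the
chart at `k` amounts to contracting its coordinate expression with those components. -/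
theorem formCoord_momentumForm (hx : x ∈ (chartAt (BaseModel n) i).source) (b : F) :
    formCoord i (momentumForm k ψ b) (extChartAt 𝓘(ℝ, BaseModel n) i x) =
      contract (coordP i k ψ (extChartAt 𝓘(ℝ, BaseModel n) i x)) b := by
  rw [formCoord, extChartAt_symm_extChartAt hx, coordP_extChartAt hx]
  exact contract_naturality (V := F) (V' := F) (ψ x).mom (C := fromCoord n i x) (C' := toCoord n i x)
    (fun v => fromCoord_toCoord hx v) (fromCoordQ F k (ψ x).q) b

theorem formCoord_momentumForm_eventuallyEq (hx : x ∈ (chartAt (BaseModel n) i).source) (b : F) :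
    formCoord i (momentumForm k ψ b) =ᶠ[𝓝 (extChartAt 𝓘(ℝ, BaseModel n) i x)]
      fun z => contract (coordP i k ψ z) b := by
  filter_upwards [eventually_mem_target hx] with z hz
  obtain ⟨y, hy, rfl⟩ := hz
  exact formCoord_momentumForm hy b

/-- The divergence of the momentum in any chart. -/
theorem sum_fderiv_coordP (hU : IsOpen U) (hψ : IsSmoothSection U ψ) (hxU : x ∈ U)
    (hx : x ∈ (chartAt (BaseModel n) i).source) (hk : (ψ x).q ∈ (chartAt F k).source) (b : F) :
    ∑ μ, fderiv ℝ (coordP i k ψ) (extChartAt 𝓘(ℝ, BaseModel n) i x) (stdVec n μ)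
        ((stdCovec n μ).smulRight b) =
      volCoord i x (extDerivAt 𝓘(ℝ, BaseModel n) (momentumForm k ψ b) x) := by
  have hd : ∀ j, x ∈ (chartAt (BaseModel n) j).source →
      DifferentiableAt ℝ (coordP j k ψ) (extChartAt 𝓘(ℝ, BaseModel n) j x) := fun j hj =>
    (hψ.contDiffAt_coordP hU hxU hj hk).differentiableAt (by simp)
  have hxx := mem_chart_source (BaseModel n) x
  -- The coordinate divergence is the exterior derivative of an `n`-form defined without a chart of
  -- `X`, and is therefore the same in all of them.
  rw [← extDeriv_contract (hd i hx),
    ← (formCoord_momentumForm_eventuallyEq hx b).extDeriv_eq]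
  refine (extDeriv_formCoord hx (momentumForm k ψ b) ?_).trans rfl
  exact (differentiableAt_contract (hd x hxx) b).congr_of_eventuallyEq
    (formCoord_momentumForm_eventuallyEq hxx b)

variable (EG G) in
/-- The derivative of the infinitesimal generator in the chart at the base point. -/
noncomputable def genDeriv (q : Q) (b : F) :
    GroupLieAlgebra 𝓘(ℝ, EG) G →L[ℝ] TangentSpace 𝓘(ℝ, F) q :=
  show EG →L[ℝ] F from fderiv ℝ (infGenCoord EG G q) (extChartAt 𝓘(ℝ, F) q q) b

/-- A smooth Lagrangian density is differentiable along the fibres. -/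
theorem Density.IsSmooth.differentiableAt {ℓ : Density n EG G X} (hℓ : ℓ.IsSmooth) (x : X)
    (σ : BaseModel n →L[ℝ] EG) : DifferentiableAt ℝ
      (show (BaseModel n →L[ℝ] EG) → (BaseModel n) [⋀^Fin (n + 1)]→L[ℝ] ℝ from ℓ x) σ := by
  have hxx := mem_chart_source (BaseModel n) x
  have h1 : DifferentiableAt ℝ (fun s => lagCoord x ℓ (extChartAt 𝓘(ℝ, BaseModel n) x x, s)) σ :=
    DifferentiableAt.comp (g := lagCoord x ℓ) (f := fun s => (extChartAt 𝓘(ℝ, BaseModel n) x x, s))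
      σ
      ((contDiffAt_lagCoord hℓ hxx σ).differentiableAt (by simp))
      ((differentiableAt_const _).prodMk differentiableAt_id)
  refine h1.congr_of_eventuallyEq (Eventually.of_forall fun s => ?_)
  have h2 := lagCoord_extChartAt hxx ℓ s
  have h3 : lieFormOfCoord (G := G) x x s = s :=
    ContinuousLinearMap.ext fun v => congrArg s
      (congrArg (fun T : BaseModel n →L[ℝ] BaseModel n => T v) (tangentCoordChange_self_clm hxx))
  have h4 : ∀ β : Vol n x, volCoord x x β = β := fun β =>
    ContinuousAlternatingMap.ext fun v => congrArg β (funext fun m =>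
      (congrArg (fun T : BaseModel n →L[ℝ] BaseModel n => T (v m))
        (tangentCoordChange_self_clm hxx)))
  exact ((h2.trans (h4 _)).trans (congrArg (ℓ x) h3)).symm

/-- The fibre derivative of the Lagrangian in coordinates. -/
theorem fderiv_lagCoord {ℓ : Density n EG G X} (hℓ : ℓ.IsSmooth)
    (hx : x ∈ (chartAt (BaseModel n) i).source) (σ : LieForm n EG G x)
    (s : BaseModel n →L[ℝ] EG) :
    fderiv ℝ (fun s => lagCoord i ℓ (extChartAt 𝓘(ℝ, BaseModel n) i x, s)) (lieFormCoord i x σ) s =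
      volCoord i x (ℓ.fiberDeriv x σ (lieFormOfCoord i x s)) := by
  let f : (BaseModel n →L[ℝ] EG) → (BaseModel n) [⋀^Fin (n + 1)]→L[ℝ] ℝ := ℓ x
  let C : (BaseModel n →L[ℝ] EG) →L[ℝ] BaseModel n →L[ℝ] EG :=
    (toCoord n i x : BaseModel n →L[ℝ] BaseModel n).precomp EG
  let D : ((BaseModel n) [⋀^Fin (n + 1)]→L[ℝ] ℝ) →L[ℝ] (BaseModel n) [⋀^Fin (n + 1)]→L[ℝ] ℝ :=
    volCoord i x
  have hf : DifferentiableAt ℝ f σ := hℓ.differentiableAt x σ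
  have h5 : (fun s => lagCoord i ℓ (extChartAt 𝓘(ℝ, BaseModel n) i x, s)) = fun s => D (f (C s)) := by
    funext s
    exact lagCoord_extChartAt hx ℓ s
  have h6 : C (lieFormCoord i x σ) = σ := lieFormOfCoord_lieFormCoord hx σ
  have h7 : HasFDerivAt (fun s => D (f (C s))) (D ∘L fderiv ℝ f σ ∘L C) (lieFormCoord i x σ) := by
    refine D.hasFDerivAt.comp (lieFormCoord i x σ : BaseModel n →L[ℝ] EG) ?_
    refine HasFDerivAt.comp (g := f) (lieFormCoord i x σ : BaseModel n →L[ℝ] EG) ?_ C.hasFDerivAt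
    rw [h6]
    exact hf.hasFDerivAt
  rw [h5, h7.fderiv]
  rfl

/-- The Euler–Lagrange expression, without coordinates. -/
theorem eulerCoord_extChartAt {ℓ : Density n EG G X} (hℓ : ℓ.IsSmooth) (hU : IsOpen U)
    (hψ : IsSmoothSection U ψ) (hxU : x ∈ U) (hx : x ∈ (chartAt (BaseModel n) i).source)
    (b : F) (s : BaseModel n →L[ℝ] EG)
    (w : (BaseModel n →L[ℝ] F) →L[ℝ] (BaseModel n) [⋀^Fin (n + 1)]→L[ℝ] ℝ) :
    eulerCoord ℓ i (ψ x).q ψ (extChartAt 𝓘(ℝ, BaseModel n) i x) b s w =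
      (volCoord i x (ℓ.fiberDeriv x (ψ x).σ (lieFormOfCoord (G := G) i x s)) -
        volCoord i x (momentumMap x (ψ x).q (ψ x).mom (lieFormOfCoord (G := G) i x s))) +
      w (show BaseModel n →L[ℝ] F from (dq ψ x - sigmaQ ψ x) ∘L fromCoord n i x) -
      (volCoord i x (extDerivAt 𝓘(ℝ, BaseModel n) (momentumForm (ψ x).q ψ b) x) +
        volCoord i x ((ψ x).mom (genDeriv EG G (ψ x).q b ∘L (ψ x).σ))) := by
  have hk := mem_chart_source F (ψ x).q
  obtain ⟨W, hW, hxW, hsm⟩ := hψ.exists_smoothFamilyOn hU hxU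
  have hd := hsm.mdifferentiableAt_q hW (hxW 0)
  have hid := tangentCoordChange_self_clm hk
  have hQ : fderiv ℝ (coordQ i (ψ x).q ψ) (extChartAt 𝓘(ℝ, BaseModel n) i x) -
      infGenCoord EG G (ψ x).q (coordQ i (ψ x).q ψ (extChartAt 𝓘(ℝ, BaseModel n) i x)) ∘L
        coordS i ψ (extChartAt 𝓘(ℝ, BaseModel n) i x) =
      (show BaseModel n →L[ℝ] F from (dq ψ x - sigmaQ ψ x) ∘L fromCoord n i x) := by
    rw [(hasFDerivAt_coordQ hd hx hk).fderiv, infGenCoord_comp_coordS hx hk, hid]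
    rfl
  have hmom : ∀ B : TX n x →L[ℝ] TangentSpace 𝓘(ℝ, F) (ψ x).q,
      coordP i (ψ x).q ψ (extChartAt 𝓘(ℝ, BaseModel n) i x)
        (show BaseModel n →L[ℝ] F from B ∘L fromCoord n i x) = volCoord i x ((ψ x).mom B) := by
    intro B
    rw [coordP_extChartAt hx, ← momentumCoord_apply hx hk, hid]
    rfl
  have hS : infGenCoord EG G (ψ x).q (coordQ i (ψ x).q ψ (extChartAt 𝓘(ℝ, BaseModel n) i x)) ∘L s =
      (show BaseModel n →L[ℝ] F from
        (infGen EG G F (ψ x).q ∘L lieFormOfCoord (G := G) i x s) ∘L fromCoord n i x) := by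
    rw [coordQ_extChartAt hx, infGenCoord_extChartAt hk, hid]
    exact ContinuousLinearMap.ext fun v => congrArg (fun u => (infGen EG G F (ψ x).q : EG → F) (s u))
      (toCoord_fromCoord hx v).symm
  have hG : fderiv ℝ (infGenCoord EG G (ψ x).q)
      (coordQ i (ψ x).q ψ (extChartAt 𝓘(ℝ, BaseModel n) i x)) b ∘L
        coordS i ψ (extChartAt 𝓘(ℝ, BaseModel n) i x) =
      (show BaseModel n →L[ℝ] F from (genDeriv EG G (ψ x).q b ∘L (ψ x).σ) ∘L fromCoord n i x) := by
    rw [coordQ_extChartAt hx, coordS_extChartAt hx]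
    rfl
  have hPS : coordP i (ψ x).q ψ (extChartAt 𝓘(ℝ, BaseModel n) i x)
      (infGenCoord EG G (ψ x).q (coordQ i (ψ x).q ψ (extChartAt 𝓘(ℝ, BaseModel n) i x)) ∘L s) =
      volCoord i x (momentumMap x (ψ x).q (ψ x).mom (lieFormOfCoord (G := G) i x s)) :=
    (congrArg _ hS).trans (hmom (infGen EG G F (ψ x).q ∘L lieFormOfCoord (G := G) i x s))
  have hPG := (congrArg (coordP i (ψ x).q ψ (extChartAt 𝓘(ℝ, BaseModel n) i x)) hG).trans
    (hmom (genDeriv EG G (ψ x).q b ∘L (ψ x).σ))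
  rw [eulerCoord, localEuler, hQ, hPS, hPG, sum_fderiv_coordP hU hψ hxU hx hk b,
    coordS_extChartAt hx, fderiv_lagCoord hℓ hx]

end Equations

end CovariantClebsch

namespace CovariantClebsch

open Filter Set

/-! ### Stationarity conditions, first without and then with a connection. -/

section Stationary

variable {n : ℕ}
  {EG : Type*} [NormedAddCommGroup EG] [NormedSpace ℝ EG] [FiniteDimensional ℝ EG]
  {G : Type*} [TopologicalSpace G] [ChartedSpace EG G] [Group G] [LieGroup 𝓘(ℝ, EG) ∞ G]
  {F : Type*} [NormedAddCommGroup F] [NormedSpace ℝ F] [FiniteDimensional ℝ F]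
  {Q : Type*} [TopologicalSpace Q] [ChartedSpace F Q] [IsManifold 𝓘(ℝ, F) ∞ Q] [MulAction G Q]
  {X : Type*} [TopologicalSpace X] [ChartedSpace (BaseModel n) X]
  [IsManifold 𝓘(ℝ, BaseModel n) ∞ X]

variable {x i : X} {k q : Q} {ψ : ∀ x : X, PhaseFiber n EG G F Q x} {U : Set X}

/-- The Euler–Lagrange equations of the Clebsch variational principle, without a connection. -/
structure EulerLagrange (ℓ : Density n EG G X) (U : Set X)
    (ψ : ∀ x : X, PhaseFiber n EG G F Q x) : Prop where
  div_eq : ∀ x ∈ U, ∀ b : F, extDerivAt 𝓘(ℝ, BaseModel n) (momentumForm (ψ x).q ψ b) x =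
    -(ψ x).mom (genDeriv EG G (ψ x).q b ∘L (ψ x).σ)
  dq_eq : ∀ x ∈ U, dq ψ x = sigmaQ ψ x
  fiberDeriv_eq : ∀ x ∈ U, ℓ.fiberDeriv x (ψ x).σ = momentumMap x (ψ x).q (ψ x).mom

/-- Tangent vectors at `x` are recorded in the preferred chart at `x`, so the coordinate maps based
there are identities. -/
theorem lieFormOfCoord_self (x : X) (s : LieForm n EG G x) : lieFormOfCoord (EG := EG) (G := G) x x s = s :=
  ContinuousLinearMap.ext fun v => congrArg s
    (congrArg (fun T : BaseModel n →L[ℝ] BaseModel n => T v)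
      (tangentCoordChange_self_clm (mem_chart_source (BaseModel n) x)))

theorem volCoord_self (x : X) (β : Vol n x) : volCoord x x β = β :=
  ContinuousAlternatingMap.ext fun v => congrArg β (funext fun m =>
    (congrArg (fun T : BaseModel n →L[ℝ] BaseModel n => T (v m))
      (tangentCoordChange_self_clm (mem_chart_source (BaseModel n) x))))

/-- The directions `b`, `w` and `s` in the Euler–Lagrange expression are independent, so each slot
vanishes by itself. In the slot of `w`, the factor paired with `w` is zero because top-degree-valued
momenta separate vectors. -/
theorem eulerLagrange_of_isCritical [T2Space X] [SigmaCompactSpace X] [OrientedAtlas n X]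
    (hact : ContMDiff (𝓘(ℝ, EG).prod 𝓘(ℝ, F)) 𝓘(ℝ, F) ∞ (fun p : G × Q => p.1 • p.2))
    {ℓ : Density n EG G X} (hℓ : ℓ.IsSmooth) (hU : IsOpen U) (hUc : IsCompact (closure U))
    (hψ : IsSmoothSection U ψ) (hcrit : IsCritical U (reducedAction ℓ U) ψ) :
    EulerLagrange ℓ U ψ := by
  have key := fun (x : X) (hx : x ∈ U) (b : F) (s : BaseModel n →L[ℝ] EG)
    (w : (BaseModel n →L[ℝ] F) →L[ℝ] (BaseModel n) [⋀^Fin (n + 1)]→L[ℝ] ℝ) =>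
    (eulerCoord_extChartAt hℓ hU hψ hx (mem_chart_source (BaseModel n) x) b s w).symm.trans
      (eulerCoord_of_isCritical hact hℓ hU hUc hψ hcrit hx (mem_chart_source (BaseModel n) x)
        (mem_chart_source F (ψ x).q) b s w)
  have hs0 : ∀ x : X, lieFormOfCoord (G := G) (EG := EG) (n := n) x x 0 = 0 := fun x =>
    lieFormOfCoord_self x 0
  -- The direction `(0, 0, 0)` already shows that the divergence slot vanishes at `b = 0`, so its
  -- linearity need not be established separately.
  have hg0 : ∀ x ∈ U, extDerivAt 𝓘(ℝ, BaseModel n) (momentumForm (ψ x).q ψ 0) x +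
      (ψ x).mom (genDeriv EG G (ψ x).q 0 ∘L (ψ x).σ) = 0 := fun x hx => by
    have h := key x hx 0 0 0
    simp only [hs0, volCoord_self, map_zero, sub_zero, zero_add, _root_.zero_apply,
      zero_sub, neg_eq_zero] at h
    exact h
  constructor
  · intro x hx b
    have h := key x hx b 0 0
    simp only [hs0, volCoord_self, map_zero, sub_zero, zero_add, _root_.zero_apply,
      zero_sub, neg_eq_zero] at h
    exact eq_neg_of_add_eq_zero_left h
  · intro x hx
    have h := fun w => key x hx 0 0 w
    simp only [hs0, volCoord_self, map_zero, sub_zero, zero_add] at h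
    have h1 := eq_of_forall_top_form (z' := 0) fun w =>
      ((sub_eq_zero.1 (h w)).trans (hg0 x hx)).trans (map_zero w).symm
    have h2 : ∀ v, (dq ψ x - sigmaQ ψ x) v = 0 := fun v => by
      have h3 := congrArg (fun T : BaseModel n →L[ℝ] F => T v) h1
      refine Eq.trans ?_ h3
      refine congrArg (dq ψ x - sigmaQ ψ x) ?_
      exact (congrArg (fun T : BaseModel n →L[ℝ] BaseModel n => T v)
        (tangentCoordChange_self_clm (mem_chart_source (BaseModel n) x))).symm
    exact ContinuousLinearMap.ext fun v => sub_eq_zero.1 (h2 v)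
  · intro x hx
    refine ContinuousLinearMap.ext fun s => ?_
    have h := key x hx 0 s 0
    simp only [volCoord_self, _root_.zero_apply, add_zero] at h
    rw [lieFormOfCoord_self] at h
    exact sub_eq_zero.1 ((sub_eq_zero.1 h).trans (hg0 x hx))

/-- By `eulerCoord_extChartAt`, the Euler–Lagrange expression in any chart of `X` is made of the
differences of the two sides of the three equations, so it vanishes there. -/
theorem EulerLagrange.isCritical [T2Space X] [SigmaCompactSpace X] [OrientedAtlas n X]
    (hact : ContMDiff (𝓘(ℝ, EG).prod 𝓘(ℝ, F)) 𝓘(ℝ, F) ∞ (fun p : G × Q => p.1 • p.2))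
    {ℓ : Density n EG G X} (hℓ : ℓ.IsSmooth) (hU : IsOpen U) (hUc : IsCompact (closure U))
    (hψ : IsSmoothSection U ψ) (h : EulerLagrange ℓ U ψ) :
    IsCritical U (reducedAction ℓ U) ψ := by
  refine isCritical_of_eulerCoord hact hℓ hU hUc fun x hx i hi b s w => ?_
  have h1 : (show BaseModel n →L[ℝ] F from (dq ψ x - sigmaQ ψ x) ∘L fromCoord n i x) = 0 := by
    rw [h.dq_eq x hx, sub_self]
    rfl
  rw [eulerCoord_extChartAt hℓ hU hψ hx hi, h1, h.div_eq x hx, h.fiberDeriv_eq x hx, map_neg,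
    neg_add_cancel, sub_self, map_zero, add_zero, sub_zero]

/-! ### The equations in terms of a connection -/

variable (cov : CovariantDerivative 𝓘(ℝ, F) F (TangentSpace 𝓘(ℝ, F) : Q → Type _))

/-- The components are constant near `x`, so only the connection term `Γ_{df(v)} b` remains.
Vanishing torsion exchanges its two arguments, which puts it in the same form as the term from
`∇σ_Q`. -/
theorem covAlong_constField (hcov : cov.torsion = 0) {f : X → Q} (hf : ContinuousAt f x)
    (b : TangentSpace 𝓘(ℝ, F) (f x)) :
    covAlong cov f (fun y : X => constField b (f y)) x =
      christoffel cov (f x) b ∘L mfderiv 𝓘(ℝ, BaseModel n) 𝓘(ℝ, F) f x := by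
  have h1 : (fun y : X => (tangentCoordChange 𝓘(ℝ, F) (f y) (f x) (f y) : F →L[ℝ] F)
      (constField b (f y))) =ᶠ[𝓝 x] fun _ => b := by
    filter_upwards [hf.preimage_mem_nhds (chart_source_mem_nhds F (f x))] with y hy
    exact coord_fromCoordQ hy b
  have h2 : mfderiv 𝓘(ℝ, BaseModel n) 𝓘(ℝ, F) (fun y : X =>
      (tangentCoordChange 𝓘(ℝ, F) (f y) (f x) (f y) : F →L[ℝ] F) (constField b (f y))) x = 0 := by
    rw [h1.mfderiv_eq]
    exact mfderiv_const
  refine ContinuousLinearMap.ext fun v => ?_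
  have h3 : covAlong cov f (fun y : X => constField b (f y)) x v = (0 : F) +
      (show F from christoffel cov (f x) (mfderiv 𝓘(ℝ, BaseModel n) 𝓘(ℝ, F) f x v)
        (constField b (f x))) :=
    congrArg₂ (fun a c : F => a + c) (congrArg (fun T : BaseModel n →L[ℝ] F => T v) h2) rfl
  refine h3.trans ((zero_add _).trans ?_)
  rw [constField_self]
  exact christoffel_symm cov hcov _ _

theorem covDiv_eq (hcov : cov.torsion = 0) (hψ : ContinuousAt (fun y => (ψ y).q) x)
    (b : TangentSpace 𝓘(ℝ, F) (ψ x).q) :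
    covDiv cov ψ x b = extDerivAt 𝓘(ℝ, BaseModel n) (momentumForm (ψ x).q ψ b) x -
      (ψ x).mom (christoffel cov (ψ x).q b ∘L dq ψ x) := by
  rw [covDiv, covAlong_constField cov hcov hψ]
  rfl

/-- For fixed `ξ`, the vector field `ξ_Q` has components `A(·) ξ` in the chart at `q`, whence an
ordinary derivative and a Christoffel term. Reassembling the columns over the basis of `T_x X` gives
a formula linear in `σ`. -/
theorem nablaGen_eq
    (hact : ContMDiff (𝓘(ℝ, EG).prod 𝓘(ℝ, F)) 𝓘(ℝ, F) ∞ (fun p : G × Q => p.1 • p.2))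
    (σ : LieForm n EG G x) (b : TangentSpace 𝓘(ℝ, F) q) :
    nablaGen cov x q σ b = genDeriv (F := F) EG G q b ∘L σ +
      christoffel cov q b ∘L infGen EG G F q ∘L σ := by
  have hq := mem_chart_source F q
  have hA := (contDiffAt_infGenCoord hact hq).differentiableAt (by simp)
  have h1 : ∀ ξ : EG, (show F from cov (fun q' : Q => infGen EG G F q' ξ) q b) =
      fderiv ℝ (infGenCoord EG G q) (extChartAt 𝓘(ℝ, F) q q) b ξ +
        (show F from christoffel cov q b (infGen EG G F q ξ)) := by
    intro ξ
    have hd := hA.clm_apply (differentiableAt_const ξ)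
    have h2 := cov_eq_fderiv_add cov (V := fun q' : Q => infGen EG G F q' ξ) hd (by
      filter_upwards [chart_source_mem_nhds F q] with q' hq'
      rw [infGenCoord_extChartAt hq']
      exact (fromCoordQ_coord hq' _).symm) b
    refine h2.trans ?_
    congr 1
    have h3 := (hA.hasFDerivAt.clm_apply (hasFDerivAt_const ξ _)).fderiv
    have h4 : ∀ (T : EG →L[ℝ] F) (D : F →L[ℝ] EG →L[ℝ] F) (b : F),
      (T ∘L (0 : F →L[ℝ] EG) + D.flip ξ) b = D b ξ := fun T D b => by simp
    exact (congrArg (fun T : F →L[ℝ] F => T b) h3).trans (h4 _ _ _)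
  let T : BaseModel n →L[ℝ] F :=
    (show EG →L[ℝ] F from fderiv ℝ (infGenCoord EG G q) (extChartAt 𝓘(ℝ, F) q q) b) ∘L
      (show BaseModel n →L[ℝ] EG from σ) +
    (show F →L[ℝ] F from christoffel cov q b) ∘L (show EG →L[ℝ] F from infGen EG G F q) ∘L
      (show BaseModel n →L[ℝ] EG from σ)
  have h4 := sum_smulRight_stdCovec T
  refine Eq.trans ?_ h4
  refine Finset.sum_congr rfl fun μ _ => ?_
  exact congrArg (fun a : F => (stdCovec n μ).smulRight a) (h1 _)

theorem IsSmoothSection.continuousAt_q (hU : IsOpen U) (hψ : IsSmoothSection U ψ) (hx : x ∈ U) :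
    ContinuousAt (fun y => (ψ y).q) x := by
  obtain ⟨W, hW, hxW, hsm⟩ := hψ.exists_smoothFamilyOn hU hx
  exact (hsm.mdifferentiableAt_q hW (hxW 0)).continuousAt

/-- The divergence equation does not depend on the torsion-free connection. -/
theorem covDiv_add_nablaGen
    (hact : ContMDiff (𝓘(ℝ, EG).prod 𝓘(ℝ, F)) 𝓘(ℝ, F) ∞ (fun p : G × Q => p.1 • p.2))
    (hcov : cov.torsion = 0) (hψ : ContinuousAt (fun y => (ψ y).q) x)
    (hdq : dq ψ x = sigmaQ ψ x) (b : TangentSpace 𝓘(ℝ, F) (ψ x).q) :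
    covDiv cov ψ x b + (ψ x).mom (nablaGen cov x (ψ x).q (ψ x).σ b) =
      extDerivAt 𝓘(ℝ, BaseModel n) (momentumForm (ψ x).q ψ b) x +
        (ψ x).mom (genDeriv EG G (ψ x).q b ∘L (ψ x).σ) := by
  rw [covDiv_eq cov hcov hψ, nablaGen_eq cov hact (ψ x).σ b, hdq, map_add]
  have : christoffel cov (ψ x).q b ∘L sigmaQ ψ x =
    christoffel cov (ψ x).q b ∘L infGen EG G F (ψ x).q ∘L (ψ x).σ := rfl
  rw [this]
  abel

/-- Both systems contain `dq = σ_Q`. Given this equation, the Christoffel terms of the covariant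
divergence and of `∇σ_Q` are the same and drop out of the remaining equation. -/
theorem stationary_iff_eulerLagrange
    (hact : ContMDiff (𝓘(ℝ, EG).prod 𝓘(ℝ, F)) 𝓘(ℝ, F) ∞ (fun p : G × Q => p.1 • p.2))
    (hcov : cov.torsion = 0) (ℓ : Density n EG G X) (hU : IsOpen U) (hψ : IsSmoothSection U ψ) :
    Stationary cov ℓ U ψ ↔ EulerLagrange ℓ U ψ := by
  refine ⟨fun h => ⟨fun x hx b => ?_, h.dq_eq, h.fiberDeriv_eq⟩,
    fun h => ⟨fun x hx b => ?_, h.dq_eq, h.fiberDeriv_eq⟩⟩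
  · have h1 := covDiv_add_nablaGen cov hact hcov (hψ.continuousAt_q hU hx) (h.dq_eq x hx) b
    rw [h.div_eq x hx b, neg_add_cancel] at h1
    exact eq_neg_of_add_eq_zero_left h1.symm
  · have h1 := covDiv_add_nablaGen cov hact hcov (hψ.continuousAt_q hU hx) (h.dq_eq x hx) b
    rw [h.div_eq x hx b, neg_add_cancel] at h1
    exact eq_neg_of_add_eq_zero_left h1

end Stationary

end CovariantClebsch

namespace CovariantClebsch

open Filter Set

/-! ### Brackets of generators: the computation in coordinates. -/

section BracketCore

variable {EG F : Type*} [NormedAddCommGroup EG] [NormedSpace ℝ EG]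
  [NormedAddCommGroup F] [NormedSpace ℝ F]

/-- Derivative at the identity of the relation between a left-invariant vector field and the
corresponding generator of a left action. -/
theorem generator_apply_fderiv {Φ : EG × F → F} {g₀ : EG} {a : F} (hΦ : ContDiffAt ℝ ∞ Φ (g₀, a))
    {A : F → EG →L[ℝ] F}
    (hA : A =ᶠ[𝓝 a] fun a' => fderiv ℝ Φ (g₀, a') ∘L ContinuousLinearMap.inl ℝ EG F)
    {l : EG → EG} (hl : DifferentiableAt ℝ l g₀)
    (h : ∀ᶠ g in 𝓝 g₀, fderiv ℝ Φ (g, a) (l g, 0) = fderiv ℝ Φ (g, a) (0, A a (l g₀))) (ξ : EG) :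
    A a (fderiv ℝ l g₀ ξ) = fderiv ℝ A a (A a (l g₀)) ξ -
      fderiv ℝ (fderiv ℝ Φ) (g₀, a) (ξ, 0) (l g₀, 0) := by
  set w := A a (l g₀) with hw
  have hB : HasFDerivAt (fderiv ℝ Φ) (fderiv ℝ (fderiv ℝ Φ) (g₀, a)) (g₀, a) :=
    ((hΦ.fderiv_right (m := ∞) (by simp)).differentiableAt (by simp)).hasFDerivAt
  have hB1 : HasFDerivAt (fun g => fderiv ℝ Φ (g, a))
      (fderiv ℝ (fderiv ℝ Φ) (g₀, a) ∘L ContinuousLinearMap.inl ℝ EG F) g₀ :=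
    HasFDerivAt.comp (g := fderiv ℝ Φ) g₀ hB (hasFDerivAt_prodMk_left g₀ a)
  have hB2 : HasFDerivAt (fun a' => fderiv ℝ Φ (g₀, a'))
      (fderiv ℝ (fderiv ℝ Φ) (g₀, a) ∘L ContinuousLinearMap.inr ℝ EG F) a :=
    HasFDerivAt.comp (g := fderiv ℝ Φ) a hB (hasFDerivAt_prodMk_right g₀ a)
  -- Both sides of `h` are differentiated in `g` at `g₀`. On the right the vector `w` is fixed, so
  -- only the mixed second derivative of `Φ` appears; by symmetry it is the derivative of the
  -- generator along `w`.
  have hL := hB1.clm_apply (hl.hasFDerivAt.prodMk (hasFDerivAt_const (0 : F) g₀))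
  have hR := hB1.clm_apply (hasFDerivAt_const ((0 : EG), w) g₀)
  have h1 := congrArg (fun T : EG →L[ℝ] F => T ξ)
    ((hL.congr_of_eventuallyEq (EventuallyEq.symm h)).unique hR)
  simp only [add_apply, ContinuousLinearMap.comp_apply, ContinuousLinearMap.flip_apply,
    ContinuousLinearMap.prod_apply, zero_apply, ContinuousLinearMap.inl_apply, map_zero,
    zero_add] at h1
  have h2 : fderiv ℝ A a w ξ = fderiv ℝ (fderiv ℝ Φ) (g₀, a) (0, w) (ξ, 0) := by
    have h3 := (hB2.clm_comp (hasFDerivAt_const (ContinuousLinearMap.inl ℝ EG F) a)).congr_of_eventuallyEq hA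
    rw [h3.fderiv]
    simp
  have hsymm : IsSymmSndFDerivAt ℝ Φ (g₀, a) := hΦ.isSymmSndFDerivAt (by
    rw [minSmoothness_of_isRCLikeNormedField]
    exact (inferInstance : ENat.LEInfty (2 : WithTop ℕ∞)).out)
  have h4 : A a (fderiv ℝ l g₀ ξ) = fderiv ℝ Φ (g₀, a) (fderiv ℝ l g₀ ξ, 0) := by
    rw [hA.self_of_nhds]; rfl
  rw [h2, h4, hsymm.eq, ← h1]
  abel

/-- The generators of a left action reverse the bracket of left-invariant vector fields. -/
theorem generator_apply_bracket {Φ : EG × F → F} {g₀ : EG} {a : F}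
    (hΦ : ContDiffAt ℝ ∞ Φ (g₀, a)) {A : F → EG →L[ℝ] F}
    (hA : A =ᶠ[𝓝 a] fun a' => fderiv ℝ Φ (g₀, a') ∘L ContinuousLinearMap.inl ℝ EG F)
    {l l' : EG → EG} (hl : DifferentiableAt ℝ l g₀) (hl' : DifferentiableAt ℝ l' g₀)
    (h : ∀ᶠ g in 𝓝 g₀, fderiv ℝ Φ (g, a) (l g, 0) = fderiv ℝ Φ (g, a) (0, A a (l g₀)))
    (h' : ∀ᶠ g in 𝓝 g₀, fderiv ℝ Φ (g, a) (l' g, 0) = fderiv ℝ Φ (g, a) (0, A a (l' g₀))) :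
    A a (fderiv ℝ l' g₀ (l g₀) - fderiv ℝ l g₀ (l' g₀)) =
      fderiv ℝ A a (A a (l' g₀)) (l g₀) - fderiv ℝ A a (A a (l g₀)) (l' g₀) := by
  have hsymm : IsSymmSndFDerivAt ℝ Φ (g₀, a) := hΦ.isSymmSndFDerivAt (by
    rw [minSmoothness_of_isRCLikeNormedField]
    exact (inferInstance : ENat.LEInfty (2 : WithTop ℕ∞)).out)
  -- The second derivatives of `Φ` in two group directions cancel by symmetry, leaving the
  -- derivatives of the generators.
  rw [map_sub, generator_apply_fderiv hΦ hA hl h, generator_apply_fderiv hΦ hA hl' h',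
    hsymm.eq (l g₀, 0)]
  abel

end BracketCore

/-! ### Left-invariant fields and the bracket of the Lie algebra in the chart at the identity. -/

section Bracket

variable {EG : Type*} [NormedAddCommGroup EG] [NormedSpace ℝ EG] [FiniteDimensional ℝ EG]
  {G : Type*} [TopologicalSpace G] [ChartedSpace EG G] [Group G] [LieGroup 𝓘(ℝ, EG) ∞ G]
  {F : Type*} [NormedAddCommGroup F] [NormedSpace ℝ F] [FiniteDimensional ℝ F]
  {Q : Type*} [TopologicalSpace Q] [ChartedSpace F Q] [IsManifold 𝓘(ℝ, F) ∞ Q] [MulAction G Q]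

/-- A left-invariant vector field in the chart at `1`. -/
noncomputable def invariantCoord (η : GroupLieAlgebra 𝓘(ℝ, EG) G) : EG → EG :=
  VectorField.mpullbackWithin 𝓘(ℝ, EG) 𝓘(ℝ, EG) (extChartAt 𝓘(ℝ, EG) (1 : G)).symm
    (mulInvariantVectorField η) (range 𝓘(ℝ, EG))

/-- The tangent spaces at `f x` and `f' x` are different types; the equality is stated between maps
of the model spaces. -/
theorem mfderiv_clm_congr {E E' M N : Type*} [NormedAddCommGroup E] [NormedSpace ℝ E]
    [TopologicalSpace M] [ChartedSpace E M] [NormedAddCommGroup E'] [NormedSpace ℝ E']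
    [TopologicalSpace N] [ChartedSpace E' N] {f f' : M → N} (h : f = f') (x : M) :
    (mfderiv 𝓘(ℝ, E) 𝓘(ℝ, E') f x : E →L[ℝ] E') =
      (mfderiv 𝓘(ℝ, E) 𝓘(ℝ, E') f' x : E →L[ℝ] E') := by
  subst h
  rfl

theorem mfderiv_clm_congr_point {E E' M N : Type*} [NormedAddCommGroup E] [NormedSpace ℝ E]
    [TopologicalSpace M] [ChartedSpace E M] [NormedAddCommGroup E'] [NormedSpace ℝ E']
    [TopologicalSpace N] [ChartedSpace E' N] (f : M → N) {x x' : M} (h : x = x') :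
    (mfderiv 𝓘(ℝ, E) 𝓘(ℝ, E') f x : E →L[ℝ] E') =
      (mfderiv 𝓘(ℝ, E) 𝓘(ℝ, E') f x' : E →L[ℝ] E') := by
  subst h
  rfl

theorem mulInvariantVectorField_one (η : GroupLieAlgebra 𝓘(ℝ, EG) G) :
    mulInvariantVectorField η (1 : G) = η := by
  have h : (fun b : G => 1 * b) = id := funext one_mul
  have h1 : (mfderiv 𝓘(ℝ, EG) 𝓘(ℝ, EG) (fun b : G => 1 * b) 1 : EG →L[ℝ] EG) =
      (mfderiv 𝓘(ℝ, EG) 𝓘(ℝ, EG) (id : G → G) 1 : EG →L[ℝ] EG) :=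
    mfderiv_clm_congr h 1
  exact congrArg (fun T : EG →L[ℝ] EG => T η) (h1.trans mfderiv_id)

theorem invariantCoord_extChartAt (η : GroupLieAlgebra 𝓘(ℝ, EG) G) {g : G}
    (hg : g ∈ (chartAt EG (1 : G)).source) :
    invariantCoord η (extChartAt 𝓘(ℝ, EG) (1 : G) g) =
      (tangentCoordChange 𝓘(ℝ, EG) g (1 : G) g : EG →L[ℝ] EG) (mulInvariantVectorField η g) :=
  mpullbackWithin_extChartAt_symm _ hg

theorem invariantCoord_one (η : GroupLieAlgebra 𝓘(ℝ, EG) G) :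
    invariantCoord η (extChartAt 𝓘(ℝ, EG) (1 : G) 1) = η := by
  rw [invariantCoord_extChartAt η (mem_chart_source EG (1 : G)),
    tangentCoordChange_self_clm (mem_chart_source EG (1 : G)), mulInvariantVectorField_one]
  rfl

theorem differentiableAt_invariantCoord (η : GroupLieAlgebra 𝓘(ℝ, EG) G) :
    DifferentiableAt ℝ (invariantCoord η) (extChartAt 𝓘(ℝ, EG) (1 : G) 1) := by
  have : LieGroup 𝓘(ℝ, EG) (minSmoothness ℝ 3) G :=
    LieGroup.of_le (n := ∞) (by
      rw [minSmoothness_of_isRCLikeNormedField]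
      exact (inferInstance : ENat.LEInfty (3 : WithTop ℕ∞)).out)
  have : CompleteSpace EG := FiniteDimensional.complete ℝ EG
  have h := (mdifferentiableAt_mulInvariantVectorField (I := 𝓘(ℝ, EG)) η (g := (1 : G)))
  have h2 := (mdifferentiableWithinAt_univ.2 h).differentiableWithinAt_mpullbackWithin_vectorField
  have hs : (extChartAt 𝓘(ℝ, EG) (1 : G)).symm ⁻¹' univ ∩ range 𝓘(ℝ, EG) = univ := by simp
  rw [hs] at h2
  exact differentiableWithinAt_univ.1 h2

/-- The bracket is that of the left-invariant fields at `1`. In the chart at `1` these fields take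
the values `η` and `ξ` at the base point, and the chart has identity differential there. -/
theorem bracket_eq_fderiv (η ξ : GroupLieAlgebra 𝓘(ℝ, EG) G) :
    (⁅η, ξ⁆ : GroupLieAlgebra 𝓘(ℝ, EG) G) =
      (fderiv ℝ (invariantCoord ξ) (extChartAt 𝓘(ℝ, EG) (1 : G) 1) η -
        fderiv ℝ (invariantCoord η) (extChartAt 𝓘(ℝ, EG) (1 : G) 1) ξ : EG) := by
  rw [GroupLieAlgebra.bracket_def, VectorField.mlieBracket, VectorField.mlieBracketWithin_apply]
  have h1 : VectorField.lieBracketWithin ℝ (invariantCoord η) (invariantCoord ξ)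
      ((extChartAt 𝓘(ℝ, EG) (1 : G)).symm ⁻¹' univ ∩ range 𝓘(ℝ, EG))
      (extChartAt 𝓘(ℝ, EG) (1 : G) 1) =
      (fderiv ℝ (invariantCoord ξ) (extChartAt 𝓘(ℝ, EG) (1 : G) 1) η -
        fderiv ℝ (invariantCoord η) (extChartAt 𝓘(ℝ, EG) (1 : G) 1) ξ : EG) := by
    have hs : (extChartAt 𝓘(ℝ, EG) (1 : G)).symm ⁻¹' univ ∩ range 𝓘(ℝ, EG) = univ := by simp
    rw [hs, VectorField.lieBracketWithin, fderivWithin_univ, fderivWithin_univ, invariantCoord_one,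
      invariantCoord_one]
  have h2 : ContinuousLinearMap.inverse (ContinuousLinearMap.id ℝ EG) =
      ContinuousLinearMap.id ℝ EG := ContinuousLinearMap.inverse_id
  have h3 : (mfderiv 𝓘(ℝ, EG) 𝓘(ℝ, EG) (extChartAt 𝓘(ℝ, EG) (1 : G)) 1 : EG →L[ℝ] EG) =
    ContinuousLinearMap.id ℝ EG := mfderiv_extChartAt_self
  refine (congrArg (ContinuousLinearMap.inverse (mfderiv 𝓘(ℝ, EG) 𝓘(ℝ, EG)
    (extChartAt 𝓘(ℝ, EG) (1 : G)) 1 : EG →L[ℝ] EG)) h1).trans ?_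
  refine (congrArg (fun T : EG →L[ℝ] EG => T.inverse _) h3).trans ?_
  exact congrArg (fun T : EG →L[ℝ] EG => T _) h2

theorem mdifferentiableAt_orbit
    (hact : ContMDiff (𝓘(ℝ, EG).prod 𝓘(ℝ, F)) 𝓘(ℝ, F) ∞ (fun p : G × Q => p.1 • p.2))
    (q : Q) (g : G) : MDifferentiableAt 𝓘(ℝ, EG) 𝓘(ℝ, F) (fun h : G => h • q) g := by
  have h : ContMDiffAt 𝓘(ℝ, EG) (𝓘(ℝ, EG).prod 𝓘(ℝ, F)) ∞ (fun h : G => (h, q)) g :=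
    contMDiffAt_id.prodMk contMDiffAt_const
  exact ((hact.contMDiffAt (x := (g, q))).comp g h).mdifferentiableAt (by simp)

theorem mdifferentiableAt_translation
    (hact : ContMDiff (𝓘(ℝ, EG).prod 𝓘(ℝ, F)) 𝓘(ℝ, F) ∞ (fun p : G × Q => p.1 • p.2))
    (g : G) (q : Q) : MDifferentiableAt 𝓘(ℝ, F) 𝓘(ℝ, F) (fun r : Q => g • r) q := by
  have h : ContMDiffAt 𝓘(ℝ, F) (𝓘(ℝ, EG).prod 𝓘(ℝ, F)) ∞ (fun r : Q => (g, r)) q :=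
    contMDiffAt_const.prodMk contMDiffAt_id
  exact ((hact.contMDiffAt (x := (g, q))).comp q h).mdifferentiableAt (by simp)

/-- Left translations carry the generators of the action along orbits to left-invariant fields. -/
theorem mfderiv_smul_mulInvariantVectorField
    (hact : ContMDiff (𝓘(ℝ, EG).prod 𝓘(ℝ, F)) 𝓘(ℝ, F) ∞ (fun p : G × Q => p.1 • p.2))
    (q : Q) (g : G) (η : GroupLieAlgebra 𝓘(ℝ, EG) G) :
    (show EG →L[ℝ] F from mfderiv 𝓘(ℝ, EG) 𝓘(ℝ, F) (fun h : G => h • q) g)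
        (mulInvariantVectorField η g) =
      (show F →L[ℝ] F from mfderiv 𝓘(ℝ, F) 𝓘(ℝ, F) (fun r : Q => g • r) q)
        (infGen EG G F q η) := by
  have horb := mdifferentiableAt_orbit hact q
  have htr : ∀ r : Q, MDifferentiableAt 𝓘(ℝ, F) 𝓘(ℝ, F) (fun r : Q => g • r) r := fun r =>
    mdifferentiableAt_translation hact g r
  have hmul : MDifferentiableAt 𝓘(ℝ, EG) 𝓘(ℝ, EG) (fun h : G => g * h) 1 :=
    (contMDiff_mul_left (I := 𝓘(ℝ, EG)) (n := ∞) (a := g)).contMDiffAt.mdifferentiableAt (by simp)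
  have h1 : (mfderiv 𝓘(ℝ, EG) 𝓘(ℝ, F) ((fun h : G => h • q) ∘ fun h : G => g * h) 1 :
      EG →L[ℝ] F) = (mfderiv 𝓘(ℝ, EG) 𝓘(ℝ, F) (fun h : G => h • q) (g * 1) : EG →L[ℝ] F) ∘L
        (mfderiv 𝓘(ℝ, EG) 𝓘(ℝ, EG) (fun h : G => g * h) 1 : EG →L[ℝ] EG) :=
    mfderiv_comp (1 : G) (horb _) hmul
  have h2 : (mfderiv 𝓘(ℝ, EG) 𝓘(ℝ, F) ((fun r : Q => g • r) ∘ fun h : G => h • q) 1 :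
      EG →L[ℝ] F) = (mfderiv 𝓘(ℝ, F) 𝓘(ℝ, F) (fun r : Q => g • r) ((1 : G) • q) : F →L[ℝ] F) ∘L
        (mfderiv 𝓘(ℝ, EG) 𝓘(ℝ, F) (fun h : G => h • q) 1 : EG →L[ℝ] F) :=
    mfderiv_comp (1 : G) (htr _) (horb 1)
  -- The identity `(g h) • q = g • (h • q)` is differentiated at `h = 1`, by the chain rule in two
  -- ways.
  have h3 : ((fun h : G => h • q) ∘ fun h : G => g * h) = (fun r : Q => g • r) ∘ fun h : G => h • q :=
    funext fun h => mul_smul g h q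
  have h4 := (h1.symm.trans (mfderiv_clm_congr h3 1)).trans h2
  have h5 := congrArg (fun T : EG →L[ℝ] F => T η) h4
  have h6 : (mfderiv 𝓘(ℝ, EG) 𝓘(ℝ, F) (fun h : G => h • q) (g * 1) : EG →L[ℝ] F) =
      (mfderiv 𝓘(ℝ, EG) 𝓘(ℝ, F) (fun h : G => h • q) g : EG →L[ℝ] F) :=
    mfderiv_clm_congr_point _ (mul_one g)
  have h7 : (mfderiv 𝓘(ℝ, F) 𝓘(ℝ, F) (fun r : Q => g • r) ((1 : G) • q) : F →L[ℝ] F) =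
      (mfderiv 𝓘(ℝ, F) 𝓘(ℝ, F) (fun r : Q => g • r) q : F →L[ℝ] F) :=
    mfderiv_clm_congr_point _ (one_smul G q)
  exact ((congrArg (fun T : EG →L[ℝ] F => T (mulInvariantVectorField η g)) h6).symm.trans h5).trans
    (congrArg (fun T : F →L[ℝ] F => T (infGen EG G F q η)) h7)

/-- Compatibility of a left-invariant vector field with the action, in charts. -/
theorem fderiv_actionCoord_invariantCoord
    (hact : ContMDiff (𝓘(ℝ, EG).prod 𝓘(ℝ, F)) 𝓘(ℝ, F) ∞ (fun p : G × Q => p.1 • p.2))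
    (q : Q) (η : GroupLieAlgebra 𝓘(ℝ, EG) G) :
    ∀ᶠ z in 𝓝 (extChartAt 𝓘(ℝ, EG) (1 : G) 1),
      fderiv ℝ (actionCoord EG G q) (z, extChartAt 𝓘(ℝ, F) q q) (invariantCoord η z, 0) =
      fderiv ℝ (actionCoord EG G q) (z, extChartAt 𝓘(ℝ, F) q q)
        (0, infGenCoord EG G q (extChartAt 𝓘(ℝ, F) q q) η) := by
  have hq := mem_chart_source F q
  have hone := mem_chart_source EG (1 : G)
  have hd : ∀ᶠ z in 𝓝 (extChartAt 𝓘(ℝ, EG) (1 : G) 1),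
      DifferentiableAt ℝ (actionCoord EG G q) (z, extChartAt 𝓘(ℝ, F) q q) := by
    have h := ((contDiffAt_actionCoord hact hq).of_le (m := 1) (by simp)).eventually (by simp)
    have ht : Tendsto (fun z : EG => (z, extChartAt 𝓘(ℝ, F) q q))
        (𝓝 (extChartAt 𝓘(ℝ, EG) (1 : G) 1))
        (𝓝 (extChartAt 𝓘(ℝ, EG) (1 : G) 1, extChartAt 𝓘(ℝ, F) q q)) :=
      (Continuous.prodMk_left (extChartAt 𝓘(ℝ, F) q q)).continuousAt
    exact (ht.eventually h).mono fun z hz => hz.differentiableAt (by simp)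
  have hs : ∀ᶠ z in 𝓝 (extChartAt 𝓘(ℝ, EG) (1 : G) 1),
      (extChartAt 𝓘(ℝ, EG) (1 : G)).symm z • q ∈ (chartAt F q).source := by
    refine eventually_extChartAt_symm hone (p := fun g => g • q ∈ (chartAt F q).source) ?_
    refine (mdifferentiableAt_orbit hact q 1).continuousAt.preimage_mem_nhds ?_
    rw [one_smul]
    exact chart_source_mem_nhds F q
  filter_upwards [hd, hs, (isOpen_extChartAt_target (I := 𝓘(ℝ, EG)) (1 : G)).mem_nhds
    (mem_extChartAt_target (1 : G))] with z hz hzq hzt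
  obtain ⟨g, hg, rfl⟩ : ∃ g ∈ (chartAt EG (1 : G)).source, extChartAt 𝓘(ℝ, EG) (1 : G) g = z :=
    ⟨_, by simpa using (extChartAt 𝓘(ℝ, EG) (1 : G)).map_target hzt,
      (extChartAt 𝓘(ℝ, EG) (1 : G)).right_inv hzt⟩
  rw [extChartAt_symm_extChartAt hg] at hzq
  -- The orbit map and the translation by `g` are the two partial maps of the action; their
  -- derivatives in charts are the restrictions of the full derivative to the two factors.
  have hO := hasFDerivAt_coord (mdifferentiableAt_orbit hact q g) hg hzq
  have hT := hasFDerivAt_coord (mdifferentiableAt_translation hact g q) hq hzq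
  have e1 : (extChartAt 𝓘(ℝ, F) q ∘ (fun h : G => h • q) ∘ (extChartAt 𝓘(ℝ, EG) (1 : G)).symm) =
      fun z => actionCoord EG G q (z, extChartAt 𝓘(ℝ, F) q q) := by
    funext z
    simp only [actionCoord, Function.comp_apply, extChartAt_symm_extChartAt hq]
  have e2 : (extChartAt 𝓘(ℝ, F) q ∘ (fun r : Q => g • r) ∘ (extChartAt 𝓘(ℝ, F) q).symm) =
      fun a => actionCoord EG G q (extChartAt 𝓘(ℝ, EG) (1 : G) g, a) := by
    funext z
    simp only [actionCoord, Function.comp_apply, extChartAt_symm_extChartAt hg]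
  rw [e1] at hO
  rw [e2] at hT
  have hO' := hO.unique (HasFDerivAt.comp (g := actionCoord EG G q) _ hz.hasFDerivAt
    (hasFDerivAt_prodMk_left _ _))
  have hT' := hT.unique (HasFDerivAt.comp (g := actionCoord EG G q) _ hz.hasFDerivAt
    (hasFDerivAt_prodMk_right _ _))
  have l1 := congrArg (fun T : EG →L[ℝ] F => T (invariantCoord η (extChartAt 𝓘(ℝ, EG) (1 : G) g))) hO'
  have l2 := congrArg (fun T : F →L[ℝ] F => T (infGen EG G F q η)) hT'
  have hinv : fromCoordQ EG (1 : G) g (invariantCoord η (extChartAt 𝓘(ℝ, EG) (1 : G) g)) =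
      mulInvariantVectorField η g := by
    rw [invariantCoord_extChartAt η hg]
    exact fromCoordQ_coord hg _
  have hgen : infGenCoord EG G q (extChartAt 𝓘(ℝ, F) q q) = infGen EG G F q := by
    rw [infGenCoord_extChartAt hq, tangentCoordChange_self_clm hq]
    rfl
  have hself : (tangentCoordChange 𝓘(ℝ, F) q q q : F →L[ℝ] F) (infGen EG G F q η) =
      infGen EG G F q η :=
    congrArg (fun T : F →L[ℝ] F => T (infGen EG G F q η)) (tangentCoordChange_self_clm hq)
  rw [hgen]
  refine l1.symm.trans (Eq.trans ?_ l2)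
  refine congrArg (tangentCoordChange 𝓘(ℝ, F) (g • q) q (g • q) : F →L[ℝ] F) ?_
  refine (congrArg (mfderiv 𝓘(ℝ, EG) 𝓘(ℝ, F) (fun h : G => h • q) g : EG →L[ℝ] F) hinv).trans ?_
  refine (mfderiv_smul_mulInvariantVectorField hact q g η).trans ?_
  exact (congrArg (mfderiv 𝓘(ℝ, F) 𝓘(ℝ, F) (fun r : Q => g • r) q : F →L[ℝ] F) hself).symm

/-- This is `generator_apply_bracket` for the action in charts, the functions `l` and `l'` being the
left-invariant fields. The order of the terms records that generators of a left action form an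
anti-representation. -/
theorem infGenCoord_bracket
    (hact : ContMDiff (𝓘(ℝ, EG).prod 𝓘(ℝ, F)) 𝓘(ℝ, F) ∞ (fun p : G × Q => p.1 • p.2))
    (q : Q) (η ξ : GroupLieAlgebra 𝓘(ℝ, EG) G) :
    infGenCoord EG G q (extChartAt 𝓘(ℝ, F) q q) (⁅η, ξ⁆ : GroupLieAlgebra 𝓘(ℝ, EG) G) =
      fderiv ℝ (infGenCoord EG G q) (extChartAt 𝓘(ℝ, F) q q)
        (infGenCoord EG G q (extChartAt 𝓘(ℝ, F) q q) ξ) η -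
      fderiv ℝ (infGenCoord EG G q) (extChartAt 𝓘(ℝ, F) q q)
        (infGenCoord EG G q (extChartAt 𝓘(ℝ, F) q q) η) ξ := by
  have hq := mem_chart_source F q
  have h := generator_apply_bracket (contDiffAt_actionCoord hact hq)
    (infGenCoord_eventuallyEq hact hq) (differentiableAt_invariantCoord η)
    (differentiableAt_invariantCoord ξ)
    (by rw [invariantCoord_one]; exact fderiv_actionCoord_invariantCoord hact q η)
    (by rw [invariantCoord_one]; exact fderiv_actionCoord_invariantCoord hact q ξ)
  rw [invariantCoord_one, invariantCoord_one] at h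
  rw [bracket_eq_fderiv]
  exact h

end Bracket

end CovariantClebsch

namespace CovariantClebsch

open Filter Set

/-! ### Leibniz rule for the divergence of a contraction. -/

section ContractField

variable {n : ℕ} {V W : Type*} [NormedAddCommGroup V] [NormedSpace ℝ V]
  [NormedAddCommGroup W] [NormedSpace ℝ W]

theorem differentiableAt_sum_clm_conj {Z A B ι : Type*} [NormedAddCommGroup Z] [NormedSpace ℝ Z]
    [NormedAddCommGroup A] [NormedSpace ℝ A] [NormedAddCommGroup B] [NormedSpace ℝ B]
    {P : Z → A →L[ℝ] B} {z : Z} (hP : DifferentiableAt ℝ P z) (s : Finset ι) (L : ι → B →L[ℝ] W)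
    (d : ι → V →L[ℝ] A) : DifferentiableAt ℝ (fun y => ∑ μ ∈ s, L μ ∘L P y ∘L d μ) z :=
  DifferentiableAt.fun_sum fun μ _ =>
    (differentiableAt_const (L μ)).clm_comp (hP.clm_comp (differentiableAt_const (d μ)))

theorem differentiableAt_contract_clm
    {P : BaseModel n → (BaseModel n →L[ℝ] V) →L[ℝ] (BaseModel n) [⋀^Fin (n + 1)]→L[ℝ] ℝ}
    {z : BaseModel n} (hP : DifferentiableAt ℝ P z) :
    DifferentiableAt ℝ (fun y => contract (P y)) z :=
  differentiableAt_sum_clm_conj hP Finset.univ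
    (fun μ => (ContinuousLinearMap.apply ℝ ((BaseModel n) [⋀^Fin n]→L[ℝ] ℝ) (stdVec n μ)) ∘L
      (ContinuousAlternatingMap.curryLeftLI (𝕜 := ℝ) (E := BaseModel n) (F := ℝ)
        (n := n)).toContinuousLinearMap)
    (fun μ => ContinuousLinearMap.smulRightL ℝ (BaseModel n) V (stdCovec n μ))

/-- The divergence of the contraction with a non-constant field. -/
theorem extDeriv_contract_field
    {P : BaseModel n → (BaseModel n →L[ℝ] V) →L[ℝ] (BaseModel n) [⋀^Fin (n + 1)]→L[ℝ] ℝ}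
    {a : BaseModel n → V} {z : BaseModel n} (hP : DifferentiableAt ℝ P z)
    {a' : BaseModel n →L[ℝ] V} (ha : HasFDerivAt a a' z) :
    extDeriv (fun y => contract (P y) (a y)) z =
      extDeriv (fun y => contract (P y) (a z)) z + P z a' := by
  have hc := (differentiableAt_contract_clm hP).hasFDerivAt
  have h1 := hc.clm_apply ha
  have h2 := hc.clm_apply (hasFDerivAt_const (a z) z)
  rw [extDeriv, extDeriv, h1.fderiv, h2.fderiv, ContinuousLinearMap.comp_zero, zero_add,
    add_comm (contract (P z) ∘L a'), ContinuousAlternatingMap.alternatizeUncurryFin_add]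
  congr 1
  exact wedgeContract_contract (P z) a'

/-- The exterior derivative of a one-form. -/
theorem extDeriv_ofSubsingleton {S : BaseModel n → BaseModel n →L[ℝ] W} {z : BaseModel n}
    (hS : DifferentiableAt ℝ S z) (u v : BaseModel n) :
    extDeriv (fun y => ContinuousAlternatingMap.ofSubsingleton ℝ (BaseModel n) W (0 : Fin 1) (S y))
      z ![u, v] = fderiv ℝ S z u v - fderiv ℝ S z v u := by
  let L : (BaseModel n →L[ℝ] W) →L[ℝ] (BaseModel n) [⋀^Fin 1]→L[ℝ] W :=
    (ContinuousAlternatingMap.ofSubsingletonLIE (𝕜 := ℝ) (E := BaseModel n) (F := W)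
      (0 : Fin 1)).toContinuousLinearEquiv.toContinuousLinearMap
  have h : HasFDerivAt (fun y => ContinuousAlternatingMap.ofSubsingleton ℝ (BaseModel n) W
      (0 : Fin 1) (S y)) (L ∘L fderiv ℝ S z) z := L.hasFDerivAt.comp z hS.hasFDerivAt
  rw [extDeriv, h.fderiv, ContinuousAlternatingMap.alternatizeUncurryFin_apply, Fin.sum_univ_two]
  have hL : ∀ (f : BaseModel n →L[ℝ] W) (w : Fin 1 → BaseModel n), L f w = f (w 0) :=
    fun f w => rfl
  simp [hL, Fin.removeNth, sub_eq_add_neg]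

theorem contract_comp_postcomp (N : (BaseModel n →L[ℝ] W) →L[ℝ] (BaseModel n) [⋀^Fin (n + 1)]→L[ℝ] ℝ)
    (A : V →L[ℝ] W) (v : V) :
    contract (N ∘L A.postcomp (BaseModel n)) v = contract N (A v) := by
  rw [contract_apply, contract_apply]
  refine Finset.sum_congr rfl fun μ _ => ?_
  have h : A.postcomp (BaseModel n) ((stdCovec n μ).smulRight v) = (stdCovec n μ).smulRight (A v) :=
    ContinuousLinearMap.ext fun u => map_smul A _ _
  rw [ContinuousLinearMap.comp_apply, h]

end ContractField

/-! ### Integrability of `DQ = A(Q) S`. -/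

section MaurerCartan

variable {E K F : Type*} [NormedAddCommGroup E] [NormedSpace ℝ E] [NormedAddCommGroup K]
  [NormedSpace ℝ K] [NormedAddCommGroup F] [NormedSpace ℝ F]

/-- The integrability condition of the equation `DQ = A(Q) ∘ S`. -/
theorem integrability_condition {A : F → K →L[ℝ] F} {Q : E → F} {S : E → E →L[ℝ] K} {z : E}
    (hA : DifferentiableAt ℝ A (Q z)) (hQ : ContDiffAt ℝ ∞ Q z) (hS : DifferentiableAt ℝ S z)
    (h : ∀ᶠ y in 𝓝 z, fderiv ℝ Q y = A (Q y) ∘L S y) (u v : E) :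
    A (Q z) (fderiv ℝ S z u v - fderiv ℝ S z v u) =
      fderiv ℝ A (Q z) (A (Q z) (S z v)) (S z u) -
        fderiv ℝ A (Q z) (A (Q z) (S z u)) (S z v) := by
  have hQd := (hQ.differentiableAt (by simp)).hasFDerivAt
  have h1 : HasFDerivAt (fun y => A (Q y)) (fderiv ℝ A (Q z) ∘L fderiv ℝ Q z) z :=
    hA.hasFDerivAt.comp z hQd
  have h2 := (h1.clm_comp hS.hasFDerivAt).congr_of_eventuallyEq h
  -- The second derivative of `Q` is obtained by differentiating the equation itself; its symmetry
  -- in `u` and `v` is the asserted condition.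
  have h3 : ∀ u v, fderiv ℝ (fderiv ℝ Q) z u v =
      A (Q z) (fderiv ℝ S z u v) + fderiv ℝ A (Q z) (A (Q z) (S z u)) (S z v) := fun u v => by
    rw [h2.fderiv, h.self_of_nhds]
    simp
  have hsymm : IsSymmSndFDerivAt ℝ Q z := hQ.isSymmSndFDerivAt (by
    rw [minSmoothness_of_isRCLikeNormedField]
    exact (inferInstance : ENat.LEInfty (2 : WithTop ℕ∞)).out)
  have h4 := hsymm.eq u v
  rw [h3, h3] at h4
  rw [map_sub, sub_eq_sub_iff_add_eq_add, h4, add_comm]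

end MaurerCartan

/-! ### The Euler–Poincaré equations and the compatibility condition. -/

section EulerPoincare

variable {n : ℕ}
  {EG : Type*} [NormedAddCommGroup EG] [NormedSpace ℝ EG] [FiniteDimensional ℝ EG]
  {G : Type*} [TopologicalSpace G] [ChartedSpace EG G] [Group G] [LieGroup 𝓘(ℝ, EG) ∞ G]
  {F : Type*} [NormedAddCommGroup F] [NormedSpace ℝ F] [FiniteDimensional ℝ F]
  {Q : Type*} [TopologicalSpace Q] [ChartedSpace F Q] [IsManifold 𝓘(ℝ, F) ∞ Q] [MulAction G Q]
  {X : Type*} [TopologicalSpace X] [ChartedSpace (BaseModel n) X]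
  [IsManifold 𝓘(ℝ, BaseModel n) ∞ X]

variable {x i : X} {k q : Q} {ψ : ∀ x : X, PhaseFiber n EG G F Q x} {U : Set X}

theorem infGenCoord_self (q : Q) :
    infGenCoord EG G q (extChartAt 𝓘(ℝ, F) q q) = infGen EG G F q := by
  rw [infGenCoord_extChartAt (mem_chart_source F q),
    tangentCoordChange_self_clm (mem_chart_source F q)]
  rfl

/-- The generators reverse the Lie bracket. -/
theorem infGen_bracket
    (hact : ContMDiff (𝓘(ℝ, EG).prod 𝓘(ℝ, F)) 𝓘(ℝ, F) ∞ (fun p : G × Q => p.1 • p.2))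
    (q : Q) (η ξ : GroupLieAlgebra 𝓘(ℝ, EG) G) :
    infGen EG G F q (⁅η, ξ⁆ : GroupLieAlgebra 𝓘(ℝ, EG) G) =
      genDeriv (F := F) EG G q (infGen EG G F q ξ) η -
        genDeriv (F := F) EG G q (infGen EG G F q η) ξ := by
  have h := infGenCoord_bracket hact q η ξ
  rw [infGenCoord_self] at h
  exact h

theorem fderiv_coordQ_eventuallyEq (hU : IsOpen U) (hψ : IsSmoothSection U ψ)
    (hdq : ∀ x ∈ U, dq ψ x = sigmaQ ψ x) (hxU : x ∈ U)
    (hx : x ∈ (chartAt (BaseModel n) i).source) (hk : (ψ x).q ∈ (chartAt F k).source) :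
    ∀ᶠ z in 𝓝 (extChartAt 𝓘(ℝ, BaseModel n) i x), fderiv ℝ (coordQ i k ψ) z =
      infGenCoord EG G k (coordQ i k ψ z) ∘L coordS i ψ z := by
  have h : ∀ᶠ y in 𝓝 x, y ∈ U ∧ (ψ y).q ∈ (chartAt F k).source :=
    (hU.eventually_mem hxU).and ((hψ.continuousAt_q hU hxU).preimage_mem_nhds
      ((chartAt F k).open_source.mem_nhds hk))
  filter_upwards [eventually_mem_target hx, eventually_extChartAt_symm hx h] with z hz hz2
  obtain ⟨y, hy, rfl⟩ := hz
  rw [extChartAt_symm_extChartAt hy] at hz2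
  obtain ⟨W, hW, hyW, hsm⟩ := hψ.exists_smoothFamilyOn hU hz2.1
  rw [(hasFDerivAt_coordQ (hsm.mdifferentiableAt_q hW (hyW 0)) hy hz2.2).fderiv,
    infGenCoord_comp_coordS hy hz2.2, hdq y hz2.1]

theorem coordS_self (x : X) (ψ : ∀ x : X, PhaseFiber n EG G F Q x) :
    coordS x ψ (extChartAt 𝓘(ℝ, BaseModel n) x x) = (ψ x).σ := by
  rw [coordS_extChartAt (mem_chart_source (BaseModel n) x)]
  refine ContinuousLinearMap.ext fun v => ?_
  exact congrArg (ψ x).σ (congrArg (fun T : BaseModel n →L[ℝ] BaseModel n => T v)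
    (tangentCoordChange_self_clm (mem_chart_source (BaseModel n) x)))

theorem dSigma_eq (hU : IsOpen U) (hψ : IsSmoothSection U ψ) (hxU : x ∈ U) (u v : TX n x) :
    (dSigma ψ x u v : EG) =
      fderiv ℝ (coordS x ψ) (extChartAt 𝓘(ℝ, BaseModel n) x x) u v -
        fderiv ℝ (coordS x ψ) (extChartAt 𝓘(ℝ, BaseModel n) x x) v u := by
  exact extDeriv_ofSubsingleton ((hψ.contDiffAt_coordS hU hxU
    (mem_chart_source (BaseModel n) x)).differentiableAt (by simp)) u v

/-- The integrability condition of `dq = σ_Q(q)` expresses `(dσ)_Q` through derivatives of the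
generators. By the bracket identity, that expression is `[σ, σ]_Q`. -/
theorem compatible_of_dq_eq
    (hact : ContMDiff (𝓘(ℝ, EG).prod 𝓘(ℝ, F)) 𝓘(ℝ, F) ∞ (fun p : G × Q => p.1 • p.2))
    (hU : IsOpen U) (hψ : IsSmoothSection U ψ) (hdq : ∀ x ∈ U, dq ψ x = sigmaQ ψ x) :
    Compatible U ψ := by
  intro x hxU u v
  have hx := mem_chart_source (BaseModel n) x
  have hk := mem_chart_source F (ψ x).q
  have hQx : coordQ x (ψ x).q ψ (extChartAt 𝓘(ℝ, BaseModel n) x x) =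
    extChartAt 𝓘(ℝ, F) (ψ x).q (ψ x).q := coordQ_extChartAt hx _ _
  have h1 := integrability_condition (A := infGenCoord EG G (ψ x).q)
    (by rw [hQx]; exact (contDiffAt_infGenCoord hact hk).differentiableAt (by simp))
    (hψ.contDiffAt_coordQ hU hxU hx hk)
    ((hψ.contDiffAt_coordS hU hxU hx).differentiableAt (by simp))
    (fderiv_coordQ_eventuallyEq hU hψ hdq hxU hx hk) u v
  rw [hQx, infGenCoord_self, coordS_self] at h1
  rw [map_sub, infGen_bracket hact, sub_eq_zero]
  exact (congrArg (show EG →L[ℝ] F from infGen EG G F (ψ x).q) (dSigma_eq hU hψ hxU u v)).trans h1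

theorem formCoord_extChartAt_congr {m : ℕ} {W : Type*} [NormedAddCommGroup W] [NormedSpace ℝ W]
    (hx : x ∈ (chartAt (BaseModel n) i).source)
    {β β' : ∀ x : X, (TangentSpace 𝓘(ℝ, BaseModel n) x) [⋀^Fin m]→L[ℝ] W} (h : β x = β' x) :
    formCoord i β (extChartAt 𝓘(ℝ, BaseModel n) i x) =
      formCoord i β' (extChartAt 𝓘(ℝ, BaseModel n) i x) := by
  rw [formCoord, formCoord, extChartAt_symm_extChartAt hx, h]

theorem contract_momentumMap (x : X) (q : Q) (w : Momentum n F x q)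
    (ξ : GroupLieAlgebra 𝓘(ℝ, EG) G) :
    contract (V := EG) (momentumMap (EG := EG) (G := G) x q w) ξ =
      contract (V := F) w (infGen EG G F q ξ) :=
  contract_comp_postcomp (V := EG) (W := F) w (infGen EG G F q) ξ

variable (EG G) in
/-- The endomorphism `b ↦ D_b ξ_Q` of the derivative of a generator in the chart at the base
point. -/
noncomputable def genDerivField (q : Q) (ξ : GroupLieAlgebra 𝓘(ℝ, EG) G) :
    TangentSpace 𝓘(ℝ, F) q →L[ℝ] TangentSpace 𝓘(ℝ, F) q :=
  show F →L[ℝ] F from (fderiv ℝ (infGenCoord EG G q) (extChartAt 𝓘(ℝ, F) q q)).flip ξ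

/-- The divergence of the momentum map. -/
theorem divLie_momentumMap
    (hact : ContMDiff (𝓘(ℝ, EG).prod 𝓘(ℝ, F)) 𝓘(ℝ, F) ∞ (fun p : G × Q => p.1 • p.2))
    (hU : IsOpen U) (hψ : IsSmoothSection U ψ) (hdq : ∀ x ∈ U, dq ψ x = sigmaQ ψ x)
    (hxU : x ∈ U) (ξ : GroupLieAlgebra 𝓘(ℝ, EG) G) :
    divLie (fun y => momentumMap (EG := EG) (G := G) y (ψ y).q (ψ y).mom) x ξ =
      extDerivAt 𝓘(ℝ, BaseModel n) (momentumForm (ψ x).q ψ (infGen EG G F (ψ x).q ξ)) x +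
        (ψ x).mom (genDerivField EG G (ψ x).q ξ ∘L sigmaQ ψ x) := by
  have hx := mem_chart_source (BaseModel n) x
  have hk := mem_chart_source F (ψ x).q
  set z₀ := extChartAt 𝓘(ℝ, BaseModel n) x x with hz₀
  let ζ : EG := ξ
  let a : BaseModel n → F := fun z => infGenCoord EG G (ψ x).q (coordQ x (ψ x).q ψ z) ζ
  have hQx : coordQ x (ψ x).q ψ z₀ = extChartAt 𝓘(ℝ, F) (ψ x).q (ψ x).q := coordQ_extChartAt hx _ _
  have hP : DifferentiableAt ℝ (coordP x (ψ x).q ψ) z₀ :=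
    (hψ.contDiffAt_coordP hU hxU hx hk).differentiableAt (by simp)
  have hQ : DifferentiableAt ℝ (coordQ x (ψ x).q ψ) z₀ :=
    (hψ.contDiffAt_coordQ hU hxU hx hk).differentiableAt (by simp)
  have hA : DifferentiableAt ℝ (infGenCoord EG G (ψ x).q) (coordQ x (ψ x).q ψ z₀) := by
    rw [hQx]
    exact (contDiffAt_infGenCoord hact hk).differentiableAt (by simp)
  -- Contracting `𝔧(ω)` with a fixed `ξ` is contracting `ω` with the field `ξ_Q(q)`, whose
  -- components in the chart at `q(x)` vary with the point and are the function `a`.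
  have hform : formCoord x (fun y => contract (V := EG)
      (momentumMap (EG := EG) (G := G) y (ψ y).q (ψ y).mom) ζ) =ᶠ[𝓝 z₀]
        fun z => contract (coordP x (ψ x).q ψ z) (a z) := by
    filter_upwards [eventually_mem_target hx, eventually_extChartAt_symm hx
      ((hψ.continuousAt_q hU hxU).preimage_mem_nhds ((chartAt F (ψ x).q).open_source.mem_nhds hk))]
      with z hz hz2
    obtain ⟨y, hy, rfl⟩ := hz
    rw [extChartAt_symm_extChartAt hy] at hz2
    rw [← formCoord_momentumForm hy]
    have h1 : fromCoordQ F (ψ x).q (ψ y).q (a (extChartAt 𝓘(ℝ, BaseModel n) x y)) =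
        infGen EG G F (ψ y).q ζ := by
      simp only [a]
      rw [coordQ_extChartAt hy, infGenCoord_extChartAt hz2]
      exact fromCoordQ_coord hz2 _
    refine formCoord_extChartAt_congr hy ?_
    refine (contract_momentumMap y (ψ y).q (ψ y).mom ξ).trans ?_
    exact congrArg (fun b : F => contract (V := F) (ψ y).mom b) h1.symm
  have ha0 : a z₀ = infGen EG G F (ψ x).q ξ := by
    simp only [a]
    rw [hQx, infGenCoord_self]
    rfl
  have hdQ : fderiv ℝ (coordQ x (ψ x).q ψ) z₀ =
      (show BaseModel n →L[ℝ] F from sigmaQ ψ x) := by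
    rw [(fderiv_coordQ_eventuallyEq hU hψ hdq hxU hx hk).self_of_nhds, hQx, infGenCoord_self,
      coordS_self]
    rfl
  have ha : HasFDerivAt a (show BaseModel n →L[ℝ] F from
      genDerivField EG G (ψ x).q ξ ∘L sigmaQ ψ x) z₀ := by
    have h1 := (hA.hasFDerivAt.comp z₀ hQ.hasFDerivAt).clm_apply (hasFDerivAt_const ζ z₀)
    refine h1.congr_fderiv ?_
    rw [hdQ, hQx]
    exact ContinuousLinearMap.ext fun v => by
      simp only [ContinuousLinearMap.comp_zero, zero_add]
      rfl
  -- The Leibniz rule separates the divergence with the components of `ξ_Q` frozen at `x` from the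
  -- derivative of these components along `dq = σ_Q`.
  have hmain := extDeriv_contract_field hP ha
  rw [← hform.extDeriv_eq] at hmain
  refine hmain.trans ?_
  have hPx : ∀ B : TX n x →L[ℝ] TangentSpace 𝓘(ℝ, F) (ψ x).q,
      coordP x (ψ x).q ψ z₀ B = (ψ x).mom B := fun B => by
    have h1 := momentumCoord_apply hx hk (ψ x).mom B
    rw [← coordP_extChartAt hx, volCoord_self] at h1
    rw [← h1]
    refine congrArg (coordP x (ψ x).q ψ z₀) (ContinuousLinearMap.ext fun v => ?_)
    refine Eq.trans ?_ (congrArg (fun T : F →L[ℝ] F => T _) (tangentCoordChange_self_clm hk)).symm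
    exact congrArg B (congrArg (fun T : BaseModel n →L[ℝ] BaseModel n => T v)
      (tangentCoordChange_self_clm hx)).symm
  refine congrArg₂ (fun α β : Vol n x => α + β) ?_ (hPx _)
  rw [← (formCoord_momentumForm_eventuallyEq hx _).extDeriv_eq, ha0]
  rfl

/-- On `U` the derivative `δℓ/δσ` is `𝔧(ω)`. The divergence equation is applied to the vector `b =
ξ_Q(q(x))`, and the anti-representation property turns what is left into `-⟨𝔧(ω), [σ, ξ]⟩`. -/
theorem EulerLagrange.eulerPoincare
    (hact : ContMDiff (𝓘(ℝ, EG).prod 𝓘(ℝ, F)) 𝓘(ℝ, F) ∞ (fun p : G × Q => p.1 • p.2))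
    {ℓ : Density n EG G X} (hU : IsOpen U) (hψ : IsSmoothSection U ψ) (h : EulerLagrange ℓ U ψ) :
    EulerPoincare ℓ U (fun x => (ψ x).σ) := by
  intro x hxU ξ
  have h1 : divLie (fun y => ℓ.fiberDeriv y (ψ y).σ) x ξ =
      divLie (fun y => momentumMap (EG := EG) (G := G) y (ψ y).q (ψ y).mom) x ξ := by
    have hx := mem_chart_source (BaseModel n) x
    refine Filter.EventuallyEq.extDeriv_eq (𝕜 := ℝ) (E := BaseModel n) ?_
    filter_upwards [eventually_extChartAt_symm hx (hU.eventually_mem hxU)] with z hz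
    rw [h.fiberDeriv_eq _ hz]
  -- This is `D_{σ_Q} ξ_Q + [σ, ξ]_Q = D_{ξ_Q} σ_Q`, the bracket identity with its negative term
  -- moved across.
  have h2 : genDerivField EG G (ψ x).q ξ ∘L sigmaQ ψ x +
      infGen EG G F (ψ x).q ∘L bracketRight EG G ξ ∘L (ψ x).σ =
      genDeriv (F := F) EG G (ψ x).q (infGen EG G F (ψ x).q ξ) ∘L (ψ x).σ := by
    refine ContinuousLinearMap.ext fun v => ?_
    have h3 := infGen_bracket hact (ψ x).q ((ψ x).σ v) ξ
    have h4 : ∀ a b c : F, c = a - b → b + c = a := fun a b c h => by rw [h]; abel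
    exact h4 _ _ _ h3
  rw [h1, divLie_momentumMap hact hU hψ h.dq_eq hxU, h.fiberDeriv_eq x hxU]
  have h5 := congrArg (ψ x).mom h2
  rw [map_add] at h5
  have h6 : ∀ a b c d : Vol n x, d = -a → b + c = a → d + b + c = 0 := fun a b c d h h' => by
    rw [h, ← h']; abel
  exact h6 _ _ _ _ (h.div_eq x hxU (infGen EG G F (ψ x).q ξ)) h5

end EulerPoincare

end CovariantClebsch

namespace CovariantClebsch

open Filter Set

/-! ### Derivatives of Legendre transforms and of collective functions. -/

section Legendre

variable {Z V : Type*} [NormedAddCommGroup Z] [NormedSpace ℝ Z] [NormedAddCommGroup V]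
  [NormedSpace ℝ V]

/-- The derivative of the Legendre transform. -/
theorem hasFDerivAt_legendre {f : Z → V} {L : (Z →L[ℝ] V) → Z} {ν : Z →L[ℝ] V}
    (hf : HasFDerivAt f ν (L ν)) (hL : DifferentiableAt ℝ L ν) :
    HasFDerivAt (fun μ => μ (L μ) - f (L μ)) (ContinuousLinearMap.apply ℝ V (L ν)) ν := by
  -- The derivative of `L` enters twice with opposite signs, because `ν` is the derivative of `f` at
  -- `L ν`; only evaluation at `L ν` remains.
  have h1 := ((hasFDerivAt_id ν).clm_apply hL.hasFDerivAt).sub (hf.comp ν hL.hasFDerivAt)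
  refine h1.congr_fderiv (ContinuousLinearMap.ext fun μ => ?_)
  simp

variable {T K F : Type*} [NormedAddCommGroup T] [NormedSpace ℝ T] [NormedAddCommGroup K]
  [NormedSpace ℝ K] [NormedAddCommGroup F] [NormedSpace ℝ F]
  {h : ((T →L[ℝ] K) →L[ℝ] V) → V} {w : (T →L[ℝ] F) →L[ℝ] V} {σ : T →L[ℝ] K}

/-- The fibre derivative of a collective Hamiltonian. -/
theorem hasFDerivAt_collective {A : K →L[ℝ] F}
    (hh : HasFDerivAt h (ContinuousLinearMap.apply ℝ V σ) (w ∘L A.postcomp T)) :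
    HasFDerivAt (fun η : (T →L[ℝ] F) →L[ℝ] V => h (η ∘L A.postcomp T)) (ContinuousLinearMap.apply ℝ V (A ∘L σ : T →L[ℝ] F)) w := by
  have hJ : HasFDerivAt (fun w : (T →L[ℝ] F) →L[ℝ] V => w ∘L A.postcomp T)
      ((A.postcomp T).precomp V : ((T →L[ℝ] F) →L[ℝ] V) →L[ℝ] (T →L[ℝ] K) →L[ℝ] V) w :=
    ((A.postcomp T : (T →L[ℝ] K) →L[ℝ] T →L[ℝ] F).precomp V).hasFDerivAt
  exact (HasFDerivAt.comp (g := h) w hh hJ).congr_fderiv (ContinuousLinearMap.ext fun η => rfl)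

/-- The derivative of a collective Hamiltonian with respect to the configuration, at constant
momentum. -/
theorem hasFDerivAt_collective_configuration {A : F → K →L[ℝ] F} {A' : F →L[ℝ] K →L[ℝ] F} {a : F}
    (hA : HasFDerivAt A A' a)
    (hh : HasFDerivAt h (ContinuousLinearMap.apply ℝ V σ) (w ∘L (A a).postcomp T)) :
    HasFDerivAt (fun a => h (w ∘L (A a).postcomp T))
      (w ∘L ((ContinuousLinearMap.compL ℝ T K F).flip σ) ∘L A') a := by
  have hB : HasFDerivAt (fun A : K →L[ℝ] F => w ∘L A.postcomp T)
      ((w.postcomp (T →L[ℝ] K)) ∘L ContinuousLinearMap.compL ℝ T K F) (A a) :=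
    ((w.postcomp (T →L[ℝ] K)) ∘L ContinuousLinearMap.compL ℝ T K F).hasFDerivAt
  exact (HasFDerivAt.comp (g := h) a hh (HasFDerivAt.comp
    (g := fun A : K →L[ℝ] F => w ∘L A.postcomp T) a hB hA)).congr_fderiv
      (ContinuousLinearMap.ext fun η => rfl)

end Legendre

/-! ### The collective Hamiltonian and the covariant Hamilton equations. -/

section Hamilton

variable {n : ℕ}
  {EG : Type*} [NormedAddCommGroup EG] [NormedSpace ℝ EG] [FiniteDimensional ℝ EG]
  {G : Type*} [TopologicalSpace G] [ChartedSpace EG G] [Group G] [LieGroup 𝓘(ℝ, EG) ∞ G]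
  {F : Type*} [NormedAddCommGroup F] [NormedSpace ℝ F] [FiniteDimensional ℝ F]
  {Q : Type*} [TopologicalSpace Q] [ChartedSpace F Q] [IsManifold 𝓘(ℝ, F) ∞ Q] [MulAction G Q]
  {X : Type*} [TopologicalSpace X] [ChartedSpace (BaseModel n) X]
  [IsManifold 𝓘(ℝ, BaseModel n) ∞ X]

variable {x i : X} {k q : Q} {ψ : ∀ x : X, PhaseFiber n EG G F Q x} {U : Set X}
  {ℓ : Density n EG G X}

theorem lieFormCoord_self (x : X) (s : LieForm n EG G x) :
    lieFormCoord (EG := EG) (G := G) x x s = s :=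
  ContinuousLinearMap.ext fun v => congrArg s
    (congrArg (fun T : BaseModel n →L[ℝ] BaseModel n => T v)
      (tangentCoordChange_self_clm (mem_chart_source (BaseModel n) x)))

theorem lieMomentumOfCoord_self (x : X) (ν : LieMomentum n EG G x) :
    lieMomentumOfCoord (EG := EG) (G := G) x x ν = ν := by
  refine ContinuousLinearMap.ext fun s => ?_
  have h : ∀ β : Vol n x, volOfCoord x x β = β := fun β =>
    ContinuousAlternatingMap.ext fun v => congrArg β (funext fun m =>
      (congrArg (fun T : BaseModel n →L[ℝ] BaseModel n => T (v m))
        (tangentCoordChange_self_clm (mem_chart_source (BaseModel n) x))))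
  exact (h _).trans (congrArg ν (lieFormCoord_self x s))

theorem Density.IsHyperregular.fiberDeriv_legendreInv (hreg : ℓ.IsHyperregular) (x : X)
    (ν : LieMomentum n EG G x) : ℓ.fiberDeriv x (ℓ.legendreInv x ν) = ν :=
  Function.rightInverse_invFun (hreg.bijective x).surjective ν

theorem Density.IsHyperregular.fiberDeriv_eq_iff (hreg : ℓ.IsHyperregular) {x : X}
    {σ : LieForm n EG G x} {ν : LieMomentum n EG G x} :
    ℓ.fiberDeriv x σ = ν ↔ σ = ℓ.legendreInv x ν := by
  constructor
  · rintro rfl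
    exact (Function.leftInverse_invFun (hreg.bijective x).injective σ).symm
  · rintro rfl
    exact hreg.fiberDeriv_legendreInv x ν

theorem Density.IsHyperregular.differentiableAt_legendreInv (hreg : ℓ.IsHyperregular) (x : X)
    (ν : (BaseModel n →L[ℝ] EG) →L[ℝ] (BaseModel n) [⋀^Fin (n + 1)]→L[ℝ] ℝ) :
    DifferentiableAt ℝ (show ((BaseModel n →L[ℝ] EG) →L[ℝ] (BaseModel n) [⋀^Fin (n + 1)]→L[ℝ] ℝ) →
      BaseModel n →L[ℝ] EG from ℓ.legendreInv x) ν := by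
  have h1 := (hreg.smooth_inv x).contMDiffAt (x := (x, ν))
    (prod_mem_nhds (chart_source_mem_nhds (BaseModel n) x) univ_mem)
  have h2 : ContMDiffAt
      𝓘(ℝ, (BaseModel n →L[ℝ] EG) →L[ℝ] (BaseModel n) [⋀^Fin (n + 1)]→L[ℝ] ℝ)
      (𝓘(ℝ, BaseModel n).prod
        𝓘(ℝ, (BaseModel n →L[ℝ] EG) →L[ℝ] (BaseModel n) [⋀^Fin (n + 1)]→L[ℝ] ℝ)) ∞
      (fun μ => (x, μ)) ν := contMDiffAt_const.prodMk contMDiffAt_id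
  have h3 := (contMDiffAt_iff_contDiffAt.1 (h1.comp ν h2)).differentiableAt (by simp)
  refine h3.congr_of_eventuallyEq (Eventually.of_forall fun μ => ?_)
  exact ((lieFormCoord_self (EG := EG) (G := G) x _).trans
    (congrArg (ℓ.legendreInv x) (lieMomentumOfCoord_self (EG := EG) (G := G) x μ))).symm

/-- Hyperregularity provides both ingredients of `hasFDerivAt_legendre`: the fibre derivative at
`legendreInv ν` is `ν`, and `legendreInv` is differentiable. -/
theorem Density.IsHyperregular.hasFDerivAt_hamiltonian (hreg : ℓ.IsHyperregular) (hℓ : ℓ.IsSmooth)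
    (x : X) (ν : (BaseModel n →L[ℝ] EG) →L[ℝ] (BaseModel n) [⋀^Fin (n + 1)]→L[ℝ] ℝ) :
    HasFDerivAt (show ((BaseModel n →L[ℝ] EG) →L[ℝ] (BaseModel n) [⋀^Fin (n + 1)]→L[ℝ] ℝ) →
      (BaseModel n) [⋀^Fin (n + 1)]→L[ℝ] ℝ from ℓ.hamiltonian x)
      (ContinuousLinearMap.apply ℝ ((BaseModel n) [⋀^Fin (n + 1)]→L[ℝ] ℝ)
        (show BaseModel n →L[ℝ] EG from ℓ.legendreInv x ν)) ν := by
  refine hasFDerivAt_legendre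
    (f := show (BaseModel n →L[ℝ] EG) → (BaseModel n) [⋀^Fin (n + 1)]→L[ℝ] ℝ from ℓ x)
    (L := show ((BaseModel n →L[ℝ] EG) →L[ℝ] (BaseModel n) [⋀^Fin (n + 1)]→L[ℝ] ℝ) →
      BaseModel n →L[ℝ] EG from ℓ.legendreInv x) ?_ (hreg.differentiableAt_legendreInv x ν)
  refine (hℓ.differentiableAt x (ℓ.legendreInv x ν)).hasFDerivAt.congr_fderiv ?_
  exact hreg.fiberDeriv_legendreInv x ν

theorem fderiv_hamiltonian (hreg : ℓ.IsHyperregular) (hℓ : ℓ.IsSmooth) (x : X)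
    (ν ν' : LieMomentum n EG G x) :
    fderiv ℝ (ℓ.hamiltonian x) ν ν' = ν' (ℓ.legendreInv x ν) := by
  have h := (hreg.hasFDerivAt_hamiltonian hℓ x ν).fderiv
  exact congrArg (fun T : ((BaseModel n →L[ℝ] EG) →L[ℝ] (BaseModel n) [⋀^Fin (n + 1)]→L[ℝ] ℝ) →L[ℝ]
    (BaseModel n) [⋀^Fin (n + 1)]→L[ℝ] ℝ => T ν') h

variable (ℓ) in
/-- The Legendre transform of the momentum map. -/
noncomputable def legendreSigma (p : PhaseFiber n EG G F Q x) : LieForm n EG G x :=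
  ℓ.legendreInv x (momentumMap x p.q p.mom)

/-- The derivative of `h` at `ν` is evaluation at `legendreInv ν`. Since the test momenta separate
points, the weak equation for `σ` is an equality. -/
theorem sigmaEqDh_iff (hreg : ℓ.IsHyperregular) (hℓ : ℓ.IsSmooth) :
    SigmaEqDh ℓ U ψ ↔ ∀ x ∈ U, (ψ x).σ = legendreSigma ℓ (ψ x) := by
  refine forall₂_congr fun x _ => ?_
  constructor
  · intro h
    refine eq_of_forall_top_form (n := n) (Z := BaseModel n →L[ℝ] EG)
      (z := (ψ x).σ) (z' := legendreSigma ℓ (ψ x)) fun ν' => ?_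
    exact (h ν').trans (fderiv_hamiltonian hreg hℓ x _ ν')
  · intro h ν'
    rw [fderiv_hamiltonian hreg hℓ, h]
    rfl

/-- At fixed `q` the momentum map is linear in the momentum. The chain rule thus shows that `∂H/∂ω`
is the generator of `δh/δν`. -/
theorem fderiv_collectiveH (hreg : ℓ.IsHyperregular) (hℓ : ℓ.IsSmooth) (x : X) (q : Q)
    (w η : Momentum n F x q) :
    fderiv ℝ (collectiveH F ℓ x q) w η =
      η (infGen EG G F q ∘L ℓ.legendreInv x (momentumMap x q w)) := by
  let A : EG →L[ℝ] F := infGen EG G F q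
  let w' : (BaseModel n →L[ℝ] F) →L[ℝ] (BaseModel n) [⋀^Fin (n + 1)]→L[ℝ] ℝ := w
  have h := (hasFDerivAt_collective (hreg.hasFDerivAt_hamiltonian hℓ x
    (w' ∘L A.postcomp (BaseModel n)))).fderiv
  exact congrArg (fun T : ((BaseModel n →L[ℝ] F) →L[ℝ] (BaseModel n) [⋀^Fin (n + 1)]→L[ℝ] ℝ) →L[ℝ]
    (BaseModel n) [⋀^Fin (n + 1)]→L[ℝ] ℝ => T η) h

variable (cov : CovariantDerivative 𝓘(ℝ, F) F (TangentSpace 𝓘(ℝ, F) : Q → Type _))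

/-- Along momenta with constant components, the momentum map varies with `q'` only through the
generator in the chart at `q`, a function with values in a fixed space of linear maps. -/
theorem momentumMap_constMomentum (x : X) {q q' : Q} (hq : q' ∈ (chartAt F q).source)
    (w : Momentum n F x q) :
    (show (BaseModel n →L[ℝ] EG) →L[ℝ] (BaseModel n) [⋀^Fin (n + 1)]→L[ℝ] ℝ from
      momentumMap (EG := EG) (G := G) x q' (constMomentum x w q')) =
      (show (BaseModel n →L[ℝ] F) →L[ℝ] (BaseModel n) [⋀^Fin (n + 1)]→L[ℝ] ℝ from w) ∘L
        (infGenCoord EG G q (extChartAt 𝓘(ℝ, F) q q')).postcomp (BaseModel n) := by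
  rw [infGenCoord_extChartAt hq]
  refine ContinuousLinearMap.ext fun s => ?_
  rfl

theorem momentumMap_eq_comp_postcomp (x : X) (w : Momentum n F x q) :
    (show (BaseModel n →L[ℝ] EG) →L[ℝ] (BaseModel n) [⋀^Fin (n + 1)]→L[ℝ] ℝ from
      momentumMap (EG := EG) (G := G) x q w) =
      (show (BaseModel n →L[ℝ] F) →L[ℝ] (BaseModel n) [⋀^Fin (n + 1)]→L[ℝ] ℝ from w) ∘L
        (infGenCoord EG G q (extChartAt 𝓘(ℝ, F) q q)).postcomp (BaseModel n) := by
  rw [infGenCoord_self]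
  refine ContinuousLinearMap.ext fun s => ?_
  rfl

theorem mfderiv_eq_of_eventuallyEq_comp {W : Type*} [NormedAddCommGroup W] [NormedSpace ℝ W]
    {f : Q → W} {g : F → W} {g' : F →L[ℝ] W} (hg : HasFDerivAt g g' (extChartAt 𝓘(ℝ, F) q q))
    (h : f =ᶠ[𝓝 q] fun q' => g (extChartAt 𝓘(ℝ, F) q q')) :
    (mfderiv 𝓘(ℝ, F) 𝓘(ℝ, W) f q : F →L[ℝ] W) = g' := by
  rw [← hg.fderiv, ← mfderiv_comp_extChartAt hg.differentiableAt]
  exact h.mfderiv_eq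

theorem hasFDerivAt_hamiltonian_infGenCoord
    (hact : ContMDiff (𝓘(ℝ, EG).prod 𝓘(ℝ, F)) 𝓘(ℝ, F) ∞ (fun p : G × Q => p.1 • p.2))
    (hreg : ℓ.IsHyperregular) (hℓ : ℓ.IsSmooth) (x : X) (q : Q)
    (w : (BaseModel n →L[ℝ] F) →L[ℝ] (BaseModel n) [⋀^Fin (n + 1)]→L[ℝ] ℝ) :
    HasFDerivAt (fun a => (show ((BaseModel n →L[ℝ] EG) →L[ℝ]
        (BaseModel n) [⋀^Fin (n + 1)]→L[ℝ] ℝ) → (BaseModel n) [⋀^Fin (n + 1)]→L[ℝ] ℝ from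
          ℓ.hamiltonian x) (w ∘L (infGenCoord EG G q a).postcomp (BaseModel n)))
      (w ∘L ((ContinuousLinearMap.compL ℝ (BaseModel n) EG F).flip
          (show BaseModel n →L[ℝ] EG from ℓ.legendreInv x
            (w ∘L (infGenCoord EG G q (extChartAt 𝓘(ℝ, F) q q)).postcomp (BaseModel n)))) ∘L
        fderiv ℝ (infGenCoord EG G q) (extChartAt 𝓘(ℝ, F) q q)) (extChartAt 𝓘(ℝ, F) q q) :=
  hasFDerivAt_collective_configuration
    ((contDiffAt_infGenCoord hact (mem_chart_source F q)).differentiableAt (by simp)).hasFDerivAt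
    (hreg.hasFDerivAt_hamiltonian hℓ x _)

theorem collectiveH_constMomentum_eventuallyEq (x : X) (q : Q) (w : Momentum n F x q) :
    (fun q' : Q => (show (BaseModel n) [⋀^Fin (n + 1)]→L[ℝ] ℝ from
        collectiveH F ℓ x q' (constMomentum x w q'))) =ᶠ[𝓝 q] fun q' : Q =>
      (show ((BaseModel n →L[ℝ] EG) →L[ℝ]
        (BaseModel n) [⋀^Fin (n + 1)]→L[ℝ] ℝ) → (BaseModel n) [⋀^Fin (n + 1)]→L[ℝ] ℝ from
          ℓ.hamiltonian x)
        ((show (BaseModel n →L[ℝ] F) →L[ℝ] (BaseModel n) [⋀^Fin (n + 1)]→L[ℝ] ℝ from w) ∘L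
          (infGenCoord EG G q (extChartAt 𝓘(ℝ, F) q q')).postcomp (BaseModel n)) := by
  filter_upwards [chart_source_mem_nhds F q] with q' hq'
  exact congrArg (ℓ.hamiltonian x) (momentumMap_constMomentum x hq' w)

theorem mfderiv_collectiveH
    (hact : ContMDiff (𝓘(ℝ, EG).prod 𝓘(ℝ, F)) 𝓘(ℝ, F) ∞ (fun p : G × Q => p.1 • p.2))
    (hreg : ℓ.IsHyperregular) (hℓ : ℓ.IsSmooth) (x : X) (q : Q)
    (w : Momentum n F x q) :
    (mfderiv 𝓘(ℝ, F) 𝓘(ℝ, (BaseModel n) [⋀^Fin (n + 1)]→L[ℝ] ℝ)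
      (fun q' : Q => show (BaseModel n) [⋀^Fin (n + 1)]→L[ℝ] ℝ from
        collectiveH F ℓ x q' (constMomentum x w q')) q :
        F →L[ℝ] (BaseModel n) [⋀^Fin (n + 1)]→L[ℝ] ℝ) =
      (show (BaseModel n →L[ℝ] F) →L[ℝ] (BaseModel n) [⋀^Fin (n + 1)]→L[ℝ] ℝ from w) ∘L
        ((ContinuousLinearMap.compL ℝ (BaseModel n) EG F).flip
          (show BaseModel n →L[ℝ] EG from ℓ.legendreInv x (
            (show (BaseModel n →L[ℝ] F) →L[ℝ] (BaseModel n) [⋀^Fin (n + 1)]→L[ℝ] ℝ from w) ∘L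
            (infGenCoord EG G q (extChartAt 𝓘(ℝ, F) q q)).postcomp (BaseModel n)))) ∘L
        fderiv ℝ (infGenCoord EG G q) (extChartAt 𝓘(ℝ, F) q q) := by
  exact mfderiv_eq_of_eventuallyEq_comp (hasFDerivAt_hamiltonian_infGenCoord hact hreg hℓ x q w)
    (collectiveH_constMomentum_eventuallyEq x q w)

/-- With `τ = δh/δν` at `𝔧(ω)`, the derivative at constant components yields `⟨ω, D_b A ∘ τ⟩`. The
vertical part of the horizontal lift yields `⟨ω, Γ_b ∘ τ_Q⟩`. Their sum is the decomposition of
`∇τ_Q` in `nablaGen_eq`. -/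
theorem partialNabla_collectiveH
    (hact : ContMDiff (𝓘(ℝ, EG).prod 𝓘(ℝ, F)) 𝓘(ℝ, F) ∞ (fun p : G × Q => p.1 • p.2))
    (hreg : ℓ.IsHyperregular) (hℓ : ℓ.IsSmooth) (x : X) (q : Q)
    (w : Momentum n F x q) (b : TangentSpace 𝓘(ℝ, F) q) :
    partialNabla cov (collectiveH F ℓ) x q w b =
      w (nablaGen cov x q (ℓ.legendreInv x (momentumMap x q w)) b) := by
  let w' : (BaseModel n →L[ℝ] F) →L[ℝ] (BaseModel n) [⋀^Fin (n + 1)]→L[ℝ] ℝ := w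
  let L : ((BaseModel n →L[ℝ] EG) →L[ℝ] (BaseModel n) [⋀^Fin (n + 1)]→L[ℝ] ℝ) →
    BaseModel n →L[ℝ] EG := ℓ.legendreInv x
  let D : EG →L[ℝ] F := fderiv ℝ (infGenCoord EG G q) (extChartAt 𝓘(ℝ, F) q q) b
  have h1 := (congrArg (fun T : F →L[ℝ] (BaseModel n) [⋀^Fin (n + 1)]→L[ℝ] ℝ => T b)
    (mfderiv_collectiveH hact hreg hℓ x q w)).trans
      (congrArg (fun ν => w' (D ∘L L ν)) (momentumMap_eq_comp_postcomp x w).symm)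
  have h2 := fderiv_collectiveH hreg hℓ x q w
    (w ∘L ContinuousLinearMap.postcomp (TX n x) (christoffel cov q b))
  rw [nablaGen_eq cov hact, map_add]
  exact congrArg₂ (fun α β : (BaseModel n) [⋀^Fin (n + 1)]→L[ℝ] ℝ => α + β) h1 h2

/-- The two derivatives of the collective Hamiltonian are those of the Clebsch system with `σ`
replaced by the Legendre transform of `𝔧(ω)`. For this `σ` the condition `δℓ/δσ = 𝔧(ω)` is
automatic. -/
theorem hamilton_iff_stationary
    (hact : ContMDiff (𝓘(ℝ, EG).prod 𝓘(ℝ, F)) 𝓘(ℝ, F) ∞ (fun p : G × Q => p.1 • p.2))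
    (hreg : ℓ.IsHyperregular) (hℓ : ℓ.IsSmooth) :
    Hamilton cov (collectiveH F ℓ) U ψ ↔
      Stationary cov ℓ U (withSigma ψ fun x => legendreSigma ℓ (ψ x)) := by
  constructor
  · intro h
    refine ⟨fun x hx b => ?_, fun x hx => ?_, fun x _ => hreg.fiberDeriv_legendreInv x _⟩
    · exact (h.div_eq x hx b).trans
        (congrArg (fun α : Vol n x => -α) (partialNabla_collectiveH cov hact hreg hℓ x _ _ b))
    · refine eq_of_forall_top_form (n := n) (Z := BaseModel n →L[ℝ] F) fun η => ?_
      exact (h.dq_eq x hx η).trans (fderiv_collectiveH hreg hℓ x _ _ η)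
  · intro h
    refine ⟨fun x hx η => ?_, fun x hx b => ?_⟩
    · rw [fderiv_collectiveH hreg hℓ]
      exact congrArg η (h.dq_eq x hx)
    · rw [partialNabla_collectiveH cov hact hreg hℓ]
      exact h.div_eq x hx b

/-- The stationarity conditions only involve the values of the section on `U`. -/
theorem stationary_withSigma_congr {τ τ' : ∀ x : X, LieForm n EG G x} (h : ∀ x ∈ U, τ x = τ' x) :
    Stationary cov ℓ U (withSigma ψ τ) → Stationary cov ℓ U (withSigma ψ τ') := by
  intro hs
  refine ⟨fun x hx b => ?_, fun x hx => ?_, fun x hx => ?_⟩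
  · have h1 := hs.div_eq x hx b
    simp only [withSigma] at h1 ⊢
    rw [← h x hx]
    exact h1
  · have h1 := hs.dq_eq x hx
    simp only [withSigma, sigmaQ] at h1 ⊢
    rw [← h x hx]
    exact h1
  · have h1 := hs.fiberDeriv_eq x hx
    simp only [withSigma] at h1 ⊢
    rw [← h x hx]
    exact h1

/-- The third stationarity equation, inverted by the Legendre map, is `σ = δh/δν`. On `U` the
section then agrees with the one built in `hamilton_iff_stationary`. -/
theorem stationary_iff_hamilton
    (hact : ContMDiff (𝓘(ℝ, EG).prod 𝓘(ℝ, F)) 𝓘(ℝ, F) ∞ (fun p : G × Q => p.1 • p.2))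
    (hreg : ℓ.IsHyperregular) (hℓ : ℓ.IsSmooth) :
    Stationary cov ℓ U ψ ↔ Hamilton cov (collectiveH F ℓ) U ψ ∧ SigmaEqDh ℓ U ψ := by
  rw [hamilton_iff_stationary cov hact hreg hℓ, sigmaEqDh_iff hreg hℓ]
  constructor
  · intro h
    have hσ : ∀ x ∈ U, (ψ x).σ = legendreSigma ℓ (ψ x) := fun x hx =>
      hreg.fiberDeriv_eq_iff.1 (h.fiberDeriv_eq x hx)
    exact ⟨stationary_withSigma_congr cov (τ := fun x => (ψ x).σ) hσ h, hσ⟩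
  · rintro ⟨h, hσ⟩
    exact stationary_withSigma_congr cov (τ' := fun x => (ψ x).σ) (fun x hx => (hσ x hx).symm) h

/-! ### Smoothness of the Legendre transform -/

/-- In charts the momentum map is composition of the coordinate momentum with the coordinate
generator, both smooth in the point; this is the form to which smoothness of the inverse Legendre
map applies. -/
theorem momentumMap_eq_lieMomentumOfCoord {y : X} (hi : y ∈ (chartAt (BaseModel n) i).source)
    (hk : q ∈ (chartAt F k).source) (w : Momentum n F y q) :
    momentumMap (EG := EG) (G := G) y q w = lieMomentumOfCoord i y (momentumCoord i y k q w ∘L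
      ContinuousLinearMap.compL ℝ (BaseModel n) EG F
        (infGenCoord EG G k (extChartAt 𝓘(ℝ, F) k q))) := by
  refine ContinuousLinearMap.ext fun s => ?_
  have h := congrArg (volOfCoord i y) (momentumCoord_apply hi hk w (infGen EG G F q ∘L s))
  rw [volOfCoord_volCoord hi] at h
  rw [infGenCoord_extChartAt hk]
  exact h.symm

/-- Only the Lie algebra component changes. In charts it is the smooth inverse Legendre map applied
to the coordinates of `𝔧(ω)`, themselves smooth functions of the momentum and the configuration. -/
theorem SmoothFamilyOn.legendre
    (hact : ContMDiff (𝓘(ℝ, EG).prod 𝓘(ℝ, F)) 𝓘(ℝ, F) ∞ (fun p : G × Q => p.1 • p.2))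
    (hreg : ℓ.IsHyperregular) {Ψ : ℝ → ∀ x : X, PhaseFiber n EG G F Q x} {W : Set (ℝ × X)}
    (hΨ : SmoothFamilyOn Ψ W) (hW : IsOpen W) :
    SmoothFamilyOn (fun ε => withSigma (Ψ ε) fun x => legendreSigma ℓ (Ψ ε x)) W := by
  refine ⟨hΨ.q, fun i => ?_, hΨ.mom⟩
  rintro ⟨ε, x⟩ ⟨hp, hx⟩
  refine ContMDiffAt.contMDiffWithinAt ?_
  have hx : x ∈ (chartAt (BaseModel n) i).source := hx
  set k := (Ψ ε x).q with hkdef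
  have hk := mem_chart_source F k
  have hq := hΨ.contMDiffAt_q hW hp
  have hnear : ∀ᶠ p : ℝ × X in 𝓝 (ε, x), p.2 ∈ (chartAt (BaseModel n) i).source ∧
      (Ψ p.1 p.2).q ∈ (chartAt F k).source :=
    inter_mem (continuousAt_snd.preimage_mem_nhds (x := (ε, x))
        ((chartAt (BaseModel n) i).open_source.mem_nhds hx))
      (hq.continuousAt.preimage_mem_nhds ((chartAt F k).open_source.mem_nhds hk))
  have hm : ContMDiffAt (𝓘(ℝ, ℝ).prod 𝓘(ℝ, BaseModel n))
      𝓘(ℝ, (BaseModel n →L[ℝ] F) →L[ℝ] (BaseModel n) [⋀^Fin (n + 1)]→L[ℝ] ℝ) ∞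
      (fun p : ℝ × X => momentumCoord i p.2 k (Ψ p.1 p.2).q (Ψ p.1 p.2).mom) (ε, x) :=
    (hΨ.mom i k).contMDiffAt (inter_mem (hW.mem_nhds hp) hnear)
  have hA : ContMDiffAt (𝓘(ℝ, ℝ).prod 𝓘(ℝ, BaseModel n)) 𝓘(ℝ, EG →L[ℝ] F) ∞
      (fun p : ℝ × X => infGenCoord EG G k (extChartAt 𝓘(ℝ, F) k (Ψ p.1 p.2).q)) (ε, x) := by
    have h1 : ContMDiffAt (𝓘(ℝ, ℝ).prod 𝓘(ℝ, BaseModel n)) 𝓘(ℝ, F) ∞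
        (fun p : ℝ × X => extChartAt 𝓘(ℝ, F) k (Ψ p.1 p.2).q) (ε, x) :=
      (contMDiffAt_extChartAt' (x := k) (x' := (Ψ ε x).q) hk).comp (ε, x) hq
    exact ContMDiffAt.comp (g := infGenCoord EG G k) (ε, x)
      (contDiffAt_infGenCoord hact hk).contMDiffAt h1
  have hN : ContMDiffAt (𝓘(ℝ, ℝ).prod 𝓘(ℝ, BaseModel n))
      𝓘(ℝ, (BaseModel n →L[ℝ] EG) →L[ℝ] (BaseModel n) [⋀^Fin (n + 1)]→L[ℝ] ℝ) ∞
      (fun p : ℝ × X => momentumCoord i p.2 k (Ψ p.1 p.2).q (Ψ p.1 p.2).mom ∘L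
        ContinuousLinearMap.compL ℝ (BaseModel n) EG F
          (infGenCoord EG G k (extChartAt 𝓘(ℝ, F) k (Ψ p.1 p.2).q))) (ε, x) :=
    hm.clm_comp (ContMDiffAt.comp (g := ContinuousLinearMap.compL ℝ (BaseModel n) EG F) (ε, x)
      (ContinuousLinearMap.contMDiff _).contMDiffAt hA)
  have hL := (hreg.smooth_inv i).contMDiffAt
    (x := (x, momentumCoord i x k (Ψ ε x).q (Ψ ε x).mom ∘L
      ContinuousLinearMap.compL ℝ (BaseModel n) EG F
        (infGenCoord EG G k (extChartAt 𝓘(ℝ, F) k (Ψ ε x).q))))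
    (prod_mem_nhds ((chartAt (BaseModel n) i).open_source.mem_nhds hx) univ_mem)
  have hcomp := ContMDiffAt.comp (ε, x) hL (contMDiffAt_snd.prodMk hN)
  refine hcomp.congr_of_eventuallyEq ?_
  filter_upwards [hnear] with p hp
  exact congrArg (fun ν => lieFormCoord i p.2 (ℓ.legendreInv p.2 ν))
    (momentumMap_eq_lieMomentumOfCoord hp.1 hp.2 (Ψ p.1 p.2).mom)

/-- The Legendre transform acts fibrewise, so applying it to local extensions of the section gives
local extensions of the transformed section, up to and including the frontier. -/
theorem IsSmoothSection.legendre
    (hact : ContMDiff (𝓘(ℝ, EG).prod 𝓘(ℝ, F)) 𝓘(ℝ, F) ∞ (fun p : G × Q => p.1 • p.2))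
    (hreg : ℓ.IsHyperregular) (hψ : IsSmoothSection U ψ) :
    IsSmoothSection U (withSigma ψ fun x => legendreSigma ℓ (ψ x)) := by
  intro x hx
  obtain ⟨W, hW, hxW, ψ', hψ', heq⟩ := hψ x hx
  refine ⟨W, hW, hxW, withSigma ψ' fun x => legendreSigma ℓ (ψ' x),
    hψ'.legendre hact hreg (isOpen_univ.prod hW), fun y hy => ?_⟩
  exact congrArg (fun p : PhaseFiber n EG G F Q y =>
    (⟨p.q, p.mom, legendreSigma ℓ p⟩ : PhaseFiber n EG G F Q y)) (heq y hy)

/-- On `U` the third stationarity equation forces `τ` to be the Legendre transform of `𝔧(ω)`.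
Conversely, that choice is smooth over the whole closure. -/
theorem hamilton_iff_exists
    (hact : ContMDiff (𝓘(ℝ, EG).prod 𝓘(ℝ, F)) 𝓘(ℝ, F) ∞ (fun p : G × Q => p.1 • p.2))
    (hreg : ℓ.IsHyperregular) (hℓ : ℓ.IsSmooth) (hψ : IsSmoothSection U ψ) :
    Hamilton cov (collectiveH F ℓ) U ψ ↔ ∃ τ : ∀ x : X, LieForm n EG G x,
      IsSmoothSection U (withSigma ψ τ) ∧ Stationary cov ℓ U (withSigma ψ τ) := by
  rw [hamilton_iff_stationary cov hact hreg hℓ]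
  constructor
  · exact fun h => ⟨_, hψ.legendre hact hreg, h⟩
  · rintro ⟨τ, -, h⟩
    exact stationary_withSigma_congr cov
      (fun x hx => hreg.fiberDeriv_eq_iff.1 (h.fiberDeriv_eq x hx)) h

end Hamilton

end CovariantClebsch

theorem proposition4p1
    {n : ℕ}
    {EG : Type*} [NormedAddCommGroup EG] [NormedSpace ℝ EG] [FiniteDimensional ℝ EG]
    {G : Type*} [TopologicalSpace G] [ChartedSpace EG G] [Group G] [LieGroup 𝓘(ℝ, EG) ∞ G]
    {F : Type*} [NormedAddCommGroup F] [NormedSpace ℝ F] [FiniteDimensional ℝ F]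
    {Q : Type*} [TopologicalSpace Q] [ChartedSpace F Q] [IsManifold 𝓘(ℝ, F) ∞ Q] [MulAction G Q]
    (hact : ContMDiff (𝓘(ℝ, EG).prod 𝓘(ℝ, F)) 𝓘(ℝ, F) ∞ (fun p : G × Q => p.1 • p.2))
    {X : Type*} [TopologicalSpace X] [ChartedSpace (BaseModel n) X]
    [IsManifold 𝓘(ℝ, BaseModel n) ∞ X] [T2Space X] [SigmaCompactSpace X] [OrientedAtlas n X]
    (ℓ : Density n EG G X) (hℓ : ℓ.IsSmooth)
    (U : Set X) (hU : IsOpen U) (hUc : IsCompact (closure U)) :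
    (∀ ψ : ∀ x : X, PhaseFiber n EG G F Q x, IsSmoothSection U ψ →
      (∀ x ∈ U, clebschForm ℓ ψ x = reducedForm ℓ ψ x) ∧
      (IsCritical U (clebschAction ℓ U) ψ ↔ IsCritical U (reducedAction ℓ U) ψ)) ∧
    (∀ cov : CovariantDerivative 𝓘(ℝ, F) F (TangentSpace 𝓘(ℝ, F) : Q → Type _),
      cov.torsion = 0 →
      ∀ ψ : ∀ x : X, PhaseFiber n EG G F Q x, IsSmoothSection U ψ →
      (IsCritical U (clebschAction ℓ U) ψ ↔ Stationary cov ℓ U ψ)) ∧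
    (∀ ψ : ∀ x : X, PhaseFiber n EG G F Q x, IsSmoothSection U ψ →
      IsCritical U (clebschAction ℓ U) ψ →
      EulerPoincare ℓ U (fun x => (ψ x).σ) ∧ Compatible U ψ) ∧
    (ℓ.IsHyperregular →
      ∀ cov : CovariantDerivative 𝓘(ℝ, F) F (TangentSpace 𝓘(ℝ, F) : Q → Type _),
      cov.torsion = 0 →
      ∀ ψ : ∀ x : X, PhaseFiber n EG G F Q x, IsSmoothSection U ψ →
      (Stationary cov ℓ U ψ ↔
        Hamilton cov (collectiveH F ℓ) U ψ ∧ SigmaEqDh ℓ U ψ) ∧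
      (Hamilton cov (collectiveH F ℓ) U ψ ↔
        ∃ τ : ∀ x : X, LieForm n EG G x,
          IsSmoothSection U (withSigma ψ τ) ∧ Stationary cov ℓ U (withSigma ψ τ))) := by
  -- Criticality is compared with the connection-free equations, so the Euler–Poincaré and
  -- compatibility statements follow without choosing a connection on `Q`.
  have hcrit : ∀ ψ : ∀ x : X, PhaseFiber n EG G F Q x, IsSmoothSection U ψ →
      (IsCritical U (clebschAction ℓ U) ψ ↔ EulerLagrange ℓ U ψ) := fun ψ hψ => by
    rw [isCritical_clebschAction_iff hact hℓ hU hUc]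
    exact ⟨eulerLagrange_of_isCritical hact hℓ hU hUc hψ,
      EulerLagrange.isCritical hact hℓ hU hUc hψ⟩
  refine ⟨fun ψ hψ => ⟨fun x hx => ?_, isCritical_clebschAction_iff hact hℓ hU hUc⟩,
    fun cov hcov ψ hψ => ?_, fun ψ hψ h => ?_, fun hreg cov _ ψ hψ => ⟨?_, ?_⟩⟩
  · obtain ⟨W, hW, hxW, hsm⟩ := hψ.exists_smoothFamilyOn hU hx
    exact SmoothFamilyOn.clebschForm_eq (Ψ := fun _ => ψ) (ε := 0) hact hℓ hsm hW (hxW 0)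
  · rw [hcrit ψ hψ, stationary_iff_eulerLagrange cov hact hcov ℓ hU hψ]
  · have hEL := (hcrit ψ hψ).1 h
    exact ⟨hEL.eulerPoincare hact hU hψ, compatible_of_dq_eq hact hU hψ hEL.dq_eq⟩
  · exact stationary_iff_hamilton cov hact hreg hℓ
  · exact hamilton_iff_exists cov hact hreg hℓ hψ
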